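/- Computation takes place on a real RAM: a machine with exact arithmetic ($+,-,\cdot,/$) and comparisons on real numbers, addition, subtraction, halving (rounded down) and comparison on integers, and indirectly addressed memory, in which every operation costs one step. Let $P$ be a convex polygon with $n\ge 3$ vertices in the plane, no three of them collinear, stored in the order in which they occur along the boundary (in either direction). Let $0<\alpha<\pi$, where $\alpha$ is given to the machine by $\cos\alpha$ and $\sin\alpha$. An axis-aligned $\alpha$-triangle is a non-degenerate triangle $pqr$ whose side $pq$, called its base, is parallel to the $x$-axis and whose interior angle at $p$ is $\alpha$. The corner $p$ may be the left or the right end of the base, and the apex $r$ may lie above or below the base; fix a non-empty set $D$ of admitted placements among these four. (For example, $D$ may consist of the two placements for which $p,q,r$ is counterclockwise, or of the single one with $p$ on the left and $r$ above, or of all four.) Then the corners of a triangle of maximum area among all axis-aligned $\alpha$-triangles with placement in $D$ that are contained in $P$ can be computed in $O(\log n)$ time in each of the following two situations: 1. The vertices are stored in an array. There are a program and a constant $C$, both depending only on $D$, such that the program takes at most $C\log n$ steps for all $P$ and $\alpha$. 2. The vertices are stored in a balanced binary search tree, whose nodes hold the coordinates of one vertex and pointers to the two children, and whose root and number $n$ of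 nodes are given. There is a program depending only on $D$ and, for every $K$, a constant $C$ depending only on $D$ and $K$, such that the program takes at most $C\log n$ steps for all $P$ and $\alpha$ and all such trees of height at most $K\log n$. -/

import Mathlib

noncomputable section

/-! ## A real RAM with a step count

A program is a fixed finite text; it does not depend on the input or on its size. A state consists
of integer registers, real registers, integer arrays and real arrays. Array cells are addressed
indirectly, by computed integers. Real cells support exact `+`, `-`, `*`, `/` and comparison; there
is no root, no trigonometric function, no rounding and no conversion between reals and integers.
Integers support `+`, `-`, halving with rounding down, and comparison; without multiplication, the
integers which `t` steps compute are larger than the given ones by a factor of at most `2 ^ O(t)`.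
Every operation, every access to a register or to an array cell, and every constant costs one
step. -/

namespace RealRAM

structure State where
  /-- integer registers -/
  ireg : ℕ → ℤ
  /-- real registers -/
  rreg : ℕ → ℝ
  /-- integer arrays: number of the array, then the address -/
  iarr : ℕ → ℤ → ℤ
  /-- real arrays: number of the array, then the address -/
  rarr : ℕ → ℤ → ℝ

/-- Integer expressions. -/
inductive IExp where
  | const (c : ℤ)
  | reg (i : ℕ)
  | get (a : ℕ) (e : IExp)
  | add (e f : IExp)
  | sub (e f : IExp)
  | half (e : IExp)

/-- Real expressions. The constants are integers, so that a program carries no real numbers. -/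
inductive RExp where
  | const (c : ℤ)
  | reg (i : ℕ)
  | get (a : ℕ) (e : IExp)
  | add (e f : RExp)
  | sub (e f : RExp)
  | mul (e f : RExp)
  | div (e f : RExp)

/-- Tests. -/
inductive BExp where
  | ile (e f : IExp)
  | rle (e f : RExp)
  | not (b : BExp)
  | and (b c : BExp)

namespace IExp

def eval (s : State) : IExp → ℤ
  | const c => c
  | reg i => s.ireg i
  | get a e => s.iarr a (e.eval s)
  | add e f => e.eval s + f.eval s
  | sub e f => e.eval s - f.eval s
  | half e => e.eval s / 2

def cost : IExp → ℕ
  | const _ => 1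
  | reg _ => 1
  | get _ e => e.cost + 1
  | add e f => e.cost + f.cost + 1
  | sub e f => e.cost + f.cost + 1
  | half e => e.cost + 1

end IExp

namespace RExp

/-- Division by zero gives zero; a program can test for it beforehand. -/
def eval (s : State) : RExp → ℝ
  | const c => (c : ℝ)
  | reg i => s.rreg i
  | get a e => s.rarr a (e.eval s)
  | add e f => e.eval s + f.eval s
  | sub e f => e.eval s - f.eval s
  | mul e f => e.eval s * f.eval s
  | div e f => e.eval s / f.eval s

def cost : RExp → ℕ
  | const _ => 1
  | reg _ => 1
  | get _ e => e.cost + 1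
  | add e f => e.cost + f.cost + 1
  | sub e f => e.cost + f.cost + 1
  | mul e f => e.cost + f.cost + 1
  | div e f => e.cost + f.cost + 1

end RExp

namespace BExp

def holds (s : State) : BExp → Prop
  | ile e f => e.eval s ≤ f.eval s
  | rle e f => e.eval s ≤ f.eval s
  | not b => ¬ b.holds s
  | and b c => b.holds s ∧ c.holds s

def cost : BExp → ℕ
  | ile e f => e.cost + f.cost + 1
  | rle e f => e.cost + f.cost + 1
  | not b => b.cost + 1
  | and b c => b.cost + c.cost + 1

end BExp

namespace State

def setIReg (s : State) (i : ℕ) (x : ℤ) : State :=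
  { s with ireg := Function.update s.ireg i x }

def setRReg (s : State) (i : ℕ) (x : ℝ) : State :=
  { s with rreg := Function.update s.rreg i x }

def setIArr (s : State) (a : ℕ) (k : ℤ) (x : ℤ) : State :=
  { s with iarr := Function.update s.iarr a (Function.update (s.iarr a) k x) }

def setRArr (s : State) (a : ℕ) (k : ℤ) (x : ℝ) : State :=
  { s with rarr := Function.update s.rarr a (Function.update (s.rarr a) k x) }

end State

/-- Programs. -/
inductive Prog where
  | skip
  | setIReg (i : ℕ) (e : IExp)
  | setRReg (i : ℕ) (e : RExp)
  | setIArr (a : ℕ) (k e : IExp)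
  | setRArr (a : ℕ) (k : IExp) (e : RExp)
  | seq (P Q : Prog)
  | ite (b : BExp) (P Q : Prog)
  | loop (b : BExp) (P : Prog)

/-- `Exec P s s' t`: started in the state `s`, the program `P` halts in the state `s'` after `t`
steps. (This relation is deterministic: `s'` and `t` are determined by `P` and `s`.)
The program `loop b P` repeats `P` as long as the test `b` holds. -/
inductive Exec : Prog → State → State → ℕ → Prop where
  | skip (s : State) : Exec .skip s s 1
  | setIReg (s : State) (i : ℕ) (e : IExp) :
      Exec (.setIReg i e) s (s.setIReg i (e.eval s)) (e.cost + 1)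
  | setRReg (s : State) (i : ℕ) (e : RExp) :
      Exec (.setRReg i e) s (s.setRReg i (e.eval s)) (e.cost + 1)
  | setIArr (s : State) (a : ℕ) (k e : IExp) :
      Exec (.setIArr a k e) s (s.setIArr a (k.eval s) (e.eval s)) (k.cost + e.cost + 1)
  | setRArr (s : State) (a : ℕ) (k : IExp) (e : RExp) :
      Exec (.setRArr a k e) s (s.setRArr a (k.eval s) (e.eval s)) (k.cost + e.cost + 1)
  | seq {P Q : Prog} {s s' s'' : State} {t t' : ℕ} :
      Exec P s s' t → Exec Q s' s'' t' → Exec (.seq P Q) s s'' (t + t')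
  | ite_true {b : BExp} {P Q : Prog} {s s' : State} {t : ℕ} :
      b.holds s → Exec P s s' t → Exec (.ite b P Q) s s' (b.cost + t + 1)
  | ite_false {b : BExp} {P Q : Prog} {s s' : State} {t : ℕ} :
      ¬ b.holds s → Exec Q s s' t → Exec (.ite b P Q) s s' (b.cost + t + 1)
  | loop_true {b : BExp} {P : Prog} {s s' s'' : State} {t t' : ℕ} :
      b.holds s → Exec P s s' t → Exec (.loop b P) s' s'' t' →
      Exec (.loop b P) s s'' (b.cost + t + t' + 1)
  | loop_false {b : BExp} {P : Prog} {s : State} :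
      ¬ b.holds s → Exec (.loop b P) s s (b.cost + 1)

end RealRAM

/-! ## Convex polygons and triangles -/

namespace AlphaTriangle

open RealRAM

/-- The plane with its Euclidean structure. -/
abbrev Plane : Type := EuclideanSpace ℝ (Fin 2)

/-- Twice the signed area of the triangle `p q r`; positive iff `p, q, r` is counterclockwise. -/
def orient (p q r : Plane) : ℝ :=
  (q 0 - p 0) * (r 1 - p 1) - (q 1 - p 1) * (r 0 - p 0)

/-- The area of the triangle with the corners `p, q, r`. -/
def area (p q r : Plane) : ℝ := |orient p q r| / 2

/-- `v 0, …, v (n - 1)` are the vertices of a convex `n`-gon, in the order in which they occur along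
its boundary, which is traversed either counterclockwise or clockwise. No three vertices are
collinear. -/
def IsConvexPolygon {n : ℕ} (v : Fin n → Plane) : Prop :=
  3 ≤ n ∧
    ((∀ i j k : Fin n, i < j → j < k → 0 < orient (v i) (v j) (v k)) ∨
      (∀ i j k : Fin n, i < j → j < k → orient (v i) (v j) (v k) < 0))

/-- The convex polygon (with its interior) whose vertices are `v 0, …, v (n - 1)`. -/
def region {n : ℕ} (v : Fin n → Plane) : Set Plane := convexHull ℝ (Set.range v)

/-- The sign that a Boolean stands for. -/
def sgn (b : Bool) : ℝ := if b then 1 else -1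

/-- A placement of a triangle `p q r` with horizontal base `p q`. First component: `true` if `p` is
the left end of the base, `false` if it is the right end. Second component: `true` if the apex `r`
is above the base, `false` if it is below. The labelling `p, q, r` is counterclockwise iff the two
components are equal. -/
abbrev Placement : Type := Bool × Bool

/-- The triangle `p q r` has the placement `d`. -/
def HasPlacement (d : Placement) (p q r : Plane) : Prop :=
  0 < sgn d.1 * (q 0 - p 0) ∧ 0 < sgn d.2 * (r 1 - p 1)

/-- `p q r` is a triangle whose base `p q` is parallel to the `x`-axis, whose interior angle at the
corner `p` of the base is `α`, and whose placement is one of those in `D`. -/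
def IsAxisAlignedTriangle (α : ℝ) (D : Set Placement) (p q r : Plane) : Prop :=
  q 1 = p 1 ∧ EuclideanGeometry.angle r p q = α ∧ ∃ d ∈ D, HasPlacement d p q r

/-- The triangle `p q r` is inscribed in (that is, contained in) the polygon. -/
def IsInscribed {n : ℕ} (v : Fin n → Plane) (p q r : Plane) : Prop :=
  convexHull ℝ ({p, q, r} : Set Plane) ⊆ region v

/-- `p q r` has maximum area among the axis-aligned triangles with angle `α` and placement in `D`
that are inscribed in the polygon. -/
def IsLargest (α : ℝ) (D : Set Placement) {n : ℕ} (v : Fin n → Plane) (p q r : Plane) : Prop :=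
  IsAxisAlignedTriangle α D p q r ∧ IsInscribed v p q r ∧
    ∀ p' q' r' : Plane, IsAxisAlignedTriangle α D p' q' r' → IsInscribed v p' q' r' →
      area p' q' r' ≤ area p q r

/-! ## Input and output

Everything in a state that is not mentioned here may be arbitrary. -/

/-- The number `n` of vertices is in integer register `0`; the angle `α` is given by its cosine and
its sine in real registers `0` and `1`. -/
def HasParameters (s : State) (n : ℕ) (α : ℝ) : Prop :=
  s.ireg 0 = n ∧ s.rreg 0 = Real.cos α ∧ s.rreg 1 = Real.sin α

/-- The vertices are stored in order in an array: real array `0` holds the `x`-coordinates and real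
array `1` the `y`-coordinates. -/
def StoredInArray (s : State) {n : ℕ} (v : Fin n → Plane) : Prop :=
  ∀ i : Fin n, s.rarr 0 (i : ℕ) = v i 0 ∧ s.rarr 1 (i : ℕ) = v i 1

/-- `IsTree s a l h`: the pointer `a` is the root of a binary tree of height `h` whose nodes, in
symmetric order, have the addresses in the list `l`. Integer array `0` holds the pointers to left
children, integer array `1` those to right children; `-1` is the null pointer. -/
inductive IsTree (s : State) : ℤ → List ℤ → ℕ → Prop where
  | nil : IsTree s (-1) [] 0
  | node (a : ℤ) (l l' : List ℤ) (h h' : ℕ) : 0 ≤ a →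
      IsTree s (s.iarr 0 a) l h → IsTree s (s.iarr 1 a) l' h' →
      IsTree s a (l ++ a :: l') (max h h' + 1)

/-- The vertices are stored in order in a binary search tree of height `h` whose root is in integer
register `1`: the `i`-th node in symmetric order holds the coordinates of `v i`, in the cells of
real arrays `0` and `1` at the address of the node. -/
def StoredInTree (s : State) {n : ℕ} (v : Fin n → Plane) (h : ℕ) : Prop :=
  ∃ node : Fin n → ℤ, IsTree s (s.ireg 1) (List.ofFn node) h ∧
    ∀ i : Fin n, s.rarr 0 (node i) = v i 0 ∧ s.rarr 1 (node i) = v i 1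

/-- The point whose coordinates are in real registers `i` and `i + 1`. -/
def outPoint (s : State) (i : ℕ) : Plane := !₂[s.rreg i, s.rreg (i + 1)]

/-- Started in the state `s`, the program `P` halts within `T` steps, and real registers
`0, …, 5` then hold the coordinates of the corners `p, q, r` of a largest triangle. -/
def FindsLargest (P : Prog) (s : State) (T : ℝ) (α : ℝ) (D : Set Placement) {n : ℕ}
    (v : Fin n → Plane) : Prop :=
  ∃ (s' : State) (t : ℕ), Exec P s s' t ∧ (t : ℝ) ≤ T ∧
    IsLargest α D v (outPoint s' 0) (outPoint s' 2) (outPoint s' 4)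

end AlphaTriangle

end

noncomputable section

/-! ### A calculus of functions on trees that compile to the machine in constant or linear time -/

namespace RealRAM

/-! ## Trees of points and their layouts in memory -/

/-! Geometry. For one placement, reflections and a shear along the x-axis preserve areas and turn
the admitted triangles into right triangles with corners `(a, b)`, `(a + w, b)`, `(a, b + h)` and
`w, h > 0` (`angle_iff`, `Raw.mem_region_iff`). There are at most four placements, so it suffices to
maximise `w * h` in a convex polygon `P`. Among the largest triangles take a leftmost one
(`exists_best`). Either its right-angled corner lies on a strictly falling edge of the lower left
boundary, or the corner is free to move left and down as far as `P` extends in these directions at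
all (`Best.cases`).

First case. Edges for the corner, the apex and the end of the base have to be found on three chains.
Optimality is used to first order: no motion that keeps the three points in `P` increases the area
(`Opt.deriv_le`). Replacing each chain by the line through one of its chords yields a constant-time
test `testA`. By convexity either answer rules out a part of at least one of the three chains,
without telling which one (`testA_high`, `testA_low`). This calls for tentative prune-and-search:
the windows on the upper and the right chain are shrunk on probation, with at least one of them
known to be right at each end, and they are certified or taken back later, when progress on the
lower chain shows which was right (`Tri.inv_step`). A potential that is linear in the tree heights
drops at every step (`Tri.meas_step`). When the edge with the corner is known, a search on two
chains finds the other two edges (`OnEdgeAt.dec`). The triangles on three fixed edges form a family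
that is linear in one parameter, so a largest one is at an end of the range or is stationary
(`edgeTris_spec`).

Second case. The apex is on the upper left and the base end on the lower right boundary. Let `u` and
`v` be the slopes of the two chains, each as a function of the coordinate of the corner that drives
it. Room to move both right and up is impossible if `u * v > 1`; room to move both left and down is
impossible if `u * v ≤ 1`, because the triangle could then be translated (`Free.tie`). Hence one
comparison always discards a part of a definite chain. At the end the apex or the base end is a
vertex, and again a linear family remains (`candFree_spec`).

All candidates are tested for containment by point location in a fan of triangles (`inside_iff`),
and the best valid one is returned (`best_spec`).

Running time. The algorithm is written as functions on trees, and `Comp` is the class of functions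
computable in constant time or in time linear in the height; it is closed under composition, pairing
and case distinction, and `Comp.loop` adds loops with a decreasing measure. A polygon is a view of a
tree in memory, so reversing, shifting and mapping it linearly costs constant time. An interval of
an array is read as a balanced tree by bisection, which makes the two situations of the theorem
instances of `exists_findsLargest`. -/

/-- A binary tree of points as it lies in memory. -/
inductive Raw where
  | nil
  | node (l : Raw) (x y : ℝ) (r : Raw)

/-- A point of the plane with a sorting key. -/
@[ext] structure V where
  key : ℝ
  x : ℝ
  y : ℝ

/-- A binary search tree of points. -/
inductive Tree where
  | nil
  | node (l : Tree) (v : V) (r : Tree)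

namespace Tree

def isNil : Tree → Bool
  | nil => true
  | node _ _ _ => false

def left : Tree → Tree
  | nil => nil
  | node l _ _ => l

def right : Tree → Tree
  | nil => nil
  | node _ _ r => r

def root : Tree → V
  | nil => ⟨0, 0, 0⟩
  | node _ v _ => v

def height : Tree → ℕ
  | nil => 0
  | node l _ r => max l.height r.height + 1

def mirror : Tree → Tree
  | nil => nil
  | node l v r => node r.mirror ⟨-v.key, v.x, v.y⟩ l.mirror

/-- The tree of the images of the points under a linear map. -/
def lin (a b c d : ℝ) : Tree → Tree
  | nil => nil
  | node l v r => node (l.lin a b c d) ⟨v.key, a * v.x + b * v.y, c * v.x + d * v.y⟩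
      (r.lin a b c d)

/-- The tree with all keys increased by one. -/
def shift : Tree → Tree
  | nil => nil
  | node l v r => node l.shift ⟨v.key + 1, v.x, v.y⟩ r.shift

/-- The points in symmetric order. -/
def toList : Tree → List V
  | nil => []
  | node l v r => l.toList ++ v :: r.toList

end Tree

namespace Raw

def height : Raw → ℕ
  | nil => 0
  | node l _ _ r => max l.height r.height + 1

/-- The points in symmetric order. -/
def toList : Raw → List (ℝ × ℝ)
  | nil => []
  | node l x y r => l.toList ++ (x, y) :: r.toList

/-- A tree in memory read with keys between `p` and `q`, through a linear map, and from right to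
left if the flag is set. -/
def view (fl : Bool) (p q a b c d : ℝ) : Raw → Tree
  | nil => .nil
  | node l x y r =>
    bif fl then
      .node (r.view fl p ((p + q) / 2) a b c d) ⟨(p + q) / 2, a * x + b * y, c * x + d * y⟩
        (l.view fl ((p + q) / 2) q a b c d)
    else
      .node (l.view fl p ((p + q) / 2) a b c d) ⟨(p + q) / 2, a * x + b * y, c * x + d * y⟩
        (r.view fl ((p + q) / 2) q a b c d)

theorem view_height (fl : Bool) (t : Raw) : ∀ p q a b c d : ℝ,
    (t.view fl p q a b c d).height = t.height := by
  induction t with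
  | nil => intros; rfl
  | node l x y r ihl ihr =>
    intro p q a b c d
    cases fl <;> simp [view, Tree.height, height, ihl, ihr, max_comm]

/-- Reversal, like the shift and the linear maps below, acts on the parameters of the view alone.
The machine therefore performs it on a few registers and never touches the tree in memory. -/
theorem view_mirror (fl : Bool) (t : Raw) : ∀ p q a b c d : ℝ,
    (t.view fl p q a b c d).mirror = t.view (!fl) (-q) (-p) a b c d := by
  induction t with
  | nil => intros; rfl
  | node l x y r ihl ihr =>
    intro p q a b c d
    have h : (-q + -p) / 2 = -((p + q) / 2) := by ring
    cases fl <;> simp [view, Tree.mirror, ihl, ihr, h]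

theorem view_shift (fl : Bool) (t : Raw) : ∀ p q a b c d : ℝ,
    (t.view fl p q a b c d).shift = t.view fl (p + 1) (q + 1) a b c d := by
  induction t with
  | nil => intros; rfl
  | node l x y r ihl ihr =>
    intro p q a b c d
    have h : (p + 1 + (q + 1)) / 2 = (p + q) / 2 + 1 := by ring
    cases fl <;> simp [view, Tree.shift, ihl, ihr, h]

theorem view_lin (fl : Bool) (t : Raw) (a' b' c' d' : ℝ) : ∀ p q a b c d : ℝ,
    (t.view fl p q a b c d).lin a' b' c' d' =
      t.view fl p q (a' * a + b' * c) (a' * b + b' * d) (c' * a + d' * c) (c' * b + d' * d) := by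
  induction t with
  | nil => intros; rfl
  | node l x y r ihl ihr =>
    intro p q a b c d
    cases fl <;> simp only [view, Tree.lin, ihl, ihr, cond_true, cond_false] <;> congr 2 <;> ring

end Raw

/-- The states differ only in registers from `m` and `n` on. -/
def Agree (m n : ℕ) (s s' : State) : Prop :=
  s'.iarr = s.iarr ∧ s'.rarr = s.rarr ∧ (∀ k < m, s'.ireg k = s.ireg k) ∧
    ∀ k < n, s'.rreg k = s.rreg k

/-- The value of the expression depends only on registers below `m` and `n`, and on the arrays. -/
def IExp.Below (m n : ℕ) (e : IExp) : Prop := ∀ s s', Agree m n s s' → e.eval s' = e.eval s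

def RExp.Below (m n : ℕ) (e : RExp) : Prop := ∀ s s', Agree m n s s' → e.eval s' = e.eval s

/-- How trees are stored: a tree is given by two integers. The expressions refer to a tree whose
integers are in the registers `i` and `i + 1`. -/
structure Layout where
  rep : (ℕ → ℤ → ℤ) → (ℕ → ℤ → ℝ) → Raw → ℤ → ℤ → Prop
  isNil : ℕ → BExp
  addr : ℕ → IExp
  left₁ : ℕ → IExp
  left₂ : ℕ → IExp
  right₁ : ℕ → IExp
  right₂ : ℕ → IExp
  nil₁ : ℤ
  nil₂ : ℤ
  cost : ℕ
  cost_isNil : ∀ i, (isNil i).cost ≤ cost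
  cost_addr : ∀ i, (addr i).cost ≤ cost
  cost_left₁ : ∀ i, (left₁ i).cost ≤ cost
  cost_left₂ : ∀ i, (left₂ i).cost ≤ cost
  cost_right₁ : ∀ i, (right₁ i).cost ≤ cost
  cost_right₂ : ∀ i, (right₂ i).cost ≤ cost
  below : ∀ i m n, i + 2 ≤ m → (addr i).Below m n ∧ (left₁ i).Below m n ∧ (left₂ i).Below m n ∧
    (right₁ i).Below m n ∧ (right₂ i).Below m n
  rep_nil : ∀ ia ra, rep ia ra .nil nil₁ nil₂
  isNil_iff : ∀ s i t, rep s.iarr s.rarr t (s.ireg i) (s.ireg (i + 1)) →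
    ((isNil i).holds s ↔ t = .nil)
  node : ∀ s i l x y r, rep s.iarr s.rarr (.node l x y r) (s.ireg i) (s.ireg (i + 1)) →
    rep s.iarr s.rarr l ((left₁ i).eval s) ((left₂ i).eval s) ∧
    rep s.iarr s.rarr r ((right₁ i).eval s) ((right₂ i).eval s) ∧
    s.rarr 0 ((addr i).eval s) = x ∧ s.rarr 1 ((addr i).eval s) = y

/-! ## Values in registers -/

/-- How the values of a type are kept in consecutive registers. -/
class Enc (α : Type) where
  ni : ℕ
  nr : ℕ
  rep : Layout → (ℕ → ℤ → ℤ) → (ℕ → ℤ → ℝ) → (ℕ → ℤ) → (ℕ → ℝ) → α → Prop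
  size : α → ℕ
  congr : ∀ L ia ra i i' r r' x, (∀ k < ni, i' k = i k) → (∀ k < nr, r' k = r k) →
    rep L ia ra i r x → rep L ia ra i' r' x

open Enc

instance : Enc Unit where
  ni := 0
  nr := 0
  rep _ _ _ _ _ _ := True
  size _ := 0
  congr := by intros; trivial

instance : Enc ℝ where
  ni := 0
  nr := 1
  rep _ _ _ _ r x := r 0 = x
  size _ := 0
  congr _ _ _ _ _ _ _ _ _ h hx := by rw [h 0 one_pos, hx]

instance : Enc Bool where
  ni := 1
  nr := 0
  rep _ _ _ i _ x := i 0 = if x then 1 else 0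
  size _ := 0
  congr _ _ _ _ _ _ _ _ h _ hx := by rw [h 0 one_pos, hx]

instance : Enc Tree where
  ni := 3
  nr := 6
  rep L ia ra i r x := ∃ t : Raw, ∃ fl : Bool, L.rep ia ra t (i 0) (i 1) ∧
    (i 2 = if fl then 1 else 0) ∧ x = t.view fl (r 0) (r 1) (r 2) (r 3) (r 4) (r 5)
  size t := t.height
  congr _ _ _ _ _ _ _ _ h h' hx := by
    simpa only [h 0 (by norm_num), h 1 (by norm_num), h 2 (by norm_num), h' 0 (by norm_num),
      h' 1 (by norm_num), h' 2 (by norm_num), h' 3 (by norm_num), h' 4 (by norm_num),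
      h' 5 (by norm_num)] using hx

instance {α β : Type} [Enc α] [Enc β] : Enc (α × β) where
  ni := ni α + ni β
  nr := nr α + nr β
  rep L ia ra i r x := rep L ia ra i r x.1 ∧
    rep L ia ra (fun k => i (ni α + k)) (fun k => r (nr α + k)) x.2
  size x := max (size x.1) (size x.2)
  congr L ia ra i i' r r' x h h' hx :=
    ⟨Enc.congr L ia ra i i' r r' x.1 (fun k hk => h k (by omega)) (fun k hk => h' k (by omega))
      hx.1, Enc.congr L ia ra _ _ _ _ x.2 (fun k hk => h _ (by omega))
      (fun k hk => h' _ (by omega)) hx.2⟩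

/-- The encoding of a type through another one. -/
@[reducible] def Enc.via {α β : Type} [Enc β] (f : α → β) : Enc α where
  ni := ni β
  nr := nr β
  rep L ia ra i r x := rep L ia ra i r (f x)
  size x := size (f x)
  congr L ia ra i i' r r' x := Enc.congr L ia ra i i' r r' (f x)

variable {α β γ δ : Type} [Enc α] [Enc β] [Enc γ] [Enc δ]

/-- Registers from `i` and `r` on hold the value `x`. -/
def Holds (L : Layout) (s : State) (i r : ℕ) (x : α) : Prop :=
  Enc.rep L s.iarr s.rarr (fun k => s.ireg (i + k)) (fun k => s.rreg (r + k)) x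

theorem Agree.refl (m n : ℕ) (s : State) : Agree m n s s :=
  ⟨rfl, rfl, fun _ _ => rfl, fun _ _ => rfl⟩

theorem Agree.trans {m n : ℕ} {s s' s'' : State} (h : Agree m n s s') (h' : Agree m n s' s'') :
    Agree m n s s'' :=
  ⟨h'.1.trans h.1, h'.2.1.trans h.2.1, fun k hk => (h'.2.2.1 k hk).trans (h.2.2.1 k hk),
    fun k hk => (h'.2.2.2 k hk).trans (h.2.2.2 k hk)⟩

theorem Agree.mono {m n m' n' : ℕ} {s s' : State} (h : Agree m' n' s s') (hm : m ≤ m')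
    (hn : n ≤ n') : Agree m n s s' :=
  ⟨h.1, h.2.1, fun k hk => h.2.2.1 k (hk.trans_le hm), fun k hk => h.2.2.2 k (hk.trans_le hn)⟩

theorem Holds.agree {L : Layout} {s s' : State} {i r m n : ℕ} {x : α} (h : Holds L s i r x)
    (hs : Agree m n s s') (hm : i + ni α ≤ m) (hn : r + nr α ≤ n) : Holds L s' i r x := by
  unfold Holds at *
  rw [hs.1, hs.2.1]
  exact Enc.congr L _ _ _ _ _ _ x (fun k hk => hs.2.2.1 _ (by omega))
    (fun k hk => hs.2.2.2 _ (by omega)) h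

theorem holds_prod {L : Layout} {s : State} {i r : ℕ} {x : α × β} :
    Holds L s i r x ↔ Holds L s i r x.1 ∧ Holds L s (i + ni α) (r + nr α) x.2 := by
  simp only [Holds, Enc.rep, add_assoc]

/-! ## Copying registers -/

def copyI (i m : ℕ) : ℕ → Prog
  | 0 => .skip
  | k + 1 => .seq (copyI i m k) (.setIReg (m + k) (.reg (i + k)))

def copyR (i m : ℕ) : ℕ → Prog
  | 0 => .skip
  | k + 1 => .seq (copyR i m k) (.setRReg (m + k) (.reg (i + k)))

/-- The blocks may overlap if the target is the lower one, since copying in ascending order then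
reads each register before it is overwritten. -/
theorem exec_copyI (i m k : ℕ) (h : m ≤ i ∨ i + k ≤ m) (s : State) :
    ∃ s', Exec (copyI i m k) s s' (2 * k + 1) ∧ s'.iarr = s.iarr ∧ s'.rarr = s.rarr ∧
      s'.rreg = s.rreg ∧ (∀ j < k, s'.ireg (m + j) = s.ireg (i + j)) ∧
      (∀ j, j < m ∨ m + k ≤ j → s'.ireg j = s.ireg j) := by
  induction k with
  | zero => exact ⟨s, .skip s, rfl, rfl, rfl, by simp, fun _ _ => rfl⟩
  | succ k ih =>
    obtain ⟨s', h1, h2, h3, h4, h5, h6⟩ := ih (by omega)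
    have he : ((IExp.reg (i + k)).eval s') = s.ireg (i + k) := h6 _ (by omega)
    refine ⟨_, (Exec.seq h1 (.setIReg s' (m + k) (.reg (i + k))) : Exec _ _ _ (2 * k + 1 + 2)),
      h2, h3, h4, ?_, ?_⟩
    · intro j hj
      simp only [State.setIReg, he]
      rcases Nat.lt_succ_iff_lt_or_eq.1 hj with hj | rfl
      · rw [Function.update_of_ne (by omega), h5 j hj]
      · rw [Function.update_self]
    · intro j hj
      simp only [State.setIReg]
      rw [Function.update_of_ne (by omega), h6 j (by omega)]

theorem exec_copyR (i m k : ℕ) (h : m ≤ i ∨ i + k ≤ m) (s : State) :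
    ∃ s', Exec (copyR i m k) s s' (2 * k + 1) ∧ s'.iarr = s.iarr ∧ s'.rarr = s.rarr ∧
      s'.ireg = s.ireg ∧ (∀ j < k, s'.rreg (m + j) = s.rreg (i + j)) ∧
      (∀ j, j < m ∨ m + k ≤ j → s'.rreg j = s.rreg j) := by
  induction k with
  | zero => exact ⟨s, .skip s, rfl, rfl, rfl, by simp, fun _ _ => rfl⟩
  | succ k ih =>
    obtain ⟨s', h1, h2, h3, h4, h5, h6⟩ := ih (by omega)
    have he : ((RExp.reg (i + k)).eval s') = s.rreg (i + k) := h6 _ (by omega)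
    refine ⟨_, (Exec.seq h1 (.setRReg s' (m + k) (.reg (i + k))) : Exec _ _ _ (2 * k + 1 + 2)),
      h2, h3, h4, ?_, ?_⟩
    · intro j hj
      simp only [State.setRReg, he]
      rcases Nat.lt_succ_iff_lt_or_eq.1 hj with hj | rfl
      · rw [Function.update_of_ne (by omega), h5 j hj]
      · rw [Function.update_self]
    · intro j hj
      simp only [State.setRReg]
      rw [Function.update_of_ne (by omega), h6 j (by omega)]

/-- Copies `a` integer and `b` real registers. -/
def copy (a b i r m n : ℕ) : Prog := .seq (copyI i m a) (copyR r n b)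

theorem exec_copy (L : Layout) (i r m n : ℕ) (h : m ≤ i ∨ i + ni α ≤ m)
    (h' : n ≤ r ∨ r + nr α ≤ n) (s : State) (x : α) (hx : Holds L s i r x) :
    ∃ s', Exec (copy (ni α) (nr α) i r m n) s s' (2 * ni α + 1 + (2 * nr α + 1)) ∧
      Agree m n s s' ∧ Holds L s' m n x := by
  obtain ⟨s', h1, h2, h3, h4, h5, h6⟩ := exec_copyI i m (ni α) h s
  obtain ⟨s'', g1, g2, g3, g4, g5, g6⟩ := exec_copyR r n (nr α) h' s'
  refine ⟨s'', .seq h1 g1, ⟨g2.trans h2, g3.trans h3, fun k hk => ?_, fun k hk => ?_⟩, ?_⟩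
  · rw [g4, h6 k (.inl hk)]
  · rw [g6 k (.inl hk), h4]
  · unfold Holds at *
    rw [g2, g3, h2, h3]
    refine Enc.congr L _ _ _ _ _ _ x (fun k hk => ?_) (fun k hk => ?_) hx
    · rw [g4, h5 k hk]
    · rw [g5 k hk, h4]

/-! ## Computable functions -/

/-- The function `f` is computed by a program that puts the result into registers from `m` and `n`
on and leaves the lower ones alone; the number of steps is bounded if `k = 0`, and linear in the
height of the trees in the input if `k = 1`. -/
@[fun_prop]
def Comp (L : Layout) (k : ℕ) (f : α → β) : Prop :=
  (∀ x, size (f x) ≤ size x) ∧ ∃ (c : ℕ) (P : ℕ → ℕ → ℕ → ℕ → Prog), ∀ i r m n : ℕ,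
    i + ni α ≤ m → r + nr α ≤ n → ∀ (s : State) (x : α), Holds L s i r x →
      ∃ s' t, Exec (P i r m n) s s' t ∧ t ≤ c * (k * size x + 1) ∧ Agree m n s s' ∧
        Holds L s' m n (f x)

variable {L : Layout} {k : ℕ}

/-- This covers projections and changes of type: the value already sits at a fixed offset in the
input registers. -/
theorem Comp.copy_of {f : α → β} (h0 : ∀ x, size (f x) ≤ size x) (a b : ℕ)
    (ha : a + ni β ≤ ni α) (hb : b + nr β ≤ nr α)
    (h : ∀ s i r x, Holds L s i r x → Holds L s (i + a) (r + b) (f x)) : Comp L k f := by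
  refine ⟨h0, 2 * ni β + 1 + (2 * nr β + 1),
    fun i r m n => copy (ni β) (nr β) (i + a) (r + b) m n, fun i r m n hi hr s x hx => ?_⟩
  obtain ⟨s', h1, h2, h3⟩ := exec_copy L (i + a) (r + b) m n (.inr (by omega))
    (.inr (by omega)) s (f x) (h s i r x hx)
  exact ⟨s', _, h1, Nat.le_mul_of_pos_right _ (by omega), h2, h3⟩

@[fun_prop]
theorem Comp.id : Comp L k (fun x : α => x) :=
  .copy_of (fun _ => le_rfl) 0 0 (by omega) (by omega) (fun _ _ _ _ h => h)

/-- The second program is charged for the size of the intermediate value; this is why `Comp` demands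
that sizes do not grow. The final value is produced above the intermediate one and then copied down
over it. -/
theorem Comp.comp' {f : α → β} {g : β → γ} (hg : Comp L k g) (hf : Comp L k f) :
    Comp L k (fun x => g (f x)) := by
  obtain ⟨h0, c, P, hP⟩ := hf
  obtain ⟨g0, d, Q, hQ⟩ := hg
  refine ⟨fun x => (g0 _).trans (h0 x), c + d + (2 * ni γ + 1 + (2 * nr γ + 1)), fun i r m n =>
    .seq (P i r m n) (.seq (Q m n (m + ni β) (n + nr β))
      (copy (ni γ) (nr γ) (m + ni β) (n + nr β) m n)), fun i r m n hi hr s x hx => ?_⟩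
  obtain ⟨s₁, t₁, h1, h2, h3, h4⟩ := hP i r m n hi hr s x hx
  obtain ⟨s₂, t₂, g1, g2, g3, g4⟩ := hQ m n _ _ le_rfl le_rfl s₁ (f x) h4
  obtain ⟨s₃, c1, c2, c3⟩ := exec_copy L (m + ni β) (n + nr β) m n (.inl (by omega))
    (.inl (by omega)) s₂ _ g4
  refine ⟨s₃, _, .seq h1 (.seq g1 c1), ?_,
    h3.trans ((g3.mono (by omega) (by omega)).trans c2), c3⟩
  have : d * (k * size (f x) + 1) ≤ d * (k * size x + 1) := by
    have := h0 x
    gcongr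
  have e : (c + d + (2 * ni γ + 1 + (2 * nr γ + 1))) * (k * size x + 1) = c * (k * size x + 1)
    + d * (k * size x + 1) + (2 * ni γ + 1 + (2 * nr γ + 1)) * (k * size x + 1) := by ring
  have : 2 * ni γ + 1 + (2 * nr γ + 1) ≤ (2 * ni γ + 1 + (2 * nr γ + 1)) * (k * size x + 1) :=
    Nat.le_mul_of_pos_right _ (by omega)
  omega

@[fun_prop]
theorem Comp.comp {f : α → β} {g : β → γ} (hg : Comp L k g) (hf : Comp L k f) :
    Comp L k (fun x => g (f x)) := hg.comp' hf

@[fun_prop]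
theorem Comp.prodMk {f : α → β} {g : α → γ} (hf : Comp L k f) (hg : Comp L k g) :
    Comp L k (fun x => (f x, g x)) := by
  obtain ⟨h0, c, P, hP⟩ := hf
  obtain ⟨g0, d, Q, hQ⟩ := hg
  refine ⟨fun x => max_le (h0 x) (g0 x), c + d, fun i r m n =>
    .seq (P i r m n) (Q i r (m + ni β) (n + nr β)), fun i r m n hi hr s x hx => ?_⟩
  obtain ⟨s₁, t₁, h1, h2, h3, h4⟩ := hP i r m n hi hr s x hx
  obtain ⟨s₂, t₂, g1, g2, g3, g4⟩ := hQ i r (m + ni β) (n + nr β) (by omega) (by omega) s₁ x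
    (hx.agree h3 hi hr)
  refine ⟨s₂, _, .seq h1 g1, by rw [add_mul]; omega,
    h3.trans (g3.mono (by omega) (by omega)), holds_prod.2 ⟨h4.agree g3 le_rfl le_rfl, g4⟩⟩

@[fun_prop]
theorem Comp.fst : Comp L k (fun x : α × β => x.1) :=
  .copy_of (fun _ => le_max_left _ _) 0 0 (by simp [ni]) (by simp [nr])
    (fun _ _ _ _ h => (holds_prod.1 h).1)

@[fun_prop]
theorem Comp.snd : Comp L k (fun x : α × β => x.2) :=
  .copy_of (fun _ => le_max_right _ _) (ni α) (nr α) le_rfl le_rfl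
    (fun _ _ _ _ h => (holds_prod.1 h).2)

/-- A computable function whose result is in some of the input registers. -/
theorem Comp.of_holds {f : α → β} (h0 : ∀ x, size (f x) = size x) (hi : ni α = ni β)
    (hr : nr α = nr β) (h : ∀ s i r x, Holds L s i r x → Holds L s i r (f x)) : Comp L k f :=
  .copy_of (fun x => (h0 x).le) 0 0 (by omega) (by omega) (fun s i r x hx => h s i r x hx)

/-! ## Straight-line programs -/

/-- Assigns values to consecutive integer registers. -/
def assignI (m : ℕ) : List IExp → Prog
  | [] => .skip
  | e :: l => .seq (.setIReg m e) (assignI (m + 1) l)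

def assignR (n : ℕ) : List RExp → Prog
  | [] => .skip
  | e :: l => .seq (.setRReg n e) (assignR (n + 1) l)

theorem agree_setIReg {m n j : ℕ} (h : m ≤ j) (s : State) (x : ℤ) :
    Agree m n s (s.setIReg j x) :=
  ⟨rfl, rfl, fun k hk => by simp [State.setIReg, Function.update_of_ne (show k ≠ j by omega)],
    fun _ _ => rfl⟩

theorem agree_setRReg {m n j : ℕ} (h : n ≤ j) (s : State) (x : ℝ) :
    Agree m n s (s.setRReg j x) :=
  ⟨rfl, rfl, fun _ _ => rfl,
    fun k hk => by simp [State.setRReg, Function.update_of_ne (show k ≠ j by omega)]⟩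

/-- The expressions are evaluated one after the other in changing states. They depend only on
registers below the targets, so all of them keep the values they had at the start. -/
theorem exec_assignI (m n : ℕ) (l : List IExp) (hl : ∀ e ∈ l, e.Below m n) : ∀ (j : ℕ), m ≤ j →
    ∀ s : State, ∃ s', Exec (assignI j l) s s' ((l.map (fun e => e.cost + 1)).sum + 1) ∧
      Agree j n s s' ∧ s'.rreg = s.rreg ∧
      ∀ (k : ℕ) (hk : k < l.length), s'.ireg (j + k) = (l[k]).eval s := by
  induction l with
  | nil => exact fun j _ s => ⟨s, .skip s, Agree.refl _ _ _, rfl, by simp⟩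
  | cons e l ih =>
    intro j hj s
    obtain ⟨s', h1, h2, h3, h4⟩ := ih (fun e he => hl e (List.mem_cons_of_mem _ he)) (j + 1)
      (by omega) (s.setIReg j (e.eval s))
    refine ⟨s', ?_, (agree_setIReg le_rfl _ _).trans (h2.mono (by omega) le_rfl),
      h3.trans rfl, ?_⟩
    · have := Exec.seq (.setIReg s j e) h1
      simpa [assignI, add_assoc] using this
    · intro k hk
      cases k with
      | zero =>
        rw [add_zero, h2.2.2.1 j (by omega)]
        simp [State.setIReg]
      | succ k =>
        have := h4 k (by simpa using hk)
        rw [show j + (k + 1) = j + 1 + k by ring, this]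
        exact hl _ (List.mem_cons_of_mem _ (List.getElem_mem _)) _ _
          (agree_setIReg hj s _)

theorem exec_assignR (m n : ℕ) (l : List RExp) (hl : ∀ e ∈ l, e.Below m n) : ∀ (j : ℕ), n ≤ j →
    ∀ s : State, ∃ s', Exec (assignR j l) s s' ((l.map (fun e => e.cost + 1)).sum + 1) ∧
      Agree m j s s' ∧ s'.ireg = s.ireg ∧
      ∀ (k : ℕ) (hk : k < l.length), s'.rreg (j + k) = (l[k]).eval s := by
  induction l with
  | nil => exact fun j _ s => ⟨s, .skip s, Agree.refl _ _ _, rfl, by simp⟩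
  | cons e l ih =>
    intro j hj s
    obtain ⟨s', h1, h2, h3, h4⟩ := ih (fun e he => hl e (List.mem_cons_of_mem _ he)) (j + 1)
      (by omega) (s.setRReg j (e.eval s))
    refine ⟨s', ?_, (agree_setRReg le_rfl _ _).trans (h2.mono le_rfl (by omega)),
      h3.trans rfl, ?_⟩
    · have := Exec.seq (.setRReg s j e) h1
      simpa [assignR, add_assoc] using this
    · intro k hk
      cases k with
      | zero =>
        rw [add_zero, h2.2.2.2 j (by omega)]
        simp [State.setRReg]
      | succ k =>
        have := h4 k (by simpa using hk)
        rw [show j + (k + 1) = j + 1 + k by ring, this]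
        exact hl _ (List.mem_cons_of_mem _ (List.getElem_mem _)) _ _
          (agree_setRReg hj s _)

/-- The function `f` is computed in constant time in states where `Φ` holds. -/
def CompIf (L : Layout) (Φ : State → ℕ → ℕ → Prop) (f : α → β) : Prop :=
  ∃ (c : ℕ) (P : ℕ → ℕ → ℕ → ℕ → Prog), ∀ i r m n : ℕ,
    i + ni α ≤ m → r + nr α ≤ n → ∀ (s : State) (x : α), Holds L s i r x → Φ s i r →
      ∃ s' t, Exec (P i r m n) s s' t ∧ t ≤ c ∧ Agree m n s s' ∧ Holds L s' m n (f x)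

theorem CompIf.toComp {f : α → β} (h : CompIf L (fun _ _ _ => True) f)
    (h0 : ∀ x, size (f x) ≤ size x) : Comp L k f := by
  obtain ⟨c, P, hP⟩ := h
  refine ⟨h0, c, P, fun i r m n hi hr s x hx => ?_⟩
  obtain ⟨s', t, h1, h2, h3⟩ := hP i r m n hi hr s x hx trivial
  exact ⟨s', t, h1, h2.trans (Nat.le_mul_of_pos_right _ (by omega)), h3⟩

theorem CompIf.ite {f : α → β} {Φ : State → ℕ → ℕ → Prop} (e : ℕ → ℕ → BExp) (c : ℕ)
    (hc : ∀ i r, (e i r).cost ≤ c) (h₁ : CompIf L (fun s i r => Φ s i r ∧ (e i r).holds s) f)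
    (h₂ : CompIf L (fun s i r => Φ s i r ∧ ¬ (e i r).holds s) f) : CompIf L Φ f := by
  obtain ⟨c₁, P₁, h₁⟩ := h₁
  obtain ⟨c₂, P₂, h₂⟩ := h₂
  refine ⟨c + (c₁ + c₂) + 1, fun i r m n => .ite (e i r) (P₁ i r m n) (P₂ i r m n),
    fun i r m n hi hr s x hx hs => ?_⟩
  have := hc i r
  by_cases hb : (e i r).holds s
  · obtain ⟨s', t, g1, g2, g3⟩ := h₁ i r m n hi hr s x hx ⟨hs, hb⟩
    exact ⟨s', _, .ite_true hb g1, by omega, g3⟩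
  · obtain ⟨s', t, g1, g2, g3⟩ := h₂ i r m n hi hr s x hx ⟨hs, hb⟩
    exact ⟨s', _, .ite_false hb g1, by omega, g3⟩

/-- The expression refers only to registers below `m` and `n`. -/
def RExp.Low (m n : ℕ) : RExp → Prop
  | const _ => True
  | reg i => i < n
  | get _ e => e.Below m n
  | add e f | sub e f | mul e f | div e f => e.Low m n ∧ f.Low m n

theorem RExp.Low.below {m n : ℕ} {e : RExp} (h : e.Low m n) : e.Below m n := by
  intro s s' hs
  induction e with
  | const => rfl
  | reg i => exact hs.2.2.2 i h
  | get a e => simp only [eval, h s s' hs, hs.2.1]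
  | add e f ihe ihf | sub e f ihe ihf | mul e f ihe ihf | div e f ihe ihf =>
    simp only [eval, ihe h.1, ihf h.2]

/-- A function that is given by expressions in the input registers is computable. -/
theorem CompIf.of_exps {f : α → β} {Φ : State → ℕ → ℕ → Prop}
    (es : ℕ → ℕ → List IExp) (fs : ℕ → ℕ → List RExp) (c : ℕ)
    (hc : ∀ i r, (((es i r).map (fun e => e.cost + 1)).sum + 1) +
      (((fs i r).map (fun e => e.cost + 1)).sum + 1) ≤ c)
    (hl : ∀ i r m n, i + ni α ≤ m → r + nr α ≤ n →
      (∀ e ∈ es i r, e.Below m n) ∧ ∀ e ∈ fs i r, e.Low m n)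
    (h : ∀ s i r (x : α), Holds L s i r x → Φ s i r → rep L s.iarr s.rarr
      (((es i r).map (IExp.eval s)).getD · 0) (((fs i r).map (RExp.eval s)).getD · 0) (f x))
    (hn : ∀ i r, (es i r).length = ni β ∧ (fs i r).length = nr β := by exact fun _ _ => ⟨rfl, rfl⟩) :
    CompIf L Φ f := by
  refine ⟨c, fun i r m n => .seq (assignI m (es i r)) (assignR n (fs i r)),
    fun i r m n hi hr s x hx hs => ?_⟩
  obtain ⟨he, hf⟩ := hl i r m n hi hr
  obtain ⟨s₁, h1, h2, h3, h4⟩ := exec_assignI m n (es i r) he m le_rfl s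
  obtain ⟨s₂, g1, g2, g3, g4⟩ := exec_assignR m n (fs i r) (fun e h => (hf e h).below) n le_rfl s₁
  refine ⟨s₂, _, .seq h1 g1, hc i r, h2.trans g2, ?_⟩
  unfold Holds
  rw [g2.1, g2.2.1, h2.1, h2.2.1]
  refine Enc.congr L _ _ _ _ _ _ _ (fun k hk => ?_) (fun k hk => ?_) (h s i r x hx hs)
  · rw [← (hn i r).1] at hk
    simp [g3, h4 k hk, hk]
  · rw [← (hn i r).2] at hk
    simp [g4 k hk, hk, (hf _ (List.getElem_mem hk)).below s s₁ h2]

/-- A real function of real registers. -/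
theorem Comp.of_rexp {f : α → ℝ} (e : ℕ → RExp) (c : ℕ) (hc : ∀ r, (e r).cost ≤ c)
    (hb : ∀ r m n, r + nr α ≤ n → (e r).Low m n)
    (h : ∀ s i r (x : α), Holds L s i r x → (e r).eval s = f x) : Comp L k f := by
  refine CompIf.toComp (.of_exps (fun _ _ => []) (fun _ r => [e r]) (c + 3) ?_ ?_ ?_)
    (fun _ => Nat.zero_le _)
  · intro i r; simp; have := hc r; omega
  · exact fun i r m n _ hr => ⟨by simp, by simpa using hb r m n hr⟩
  · exact fun s i r x hx _ => h s i r x hx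

theorem Comp.const_real (c : ℤ) : Comp L k (fun _ : α => (c : ℝ)) :=
  .of_rexp (fun _ => .const c) 1 (fun _ => le_rfl) (fun _ _ _ _ => trivial) (fun _ _ _ _ _ => rfl)

theorem holds_real₂ {s : State} {i r : ℕ} {x : ℝ × ℝ} (h : Holds L s i r x) :
    s.rreg r = x.1 ∧ s.rreg (r + 1) = x.2 := ⟨h.1, h.2⟩

/-- A binary operation on real numbers. -/
theorem Comp.op (o : RExp → RExp → RExp) {g : ℝ → ℝ → ℝ}
    (hc : ∀ e f, (o e f).cost = e.cost + f.cost + 1 := by intros; rfl)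
    (hl : ∀ m n e f, (o e f).Low m n ↔ e.Low m n ∧ f.Low m n := by intros; rfl)
    (he : ∀ s e f, (o e f).eval s = g (e.eval s) (f.eval s) := by intros; rfl) :
    Comp L k (fun x : ℝ × ℝ => g x.1 x.2) :=
  .of_rexp (fun r => o (.reg r) (.reg (r + 1))) 3 (fun _ => (hc _ _).le)
    (fun r m n (h : r + 2 ≤ n) => (hl _ _ _ _).2 ⟨by simp [RExp.Low]; omega,
      by simp [RExp.Low]; omega⟩)
    (fun s i r x h => by simp [he, RExp.eval, holds_real₂ h])

@[fun_prop] theorem Comp.add : Comp L k (fun x : ℝ × ℝ => x.1 + x.2) := .op .add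
@[fun_prop] theorem Comp.sub : Comp L k (fun x : ℝ × ℝ => x.1 - x.2) := .op .sub
@[fun_prop] theorem Comp.mul : Comp L k (fun x : ℝ × ℝ => x.1 * x.2) := .op .mul
@[fun_prop] theorem Comp.div : Comp L k (fun x : ℝ × ℝ => x.1 / x.2) := .op .div

@[fun_prop] theorem Comp.neg : Comp L k (fun x : ℝ => -x) := by
  simpa using Comp.sub.comp' ((Comp.const_real 0).prodMk Comp.id)

/-! ## Tests -/

/-- A test of the input registers is computable. -/
theorem Comp.of_bexp {f : α → Bool} (e : ℕ → ℕ → BExp) (c : ℕ) (hc : ∀ i r, (e i r).cost ≤ c)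
    (h : ∀ s i r (x : α), Holds L s i r x → ((e i r).holds s ↔ f x = true)) : Comp L k f := by
  refine ⟨fun _ => Nat.zero_le _, c + 3, fun i r m n => .ite (e i r) (.setIReg m (.const 1))
    (.setIReg m (.const 0)), fun i r m n hi hr s x hx => ?_⟩
  have hc' : (e i r).cost + (1 + 1) + 1 ≤ (c + 3) * (k * size x + 1) :=
    (show _ ≤ c + 3 by have := hc i r; omega).trans (Nat.le_mul_of_pos_right _ (by omega))
  by_cases hb : (e i r).holds s
  · refine ⟨_, _, .ite_true hb (.setIReg _ _ _), hc', agree_setIReg le_rfl _ _, ?_⟩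
    have := (h s i r x hx).1 hb
    simp [Holds, rep, State.setIReg, this, IExp.eval]
  · refine ⟨_, _, .ite_false hb (.setIReg _ _ _), hc', agree_setIReg le_rfl _ _, ?_⟩
    have := (h s i r x hx).not.1 hb
    simp [Holds, rep, State.setIReg, this, IExp.eval]

open Classical in
/-- The test whether `x ≤ y`. -/
def leB (x y : ℝ) : Bool := decide (x ≤ y)

open Classical in
/-- The test whether `x < y`. -/
def ltB (x y : ℝ) : Bool := decide (x < y)

@[simp] theorem leB_iff {x y : ℝ} : leB x y = true ↔ x ≤ y := by simp [leB]
@[simp] theorem ltB_iff {x y : ℝ} : ltB x y = true ↔ x < y := by simp [ltB]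
@[simp] theorem leB_false {x y : ℝ} : leB x y = false ↔ y < x := by simp [leB]
@[simp] theorem ltB_false {x y : ℝ} : ltB x y = false ↔ y ≤ x := by simp [ltB]

theorem comp_leB : Comp L k (fun x : ℝ × ℝ => leB x.1 x.2) :=
  .of_bexp (fun _ r => .rle (.reg r) (.reg (r + 1))) 3 (fun _ _ => le_rfl)
    (fun s i r x h => by simp [BExp.holds, RExp.eval, holds_real₂ h])

theorem comp_ltB : Comp L k (fun x : ℝ × ℝ => ltB x.1 x.2) :=
  .of_bexp (fun _ r => .not (.rle (.reg (r + 1)) (.reg r))) 4 (fun _ _ => le_rfl)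
    (fun s i r x h => by simp [BExp.holds, RExp.eval, holds_real₂ h])

@[fun_prop]
theorem Comp.leB {f g : α → ℝ} (hf : Comp L k f) (hg : Comp L k g) :
    Comp L k (fun x => leB (f x) (g x)) := comp_leB.comp' (hf.prodMk hg)

@[fun_prop]
theorem Comp.ltB {f g : α → ℝ} (hf : Comp L k f) (hg : Comp L k g) :
    Comp L k (fun x => ltB (f x) (g x)) := comp_ltB.comp' (hf.prodMk hg)

theorem comp_true : Comp L k (fun _ : α => true) :=
  .of_bexp (fun _ _ => .ile (.const 0) (.const 0)) 3 (fun _ _ => le_rfl)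
    (fun s i r x h => by simp [BExp.holds])

theorem comp_false : Comp L k (fun _ : α => false) :=
  .of_bexp (fun _ _ => .ile (.const 1) (.const 0)) 3 (fun _ _ => le_rfl)
    (fun s i r x h => by simp [BExp.holds, IExp.eval])

/-- Case distinction. -/
@[fun_prop]
theorem Comp.cond {b : α → Bool} {f g : α → β} (hb : Comp L k b) (hf : Comp L k f)
    (hg : Comp L k g) : Comp L k (fun x => bif b x then f x else g x) := by
  obtain ⟨_, c, P, hP⟩ := hb
  obtain ⟨f0, d, Q, hQ⟩ := hf
  obtain ⟨g0, e, R, hR⟩ := hg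
  refine ⟨fun x => by cases h : b x <;> simp [h, f0, g0], c + d + e + 4, fun i r m n =>
    .seq (P i r m n) (.ite (.ile (.const 1) (.reg m)) (Q i r m n) (R i r m n)),
    fun i r m n hi hr s x hx => ?_⟩
  obtain ⟨s₁, t₁, h1, h2, h3, h4⟩ := hP i r m n hi hr s x hx
  have hx' := hx.agree h3 hi hr
  have hm : s₁.ireg m = if b x then 1 else 0 := h4
  have e1 : (c + d + e + 4) * (k * size x + 1) = c * (k * size x + 1) + d * (k * size x + 1) +
    e * (k * size x + 1) + 4 * (k * size x + 1) := by ring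
  have e2 : 4 ≤ 4 * (k * size x + 1) := Nat.le_mul_of_pos_right _ (by omega)
  have hcost : (BExp.ile (.const 1) (.reg m)).cost = 3 := rfl
  cases hbx : b x with
  | true =>
    obtain ⟨s₂, t₂, g1, g2, g3, g4⟩ := hQ i r m n hi hr s₁ x hx'
    refine ⟨s₂, _, .seq h1 (.ite_true (by simp [BExp.holds, IExp.eval, hm, hbx]) g1), ?_,
      h3.trans g3, by simp only [hbx]; exact g4⟩
    omega
  | false =>
    obtain ⟨s₂, t₂, g1, g2, g3, g4⟩ := hR i r m n hi hr s₁ x hx'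
    refine ⟨s₂, _, .seq h1 (.ite_false (by simp [BExp.holds, IExp.eval, hm, hbx]) g1), ?_,
      h3.trans g3, by simp only [hbx]; exact g4⟩
    omega

/-! ## Constants -/

/-- The constant `c` is computable. -/
class CompConst (c : β) : Prop where
  comp : ∀ {α : Type} [Enc α] (L : Layout) (k : ℕ), Comp L k (fun _ : α => c)

@[fun_prop]
theorem Comp.const (c : β) [h : CompConst c] : Comp L k (fun _ : α => c) := h.comp L k

instance : CompConst true := ⟨fun _ _ => comp_true⟩
instance : CompConst false := ⟨fun _ _ => comp_false⟩
instance : CompConst (0 : ℝ) := ⟨fun L k => by simpa using Comp.const_real (L := L) (k := k) 0⟩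
instance : CompConst (1 : ℝ) := ⟨fun L k => by simpa using Comp.const_real (L := L) (k := k) 1⟩
instance (c : ℝ) [CompConst c] : CompConst (-c) :=
  ⟨fun L k => Comp.neg.comp' (Comp.const (L := L) (k := k) c)⟩

instance (b : β) (c : γ) [CompConst b] [CompConst c] : CompConst (b, c) :=
  ⟨fun _ _ => (Comp.const b).prodMk (Comp.const c)⟩

@[fun_prop]
theorem Comp.and {f g : α → Bool} (hf : Comp L k f) (hg : Comp L k g) :
    Comp L k (fun x => f x && g x) := by
  have : (fun x => f x && g x) = fun x => bif f x then g x else false := by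
    funext x; cases f x <;> rfl
  rw [this]
  exact hf.cond hg (.const _)

@[fun_prop]
theorem Comp.or {f g : α → Bool} (hf : Comp L k f) (hg : Comp L k g) :
    Comp L k (fun x => f x || g x) := by
  have : (fun x => f x || g x) = fun x => bif f x then true else g x := by
    funext x; cases f x <;> rfl
  rw [this]
  exact hf.cond (.const _) hg

@[fun_prop]
theorem Comp.not {f : α → Bool} (hf : Comp L k f) : Comp L k (fun x => !f x) := by
  have : (fun x => !f x) = fun x => bif f x then false else true := by
    funext x; cases f x <;> rfl
  rw [this]
  exact hf.cond (.const _) (.const _)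

/-! ## Loops -/

/-- Repeats `f` as long as `b` holds, at most `n` times. -/
def iter (b : α → Bool) (f : α → α) : ℕ → α → α
  | 0, x => x
  | n + 1, x => bif b x then iter b f n (f x) else x

-- The bound on the number of rounds is at least the measure, so the iteration ends because the test
-- fails and not because the rounds run out.
omit [Enc α] in
theorem iter_induction {b : α → Bool} {f : α → α} {μ : α → ℕ}
    (hμ : ∀ x, b x = true → μ (f x) < μ x) {Q : α → Prop} (h : ∀ x, Q x → b x = true → Q (f x))
    {n : ℕ} {x : α} (hx : Q x) (hn : μ x ≤ n) : Q (iter b f n x) ∧ b (iter b f n x) = false := by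
  induction n generalizing x with
  | zero =>
    refine ⟨hx, ?_⟩
    by_contra hb
    have := hμ x (by simpa [iter] using hb)
    omega
  | succ n ih =>
    cases hb : b x with
    | true =>
      have := ih (h x hx hb) (by have := hμ x hb; omega)
      simpa [iter, hb] using this
    | false => simpa [iter, hb] using hx

/-- The current value lies in the registers from `m` and `n` on, followed by the value of the test.
A round builds the next value above, copies it down and repeats the test. It takes constant time
because `b` and `f` do, and the measure bounds the number of rounds linearly in the size. -/
theorem Comp.loop {b : α → Bool} {f : α → α} (μ : α → ℕ) (hμ : ∀ x, b x = true → μ (f x) < μ x)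
    (a : ℕ) (ha : ∀ x, μ x ≤ a * (size x + 1)) (hb : Comp L 0 b) (hf : Comp L 0 f) :
    Comp L 1 (fun x => iter b f (μ x) x) := by
  obtain ⟨-, c, P, hP⟩ := hb
  obtain ⟨f0, d, Q, hQ⟩ := hf
  have hsize : ∀ n x, size (iter b f n x) ≤ size x := by
    intro n
    induction n with
    | zero => exact fun x => le_rfl
    | succ n ih =>
      intro x
      cases hbx : b x with
      | true => simpa [iter, hbx] using (ih _).trans (f0 x)
      | false => simp [iter, hbx]
  set w := 2 * ni α + 1 + (2 * nr α + 1) with hw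
  let B := fun m n : ℕ => Prog.loop (.ile (.const 1) (.reg (m + ni α)))
    (.seq (Q m n (m + ni α) (n + nr α))
      (.seq (copy (ni α) (nr α) (m + ni α) (n + nr α) m n) (P m n (m + ni α) (n + nr α))))
  have key : ∀ m n N s x, μ x ≤ N → Holds L s m n x → Holds L s (m + ni α) (n + nr α) (b x) →
      ∃ s' t, Exec (B m n) s s' t ∧ t ≤ (c + d + w + 4) * N + 4 ∧ Agree m n s s' ∧
        Holds L s' m n (iter b f N x) := by
    intro m n N
    induction N with
    | zero =>
      intro s x hN hx hbx
      have hbf : b x = false := by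
        by_contra h
        have := hμ x (by simpa using h)
        omega
      have hm : s.ireg (m + ni α) = 0 := by simpa [Holds, rep, hbf] using hbx
      exact ⟨s, _, .loop_false (by simp [BExp.holds, IExp.eval, hm]), by simp [BExp.cost, IExp.cost],
        Agree.refl _ _ _, by simpa [iter] using hx⟩
    | succ N ih =>
      intro s x hN hx hbx
      cases hbf : b x with
      | false =>
        have hm : s.ireg (m + ni α) = 0 := by simpa [Holds, rep, hbf] using hbx
        exact ⟨s, _, .loop_false (by simp [BExp.holds, IExp.eval, hm]),
          by simp [BExp.cost, IExp.cost], Agree.refl _ _ _, by simpa [iter, hbf] using hx⟩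
      | true =>
        have hm : s.ireg (m + ni α) = 1 := by simpa [Holds, rep, hbf] using hbx
        obtain ⟨s₁, t₁, h1, h2, h3, h4⟩ := hQ m n _ _ le_rfl le_rfl s x hx
        obtain ⟨s₂, g1, g2, g3⟩ := exec_copy L (m + ni α) (n + nr α) m n (.inl (by omega))
          (.inl (by omega)) s₁ _ h4
        obtain ⟨s₃, t₃, e1, e2, e3, e4⟩ := hP m n _ _ le_rfl le_rfl s₂ _ g3
        obtain ⟨s₄, t₄, k1, k2, k3, k4⟩ := ih s₃ (f x) (by have := hμ x hbf; omega)
          (g3.agree e3 le_rfl le_rfl) e4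
        refine ⟨s₄, _, .loop_true (by simp [BExp.holds, IExp.eval, hm])
          (.seq h1 (.seq g1 e1)) k1, ?_, (h3.mono (by omega) (by omega)).trans
            (g2.trans ((e3.mono (by omega) (by omega)).trans k3)), by simpa [iter, hbf] using k4⟩
        simp only [BExp.cost, IExp.cost, zero_mul, zero_add, mul_one] at *
        have : (c + d + w + 4) * (N + 1) = (c + d + w + 4) * N + (c + d + w + 4) := by ring
        omega
  refine ⟨fun x => hsize _ x, w + c + ((c + d + w + 4) * a + 4), fun i r m n =>
    .seq (copy (ni α) (nr α) i r m n) (.seq (P m n (m + ni α) (n + nr α)) (B m n)),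
    fun i r m n hi hr s x hx => ?_⟩
  obtain ⟨s₁, h1, h2, h3⟩ := exec_copy L i r m n (.inr hi) (.inr hr) s x hx
  obtain ⟨s₂, t₂, g1, g2, g3, g4⟩ := hP m n _ _ le_rfl le_rfl s₁ x h3
  obtain ⟨s₃, t₃, e1, e2, e3, e4⟩ := key m n (μ x) s₂ x le_rfl (h3.agree g3 le_rfl le_rfl) g4
  refine ⟨s₃, _, .seq h1 (.seq g1 e1), ?_, h2.trans ((g3.mono (by omega) (by omega)).trans e3), e4⟩
  have q1 : (c + d + w + 4) * μ x ≤ (c + d + w + 4) * (a * (size x + 1)) :=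
    Nat.mul_le_mul_left _ (ha x)
  have q2 : (w + c + ((c + d + w + 4) * a + 4)) * (1 * size x + 1) =
    (w + c + 4) * (size x + 1) + (c + d + w + 4) * (a * (size x + 1)) := by ring
  have q3 : w + c + 4 ≤ (w + c + 4) * (size x + 1) := Nat.le_mul_of_pos_right _ (by omega)
  simp only [zero_mul, zero_add, mul_one] at g2
  rw [q2]
  omega

/-! ## Structures -/

theorem Comp.via_to {α β : Type} [Enc β] (f : α → β) :
    letI := Enc.via f
    Comp L k f :=
  letI := Enc.via f
  .of_holds (fun _ => rfl) rfl rfl (fun _ _ _ _ h => h)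

theorem Comp.via_of {α β : Type} [Enc β] (f : α → β) (g : β → α) (h : ∀ x, f (g x) = x) :
    letI := Enc.via f
    Comp L k g :=
  letI := Enc.via f
  .of_holds (fun x => congrArg size (h x)) rfl rfl (fun s i r x hx => by
    unfold Holds at *; change rep _ _ _ _ _ (f (g x)); rwa [h])

instance : Enc V := Enc.via (fun v : V => (v.key, v.x, v.y))

theorem comp_V : Comp L k (fun v : V => (v.key, v.x, v.y)) := Comp.via_to _
@[fun_prop] theorem Comp.key : Comp L k V.key := Comp.fst.comp' comp_V
@[fun_prop] theorem Comp.x : Comp L k V.x := (Comp.fst.comp' Comp.snd).comp' comp_V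
@[fun_prop] theorem Comp.y : Comp L k V.y := (Comp.snd.comp' Comp.snd).comp' comp_V
@[fun_prop] theorem Comp.vMk : Comp L k (fun z : ℝ × ℝ × ℝ => V.mk z.1 z.2.1 z.2.2) :=
  .via_of (fun v : V => (v.key, v.x, v.y)) _ fun _ => rfl

/-! ## Operations on trees -/

@[fun_prop]
theorem Comp.isNil : Comp L k Tree.isNil := by
  refine .of_bexp (fun i _ => L.isNil i) L.cost (fun i _ => L.cost_isNil i)
    fun s i r x ⟨t, fl, h1, h2, h3⟩ => ?_
  rw [L.isNil_iff s i t h1, h3]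
  cases t with
  | nil => simp [Raw.view, Tree.isNil]
  | node => cases fl <;> simp [Raw.view, Tree.isNil]

theorem holds_tree {s : State} {i r : ℕ} {x : Tree} (h : Holds L s i r x) :
    ∃ t : Raw, ∃ fl : Bool, L.rep s.iarr s.rarr t (s.ireg i) (s.ireg (i + 1)) ∧
    (s.ireg (i + 2) = if fl then 1 else 0) ∧ x = t.view fl (s.rreg r) (s.rreg (r + 1))
      (s.rreg (r + 2)) (s.rreg (r + 3)) (s.rreg (r + 4)) (s.rreg (r + 5)) := h

theorem IExp.below_reg {m n i : ℕ} (h : i < m) : (IExp.reg i).Below m n :=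
  fun _ _ hs => hs.2.2.1 i h

theorem IExp.below_const {m n : ℕ} {c : ℤ} : (IExp.const c).Below m n := fun _ _ _ => rfl

/-- The middle of the interval of keys. -/
def midExp (r : ℕ) : RExp := .div (.add (.reg r) (.reg (r + 1))) (.const 2)

theorem midExp_eval (s : State) (r : ℕ) :
    (midExp r).eval s = (s.rreg r + s.rreg (r + 1)) / 2 := by simp [midExp, RExp.eval]

theorem compIf_nil {Φ : State → ℕ → ℕ → Prop} {f : α → Tree}
    (hf : ∀ s i r x, Holds L s i r x → Φ s i r → f x = .nil) : CompIf L Φ f :=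
  .of_exps (fun _ _ => [.const L.nil₁, .const L.nil₂, .const 0])
    (fun _ _ => List.replicate 6 (.const 0)) 24 (by simp [IExp.cost, RExp.cost])
    (by simp [IExp.below_const, RExp.Low])
    (fun s i r x hx hs => ⟨.nil, false, L.rep_nil _ _, rfl, hf s i r x hx hs⟩)

instance : CompConst Tree.nil :=
  ⟨fun _ _ => (compIf_nil fun _ _ _ _ _ _ => rfl).toComp fun _ => Nat.zero_le _⟩

/-- A subtree: the flag says whether it comes first in memory, the keys are in the registers given
by the last two expressions. -/
theorem compIf_child (b : Bool) (lo hi : ℕ → RExp)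
    (hl : ∀ r m n, r + 6 ≤ n → (lo r).Low m n ∧ (hi r).Low m n)
    (hc : ∀ r, (lo r).cost + (hi r).cost ≤ 6)
    {Φ : State → ℕ → ℕ → Prop} {f : Tree → Tree}
    (h : ∀ s i r (t : Raw) (fl : Bool), Φ s i r → L.rep s.iarr s.rarr t (s.ireg i)
      (s.ireg (i + 1)) → (s.ireg (i + 2) = if fl then 1 else 0) → ∃ l x y r', t = .node l x y r' ∧
      f (t.view fl (s.rreg r) (s.rreg (r + 1)) (s.rreg (r + 2)) (s.rreg (r + 3)) (s.rreg (r + 4))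
        (s.rreg (r + 5))) = (bif b then l else r').view fl ((lo r).eval s) ((hi r).eval s)
          (s.rreg (r + 2)) (s.rreg (r + 3)) (s.rreg (r + 4)) (s.rreg (r + 5))) :
    CompIf L Φ f := by
  refine .of_exps (fun i _ => [bif b then L.left₁ i else L.right₁ i,
    bif b then L.left₂ i else L.right₂ i, .reg (i + 2)]) (fun _ r => [lo r, hi r, .reg (r + 2),
      .reg (r + 3), .reg (r + 4), .reg (r + 5)]) (2 * L.cost + 26) ?_ ?_ ?_
  · intro i r
    have h1 := L.cost_left₁ i
    have h2 := L.cost_left₂ i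
    have h3 := L.cost_right₁ i
    have h4 := L.cost_right₂ i
    have h5 := hc r
    cases b <;> simp [IExp.cost, RExp.cost] <;> omega
  · intro i r m n (hi' : i + 3 ≤ m) (hr : r + 6 ≤ n)
    have h1 := L.below i m n (by omega)
    have h2 : (IExp.reg (i + 2)).Below m n := IExp.below_reg (by omega)
    cases b <;> simp [RExp.Low, hl r m n hr, h1, h2] <;> omega
  · intro s i r x hx hs
    obtain ⟨t, fl, g1, g2, g3⟩ := holds_tree hx
    obtain ⟨l, u, v, w, rfl, h4⟩ := h s i r t fl hs g1 g2
    obtain ⟨n1, n2, -⟩ := L.node s i l u v w g1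
    refine ⟨bif b then l else w, fl, ?_, g2, g3 ▸ h4⟩
    cases b
    · exact n2
    · exact n1

theorem isNil_cases {s : State} {i : ℕ} {t : Raw}
    (h : L.rep s.iarr s.rarr t (s.ireg i) (s.ireg (i + 1))) (hn : ¬ (L.isNil i).holds s) :
    ∃ l x y r, t = .node l x y r := by
  rw [L.isNil_iff s i t h] at hn
  cases t with
  | nil => exact absurd rfl hn
  | node l x y r => exact ⟨l, x, y, r, rfl⟩

theorem eq_nil {s : State} {i r : ℕ} {x : Tree} (hx : Holds L s i r x)
    (hs : (L.isNil i).holds s) : x = .nil := by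
  obtain ⟨t, fl, g1, g2, g3⟩ := holds_tree hx
  rw [g3, (L.isNil_iff s i t g1).1 hs]
  rfl

/-- The left subtree or the right one. -/
theorem comp_child (b : Bool) : Comp L k (fun T => bif b then Tree.left T else T.right) := by
  have h (b' : Bool) {Φ : State → ℕ → ℕ → Prop} := compIf_child (L := L) (Φ := Φ)
    (f := fun T => bif b then T.left else T.right) b' (fun r => bif b then .reg r else midExp r)
    (fun r => bif b then midExp r else .reg (r + 1))
    (fun r m n h => by cases b <;> simp [RExp.Low, midExp] <;> omega)
    (fun r => by cases b <;> exact le_rfl)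
  refine CompIf.toComp (.ite (fun i _ => L.isNil i) L.cost (fun i _ => L.cost_isNil i)
    (compIf_nil fun s i r x hx hs => by rw [eq_nil hx hs.2]; cases b <;> rfl)
    -- A set flag means reading from right to left, so the wanted child of the view is then the
    -- opposite child in memory. The key interval is halved on the same side in either case.
    (.ite (fun i _ => .ile (.const 1) (.reg (i + 2))) 3 (fun _ _ => le_rfl)
    (h (!b) ?_) (h b ?_))) ?_
  any_goals
    rintro s i r t fl ⟨⟨-, h1⟩, h2⟩ h3 h4
    obtain ⟨l, x, y, r', rfl⟩ := isNil_cases h3 h1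
    cases fl <;> simp [BExp.holds, IExp.eval, h4] at h2
    exact ⟨l, x, y, r', rfl, by
      cases b <;> simp [Raw.view, Tree.left, Tree.right, midExp_eval, RExp.eval]⟩
  intro x
  cases x with
  | nil => cases b <;> exact le_rfl
  | node l v r =>
    cases b
    · exact (le_max_right _ _).trans (Nat.le_succ _)
    · exact (le_max_left _ _).trans (Nat.le_succ _)

@[fun_prop] theorem Comp.left : Comp L k Tree.left := comp_child true
@[fun_prop] theorem Comp.right : Comp L k Tree.right := comp_child false

@[fun_prop]
theorem Comp.root : Comp L k Tree.root := by
  refine CompIf.toComp (.ite (fun i _ => L.isNil i) L.cost (fun i _ => L.cost_isNil i)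
    (.of_exps (fun _ _ => []) (fun _ _ => [.const 0, .const 0, .const 0]) 8 (by simp [RExp.cost])
      (by simp [RExp.Low]) fun s i r x hx hs => ?_)
    (.of_exps (fun _ _ => []) (fun i r => [midExp r,
      .add (.mul (.reg (r + 2)) (.get 0 (L.addr i))) (.mul (.reg (r + 3)) (.get 1 (L.addr i))),
      .add (.mul (.reg (r + 4)) (.get 0 (L.addr i))) (.mul (.reg (r + 5)) (.get 1 (L.addr i)))])
      (4 * L.cost + 40) ?_ ?_ fun s i r x hx hs => ?_)) (fun _ => Nat.zero_le _)
  · rw [eq_nil hx hs.2]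
    exact ⟨Int.cast_zero, Int.cast_zero, Int.cast_zero⟩
  · intro i r
    have h1 := L.cost_addr i
    simp [midExp, RExp.cost]
    omega
  · intro i r m n (hi : i + 3 ≤ m) (hr : r + 6 ≤ n)
    simp [midExp, RExp.Low, L.below i m n (by omega)]
    omega
  · obtain ⟨t, fl, g1, g2, g3⟩ := holds_tree hx
    obtain ⟨l, u, v, w, rfl⟩ := isNil_cases g1 hs.2
    obtain ⟨-, -, n1, n2⟩ := L.node s i l u v w g1
    have e0 := midExp_eval s r
    rw [g3, ← n1, ← n2]
    cases fl <;> exact ⟨e0, rfl, rfl⟩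

theorem Tree.mirror_height (t : Tree) : t.mirror.height = t.height := by
  induction t with
  | nil => rfl
  | node l v r ihl ihr => simp [mirror, height, ihl, ihr, max_comm]

theorem Tree.shift_height (t : Tree) : t.shift.height = t.height := by
  induction t with
  | nil => rfl
  | node l v r ihl ihr => simp [shift, height, ihl, ihr]

theorem Tree.lin_height (a b c d : ℝ) (t : Tree) : (t.lin a b c d).height = t.height := by
  induction t with
  | nil => rfl
  | node l v r ihl ihr => simp [lin, height, ihl, ihr]

theorem below_tree {i m n : ℕ} (h : i + 3 ≤ m) :
    ∀ e ∈ [IExp.reg i, .reg (i + 1), .reg (i + 2)], e.Below m n := by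
  intro e he
  fin_cases he <;> exact IExp.below_reg (by omega)

@[fun_prop]
theorem Comp.mirror : Comp L k Tree.mirror := by
  refine CompIf.toComp (.of_exps (fun i _ => [.reg i, .reg (i + 1), .sub (.const 1) (.reg (i + 2))])
    (fun _ r => [.sub (.const 0) (.reg (r + 1)), .sub (.const 0) (.reg r), .reg (r + 2),
      .reg (r + 3), .reg (r + 4), .reg (r + 5)]) 30 (by simp [RExp.cost, IExp.cost]) ?_
      fun s i r x hx _ => ?_) (fun x => (Tree.mirror_height x).le)
  · intro i r m n (hi : i + 3 ≤ m) (hr : r + 6 ≤ n)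
    have h := below_tree (n := n) hi
    simp only [List.forall_mem_cons] at h ⊢
    refine ⟨⟨h.1, h.2.1, fun s s' hs => congrArg (1 - ·) (h.2.2.1 s s' hs), by simp⟩, ?_⟩
    simp [RExp.Low]
    omega
  · obtain ⟨t, fl, g1, g2, g3⟩ := holds_tree hx
    refine ⟨t, !fl, g1, ?_, by rw [g3, Raw.view_mirror]; simp [RExp.eval]⟩
    change 1 - s.ireg (i + 2) = _
    rw [g2]
    cases fl <;> rfl

@[fun_prop]
theorem Comp.shift : Comp L k Tree.shift := by
  refine CompIf.toComp (.of_exps (fun i _ => [.reg i, .reg (i + 1), .reg (i + 2)])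
    (fun _ r => [.add (.reg r) (.const 1), .add (.reg (r + 1)) (.const 1), .reg (r + 2),
      .reg (r + 3), .reg (r + 4), .reg (r + 5)]) 30 (by simp [RExp.cost, IExp.cost]) ?_
      fun s i r x hx _ => ?_) (fun x => (Tree.shift_height x).le)
  · exact fun i r m n hi (hr : r + 6 ≤ n) => ⟨below_tree hi, by simp [RExp.Low]; omega⟩
  · obtain ⟨t, fl, g1, g2, g3⟩ := holds_tree hx
    exact ⟨t, fl, g1, g2, by rw [g3, Raw.view_shift]; simp [RExp.eval]⟩

theorem comp_lin : Comp L k (fun x : (ℝ × ℝ × ℝ × ℝ) × Tree =>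
    x.2.lin x.1.1 x.1.2.1 x.1.2.2.1 x.1.2.2.2) := by
  refine CompIf.toComp (.of_exps (fun i _ => [.reg i, .reg (i + 1), .reg (i + 2)])
    (fun _ r => [.reg (r + 4), .reg (r + 5),
      .add (.mul (.reg r) (.reg (r + 6))) (.mul (.reg (r + 1)) (.reg (r + 8))),
      .add (.mul (.reg r) (.reg (r + 7))) (.mul (.reg (r + 1)) (.reg (r + 9))),
      .add (.mul (.reg (r + 2)) (.reg (r + 6))) (.mul (.reg (r + 3)) (.reg (r + 8))),
      .add (.mul (.reg (r + 2)) (.reg (r + 7))) (.mul (.reg (r + 3)) (.reg (r + 9)))]) 60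
      (by simp [RExp.cost, IExp.cost]) ?_ fun s i r x hx _ => ?_)
      (fun x => (Tree.lin_height _ _ _ _ x.2).le.trans (le_max_right (size x.1) (size x.2)))
  · exact fun i r m n hi (hr : r + 10 ≤ n) => ⟨below_tree hi, by simp [RExp.Low]; omega⟩
  · obtain ⟨⟨c0, c1, c2, c3⟩, hx2⟩ := holds_prod.1 hx
    obtain ⟨t, fl, g1, g2, g3⟩ := holds_tree hx2
    refine ⟨t, fl, g1, g2, ?_⟩
    rw [g3, Raw.view_lin, ← c0, ← c1, ← c2, ← c3]
    rfl

@[fun_prop]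
theorem Comp.lin {a b c d : α → ℝ} {t : α → Tree} (ha : Comp L k a) (hb : Comp L k b)
    (hc : Comp L k c) (hd : Comp L k d) (ht : Comp L k t) :
    Comp L k (fun x => (t x).lin (a x) (b x) (c x) (d x)) :=
  comp_lin.comp' ((ha.prodMk (hb.prodMk (hc.prodMk hd))).prodMk ht)

/-! ### Largest right triangles: first-order conditions and the tests that they justify -/

section

/-! ## Locally optimal triangles -/

/-- The triangle with the corners `(a, b)`, `(a + w, b)`, `(a, b + h)` has its corners in `P`. -/
def Fits (P : Set (ℝ × ℝ)) (a b w h : ℝ) : Prop :=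
  0 < w ∧ 0 < h ∧ (a, b) ∈ P ∧ (a + w, b) ∈ P ∧ (a, b + h) ∈ P

/-- The triangle is largest among those that fit. -/
def Opt (P : Set (ℝ × ℝ)) (a b w h : ℝ) : Prop :=
  Fits P a b w h ∧ ∀ a' b' w' h', Fits P a' b' w' h' → w' * h' ≤ w * h

/-- The image under the rotation by a right angle, `(x, y) ↦ (-y, x)`. -/
def rot (P : Set (ℝ × ℝ)) : Set (ℝ × ℝ) := {z | (z.2, -z.1) ∈ P}

/-- The image under the reflection `(x, y) ↦ (y, x)`. -/
def flip (P : Set (ℝ × ℝ)) : Set (ℝ × ℝ) := {z | (z.2, z.1) ∈ P}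

def V.pt (v : V) : ℝ × ℝ := (v.x, v.y)

/-- The line through `v₁` and `v₂` at `x`. -/
def lineAt (v₁ v₂ : V) (x : ℝ) : ℝ := v₁.y + (v₂.y - v₁.y) / (v₂.x - v₁.x) * (x - v₁.x)

/-- `v₁` and `v₂` are on the upper boundary of `P`, adjacent if `ex`. -/
structure UpperPair (P : Set (ℝ × ℝ)) (v₁ v₂ : V) (ex : Bool) : Prop where
  mem₁ : v₁.pt ∈ P
  mem₂ : v₂.pt ∈ P
  lt : v₁.x < v₂.x
  le : ∀ z ∈ P, z.1 ≤ v₁.x ∨ v₂.x ≤ z.1 ∨ ex = true → z.2 ≤ lineAt v₁ v₂ z.1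

/-- The line of slope `-m` through `v` supports `P`, with `P` above it. -/
def SuppAt (P : Set (ℝ × ℝ)) (v : V) (m : ℝ) : Prop :=
  0 < m ∧ v.pt ∈ P ∧ ∀ z ∈ P, 0 ≤ m * (z.1 - v.x) + (z.2 - v.y)

/-- The bound up to which a test with the pair may be answered `high`. -/
def hb (v₁ v₂ : V) (ex : Bool) : V := bif ex then v₂ else v₁

/-- The bound from which a test with the pair may be answered `low`. -/
def lb (v₁ v₂ : V) (ex : Bool) : V := bif ex then v₁ else v₂

variable {P : Set (ℝ × ℝ)} {a b w h : ℝ}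

theorem mem_congr {x y x' y' : ℝ} (h : (x, y) ∈ P) (hx : x' = x := by linarith)
    (hy : y' = y := by linarith) : (x', y') ∈ P := by rwa [hx, hy]

theorem seg_mem (hP : Convex ℝ P) {x y dx dy s : ℝ} (hs : 0 < s) (h₀ : (x, y) ∈ P)
    (h₁ : (x + s * dx, y + s * dy) ∈ P) {ε : ℝ} (h0 : 0 ≤ ε) (h1 : ε ≤ s) :
    (x + ε * dx, y + ε * dy) ∈ P := by
  have := hP h₀ h₁ (a := 1 - ε / s) (b := ε / s) (by rw [sub_nonneg]; exact (div_le_one hs).2 h1)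
    (by positivity) (by ring)
  convert this using 1
  ext <;> simp <;> field_simp <;> ring

/-- The derivative of the area along a direction in which the triangle can move is not positive. -/
theorem Opt.deriv_le (hP : Convex ℝ P) (ht : Opt P a b w h) {α β ρ σ s₁ s₂ s₃ : ℝ}
    (h₁ : 0 < s₁) (h₂ : 0 < s₂) (h₃ : 0 < s₃) (hp : (a + s₁ * α, b + s₁ * β) ∈ P)
    (hr : (a + s₂ * α, b + h + s₂ * ρ) ∈ P) (hq : (a + w + s₃ * σ, b + s₃ * β) ∈ P) :
    (σ - α) * h + (ρ - β) * w ≤ 0 := by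
  obtain ⟨⟨hw, hh, m1, m2, m3⟩, hopt⟩ := ht
  by_contra! hD
  set D := (σ - α) * h + (ρ - β) * w
  set A := |σ - α|
  set B := |ρ - β|
  have hA : 0 ≤ A := abs_nonneg _
  have hB : 0 ≤ B := abs_nonneg _
  have key (c M : ℝ) (hM : 0 < M) : ∀ᶠ ε in nhdsWithin 0 (Set.Ioi 0), ε * c < M :=
    nhdsWithin_le_nhds (((continuous_mul_const c).tendsto' 0 0 (zero_mul c)).eventually_lt_const hM)
  -- A common `ε` for which the three points stay on their segments, both legs stay positive, and
  -- the quadratic term of the area cannot cancel the linear gain `ε * D`.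
  obtain ⟨ε, e1, e2, e3, e4, e5, e6, e0 : 0 < ε⟩ := ((key 1 _ h₁).and
    ((key 1 _ h₂).and ((key 1 _ h₃).and ((key A _ hw).and ((key B _ hh).and
      ((key (A * B) _ hD).and self_mem_nhdsWithin)))))).exists
  rw [mul_one] at e1 e2 e3
  have k1 : -A ≤ σ - α := neg_abs_le _
  have k2 : -B ≤ ρ - β := neg_abs_le _
  have k3 : -(A * B) ≤ (σ - α) * (ρ - β) := by rw [← abs_mul]; exact neg_abs_le _
  have := hopt (a + ε * α) (b + ε * β) (w + ε * (σ - α)) (h + ε * (ρ - β))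
    ⟨by nlinarith, by nlinarith, seg_mem hP h₁ m1 hp e0.le e1.le,
      mem_congr (seg_mem hP h₃ m2 hq e0.le e3.le), mem_congr (seg_mem hP h₂ m3 hr e0.le e2.le)⟩
  have : ε * (D + ε * ((σ - α) * (ρ - β))) ≤ 0 := by simp only [D]; linarith
  have := nonpos_of_mul_nonpos_right this e0
  nlinarith

theorem Opt.top (ht : Opt P a b w h) {y : ℝ} (hy : (a, y) ∈ P) : y ≤ b + h := by
  obtain ⟨⟨hw, hh, m1, m2, m3⟩, hopt⟩ := ht
  by_contra! hlt
  have := hopt a b w (y - b) ⟨hw, by linarith, m1, m2, by simpa using hy⟩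
  nlinarith

theorem Opt.rightmost (ht : Opt P a b w h) {x : ℝ} (hx : (x, b) ∈ P) : x ≤ a + w := by
  obtain ⟨⟨hw, hh, m1, m2, m3⟩, hopt⟩ := ht
  by_contra! hlt
  have := hopt a b (x - a) h ⟨by linarith, hh, m1, by simpa using hx, m3⟩
  nlinarith

/-- Moving to the right. -/
theorem Opt.right_le (hP : Convex ℝ P) (ht : Opt P a b w h) {x y : ℝ} (hx : a < x)
    (hm : (x, y) ∈ P) : (y - (b + h)) / (x - a) * w ≤ h := by
  have hx' : 0 < x - a := by linarith
  have := ht.deriv_le hP (α := 1) (β := 0) (ρ := (y - (b + h)) / (x - a)) (σ := 0) ht.1.1 hx'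
    one_pos (by simpa using ht.1.2.2.2.1)
    (mem_congr hm (by ring) (by field_simp; ring)) (by simpa using ht.1.2.2.2.1)
  linarith

theorem Opt.flip (ht : Opt P a b w h) : Opt (flip P) b a h w := by
  obtain ⟨⟨hw, hh, m1, m2, m3⟩, hopt⟩ := ht
  refine ⟨⟨hh, hw, m1, m3, m2⟩, fun a' b' w' h' ⟨g1, g2, g3, g4, g5⟩ => ?_⟩
  have := hopt b' a' h' w' ⟨g2, g1, g3, g5, g4⟩
  linarith

theorem flip_convex (hP : Convex ℝ P) : Convex ℝ (flip P) := by
  intro x hx y hy s t hs ht hst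
  exact hP hx hy hs ht hst

/-- Moving up. -/
theorem Opt.up_le (hP : Convex ℝ P) (ht : Opt P a b w h) {x y : ℝ} (hy : b < y)
    (hm : (x, y) ∈ P) : (x - (a + w)) / (y - b) * h ≤ w :=
  ht.flip.right_le (flip_convex hP) hy hm

/-! ## The test for three chords -/

/-- Here `u`, `v`, `m` are slopes of chords, and `u₂`, `v₂`, `m₂` those of directions in which the
points of the optimal triangle can really move; `hl` and `wl` are the legs that the lines through
the chords allow at the tested point. The test claims that moving on from that point gains area,
whereas `opt` says that the motion towards it does not. Passing from `m` to `m₂` preserves the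
claim, as `v * hl ≤ wl`; but the resulting difference of the two sides is a sum of nonnegative
terms. -/
theorem core_algebra {w h u v m u₂ v₂ m₂ ρ κ δ hl wl : ℝ} (hw : 0 < w) (hh : 0 < h) (hm : 0 < m)
    (hm₂ : m ≤ m₂) (hu : u ≤ u₂) (hv : v₂ ≤ v) (hρ : 0 ≤ ρ) (hκ : 0 ≤ κ) (hδ : 0 ≤ δ)
    (opt : (u₂ + m₂) * w ≤ (1 + v₂ * m₂) * h) (hQ : κ * (1 + v₂ * m₂) ≤ m₂ * w)
    (ehl : hl = h + (u₂ - u) * ρ + (u + m₂) * δ) (ewl : wl = w + (v - v₂) * κ - (1 + v * m₂) * δ)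
    (hl0 : 0 ≤ hl) (huv : ¬ (0 < u ∧ 0 < v ∧ 1 < u * v)) (hum : 0 < u + m)
    (htest : 1 + v * m ≤ 0 ∨ (1 + v * m) * hl < (u + m) * wl) : False := by
  have hA : 0 < u₂ + m₂ := by linarith
  have hB : 0 < 1 + v₂ * m₂ := by
    by_contra! hB
    nlinarith [mul_pos hA hw]
  have hBl : 0 < 1 + v * m₂ := by nlinarith
  rcases le_or_gt (1 + v * m) 0 with h1 | h1
  · nlinarith
  have htest := htest.resolve_left (by linarith)
  have hwl : 0 < wl := by
    by_contra! hc
    nlinarith [mul_nonneg h1.le hl0]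
  -- The excluded steep case is needed here only: if `u` and `v` are positive, `u * v ≤ 1` turns the
  -- test into this bound.
  have hvw : v * hl ≤ wl := by
    rcases le_or_gt v 0 with hv0 | hv0
    · nlinarith
    rcases le_or_gt u 0 with hu0 | hu0
    · have : m * (v * hl) ≤ m * wl := by nlinarith
      exact le_of_mul_le_mul_left this hm
    · have h2 : u * v ≤ 1 := by
        by_contra! hc; exact huv ⟨hu0, hv0, hc⟩
      have : (u + m) * (v * hl) ≤ (u + m) * wl := by nlinarith
      exact le_of_mul_le_mul_left this hum
  have key : (1 + v * m₂) * hl < (u + m₂) * wl := by nlinarith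
  have hκA : (u₂ + m₂) * κ ≤ m₂ * h := by
    have : (1 + v₂ * m₂) * ((u₂ + m₂) * κ) ≤ (1 + v₂ * m₂) * (m₂ * h) := by
      calc _ = (u₂ + m₂) * (κ * (1 + v₂ * m₂)) := by ring
        _ ≤ (u₂ + m₂) * (m₂ * w) := by gcongr
        _ = m₂ * ((u₂ + m₂) * w) := by ring
        _ ≤ m₂ * ((1 + v₂ * m₂) * h) := by gcongr; linarith
        _ = _ := by ring
    exact le_of_mul_le_mul_left this hB
  have e : (1 + v * m₂) * hl - (u + m₂) * wl = ((1 + v₂ * m₂) * h - (u₂ + m₂) * w) +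
      (v - v₂) * (m₂ * h - (u₂ + m₂) * κ) + (u₂ - u) * ((v - v₂) * κ) + (u₂ - u) * w +
      (1 + v * m₂) * ((u₂ - u) * ρ) + 2 * ((u + m₂) * ((1 + v * m₂) * δ)) := by
    rw [ehl, ewl]; ring
  have e1 : 0 ≤ (v - v₂) * (m₂ * h - (u₂ + m₂) * κ) :=
    mul_nonneg (by linarith) (by linarith)
  have e2 : 0 ≤ (u₂ - u) * ((v - v₂) * κ) :=
    mul_nonneg (by linarith) (mul_nonneg (by linarith) hκ)
  have e3 : 0 ≤ (u₂ - u) * w := mul_nonneg (by linarith) hw.le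
  have e4 : 0 ≤ (1 + v * m₂) * ((u₂ - u) * ρ) :=
    mul_nonneg hBl.le (mul_nonneg (by linarith) hρ)
  have e5 : 0 ≤ (u + m₂) * ((1 + v * m₂) * δ) :=
    mul_nonneg (by linarith) (mul_nonneg hBl.le hδ)
  linarith

/-- The slope of the line through `v₁` and `v₂`. -/
def slope (v₁ v₂ : V) : ℝ := (v₂.y - v₁.y) / (v₂.x - v₁.x)

theorem UpperPair.hb_mem {v₁ v₂ : V} {ex : Bool} (hv : UpperPair P v₁ v₂ ex) :
    (hb v₁ v₂ ex).pt ∈ P := by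
  cases ex
  · exact hv.mem₁
  · exact hv.mem₂

theorem UpperPair.hb_line {v₁ v₂ : V} {ex : Bool} (hv : UpperPair P v₁ v₂ ex) :
    (hb v₁ v₂ ex).y = v₁.y + slope v₁ v₂ * ((hb v₁ v₂ ex).x - v₁.x) := by
  have := hv.lt
  cases ex
  · simp [hb]
  · simp only [hb, slope, cond_true]
    rw [div_mul_cancel₀ _ (by linarith)]
    ring

theorem UpperPair.hb_top {v₁ v₂ : V} {ex : Bool} (hv : UpperPair P v₁ v₂ ex) {y : ℝ}
    (hy : ((hb v₁ v₂ ex).x, y) ∈ P) : y ≤ (hb v₁ v₂ ex).y := by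
  rw [hv.hb_line]
  refine hv.le _ hy ?_
  cases ex
  · exact .inl le_rfl
  · exact .inr (.inl le_rfl)

theorem UpperPair.le_of_lt_hb {v₁ v₂ : V} {ex : Bool} (hv : UpperPair P v₁ v₂ ex) {z : ℝ × ℝ}
    (hz : z ∈ P) (hlt : z.1 < (hb v₁ v₂ ex).x) : z.2 ≤ v₁.y + slope v₁ v₂ * (z.1 - v₁.x) := by
  refine hv.le z hz ?_
  cases ex
  · exact .inl hlt.le
  · exact .inr (.inr rfl)

theorem UpperPair.lb_mem {v₁ v₂ : V} {ex : Bool} (hv : UpperPair P v₁ v₂ ex) :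
    (lb v₁ v₂ ex).pt ∈ P := by
  cases ex
  · exact hv.mem₂
  · exact hv.mem₁

theorem UpperPair.lb_line {v₁ v₂ : V} {ex : Bool} (hv : UpperPair P v₁ v₂ ex) :
    (lb v₁ v₂ ex).y = v₁.y + slope v₁ v₂ * ((lb v₁ v₂ ex).x - v₁.x) := by
  have := hv.lt
  cases ex
  · simp only [lb, slope, cond_false]
    rw [div_mul_cancel₀ _ (by linarith)]
    ring
  · simp [lb]

theorem UpperPair.le_of_lb_lt {v₁ v₂ : V} {ex : Bool} (hv : UpperPair P v₁ v₂ ex) {z : ℝ × ℝ}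
    (hz : z ∈ P) (hlt : (lb v₁ v₂ ex).x < z.1) : z.2 ≤ v₁.y + slope v₁ v₂ * (z.1 - v₁.x) := by
  refine hv.le z hz ?_
  cases ex
  · exact .inr (.inl hlt.le)
  · exact .inr (.inr rfl)

/-- The slope from a point on the left of the bound to the bound. -/
theorem UpperPair.slope_le {v₁ v₂ : V} {ex : Bool} (hv : UpperPair P v₁ v₂ ex) {z : ℝ × ℝ}
    (hz : z ∈ P) (hlt : z.1 < (hb v₁ v₂ ex).x) :
    slope v₁ v₂ ≤ ((hb v₁ v₂ ex).y - z.2) / ((hb v₁ v₂ ex).x - z.1) := by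
  rw [le_div_iff₀ (by linarith), hv.hb_line]
  linarith [hv.le_of_lt_hb hz hlt]

theorem lineAt_mem (hP : Convex ℝ P) {u v : V} (hu : u.pt ∈ P) (hv : v.pt ∈ P) (h : u.x < v.x)
    {x : ℝ} (h₁ : u.x ≤ x) (h₂ : x ≤ v.x) : (x, lineAt u v x) ∈ P :=
  mem_congr (seg_mem hP (dx := 1) (dy := slope u v) (s := v.x - u.x) (by linarith) hu
    (mem_congr hv (by ring) (by rw [slope, mul_div_cancel₀ _ (by linarith)]; ring))
    (ε := x - u.x) (by linarith) (by linarith)) (by ring) (by rw [lineAt, slope]; ring)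

theorem mem_of_flip {x y : ℝ} (h : (x, y) ∈ flip P) : (y, x) ∈ P := h

/-- A supported point is not above the line of an upper pair. -/
theorem UpperPair.supp_le {v₁ v₂ z : V} {ex : Bool} (hP : Convex ℝ P) (hv : UpperPair P v₁ v₂ ex)
    {m : ℝ} (hz : SuppAt P z m) : z.y ≤ v₁.y + slope v₁ v₂ * (z.x - v₁.x) := by
  have hlt := hv.lt
  by_cases hc : z.x ≤ v₁.x ∨ v₂.x ≤ z.x
  · exact hv.le _ hz.2.1 (hc.imp_right .inl)
  · push Not at hc
    obtain ⟨hm, _, hs⟩ := hz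
    have h2 := hs _ (lineAt_mem hP hv.mem₁ hv.mem₂ hlt hc.1.le hc.2.le)
    simp only [lineAt] at h2
    rw [slope]
    nlinarith

/-- If corner, apex and base end are all before their bounds, they can move towards `x`, `R` and
`Q`, and the slopes of these motions compare with those of the chords by convexity. `core_algebra`
then refutes the test, which claims a gain at `x`. -/
theorem high_core {r₁ r₂ q₁ q₂ x : V} {er eq : Bool} {m m₀ : ℝ} (hP : Convex ℝ P)
    (ht : Opt P a b w h) (hr : UpperPair P r₁ r₂ er) (hq : UpperPair (rot P) q₁ q₂ eq)
    (hx : SuppAt P x m₀) (hm : 0 < m) (hmm₀ : m ≤ m₀)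
    (ar : a < (hb r₁ r₂ er).x) (bq : -b < (hb q₁ q₂ eq).x) (ax : a < x.x) (bx : x.y < b)
    (huv : ¬ (0 < slope r₁ r₂ ∧ 0 < -slope q₁ q₂ ∧ 1 < slope r₁ r₂ * -slope q₁ q₂))
    (hum : 0 < slope r₁ r₂ + m)
    (htest : 1 + -slope q₁ q₂ * m ≤ 0 ∨
      (1 + -slope q₁ q₂ * m) * (lineAt r₁ r₂ x.x - x.y) <
        (slope r₁ r₂ + m) * (lineAt q₁ q₂ (-x.y) - x.x)) : False := by
  obtain ⟨⟨hw, hh, mp, mq, mr⟩, -⟩ := id ht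
  set R := hb r₁ r₂ er with hR
  set Q := hb q₁ q₂ eq with hQ
  have mq' : (-b, a + w) ∈ rot P := by simpa [rot] using mq
  obtain ⟨hm₀, hxm, hs⟩ := id hx
  replace hxm : (x.x, x.y) ∈ P := hxm
  have hδ : 0 < x.x - a := by linarith
  have hρ : 0 < R.x - a := by linarith
  have hκ : 0 < Q.x + b := by linarith
  set m₂ := (b - x.y) / (x.x - a) with hm₂
  have hm₀m₂ : m₀ ≤ m₂ := by
    rw [hm₂, le_div_iff₀ hδ]
    have := hs _ mp
    simp only at this
    linarith
  have em₂ : m₂ * (x.x - a) = b - x.y := div_mul_cancel₀ _ hδ.ne'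
  set u₂ := (R.y - (b + h)) / (R.x - a) with hu₂
  have eu₂ : u₂ * (R.x - a) = R.y - (b + h) := div_mul_cancel₀ _ hρ.ne'
  set v₂ := (a + w - Q.y) / (Q.x + b) with hv₂
  have ev₂ : v₂ * (Q.x + b) = a + w - Q.y := div_mul_cancel₀ _ hκ.ne'
  have hu : slope r₁ r₂ ≤ u₂ := hr.slope_le mr ar
  have hv : v₂ ≤ -slope q₁ q₂ := by
    have h1 := hq.slope_le mq' bq
    have h2 : v₂ = -((Q.y - (a + w)) / (Q.x - -b)) := by rw [hv₂, ← neg_div]; ring_nf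
    rw [h2]
    exact neg_le_neg h1
  have hQm : (Q.y, -Q.x) ∈ P := hq.hb_mem
  have hRm : (R.x, R.y) ∈ P := hr.hb_mem
  have hm₂0 : 0 < m₂ := lt_of_lt_of_le hm₀ hm₀m₂
  have opt := ht.deriv_le hP (α := 1) (β := -m₂) (ρ := u₂) (σ := -(v₂ * m₂)) hδ hρ
    (s₃ := (Q.x + b) / m₂) (by positivity) (mem_congr hxm) (mem_congr hRm)
    (mem_congr hQm (by field_simp; linarith) (by field_simp; ring))
  have hQl : (Q.x + b) * (1 + v₂ * m₂) ≤ m₂ * w := by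
    -- In unrotated coordinates: `Q` does not lie below the line through `(a, b)` and `x`.
    suffices 0 ≤ m₂ * (Q.y - x.x) + (-Q.x - x.y) by nlinarith
    rcases le_or_gt x.y (-Q.x) with hc | hc
    · -- the chord at the height of `Q`
      have h1 := seg_mem hP (x := a) (y := b) (dx := 1) (dy := -m₂) hδ mp (mem_congr hxm) (ε := (Q.x + b) / m₂) (by positivity) (by
          rw [div_le_iff₀ hm₂0]; linarith)
      have h3 := hq.hb_top (show (a + (Q.x + b) / m₂ * 1, -Q.x) ∈ P from
        mem_congr h1 rfl (by field_simp; ring))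
      have h4 : m₂ * (a + (Q.x + b) / m₂ * 1) ≤ m₂ * Q.y := by gcongr
      have h5 : m₂ * (a + (Q.x + b) / m₂ * 1) = m₂ * a + (Q.x + b) := by field_simp
      nlinarith
    -- Now `Q` is below `x`. The supporting line at `x` puts it to the right of `x`, and the steeper
    -- line of slope `-m₂` then passes below it as well.
    · have h1 := hs _ hQm
      simp only at h1
      have h2 : x.x ≤ Q.y := by
        by_contra! h2
        nlinarith
      nlinarith
  refine core_algebra (m := m) hw hh hm (hmm₀.trans hm₀m₂) hu hv hρ.le hκ.le hδ.le (by linarith) hQl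
    (hl := lineAt r₁ r₂ x.x - x.y) (wl := lineAt q₁ q₂ (-x.y) - x.x) ?_ ?_ ?_ huv hum htest
  · have := hr.hb_line
    rw [← hR] at this
    have e : lineAt r₁ r₂ x.x = R.y + slope r₁ r₂ * (x.x - R.x) := by
      rw [lineAt, ← slope, this]; ring
    rw [e]
    linarith
  · have := hq.hb_line
    rw [← hQ] at this
    have e : lineAt q₁ q₂ (-x.y) = Q.y + slope q₁ q₂ * (-x.y - Q.x) := by
      rw [lineAt, ← slope, this]; ring
    rw [e]
    have e2 : -slope q₁ q₂ * m₂ * (x.x - a) = -slope q₁ q₂ * (b - x.y) := by rw [mul_assoc, em₂]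
    linarith
  · have := hr.supp_le hP hx
    rw [lineAt, ← slope]
    linarith

/-! ### Reflected chords -/

/-- The image of a point on a chain under the reflection `(x, y) ↦ (y, x)`, which exchanges the
upper and the (rotated) right chain. -/
def V.neg (v : V) : V := ⟨v.key, -v.x, v.y⟩

def V.swap (v : V) : V := ⟨v.key, v.y, v.x⟩

theorem lineAt_comm {v₁ v₂ : V} (h : v₁.x ≠ v₂.x) (x : ℝ) : lineAt v₂ v₁ x = lineAt v₁ v₂ x := by
  have h1 : v₂.x - v₁.x ≠ 0 := sub_ne_zero.2 h.symm
  have h2 : v₁.x - v₂.x ≠ 0 := sub_ne_zero.2 h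
  simp only [lineAt]
  field_simp
  ring

theorem slope_neg (v₁ v₂ : V) : slope v₂.neg v₁.neg = -slope v₁ v₂ := by
  simp only [slope, V.neg]
  rw [show v₁.y - v₂.y = -(v₂.y - v₁.y) by ring, show -v₁.x - -v₂.x = v₂.x - v₁.x by ring, neg_div]

theorem lineAt_neg {v₁ v₂ : V} (h : v₁.x ≠ v₂.x) (x : ℝ) :
    lineAt v₂.neg v₁.neg x = lineAt v₁ v₂ (-x) := by
  rw [← lineAt_comm h, lineAt, ← slope, slope_neg, lineAt]
  simp only [V.neg, slope]
  have h1 : v₂.x - v₁.x ≠ 0 := sub_ne_zero.2 h.symm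
  have h2 : v₁.x - v₂.x ≠ 0 := sub_ne_zero.2 h
  field_simp
  ring

theorem UpperPair.neg {P Q : Set (ℝ × ℝ)} (hPQ : ∀ z ∈ Q, (-z.1, z.2) ∈ P)
    (hQP : ∀ z ∈ P, (-z.1, z.2) ∈ Q) {v₁ v₂ : V} {ex : Bool} (h : UpperPair P v₁ v₂ ex) :
    UpperPair Q v₂.neg v₁.neg ex where
  mem₁ := hQP _ h.mem₂
  mem₂ := hQP _ h.mem₁
  lt := neg_lt_neg h.lt
  le z hz hc := by
    rw [lineAt_neg h.lt.ne]
    refine h.le _ (hPQ z hz) ?_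
    simp only [V.neg] at hc ⊢
    rcases hc with hc | hc | hc
    · exact .inr (.inl (by linarith))
    · exact .inl (by linarith)
    · exact .inr (.inr hc)

theorem UpperPair.to_flip {r₁ r₂ : V} {er : Bool} (h : UpperPair P r₁ r₂ er) :
    UpperPair (rot (flip P)) r₂.neg r₁.neg er :=
  h.neg (fun z hz => hz) (fun z hz => by change (- -z.1, z.2) ∈ P; rwa [neg_neg])

theorem UpperPair.rot_flip {r₁ r₂ : V} {er : Bool} (h : UpperPair (rot P) r₁ r₂ er) :
    UpperPair (flip P) r₂.neg r₁.neg er :=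
  h.neg (fun z hz => by simpa [rot, RealRAM.flip] using hz)
    (fun z hz => by simpa [rot, RealRAM.flip] using hz)

theorem SuppAt.to_flip {x : V} {m : ℝ} (hx : SuppAt P x m) : SuppAt (flip P) x.swap m⁻¹ := by
  obtain ⟨hm, h1, h2⟩ := hx
  refine ⟨inv_pos.2 hm, h1, fun z hz => ?_⟩
  have := h2 _ hz
  simp only [V.swap] at this ⊢
  have h3 : 0 ≤ m⁻¹ * (m * (z.2 - x.x) + (z.1 - x.y)) := mul_nonneg (inv_pos.2 hm).le this
  rw [mul_add, inv_mul_cancel_left₀ hm.ne'] at h3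
  linarith

theorem hb_neg (v₁ v₂ : V) (ex : Bool) : hb v₂.neg v₁.neg ex = (lb v₁ v₂ ex).neg := by
  cases ex <;> rfl

/-- The reflection at the diagonal exchanges the two legs, the upper and the right chain, and
forward and backward motion. Thus `high_core` applies at the other end `y` of the chord. -/
theorem low_core {r₁ r₂ q₁ q₂ x y : V} {er eq : Bool} {m m₀ : ℝ} (hP : Convex ℝ P)
    (ht : Opt P a b w h) (hr : UpperPair P r₁ r₂ er) (hq : UpperPair (rot P) q₁ q₂ eq)
    (hy : SuppAt P y m₀) (hmm₀ : m₀ ≤ m) (hxy : x.x < y.x) (hyx : x.y - y.y = m * (y.x - x.x))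
    (ar : (lb r₁ r₂ er).x < a) (bq : (lb q₁ q₂ eq).x < -b) (ax : y.x < a) (bx : b < y.y)
    (huv : ¬ (0 < slope r₁ r₂ ∧ 0 < -slope q₁ q₂ ∧ 1 < slope r₁ r₂ * -slope q₁ q₂))
    (hum : 0 < slope r₁ r₂ + m) (hvm : 0 < 1 + -slope q₁ q₂ * m)
    (htest : (slope r₁ r₂ + m) * (lineAt q₁ q₂ (-x.y) - x.x) ≤
      (1 + -slope q₁ q₂ * m) * (lineAt r₁ r₂ x.x - x.y)) : False := by
  set u := slope r₁ r₂ with hu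
  set v := -slope q₁ q₂ with hv
  have hm0 : 0 < m := hy.1.trans_le hmm₀
  have hd : 0 < y.x - x.x := by linarith
  have e1 : lineAt r₁ r₂ y.x = lineAt r₁ r₂ x.x + u * (y.x - x.x) := by
    simp only [lineAt, hu, slope]; ring
  have e2 : lineAt q₁ q₂ (-y.y) = lineAt q₁ q₂ (-x.y) - v * (m * (y.x - x.x)) := by
    rw [← hyx]; simp only [lineAt, hv, slope]; ring
  refine high_core (m := m⁻¹) (flip_convex hP) ht.flip hq.rot_flip hr.to_flip hy.to_flip
    (inv_pos.2 hm0) (inv_anti₀ hy.1 hmm₀) ?_ ?_ bx ax ?_ ?_ (.inr ?_)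
  · rw [hb_neg]; simp only [V.neg]; linarith
  · rw [hb_neg]; simp only [V.neg]; linarith
  · rw [slope_neg, slope_neg, neg_neg, mul_comm, and_left_comm]; exact huv
  · rw [slope_neg, ← hv]
    have : v + m⁻¹ = m⁻¹ * (1 + v * m) := by field_simp; ring
    rw [this]
    exact mul_pos (inv_pos.2 hm0) hvm
  · rw [slope_neg, slope_neg, neg_neg, ← hv, ← hu, lineAt_neg hr.lt.ne, lineAt_neg hq.lt.ne]
    simp only [V.swap, neg_neg]
    rw [e1, e2]
    have e3 : v + m⁻¹ = m⁻¹ * (1 + v * m) := by field_simp; ring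
    have e4 : 1 + u * m⁻¹ = m⁻¹ * (u + m) := by field_simp; ring
    rw [e3, e4, mul_assoc, mul_assoc]
    refine mul_lt_mul_of_pos_left ?_ (inv_pos.2 hm0)
    -- From `x` to `y` the height between the lines grows by `u + m` per unit and the width shrinks
    -- by `1 + v * m`. This makes the weak inequality at `x` strict at `y`.
    have : 0 < (u + m) * ((1 + v * m) * (y.x - x.x)) := mul_pos hum (mul_pos hvm hd)
    nlinarith

/-! ### Steep chords -/

/-- `h₃` and `h₄` are optimality under motions to the right and upwards; multiplied, they force `u *
v ≤ 1`. So between steep chords at most one of these motions is open. -/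
theorem steep_absurd {w h u v u₂ v₂ : ℝ} (hw : 0 < w) (hh : 0 < h) (hu : 0 < u) (huv : 1 < u * v)
    (h₁ : u ≤ u₂) (h₂ : v ≤ v₂) (h₃ : u₂ * w ≤ h) (h₄ : v₂ * h ≤ w) : False := by
  have h5 : u * w ≤ h := (mul_le_mul_of_nonneg_right h₁ hw.le).trans h₃
  have h6 : v * h ≤ w := (mul_le_mul_of_nonneg_right h₂ hh.le).trans h₄
  nlinarith [mul_le_mul_of_nonneg_left h6 hu.le]

/-- Moving up along a chord of the right chain. -/
theorem Opt.up_slope {q₁ q₂ z : V} (hP : Convex ℝ P) (ht : Opt P a b w h)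
    (hz : z.pt ∈ rot P)
    (hl : z.y = q₁.y + slope q₁ q₂ * (z.x - q₁.x)) (hb : z.x < -b)
    (hle : a + w ≤ q₁.y + slope q₁ q₂ * (-b - q₁.x)) :
    ∃ v₂, -slope q₁ q₂ ≤ v₂ ∧ v₂ * h ≤ w := by
  refine ⟨_, ?_, ht.up_le hP (x := z.y) (y := -z.x) (by linarith) hz⟩
  rw [le_div_iff₀ (by linarith), hl]
  linarith

/-- The test compares the legs of the right triangle with apex `R` and base end `q₁`. If the base is
above `q₁`, the chord is an edge and both motions are open, against `steep_absurd`. Otherwise the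
segment from `q₁` to `R` makes the base too long for `u * w ≤ h`. -/
theorem high_steep {r₁ r₂ q₁ q₂ : V} {er eq : Bool} (hP : Convex ℝ P) (ht : Opt P a b w h)
    (hr : UpperPair P r₁ r₂ er) (hq : UpperPair (rot P) q₁ q₂ eq)
    (ar : a < (hb r₁ r₂ er).x) (bq : -b < (hb q₁ q₂ eq).x) (hu : 0 < slope r₁ r₂)
    (huv : 1 < slope r₁ r₂ * -slope q₁ q₂)
    (htest : (hb r₁ r₂ er).y + q₁.x < slope r₁ r₂ * (q₁.y - (hb r₁ r₂ er).x)) : False := by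
  obtain ⟨⟨hw, hh, mp, mq, mr⟩, -⟩ := id ht
  set R := hb r₁ r₂ er with hR
  set u := slope r₁ r₂ with hu'
  have hα : 0 < R.x - a := by linarith
  have hu₂ : u ≤ (R.y - (b + h)) / (R.x - a) := hr.slope_le mr ar
  have hright := ht.right_le hP ar (y := R.y) hr.hb_mem
  have mq' : (-b, a + w) ∈ rot P := by simpa [rot] using mq
  rcases lt_or_ge q₁.x (-b) with hc | hc
  · have heq : eq = true := by
      cases eq
      · simp [hb] at bq; linarith
      · rfl
    obtain ⟨v₂, h1, h2⟩ := ht.up_slope hP hq.mem₁ (by simp) hc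
      (hq.le _ mq' (.inr (.inr heq)))
    exact steep_absurd hw hh hu huv hu₂ h1 hright h2
  have huw : u * w ≤ h := (mul_le_mul_of_nonneg_right hu₂ hw.le).trans hright
  have hle : b + h ≤ R.y - u * (R.x - a) := by
    rw [le_div_iff₀ hα] at hu₂
    linarith
  have hpos : 0 < R.y - b := by nlinarith
  set H := R.y + q₁.x with hH
  have hH0 : 0 < H := by linarith
  -- The point of the segment from `q₁` to `R` at the height `b`; it bounds `w` from below.
  have hyp : (q₁.y + (q₁.x + b) * ((R.x - q₁.y) / H), -q₁.x + (q₁.x + b) * 1) ∈ P := by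
    refine seg_mem hP hH0 (show (q₁.y, -q₁.x) ∈ P from hq.mem₁)
      (mem_congr hr.hb_mem (by field_simp; ring)) (by linarith) (by linarith)
  have h1 := ht.rightmost (x := q₁.y + (q₁.x + b) * ((R.x - q₁.y) / H)) (mem_congr hyp)
  have h2 : H * (q₁.y + (q₁.x + b) * ((R.x - q₁.y) / H)) ≤ H * (a + w) := by gcongr
  have h3 : H * (q₁.y + (q₁.x + b) * ((R.x - q₁.y) / H)) = H * q₁.y +
      (q₁.x + b) * (R.x - q₁.y) := by field_simp
  have h4 : (q₁.y - R.x) * (R.y - b) + (R.x - a) * H ≤ H * w := by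
    rw [h3] at h2
    simp only [hH] at h2 ⊢
    nlinarith
  have h5 : u * ((q₁.y - R.x) * (R.y - b) + (R.x - a) * H) ≤ u * (H * w) := by gcongr
  have h6 : H * (u * w) ≤ H * h := by gcongr
  have h7 : H * h ≤ H * (R.y - b - u * (R.x - a)) := by gcongr; linarith
  have h8 : H * (R.y - b) < u * (q₁.y - R.x) * (R.y - b) := by gcongr
  have h9 : 0 < u * ((R.x - a) * H) := by positivity
  nlinarith

/-- If the apex is in the middle of an edge, it can still move right, and `steep_absurd` applies.
Otherwise `R` is not to the right of the corner, and the reflection at the diagonal leads to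
`high_steep`. -/
theorem low_steep {r₁ r₂ q₁ q₂ : V} {er eq : Bool} (hP : Convex ℝ P) (ht : Opt P a b w h)
    (hr : UpperPair P r₁ r₂ er) (hq : UpperPair (rot P) q₁ q₂ eq)
    (ar : (lb r₁ r₂ er).x < a) (bq : (lb q₁ q₂ eq).x < -b) (hu : 0 < slope r₁ r₂)
    (hv : 0 < -slope q₁ q₂) (huv : 1 < slope r₁ r₂ * -slope q₁ q₂)
    (htest : slope r₁ r₂ * (q₁.y - (hb r₁ r₂ er).x) ≤ (hb r₁ r₂ er).y + q₁.x) : False := by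
  obtain ⟨⟨hw, hh, mp, mq, mr⟩, -⟩ := id ht
  set R := hb r₁ r₂ er with hR
  set Q := lb q₁ q₂ eq with hQ
  set u := slope r₁ r₂ with hu'
  set v := -slope q₁ q₂ with hv'
  have mq' : (-b, a + w) ∈ rot P := by simpa [rot] using mq
  have hqlt := hq.lt
  have hrlt := hr.lt
  have hQq : q₁.x ≤ Q.x := by
    rw [hQ]; cases eq
    · exact hqlt.le
    · exact le_rfl
  have hQl : Q.y = q₁.y + slope q₁ q₂ * (Q.x - q₁.x) := hq.lb_line
  have hql := hq.le_of_lb_lt mq' bq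
  have hRl : r₂.y = R.y + u * (r₂.x - R.x) := by
    have h1 := hr.hb_line
    rw [← hR] at h1
    have : u * (r₂.x - r₁.x) = r₂.y - r₁.y := div_mul_cancel₀ _ (by linarith)
    linarith
  have hR2 : R.x ≤ r₂.x := by
    rw [hR]; cases er
    · exact hrlt.le
    · exact le_rfl
  by_cases hc : er = true ∧ a < r₂.x
  · obtain ⟨v₂, h1, h2⟩ := ht.up_slope (q₁ := q₁) (q₂ := q₂) hP hq.lb_mem hq.lb_line
      bq hql
    have h3 : R = r₂ := by rw [hR, hc.1]; rfl
    have h4 : a < R.x := by rw [h3]; exact hc.2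
    exact steep_absurd hw hh hu huv (hr.slope_le mr h4) h1
      (ht.right_le hP h4 (y := R.y) hr.hb_mem) h2
  have haR : R.x ≤ a := by
    by_cases h1 : er = true
    · rw [not_and] at hc
      have := hc h1
      rw [hR, h1]
      exact not_lt.1 this
    · have : er = false := by simpa using h1
      rw [this] at ar
      exact hR2.trans ar.le
  rcases le_or_gt (q₁.y - R.x) 0 with hX | hX
  · nlinarith
  refine high_steep (flip_convex hP) ht.flip hq.rot_flip hr.to_flip ?_ ?_ ?_ ?_ ?_
  · rw [hb_neg]; simp only [V.neg]; linarith
  · rw [hb_neg]; simp only [V.neg]; linarith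
  · rw [slope_neg]; exact hv
  · rw [slope_neg, slope_neg, neg_neg, mul_comm]; exact huv
  · rw [hb_neg, slope_neg, ← hQ, ← hv']
    simp only [V.neg]
    rw [hQl, hRl]
    have h1 : q₁.y - R.x < v * (R.y + q₁.x) := by
      calc q₁.y - R.x < u * v * (q₁.y - R.x) := by nlinarith
        _ = v * (u * (q₁.y - R.x)) := by ring
        _ ≤ v * (R.y + q₁.x) := by gcongr
    have h2 : 0 ≤ u * v * (r₂.x - R.x) := by
      have : 0 ≤ r₂.x - R.x := by linarith
      positivity
    have h3 : 0 ≤ v * (Q.x - q₁.x) := mul_nonneg hv.le (by linarith)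
    nlinarith

/-! ### The tie -/

/-- The upper chain falls at least as fast as the lower one. Moving back therefore never loses
height, and optimality leaves only the case in which both chains and the hypotenuse have the same
slope. The triangle can then be translated to the left, although it is a leftmost one; this is where
that choice is needed. -/
theorem low_flat {r₁ r₂ y : V} {er : Bool} {m m₀ : ℝ} (hP : Convex ℝ P) (ht : Opt P a b w h)
    (hmin : ∀ a' b' w' h', Fits P a' b' w' h' → w' * h' = w * h → a ≤ a')
    (hr : UpperPair P r₁ r₂ er) (hy : SuppAt P y m₀) (hm₀m : m₀ ≤ m)
    (ar : (lb r₁ r₂ er).x < a) (ax : y.x < a) (bx : b < y.y)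
    (hum : slope r₁ r₂ + m ≤ 0) : False := by
  obtain ⟨⟨hw, hh, mp, mq, mr⟩, -⟩ := id ht
  set R := lb r₁ r₂ er with hR
  have hrlt := hr.lt
  have hRm : (R.x, R.y) ∈ P := hr.lb_mem
  have hRl : R.y = r₁.y + slope r₁ r₂ * (R.x - r₁.x) := hr.lb_line
  have hrl := hr.le_of_lb_lt mr ar
  obtain ⟨hm₀, hym, hs⟩ := hy
  have hym' : (y.x, y.y) ∈ P := hym
  have hδ : 0 < a - y.x := by linarith
  have hρ : 0 < a - R.x := by linarith
  set m₂ := (y.y - b) / (a - y.x) with hm₂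
  have em₂ : m₂ * (a - y.x) = y.y - b := div_mul_cancel₀ _ hδ.ne'
  have hm₂0 : 0 < m₂ := div_pos (by linarith) hδ
  have hm₂m₀ : m₂ ≤ m₀ := by
    rw [hm₂, div_le_iff₀ hδ]
    have := hs _ mp
    simp only at this
    linarith
  set u₂ := (b + h - R.y) / (a - R.x) with hu₂
  have eu₂ : u₂ * (a - R.x) = b + h - R.y := div_mul_cancel₀ _ hρ.ne'
  have huu : u₂ ≤ slope r₁ r₂ := by
    rw [hu₂, div_le_iff₀ hρ]
    linarith
  -- The segment from `R` to the base end lies in `P`, so above the corner it is not higher than the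
  -- apex.
  have hext : -u₂ * w ≤ h := by
    have h1 : (R.x + (a - R.x) * 1, R.y + (a - R.x) * ((b - R.y) / (a + w - R.x))) ∈ P := by
      refine seg_mem hP (s := a + w - R.x) (by linarith) hRm (mem_congr mq (by ring) ?_) hρ.le
        (by linarith)
      rw [mul_div_cancel₀ _ (by linarith)]; ring
    have h2 := ht.top (y := R.y + (a - R.x) * ((b - R.y) / (a + w - R.x))) (mem_congr h1)
    have h3 : (b - R.y) / (a + w - R.x) ≤ u₂ := by
      rw [← mul_le_mul_iff_of_pos_left hρ]
      linarith
    rw [div_le_iff₀ (by linarith)] at h3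
    linarith
  -- Corner and apex move back along their chains, while the base end moves up along the hypotenuse.
  have hback := ht.deriv_le hP (α := -1) (β := m₂) (ρ := -u₂) (σ := -(w / h * m₂)) hδ hρ
    (s₃ := h / m₂) (by positivity) (mem_congr hym') (mem_congr hRm)
    (mem_congr mr (by field_simp; ring) (by field_simp))
  have e1 : w / h * m₂ * h = w * m₂ := by field_simp
  have h1 : h ≤ (u₂ + 2 * m₂) * w := by linarith
  have h2 : 0 ≤ u₂ + m₂ := by
    by_contra! hc
    nlinarith
  have h3 : u₂ = -m₂ := by linarith
  have h4 : h = m₂ * w := by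
    rw [h3] at h1 hext
    linarith
  -- A translation by `ε * (-1, m₂)` moves the corner towards `y`, the apex towards `R`, and the
  -- base end along the hypotenuse; the three bounds keep each on its segment.
  set ε := min (a - y.x) (min (a - R.x) w) with hε
  have hε0 : 0 < ε := by positivity
  have hε1 : ε ≤ a - y.x := by simp [hε]
  have hε2 : ε ≤ a - R.x := by simp [hε]
  have hε3 : ε ≤ w := by simp [hε]
  have := hmin (a - ε) (b + ε * m₂) w h ⟨hw, hh,
    mem_congr (seg_mem hP (dx := -1) (dy := m₂) hδ mp (mem_congr hym') hε0.le hε1),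
    mem_congr (seg_mem hP (dx := -1) (dy := m₂) hw mq (mem_congr mr) hε0.le hε3),
    mem_congr (seg_mem hP (dx := -1) (dy := m₂) hρ mr
      (mem_congr hRm (by ring) (by rw [h3] at eu₂; linarith)) hε0.le hε2)⟩ rfl
  linarith

/-! ### The test -/

/-- The test with a point and the slope of a chord of the lower left chain, a chord of the upper
chain and a chord of the right chain; the last one is given in rotated coordinates. -/
def testA (x : V) (m : ℝ) (r₁ r₂ : V) (er : Bool) (q₁ q₂ : V) : Bool :=
  bif ltB 0 (slope r₁ r₂) && (ltB 0 (-slope q₁ q₂) && ltB 1 (slope r₁ r₂ * -slope q₁ q₂)) then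
    ltB ((hb r₁ r₂ er).y + q₁.x) (slope r₁ r₂ * (q₁.y - (hb r₁ r₂ er).x))
  else
    ltB 0 (slope r₁ r₂ + m) && (leB (1 + -slope q₁ q₂ * m) 0 ||
      ltB ((1 + -slope q₁ q₂ * m) * (lineAt r₁ r₂ x.x - x.y))
        ((slope r₁ r₂ + m) * (lineAt q₁ q₂ (-x.y) - x.x)))

/-- Used in the contrapositive: a positive answer shows that at least one of the three positions has
reached its bound. The slope `m` may be that of a chord, as long as a supporting line at `x` is at
least as steep. -/
theorem testA_high {r₁ r₂ q₁ q₂ x : V} {er eq : Bool} {m m₀ : ℝ} (hP : Convex ℝ P)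
    (ht : Opt P a b w h) (hr : UpperPair P r₁ r₂ er) (hq : UpperPair (rot P) q₁ q₂ eq)
    (hx : SuppAt P x m₀) (hm : 0 < m) (hmm₀ : m ≤ m₀)
    (ar : a < (hb r₁ r₂ er).x) (bq : -b < (hb q₁ q₂ eq).x) (ax : a < x.x) (bx : x.y < b) :
    testA x m r₁ r₂ er q₁ q₂ = false := by
  by_contra hc
  rw [Bool.not_eq_false, testA] at hc
  by_cases huv : 0 < slope r₁ r₂ ∧ 0 < -slope q₁ q₂ ∧ 1 < slope r₁ r₂ * -slope q₁ q₂
  · obtain ⟨h1, h2, h3⟩ := huv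
    simp only [ltB_iff.2 h1, ltB_iff.2 h2, ltB_iff.2 h3, Bool.and_self, cond_true, ltB_iff] at hc
    exact high_steep hP ht hr hq ar bq h1 h3 hc
  · have : (ltB 0 (slope r₁ r₂) && (ltB 0 (-slope q₁ q₂) &&
        ltB 1 (slope r₁ r₂ * -slope q₁ q₂))) = false := by
      rw [← Bool.not_eq_true]; simpa only [Bool.and_eq_true, ltB_iff] using huv
    rw [this, cond_false, Bool.and_eq_true, Bool.or_eq_true, ltB_iff, ltB_iff, leB_iff] at hc
    exact high_core hP ht hr hq hx hm hmm₀ ar bq ax bx huv hc.1 hc.2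

/-- Used in the contrapositive: a negative answer shows that at least one of the three positions is
not beyond its bound. The test is evaluated at `x`, but the conclusion concerns the other end `y` of
the chord. -/
theorem testA_low {r₁ r₂ q₁ q₂ x y : V} {er eq : Bool} {m m₀ : ℝ} (hP : Convex ℝ P)
    (ht : Opt P a b w h)
    (hmin : ∀ a' b' w' h', Fits P a' b' w' h' → w' * h' = w * h → a ≤ a')
    (hr : UpperPair P r₁ r₂ er) (hq : UpperPair (rot P) q₁ q₂ eq)
    (hy : SuppAt P y m₀) (hmm₀ : m₀ ≤ m) (hxy : x.x < y.x) (hyx : x.y - y.y = m * (y.x - x.x))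
    (ar : (lb r₁ r₂ er).x < a) (bq : (lb q₁ q₂ eq).x < -b) (ax : y.x < a) (bx : b < y.y) :
    testA x m r₁ r₂ er q₁ q₂ = true := by
  by_contra hc
  rw [Bool.not_eq_true, testA] at hc
  by_cases huv : 0 < slope r₁ r₂ ∧ 0 < -slope q₁ q₂ ∧ 1 < slope r₁ r₂ * -slope q₁ q₂
  · obtain ⟨h1, h2, h3⟩ := huv
    simp only [ltB_iff.2 h1, ltB_iff.2 h2, ltB_iff.2 h3, Bool.and_self, cond_true, ltB_false] at hc
    exact low_steep hP ht hr hq ar bq h1 h2 h3 hc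
  · have : (ltB 0 (slope r₁ r₂) && (ltB 0 (-slope q₁ q₂) &&
        ltB 1 (slope r₁ r₂ * -slope q₁ q₂))) = false := by
      rw [← Bool.not_eq_true]; simpa only [Bool.and_eq_true, ltB_iff] using huv
    rw [this, cond_false, Bool.and_eq_false_iff, Bool.or_eq_false_iff, ltB_false, ltB_false,
      leB_false] at hc
    rcases le_or_gt (slope r₁ r₂ + m) 0 with h1 | h1
    · exact low_flat hP ht hmin hr hy hmm₀ ar ax bx h1
    · obtain ⟨h2, h3⟩ := hc.resolve_left (by linarith)
      exact low_core hP ht hr hq hy hmm₀ hxy hyx ar bq ax bx huv h1 h2 h3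

attribute [reducible] hb lb slope lineAt testA

end

section

variable {P : Set (ℝ × ℝ)} {a b w h : ℝ}

/-! ## Optimal triangles whose corner can move left and down -/

/-- The triangle is largest, its corner can be moved to the left and down unless this is impossible
for all points of `P`, and the triangle cannot be translated to the left and down. -/
structure Free (P : Set (ℝ × ℝ)) (a b w h : ℝ) : Prop where
  opt : Opt P a b w h
  left : (∃ s > 0, (a - s, b) ∈ P) ∨ ∀ z ∈ P, a ≤ z.1
  down : (∃ s > 0, (a, b - s) ∈ P) ∨ ∀ z ∈ P, b ≤ z.2
  slide : ∀ s > 0, ∀ t > 0, ¬ Fits P (a - s) (b - t) w h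

theorem Free.flip (ht : Free P a b w h) : Free (flip P) b a h w where
  opt := ht.opt.flip
  left := ht.down.imp_right fun hd _ hz => hd _ hz
  down := ht.left.imp_right fun hd _ hz => hd _ hz
  slide s hs t ht' hf := ht.slide t ht' s hs ⟨hf.2.1, hf.1, hf.2.2.1, hf.2.2.2.2, hf.2.2.2.1⟩

/-- The corner moves to the left and the apex towards `(x, y)`, while the base end stays. A point of
`P` to the left of the corner excludes the second alternative in `Free.left`. -/
theorem Free.left_le (hP : Convex ℝ P) (ht : Free P a b w h) {x y : ℝ} (hx : x < a)
    (hm : (x, y) ∈ P) : h ≤ (b + h - y) / (a - x) * w := by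
  obtain ⟨s, hs, hl⟩ := ht.left.resolve_right (fun hc => absurd (hc _ hm) (not_le.2 hx))
  have hx' : 0 < a - x := by linarith
  have := ht.opt.deriv_le hP (α := -1) (β := 0) (ρ := -((b + h - y) / (a - x))) (σ := 0) hs hx'
    one_pos (mem_congr hl) (mem_congr hm (by ring) (by field_simp; ring)) (by simpa using ht.opt.1.2.2.2.1)
  linarith

theorem Free.down_le (hP : Convex ℝ P) (ht : Free P a b w h) {x y : ℝ} (hy : y < b)
    (hm : (x, y) ∈ P) : w ≤ (a + w - x) / (b - y) * h :=
  ht.flip.left_le (flip_convex hP) hy hm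

/-- Optimality to the left and downwards gives `u₂ * v₂ ≥ 1` for the actual slopes, so `u * v ≤ 1`
forces equality. Then apex and base end can both follow a translation by a multiple of `(-v₂, -1)`,
which `Free.slide` forbids. -/
theorem Free.tie (hP : Convex ℝ P) (ht : Free P a b w h) {x y x' y' u v : ℝ} (hx : x < a)
    (hm : (x, y) ∈ P) (hy : y' < b) (hm' : (x', y') ∈ P) (hu : (b + h - y) / (a - x) ≤ u)
    (hv : (a + w - x') / (b - y') ≤ v) (hu0 : 0 < u) (huv : u * v ≤ 1) : False := by
  obtain ⟨hw, hh, mp, mq, mr⟩ := ht.opt.1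
  have h1 := ht.left_le hP hx hm
  have h2 := ht.down_le hP hy hm'
  obtain ⟨s, hs, hl⟩ := ht.left.resolve_right (fun hc => absurd (hc _ hm) (not_le.2 hx))
  obtain ⟨t, ht', hd⟩ := ht.down.resolve_right (fun hc => absurd (hc _ hm') (not_le.2 hy))
  have hxa : 0 < a - x := by linarith
  have hyb : 0 < b - y' := by linarith
  set u₂ := (b + h - y) / (a - x) with hu₂
  set v₂ := (a + w - x') / (b - y') with hv₂
  have eu : u₂ * (a - x) = b + h - y := div_mul_cancel₀ _ hxa.ne'
  have ev : v₂ * (b - y') = a + w - x' := div_mul_cancel₀ _ hyb.ne'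
  have hu₂0 : 0 < u₂ := by
    by_contra! hc; nlinarith
  have hv₂0 : 0 < v₂ := by
    by_contra! hc; nlinarith
  have h3 : 1 ≤ u₂ * v₂ := by
    have : h ≤ u₂ * v₂ * h := by
      calc h ≤ u₂ * w := h1
        _ ≤ u₂ * (v₂ * h) := by gcongr
        _ = _ := by ring
    by_contra! hc
    nlinarith
  have h4 : u₂ * v₂ = 1 := by
    refine le_antisymm ?_ h3
    calc u₂ * v₂ ≤ u * v := by gcongr
      _ ≤ 1 := huv
  -- translate by a multiple of `(-v₂, -1)`
  set ε := min (min (s / 2 / v₂) (t / 2)) (min ((a - x) / v₂) (b - y')) with hε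
  have hε0 : 0 < ε := by positivity
  have hε1 : ε ≤ s / 2 / v₂ := by simp [hε]
  have hε2 : ε ≤ t / 2 := by simp [hε]
  have hε3 : ε ≤ (a - x) / v₂ := by simp [hε]
  have hε4 : ε ≤ b - y' := by simp [hε]
  rw [le_div_iff₀ hv₂0] at hε1 hε3
  refine ht.slide (ε * v₂) (by positivity) ε hε0 ⟨hw, hh, ?_, ?_, ?_⟩
  -- The new corner is the midpoint of a point to the left of the old one and a point below it;
  -- hence the factors `2`.
  · have h5 := hP (mem_congr (seg_mem hP (dx := -1) (dy := 0) hs mp (mem_congr hl)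
        (ε := 2 * (ε * v₂)) (by positivity) (by linarith)) (x' := a - 2 * (ε * v₂)) (y' := b))
      (mem_congr (seg_mem hP (dx := 0) (dy := -1) ht' mp (mem_congr hd) (ε := 2 * ε)
        (by positivity) (by linarith)) (x' := a) (y' := b - 2 * ε))
      (a := 1 / 2) (b := 1 / 2) (by norm_num) (by norm_num) (by norm_num)
    exact mem_congr h5 (by simp; ring) (by simp; ring)
  · exact mem_congr (seg_mem hP (dx := -v₂) (dy := -1) hyb mq (mem_congr hm') hε0.le hε4)
  · refine mem_congr (seg_mem hP (dx := -v₂) (dy := -1) (s := (a - x) / v₂) (by positivity) mr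
      (mem_congr hm (by field_simp; ring) ?_) hε0.le (by rwa [le_div_iff₀ hv₂0]))
    have : (a - x) / v₂ = u₂ * (a - x) := by
      rw [div_eq_iff hv₂0.ne']; linear_combination -(a - x) * h4
    linarith

/-- Two points on a line of slope `u > 0`: the graph of an increasing concave function passes
through them, and its value `T` at `a` is below the line on the left of `v₁` and on the right
of `v₂`. -/
structure Ref (P : Set (ℝ × ℝ)) (a T u : ℝ) (v₁ v₂ : V) : Prop where
  pos : 0 < u
  mem₁ : v₁.pt ∈ P
  mem₂ : v₂.pt ∈ P
  line : v₂.y - v₁.y = u * (v₂.x - v₁.x)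
  le : v₁.x ≤ v₂.x
  le₁ : a < v₁.x → T ≤ v₁.y - u * (v₁.x - a)
  le₂ : v₂.x < a → T ≤ v₂.y + u * (a - v₂.x)
  ge₁ : v₁.x ≤ a → v₁.y ≤ T
  ge₂ : v₂.x ≤ a → v₂.y ≤ T
  mono₂ : a ≤ v₂.x → T ≤ v₂.y

section
variable {u v : ℝ} {r₁ r₂ q₁ q₂ : V}

theorem Ref.right (hP : Convex ℝ P) (ht : Opt P a b w h) (hr : Ref P a (b + h) u r₁ r₂)
    (ha : a < r₁.x) : u * w ≤ h := by
  refine le_trans ?_ (ht.right_le hP ha (y := r₁.y) hr.mem₁)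
  refine mul_le_mul_of_nonneg_right ?_ ht.1.1.le
  rw [le_div_iff₀ (by linarith)]
  linarith [hr.le₁ ha]

theorem Ref.left_slope (hr : Ref P a (b + h) u r₁ r₂) (ha : r₂.x < a) :
    (b + h - r₂.y) / (a - r₂.x) ≤ u := by
  rw [div_le_iff₀ (by linarith)]
  linarith [hr.le₂ ha]

theorem Ref.left (hP : Convex ℝ P) (ht : Free P a b w h) (hr : Ref P a (b + h) u r₁ r₂)
    (ha : r₂.x < a) : h ≤ u * w :=
  (ht.left_le hP ha (y := r₂.y) hr.mem₂).trans
    (mul_le_mul_of_nonneg_right (hr.left_slope ha) ht.opt.1.1.le)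

theorem Ref.up (hP : Convex ℝ P) (ht : Opt P a b w h) (hq : Ref (flip P) b (a + w) v q₁ q₂)
    (hb : b < q₁.x) : v * h ≤ w := Ref.right (flip_convex hP) ht.flip hq hb

theorem Ref.down (hP : Convex ℝ P) (ht : Free P a b w h) (hq : Ref (flip P) b (a + w) v q₁ q₂)
    (hb : q₂.x < b) : w ≤ v * h := Ref.left (flip_convex hP) ht.flip hq hb

theorem Ref.absurd_of_steep (hP : Convex ℝ P) (ht : Opt P a b w h)
    (hr : Ref P a (b + h) u r₁ r₂) (hq : Ref (RealRAM.flip P) b (a + w) v q₁ q₂) (huv : 1 < u * v)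
    (ha : a < r₁.x) (hb : b < q₁.x) : False := by
  have h1 := hr.right hP ht ha
  have h2 := hq.up hP ht hb
  have := hr.pos
  have := ht.1.2.1
  nlinarith

theorem Ref.absurd_of_flat (hP : Convex ℝ P) (ht : Free P a b w h)
    (hr : Ref P a (b + h) u r₁ r₂) (hq : Ref (RealRAM.flip P) b (a + w) v q₁ q₂) (huv : u * v ≤ 1)
    (ha : r₂.x < a) (hb : q₂.x < b) : False :=
  ht.tie hP ha hr.mem₂ hb hq.mem₂ (hr.left_slope ha)
    (Ref.left_slope (P := RealRAM.flip P) hq hb) hr.pos huv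

/-! The points `q₁`, `q₂` are given in coordinates `(y, x)`. -/

/-- For `u * v > 1` the motions to the right and upwards cannot both be open, and for `u * v ≤ 1`
those to the left and downwards cannot. In this lemma and the next three, the legs of the right
triangle spanned by the two reference points tell which of the two chains can be cut. -/
theorem both_steep_right (hP : Convex ℝ P) (ht : Free P a b w h)
    (hr : Ref P a (b + h) u r₁ r₂) (hq : Ref (flip P) b (a + w) v q₁ q₂) (huv : 1 < u * v)
    (htest : r₁.y - q₁.x < u * (q₁.y - r₁.x)) : r₁.x ≤ a := by
  by_contra! ha
  have h1 := hr.right hP ht.opt ha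
  have h2 := hr.le₁ ha
  have hu := hr.pos
  rcases lt_or_ge b q₁.x with hb | hb
  · exact hr.absurd_of_steep hP ht.opt hq huv ha hb
  · have h3 := hq.ge₁ hb
    nlinarith

theorem both_steep_up (hP : Convex ℝ P) (ht : Free P a b w h)
    (hr : Ref P a (b + h) u r₁ r₂) (hq : Ref (flip P) b (a + w) v q₁ q₂) (huv : 1 < u * v)
    (htest : u * (q₁.y - r₁.x) ≤ r₁.y - q₁.x) : q₁.x ≤ b := by
  by_contra! hb
  have h1 := hq.up hP ht.opt hb
  have h2 := hq.le₁ hb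
  have hu := hr.pos
  have hv := hq.pos
  rcases lt_or_ge a r₁.x with ha | ha
  · exact hr.absurd_of_steep hP ht.opt hq huv ha hb
  · have h3 := hr.ge₁ ha
    have hw := ht.opt.1.1
    have h4 : 0 < q₁.y - r₁.x := by nlinarith
    have h5 : q₁.y - r₁.x < v * (r₁.y - q₁.x) := by
      calc q₁.y - r₁.x < u * v * (q₁.y - r₁.x) := by nlinarith
        _ = v * (u * (q₁.y - r₁.x)) := by ring
        _ ≤ _ := by gcongr
    nlinarith

theorem both_flat_left (hP : Convex ℝ P) (ht : Free P a b w h)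
    (hr : Ref P a (b + h) u r₁ r₂) (hq : Ref (flip P) b (a + w) v q₁ q₂) (huv : u * v ≤ 1)
    (htest : u * (q₂.y - r₂.x) ≤ r₂.y - q₂.x) : a ≤ r₂.x := by
  by_contra! ha
  rcases lt_or_ge q₂.x b with hb | hb
  · exact hr.absurd_of_flat hP ht hq huv ha hb
  · have h1 := hr.left hP ht ha
    have h2 := hr.ge₂ ha.le
    have h3 := hq.mono₂ hb
    have hu := hr.pos
    nlinarith

theorem both_flat_down (hP : Convex ℝ P) (ht : Free P a b w h)
    (hr : Ref P a (b + h) u r₁ r₂) (hq : Ref (flip P) b (a + w) v q₁ q₂) (huv : u * v ≤ 1)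
    (htest : r₂.y - q₂.x < u * (q₂.y - r₂.x)) : b ≤ q₂.x := by
  by_contra! hb
  rcases lt_or_ge r₂.x a with ha | ha
  · exact hr.absurd_of_flat hP ht hq huv ha hb
  · have h1 := hq.down hP ht hb
    have h2 := hq.ge₂ hb.le
    have h3 := hr.mono₂ ha
    have hu := hr.pos
    have hh := ht.opt.1.2.1
    have h4 : u * w ≤ h := by
      calc u * w ≤ u * (v * h) := by gcongr
        _ = u * v * h := by ring
        _ ≤ 1 * h := by gcongr
        _ = h := one_mul h
    nlinarith

/-- The point `r` is on a segment of slope `u` between `r₁` and `r₂`. -/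
structure OnEdge (P : Set (ℝ × ℝ)) (a T u : ℝ) (r₁ r₂ : V) : Prop where
  mem₁ : r₁.pt ∈ P
  mem₂ : r₂.pt ∈ P
  nonneg : 0 ≤ u
  le₁ : r₁.x ≤ a
  le₂ : a ≤ r₂.x
  line₁ : T = r₁.y + u * (a - r₁.x)
  line₂ : T = r₂.y - u * (r₂.x - a)

theorem OnEdge.right (hP : Convex ℝ P) (ht : Opt P a b w h) (hr : OnEdge P a (b + h) u r₁ r₂)
    (ha : a < r₂.x) : u * w ≤ h := by
  refine le_trans ?_ (ht.right_le hP ha (y := r₂.y) hr.mem₂)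
  refine mul_le_mul_of_nonneg_right ?_ ht.1.1.le
  rw [le_div_iff₀ (by linarith)]
  linarith [hr.line₂]

theorem OnEdge.left_slope (hr : OnEdge P a (b + h) u r₁ r₂) (ha : r₁.x < a) :
    (b + h - r₁.y) / (a - r₁.x) ≤ u := by
  rw [div_le_iff₀ (by linarith)]
  linarith [hr.line₁]

/-- In this lemma and the next three the edge with the apex is known, and only the other chain is
cut. The comparison is made with the right end of the edge if the pair is steep and with the left
end otherwise. -/
theorem edge_steep_up (hP : Convex ℝ P) (ht : Free P a b w h) (hr : OnEdge P a (b + h) u r₁ r₂)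
    (hq : Ref (flip P) b (a + w) v q₁ q₂) (huv : 1 < u * v)
    (htest : q₁.y - r₂.x < v * (r₂.y - q₁.x)) : q₁.x ≤ b := by
  by_contra! hb
  have h1 := hq.up hP ht.opt hb
  have h2 := hq.le₁ hb
  have hv := hq.pos
  have hh := ht.opt.1.2.1
  rcases lt_or_ge a r₂.x with ha | ha
  · have h3 := hr.right hP ht.opt ha
    have hu : 0 < u := by
      by_contra! hc
      nlinarith [hr.nonneg]
    nlinarith
  · have ha' : a = r₂.x := le_antisymm hr.le₂ ha
    have h3 := hr.line₂
    rw [ha', sub_self, mul_zero, sub_zero] at h3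
    nlinarith

theorem edge_steep_down (hP : Convex ℝ P) (ht : Free P a b w h)
    (hr : OnEdge P a (b + h) u r₁ r₂) (hq : Ref (flip P) b (a + w) v q₁ q₂)
    (htest : v * (r₂.y - q₁.x) ≤ q₁.y - r₂.x) : b ≤ q₂.x := by
  by_contra! hb
  have h1 := hq.down hP ht hb
  have h2 := hq.ge₂ hb.le
  have h4 := hq.line
  have h5 := hq.le
  have hv := hq.pos
  have h3 := hr.line₂
  have h6 : 0 ≤ u * (r₂.x - a) := mul_nonneg hr.nonneg (by linarith [hr.le₂])
  have h7 := hr.le₂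
  nlinarith

theorem edge_flat_up (hP : Convex ℝ P) (ht : Free P a b w h) (hr : OnEdge P a (b + h) u r₁ r₂)
    (hq : Ref (flip P) b (a + w) v q₁ q₂)
    (htest : q₁.y - r₁.x < v * (r₁.y - q₁.x)) : q₁.x ≤ b := by
  by_contra! hb
  have h1 := hq.up hP ht.opt hb
  have h2 := hq.le₁ hb
  have hv := hq.pos
  have h3 := hr.line₁
  have h6 : 0 ≤ u * (a - r₁.x) := mul_nonneg hr.nonneg (by linarith [hr.le₁])
  have h7 := hr.le₁
  nlinarith

theorem edge_flat_down (hP : Convex ℝ P) (ht : Free P a b w h) (hr : OnEdge P a (b + h) u r₁ r₂)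
    (hq : Ref (flip P) b (a + w) v q₁ q₂) (huv : u * v ≤ 1)
    (htest : v * (r₁.y - q₁.x) ≤ q₁.y - r₁.x) : b ≤ q₂.x := by
  by_contra! hb
  have h1 := hq.down hP ht hb
  have h2 := hq.ge₂ hb.le
  have h4 := hq.line
  have h5 := hq.le
  have hv := hq.pos
  have h3 := hr.line₁
  rcases lt_or_ge r₁.x a with ha | ha
  · have hsl := hr.left_slope ha
    have hu : 0 < u := by
      have h8 := ht.left_le hP ha (y := r₁.y) hr.mem₁
      by_contra! hc
      have hw := ht.opt.1.1
      have hh := ht.opt.1.2.1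
      nlinarith
    exact ht.tie hP ha hr.mem₁ hb hq.mem₂ hsl (Ref.left_slope (P := RealRAM.flip P) hq hb) hu huv
  · have ha' : a = r₁.x := le_antisymm ha hr.le₁
    rw [ha', sub_self, mul_zero, add_zero] at h3
    nlinarith

end

end

/-! ### Binary search on the boundary of the polygon: windows, turns, chains, extreme vertices,
point location -/

/-! ## Sorted trees and gaps -/

def Tree.Sorted (t : Tree) : Prop := t.toList.Pairwise (fun u v => u.key < v.key)

theorem Tree.sorted_nil : Tree.nil.Sorted := List.Pairwise.nil

theorem Tree.sorted_node {l r : Tree} {v : V} : (Tree.node l v r).Sorted ↔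
    l.Sorted ∧ r.Sorted ∧ (∀ u ∈ l.toList, u.key < v.key) ∧ (∀ u ∈ r.toList, v.key < u.key) ∧
      ∀ u ∈ l.toList, ∀ w ∈ r.toList, u.key < w.key := by
  simp only [Sorted, toList, List.pairwise_append, List.pairwise_cons, List.mem_cons,
    forall_eq_or_imp]
  grind

/-- `G` contains the points of `N` between `a` and `b`. -/
structure Gap (N : Set V) (a : V) (G : Tree) (b : V) : Prop where
  sorted : G.Sorted
  mem : ∀ v ∈ G.toList, v ∈ N
  of_lt : ∀ v ∈ N, a.key < v.key → v.key < b.key → v ∈ G.toList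

namespace Gap

variable {N : Set V} {a b v : V} {G l r : Tree}

theorem root_mem (h : Gap N a (.node l v r) b) : v ∈ N := h.mem v (by simp [Tree.toList])

theorem left (h : Gap N a (.node l v r) b) (hb : v.key ≤ b.key) : Gap N a l v := by
  obtain ⟨h1, h2, h3⟩ := h
  obtain ⟨s1, s2, s3, s4, s5⟩ := Tree.sorted_node.1 h1
  refine ⟨s1, fun u hu => h2 u (by simp [Tree.toList, hu]), fun u hu h4 h5 => ?_⟩
  have := h3 u hu h4 (h5.trans_le hb)
  simp only [Tree.toList, List.mem_append, List.mem_cons] at this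
  grind

theorem right (h : Gap N a (.node l v r) b) (ha : a.key ≤ v.key) : Gap N v r b := by
  obtain ⟨h1, h2, h3⟩ := h
  obtain ⟨s1, s2, s3, s4, s5⟩ := Tree.sorted_node.1 h1
  refine ⟨s2, fun u hu => h2 u (by simp [Tree.toList, hu]), fun u hu h4 h5 => ?_⟩
  have := h3 u hu (ha.trans_lt h4) h5
  simp only [Tree.toList, List.mem_append, List.mem_cons] at this
  grind

/-- A tree may contain more than the gap needs. If its root is outside, one child alone still covers
the gap. -/
theorem right_of_le (h : Gap N a (.node l v r) b) (ha : v.key ≤ a.key) : Gap N a r b := by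
  obtain ⟨h1, h2, h3⟩ := h
  obtain ⟨s1, s2, s3, s4, s5⟩ := Tree.sorted_node.1 h1
  refine ⟨s2, fun u hu => h2 u (by simp [Tree.toList, hu]), fun u hu h4 h5 => ?_⟩
  have := h3 u hu h4 h5
  simp only [Tree.toList, List.mem_append, List.mem_cons] at this
  grind

theorem left_of_le (h : Gap N a (.node l v r) b) (hb : b.key ≤ v.key) : Gap N a l b := by
  obtain ⟨h1, h2, h3⟩ := h
  obtain ⟨s1, s2, s3, s4, s5⟩ := Tree.sorted_node.1 h1
  refine ⟨s1, fun u hu => h2 u (by simp [Tree.toList, hu]), fun u hu h4 h5 => ?_⟩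
  have := h3 u hu h4 h5
  simp only [Tree.toList, List.mem_append, List.mem_cons] at this
  grind

theorem nil_iff : Gap N a .nil b ↔ ∀ u ∈ N, a.key < u.key → ¬ u.key < b.key :=
  ⟨fun h u hu h1 h2 => by simpa [Tree.toList] using h.of_lt u hu h1 h2,
    fun h => ⟨Tree.sorted_nil, by simp [Tree.toList], fun u hu h1 h2 => absurd h2 (h u hu h1)⟩⟩

end Gap

/-! ## Search windows -/

/-- The part of a chain between `lo` and `hi`: the points between `lo` and `x` are in `A`, those
between `x` and `hi` in `B`. -/
structure PW where
  lo : V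
  A : Tree
  x : V
  B : Tree
  hi : V
  turn : Bool

def PW.tup (w : PW) := (w.lo, w.A, w.x, w.B, w.hi, w.turn)

instance : Enc PW := Enc.via PW.tup

theorem PW.comp_tup : Comp L k PW.tup := Comp.via_to _
@[fun_prop] theorem PW.comp_lo : Comp L k PW.lo := Comp.fst.comp' comp_tup
@[fun_prop] theorem PW.comp_A : Comp L k PW.A := (Comp.fst.comp' Comp.snd).comp' comp_tup
@[fun_prop] theorem PW.comp_x : Comp L k PW.x :=
  (Comp.fst.comp' (Comp.snd.comp' Comp.snd)).comp' comp_tup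
@[fun_prop] theorem PW.comp_B : Comp L k PW.B :=
  (Comp.fst.comp' (Comp.snd.comp' (Comp.snd.comp' Comp.snd))).comp' comp_tup
@[fun_prop] theorem PW.comp_hi : Comp L k PW.hi :=
  (Comp.fst.comp' (Comp.snd.comp' (Comp.snd.comp' (Comp.snd.comp' Comp.snd)))).comp' comp_tup
@[fun_prop] theorem PW.comp_turn : Comp L k PW.turn :=
  (Comp.snd.comp' (Comp.snd.comp' (Comp.snd.comp' (Comp.snd.comp' Comp.snd)))).comp' comp_tup
@[fun_prop] theorem PW.comp_mk : Comp L k (fun z : V × Tree × V × Tree × V × Bool =>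
    PW.mk z.1 z.2.1 z.2.2.1 z.2.2.2.1 z.2.2.2.2.1 z.2.2.2.2.2) :=
  .via_of PW.tup _ fun _ => rfl

namespace PW

def done (w : PW) : Bool := w.A.isNil && w.B.isNil

/-- The current chord can be used. -/
def ready (w : PW) : Bool :=
  bif w.turn then !w.B.isNil && (ltB w.x.key w.B.root.key && ltB w.B.root.key w.hi.key)
  else !w.A.isNil && (ltB w.lo.key w.A.root.key && ltB w.A.root.key w.x.key)

def fst (w : PW) : V := bif w.turn then w.x else w.A.root
def snd (w : PW) : V := bif w.turn then w.B.root else w.x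

/-- The child of a tree whose root is not between the ends of the gap. -/
def child (c : ℝ) (G : Tree) : Tree := bif leB G.root.key c then G.right else G.left

def skip (w : PW) : PW :=
  bif w.turn then ⟨w.lo, w.A, w.x, child w.x.key w.B, w.hi, false⟩
  else ⟨w.lo, child w.lo.key w.A, w.x, w.B, w.hi, true⟩

/-- The part from the first point of the chord on. -/
def high (w : PW) : PW :=
  bif w.turn then ⟨w.x, w.B.left, w.B.root, w.B.right, w.hi, false⟩
  else ⟨w.A.root, w.A.right, w.x, w.B, w.hi, true⟩

/-- The part up to the second point of the chord. -/
def low (w : PW) : PW :=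
  bif w.turn then ⟨w.lo, w.A, w.x, w.B.left, w.B.root, false⟩
  else ⟨w.lo, w.A.left, w.A.root, w.A.right, w.x, false⟩

/-- A step looks at one of the two trees and may pass the turn to the other. The tree that has just
been looked at is counted as one higher while the other waits for its turn; in this way each step
decreases the measure. -/
def meas (w : PW) : ℕ :=
  bif w.turn then 2 * max (w.A.height + 1) w.B.height else 2 * max w.A.height w.B.height + 1

@[fun_prop] theorem comp_done : Comp L k done := by unfold done; fun_prop
@[fun_prop] theorem comp_ready : Comp L k ready := by unfold ready; fun_prop
@[fun_prop] theorem comp_fst : Comp L k fst := by unfold fst; fun_prop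
@[fun_prop] theorem comp_snd : Comp L k snd := by unfold snd; fun_prop
attribute [reducible] child skip high low

theorem height_left (t : Tree) : t.left.height ≤ t.height - 1 := by
  cases t
  · exact le_rfl
  · simp [Tree.left, Tree.height]

theorem height_right (t : Tree) : t.right.height ≤ t.height - 1 := by
  cases t
  · exact le_rfl
  · simp [Tree.right, Tree.height]

theorem height_child (c : ℝ) (t : Tree) : (child c t).height ≤ t.height - 1 := by
  unfold child
  cases leB t.root.key c
  · exact height_left t
  · exact height_right t

theorem height_pos {t : Tree} (h : t.isNil = false) : 0 < t.height := by
  cases t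
  · simp [Tree.isNil] at h
  · simp [Tree.height]

theorem meas_skip {w : PW} (h : w.done = false) : w.skip.meas < w.meas := by
  have h1 := height_child w.x.key w.B
  have h2 := height_child w.lo.key w.A
  have h3 : 0 < w.A.height ∨ 0 < w.B.height := by
    simp only [done, Bool.and_eq_false_iff] at h
    exact h.imp height_pos height_pos
  cases ht : w.turn <;> simp only [skip, meas, ht, cond_true, cond_false] <;> omega

theorem meas_high {w : PW} (h : w.ready = true) : w.high.meas < w.meas := by
  have h1 := height_left w.B
  have h2 := height_right w.B
  have h3 := height_right w.A
  cases ht : w.turn <;> simp [ready, ht] at h <;> have h4 := height_pos h.1 <;>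
    simp only [high, meas, ht, cond_true, cond_false] <;> omega

theorem meas_low {w : PW} (h : w.ready = true) : w.low.meas < w.meas := by
  have h1 := height_left w.B
  have h2 := height_left w.A
  have h3 := height_right w.A
  cases ht : w.turn <;> simp [ready, ht] at h <;> have h4 := height_pos h.1 <;>
    simp only [low, meas, ht, cond_true, cond_false] <;> omega

theorem meas_le (w : PW) : w.meas ≤ 2 * (size w + 1) := by
  have h1 : w.A.height ≤ size w :=
    (le_max_left _ _).trans (le_max_right (size w.lo) (size (w.A, w.x, w.B, w.hi, w.turn)))
  have h2 : w.B.height ≤ size w :=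
    (le_max_left (size w.B) (size (w.hi, w.turn))).trans ((le_max_right (size w.x) _).trans
      ((le_max_right (size w.A) _).trans (le_max_right (size w.lo) _)))
  cases ht : w.turn <;> simp only [meas, ht, cond_true, cond_false] <;> omega

/-- The window describes a part of the chain `N`. -/
structure Ok (N : Set V) (w : PW) : Prop where
  lo : w.lo ∈ N
  x : w.x ∈ N
  hi : w.hi ∈ N
  lo_le : w.lo.key ≤ w.x.key
  le_hi : w.x.key ≤ w.hi.key
  gapA : Gap N w.lo w.A w.x
  gapB : Gap N w.x w.B w.hi

variable {N : Set V} {w : PW}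

theorem eq_node {t : Tree} (h : t.isNil = false) : t = .node t.left t.root t.right := by
  cases t
  · simp [Tree.isNil] at h
  · rfl

theorem ready_true (ht : w.turn = true) (h : w.ready = true) : w.B.isNil = false ∧
    w.x.key < w.B.root.key ∧ w.B.root.key < w.hi.key := by
  simpa [ready, ht] using h

theorem ready_false (ht : w.turn = false) (h : w.ready = true) : w.A.isNil = false ∧
    w.lo.key < w.A.root.key ∧ w.A.root.key < w.x.key := by
  simpa [ready, ht] using h

theorem Ok.fst_snd (hw : w.Ok N) (h : w.ready = true) : w.fst ∈ N ∧ w.snd ∈ N ∧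
    w.lo.key ≤ w.fst.key ∧ w.fst.key < w.snd.key ∧ w.snd.key ≤ w.hi.key := by
  cases ht : w.turn with
  | true =>
    obtain ⟨h1, h2, h3⟩ := ready_true ht h
    simp only [fst, snd, ht, cond_true]
    exact ⟨hw.x, (eq_node h1 ▸ hw.gapB).root_mem, hw.lo_le, h2, h3.le⟩
  | false =>
    obtain ⟨h1, h2, h3⟩ := ready_false ht h
    simp only [fst, snd, ht, cond_false]
    exact ⟨(eq_node h1 ▸ hw.gapA).root_mem, hw.x, h2.le, h3, hw.le_hi⟩

theorem Ok.high (hw : w.Ok N) (h : w.ready = true) : w.high.Ok N := by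
  cases ht : w.turn with
  | true =>
    obtain ⟨h1, h2, h3⟩ := ready_true ht h
    have hB := hw.gapB
    rw [eq_node h1] at hB
    simp only [PW.high, ht, cond_true]
    exact ⟨hw.x, hB.root_mem, hw.hi, h2.le, h3.le, hB.left h3.le, hB.right h2.le⟩
  | false =>
    obtain ⟨h1, h2, h3⟩ := ready_false ht h
    have hA := hw.gapA
    rw [eq_node h1] at hA
    simp only [PW.high, ht, cond_false]
    exact ⟨hA.root_mem, hw.x, hw.hi, h3.le, hw.le_hi, hA.right h2.le, hw.gapB⟩

theorem Ok.low (hw : w.Ok N) (h : w.ready = true) : w.low.Ok N := by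
  cases ht : w.turn with
  | true =>
    obtain ⟨h1, h2, h3⟩ := ready_true ht h
    have hB := hw.gapB
    rw [eq_node h1] at hB
    simp only [PW.low, ht, cond_true]
    exact ⟨hw.lo, hw.x, hB.root_mem, hw.lo_le, h2.le, hw.gapA, hB.left h3.le⟩
  | false =>
    obtain ⟨h1, h2, h3⟩ := ready_false ht h
    have hA := hw.gapA
    rw [eq_node h1] at hA
    simp only [PW.low, ht, cond_false]
    exact ⟨hw.lo, hA.root_mem, hw.x, h2.le, h3.le, hA.left h3.le, hA.right h2.le⟩

theorem gap_child {a b : V} {G : Tree} (hG : Gap N a G b)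
    (h : (!G.isNil && (ltB a.key G.root.key && ltB G.root.key b.key)) = false) :
    Gap N a (child a.key G) b := by
  cases hn : G.isNil with
  | true =>
    cases G with
    | nil =>
      unfold child
      cases leB Tree.nil.root.key a.key <;> exact hG
    | node => simp [Tree.isNil] at hn
  | false =>
    rw [eq_node hn] at hG
    unfold child
    cases hc : leB G.root.key a.key with
    | true => exact hG.right_of_le (leB_iff.1 hc)
    | false =>
      refine hG.left_of_le ?_
      simp only [hn, Bool.not_false, Bool.true_and, Bool.and_eq_false_iff, ltB_false] at h
      exact h.resolve_left (not_le.2 (leB_false.1 hc))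

theorem Ok.skip (hw : w.Ok N) (h : w.ready = false) : w.skip.Ok N := by
  cases ht : w.turn with
  | true =>
    simp only [PW.skip, ht, cond_true]
    refine ⟨hw.lo, hw.x, hw.hi, hw.lo_le, hw.le_hi, hw.gapA, gap_child hw.gapB ?_⟩
    simpa [ready, ht] using h
  | false =>
    simp only [PW.skip, ht, cond_false]
    refine ⟨hw.lo, hw.x, hw.hi, hw.lo_le, hw.le_hi, gap_child hw.gapA ?_, hw.gapB⟩
    simpa [ready, ht] using h

theorem skip_lo : w.skip.lo = w.lo := by unfold skip; cases w.turn <;> rfl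
theorem skip_hi : w.skip.hi = w.hi := by unfold skip; cases w.turn <;> rfl
theorem high_lo : w.high.lo = w.fst := by unfold high fst; cases w.turn <;> rfl
theorem high_hi : w.high.hi = w.hi := by unfold high; cases w.turn <;> rfl
theorem low_lo : w.low.lo = w.lo := by unfold low; cases w.turn <;> rfl
theorem low_hi : w.low.hi = w.snd := by unfold low snd; cases w.turn <;> rfl

/-- When the search is over, the points are adjacent. -/
theorem Ok.adj (hw : w.Ok N) (h : w.done = true) :
    (∀ u ∈ N, w.lo.key < u.key → ¬ u.key < w.x.key) ∧
      ∀ u ∈ N, w.x.key < u.key → ¬ u.key < w.hi.key := by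
  simp only [done, Bool.and_eq_true] at h
  have e : ∀ t : Tree, t.isNil = true → t = .nil := fun t ht => by
    cases t
    · rfl
    · simp [Tree.isNil] at ht
  exact ⟨Gap.nil_iff.1 (e _ h.1 ▸ hw.gapA), Gap.nil_iff.1 (e _ h.2 ▸ hw.gapB)⟩

/-- One step of a search. -/
def step (w : PW) (d : Bool) : PW := bif w.ready then bif d then w.high else w.low else w.skip

@[fun_prop] theorem comp_step : Comp L k (fun z : PW × Bool => z.1.step z.2) := by
  unfold step; fun_prop

theorem meas_step {w : PW} (h : w.done = false) (d : Bool) : (w.step d).meas < w.meas := by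
  unfold step
  cases hr : w.ready with
  | false => exact meas_skip h
  | true =>
    cases d
    · exact meas_low hr
    · exact meas_high hr

end PW

/-! ## Searching a window -/

/-- The search in which `d c u v` decides for a chord `u v` whether to go on from `u` upwards or
from `v` downwards. -/
def search {γ : Type} (d : γ → V → V → Bool) (c : γ) (w : PW) : PW :=
  (iter (fun s : γ × PW => !s.2.done) (fun s => (s.1, s.2.step (d s.1 s.2.fst s.2.snd)))
    w.meas (c, w)).2

@[fun_prop] theorem Comp.search {d : γ → V → V → Bool}
    (hd : Comp L 0 (fun z : γ × V × V => d z.1 z.2.1 z.2.2)) {c : α → γ} {w : α → PW}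
    (hc : Comp L 1 c) (hw : Comp L 1 w) : Comp L 1 (fun x => search d (c x) (w x)) := by
  have h1 : Comp L 0 (fun s : γ × PW => d s.1 s.2.fst s.2.snd) :=
    hd.comp' (f := fun s : γ × PW => (s.1, s.2.fst, s.2.snd)) (by fun_prop)
  have h2 := Comp.loop (L := L) (b := fun s : γ × PW => !s.2.done)
    (f := fun s => (s.1, s.2.step (d s.1 s.2.fst s.2.snd))) (fun s => s.2.meas)
    (fun s hs => PW.meas_step (by simpa using hs) _) 2
    (fun s => (PW.meas_le s.2).trans (by
      have : size s.2 ≤ size s := le_max_right (size s.1) (size s.2)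
      omega)) (by fun_prop) (by fun_prop)
  exact (Comp.snd.comp' h2).comp' (hc.prodMk hw)

/-- `Q` is an invariant of the two ends of the window. Decisions are made for chords, not for single
vertices, so the two possible new windows overlap in the chord. -/
theorem search_spec {γ : Type} {N : Set V} {d : γ → V → V → Bool} {c : γ} {w : PW} (hw : w.Ok N)
    (Q : V → V → Prop) (h0 : Q w.lo w.hi)
    (hQ : ∀ lo ∈ N, ∀ hi ∈ N, ∀ u ∈ N, ∀ v ∈ N, lo.key ≤ u.key → u.key < v.key → v.key ≤ hi.key →
      Q lo hi → (d c u v = true → Q u hi) ∧ (d c u v = false → Q lo v)) :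
    (search d c w).Ok N ∧ (search d c w).done = true ∧ Q (search d c w).lo (search d c w).hi := by
  have := iter_induction (b := fun s : γ × PW => !s.2.done)
    (f := fun s => (s.1, s.2.step (d s.1 s.2.fst s.2.snd))) (μ := fun s => s.2.meas)
    (fun s hs => PW.meas_step (by simpa using hs) _)
    (Q := fun s => s.1 = c ∧ s.2.Ok N ∧ Q s.2.lo s.2.hi) (fun s ⟨h1, h2, h3⟩ hb => ?_)
    (n := w.meas) (x := (c, w)) ⟨rfl, hw, h0⟩ le_rfl
  · obtain ⟨⟨-, h1, h2⟩, h3⟩ := this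
    have h4 : (search d c w).done = true := by unfold search; simpa using h3
    exact ⟨h1, h4, h2⟩
  · refine ⟨h1, ?_⟩
    simp only [PW.step, h1]
    cases hr : s.2.ready with
    | false =>
      simp only [cond_false, PW.skip_lo, PW.skip_hi]
      exact ⟨h2.skip hr, h3⟩
    | true =>
      obtain ⟨g1, g2, g3, g4, g5⟩ := h2.fst_snd hr
      have := hQ _ h2.lo _ h2.hi _ g1 _ g2 g3 g4 g5 h3
      cases hd : d c s.2.fst s.2.snd with
      | true =>
        simp only [cond_true, PW.high_lo, PW.high_hi]
        exact ⟨h2.high hr, this.1 hd⟩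
      | false =>
        simp only [cond_true, cond_false, PW.low_lo, PW.low_hi]
        exact ⟨h2.low hr, this.2 hd⟩

/-! ## Cyclic sequences of vertices -/

/-- The next occurrences of a vertex. -/
def V.sh (v : V) (k : ℤ) : V := ⟨v.key + k, v.x, v.y⟩

/-- Twice the signed area of the triangle `u v z`. -/
def side (u v : V) (z : ℝ × ℝ) : ℝ := (v.x - u.x) * (z.2 - u.y) - (v.y - u.y) * (z.1 - u.x)

/-- The vertices of a convex polygon in counterclockwise order; the keys go up by one in each
turn. -/
structure Cyc (N : Set V) : Prop where
  inj : ∀ u ∈ N, ∀ v ∈ N, u.key = v.key → u = v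
  sh : ∀ v ∈ N, ∀ k : ℤ, v.sh k ∈ N
  pos : ∀ u ∈ N, ∀ v ∈ N, ∀ w ∈ N, u.key < v.key → v.key < w.key → w.key < u.key + 1 →
    0 < side u v w.pt
  succ : ∀ u ∈ N, ∃ v ∈ N, u.key < v.key ∧ ∀ w ∈ N, u.key < w.key → ¬ w.key < v.key
  pred : ∀ v ∈ N, ∃ u ∈ N, u.key < v.key ∧ ∀ w ∈ N, u.key < w.key → ¬ w.key < v.key
  three : ∀ u ∈ N, ∃ v ∈ N, ∃ w ∈ N, u.key < v.key ∧ v.key < w.key ∧ w.key < u.key + 1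
  fin : (V.pt '' N).Finite
  nonempty : N.Nonempty

/-- The polygon. -/
def hull (N : Set V) : Set (ℝ × ℝ) := convexHull ℝ (V.pt '' N)

/-- Consecutive vertices. -/
structure Adj (N : Set V) (u v : V) : Prop where
  left : u ∈ N
  right : v ∈ N
  lt : u.key < v.key
  adj : ∀ w ∈ N, u.key < w.key → ¬ w.key < v.key

theorem hull_convex (N : Set V) : Convex ℝ (hull N) := convex_convexHull _ _

theorem mem_hull {N : Set V} {v : V} (h : v ∈ N) : v.pt ∈ hull N :=
  subset_convexHull _ _ ⟨v, h, rfl⟩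

theorem le_of_hull {N : Set V} {α β t : ℝ} (h : ∀ v ∈ N, α * v.x + β * v.y ≤ t) {z : ℝ × ℝ}
    (hz : z ∈ hull N) : α * z.1 + β * z.2 ≤ t := by
  have hc : Convex ℝ {z : ℝ × ℝ | α * z.1 + β * z.2 ≤ t} := by
    intro x hx y hy r s hr hs hrs
    simp only [Set.mem_ofPred_eq, Prod.fst_add, Prod.smul_fst, smul_eq_mul, Prod.snd_add,
      Prod.smul_snd] at *
    calc _ = r * (α * x.1 + β * x.2) + s * (α * y.1 + β * y.2) := by ring
      _ ≤ r * t + s * t := by gcongr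
      _ = t := by rw [← add_mul, hrs, one_mul]
  refine convexHull_min ?_ hc hz
  rintro _ ⟨v, hv, rfl⟩
  exact h v hv

theorem side_quad (a b c d : V) : side b c d.pt + side a b d.pt =
    side a c d.pt + side a b c.pt := by
  simp only [side, V.pt]; ring

theorem side_quad_x (a b c d : V) : side b c d.pt * a.x + side a b d.pt * c.x =
    side a c d.pt * b.x + side a b c.pt * d.x := by
  simp only [side, V.pt]; ring

theorem side_quad_y (a b c d : V) : side b c d.pt * a.y + side a b d.pt * c.y =
    side a c d.pt * b.y + side a b c.pt * d.y := by
  simp only [side, V.pt]; ring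

namespace Cyc

variable {N : Set V} (hN : Cyc N)
include hN

theorem rep {u w : V} (hw : w ∈ N) : ∃ k : ℤ, w.sh k ∈ N ∧ u.key ≤ (w.sh k).key ∧
    (w.sh k).key < u.key + 1 := by
  refine ⟨⌈u.key - w.key⌉, hN.sh w hw _, ?_, ?_⟩
  · have := Int.le_ceil (u.key - w.key)
    simp only [V.sh]; linarith
  · have := Int.ceil_lt_add_one (u.key - w.key)
    simp only [V.sh]; linarith

theorem exists_adj_right {u : V} (hu : u ∈ N) : ∃ v, Adj N u v := by
  obtain ⟨v, hv, h1, h2⟩ := hN.succ u hu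
  exact ⟨v, hu, hv, h1, h2⟩

theorem exists_adj_left {v : V} (hv : v ∈ N) : ∃ u, Adj N u v := by
  obtain ⟨u, hu, h1, h2⟩ := hN.pred v hv
  exact ⟨u, hu, hv, h1, h2⟩

/-- Every vertex occurs in the turn that starts at `u`; there it equals `u` or `v`, or it comes
after both and is on the left by orientation. -/
theorem side_nonneg {u v : V} (h : Adj N u v) {z : ℝ × ℝ} (hz : z ∈ hull N) :
    0 ≤ side u v z := by
  have : ∀ w ∈ N, 0 ≤ side u v w.pt := by
    intro w hw
    obtain ⟨k, h1, h2, h3⟩ := hN.rep (u := u) hw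
    rcases h2.eq_or_lt with e | h2
    · have := hN.inj _ h.left _ h1 e
      have e1 : w.x = u.x := by rw [this]; rfl
      have e2 : w.y = u.y := by rw [this]; rfl
      simp [side, V.pt, e1, e2]
    · rcases (not_lt.1 (h.adj _ h1 h2)).eq_or_lt with e | h4
      · have := hN.inj _ h.right _ h1 e
        have e1 : w.x = v.x := by rw [this]; rfl
        have e2 : w.y = v.y := by rw [this]; rfl
        simp [side, V.pt, e1, e2, mul_comm]
      · exact (hN.pos _ h.left _ h.right _ h1 h.lt h4 h3).le
  have h2 := le_of_hull (α := v.y - u.y) (β := -(v.x - u.x))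
    (t := (v.y - u.y) * u.x - (v.x - u.x) * u.y) (fun w hw => by
      have := this w hw
      simp only [side, V.pt] at this
      linarith) hz
  simp only [side]
  linarith

/-- A linear function does not alternate on four vertices. -/
theorem quad {a b c d : V} (ha : a ∈ N) (hb : b ∈ N) (hc : c ∈ N) (hd : d ∈ N)
    (hab : a.key < b.key) (hbc : b.key < c.key) (hcd : c.key < d.key) (hda : d.key < a.key + 1)
    {α β t : ℝ} (h0 : α ≠ 0 ∨ β ≠ 0) (h1 : α * a.x + β * a.y ≤ t) (h2 : t ≤ α * b.x + β * b.y)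
    (h3 : α * c.x + β * c.y ≤ t) (h4 : t ≤ α * d.x + β * d.y) : False := by
  have p1 := hN.pos _ hb _ hc _ hd hbc hcd (by linarith)
  have p2 := hN.pos _ ha _ hb _ hd hab (by linarith) hda
  have p3 := hN.pos _ ha _ hc _ hd (by linarith) hcd hda
  have p4 := hN.pos _ ha _ hb _ hc hab hbc (by linarith)
  have e1 := side_quad a b c d
  have e2 := side_quad_x a b c d
  have e3 := side_quad_y a b c d
  -- The affine dependence of four points of the plane. All terms are nonnegative, so all vanish,
  -- and the linear function is constant on the proper triangle `a b c`.
  have key : side b c d.pt * (t - (α * a.x + β * a.y)) + side a b d.pt * (t - (α * c.x + β * c.y))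
      + side a c d.pt * (α * b.x + β * b.y - t) + side a b c.pt * (α * d.x + β * d.y - t) = 0 := by
    grind
  have q1 : 0 ≤ side b c d.pt * (t - (α * a.x + β * a.y)) := mul_nonneg p1.le (by linarith)
  have q2 : 0 ≤ side a b d.pt * (t - (α * c.x + β * c.y)) := mul_nonneg p2.le (by linarith)
  have q3 : 0 ≤ side a c d.pt * (α * b.x + β * b.y - t) := mul_nonneg p3.le (by linarith)
  have q4 : 0 ≤ side a b c.pt * (α * d.x + β * d.y - t) := mul_nonneg p4.le (by linarith)
  have r1 : t - (α * a.x + β * a.y) = 0 :=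
    (mul_eq_zero.1 (by linarith : side b c d.pt * (t - (α * a.x + β * a.y)) = 0)).resolve_left p1.ne'
  have r2 : t - (α * c.x + β * c.y) = 0 :=
    (mul_eq_zero.1 (by linarith : side a b d.pt * (t - (α * c.x + β * c.y)) = 0)).resolve_left p2.ne'
  have r3 : α * b.x + β * b.y - t = 0 :=
    (mul_eq_zero.1 (by linarith : side a c d.pt * (α * b.x + β * b.y - t) = 0)).resolve_left p3.ne'
  have s1 : α * (b.x - a.x) + β * (b.y - a.y) = 0 := by linarith
  have s2 : α * (c.x - a.x) + β * (c.y - a.y) = 0 := by linarith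
  have s3 : α * side a b c.pt = 0 := by
    simp only [side, V.pt]; linear_combination (c.y - a.y) * s1 - (b.y - a.y) * s2
  have s4 : β * side a b c.pt = 0 := by
    simp only [side, V.pt]; linear_combination (b.x - a.x) * s2 - (c.x - a.x) * s1
  grind

theorem exists_x_ne (t : ℝ) : ∃ v ∈ N, v.x ≠ t := by
  obtain ⟨u, hu⟩ := hN.nonempty
  obtain ⟨v, hv, w, hw, h1, h2, h3⟩ := hN.three u hu
  by_contra! h
  have := hN.pos _ hu _ hv _ hw h1 h2 h3
  simp [side, V.pt, h u hu, h v hv, h w hw] at this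

end Cyc

/-! ## Extreme vertices -/

/-- The vertex is largest for `α x + β y`, and for `γ x + δ y` among those. -/
def IsExt (N : Set V) (α β γ δ : ℝ) (e : V) : Prop := e ∈ N ∧ ∀ v ∈ N,
  α * v.x + β * v.y < α * e.x + β * e.y ∨
    α * v.x + β * v.y = α * e.x + β * e.y ∧ γ * v.x + δ * v.y ≤ γ * e.x + δ * e.y

theorem IsExt.le {N : Set V} {α β γ δ : ℝ} {e : V} (h : IsExt N α β γ δ e) {v : V} (hv : v ∈ N) :
    α * v.x + β * v.y ≤ α * e.x + β * e.y := (h.2 v hv).elim le_of_lt (fun h => h.1.le)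

theorem IsExt.tie {N : Set V} {α β γ δ : ℝ} {e : V} (h : IsExt N α β γ δ e) {v : V} (hv : v ∈ N)
    (he : α * e.x + β * e.y ≤ α * v.x + β * v.y) : γ * v.x + δ * v.y ≤ γ * e.x + δ * e.y :=
  (h.2 v hv).elim (fun h => absurd h he.not_gt) (fun h => h.2)

namespace Cyc

variable {N : Set V} (hN : Cyc N)
include hN

/-- Strictly inside the run, a failure would make the abscissa alternate on `R`, `u`, `v`, `L`,
against `quad`. At the ends of the run, the choice of the highest among the extreme vertices and the
orientation decide. -/
theorem upper_mono {R L u v : V} (hR : IsExt N 1 0 0 1 R) (hL : IsExt N (-1) 0 0 1 L)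
    (hLR : L.key < R.key + 1) (hu : u ∈ N) (hv : v ∈ N) (h1 : R.key ≤ u.key)
    (h2 : u.key < v.key) (h3 : v.key ≤ L.key) : v.x < u.x := by
  have lR : ∀ w ∈ N, w.x ≤ R.x := fun w hw => by simpa using hR.le hw
  have lL : ∀ w ∈ N, L.x ≤ w.x := fun w hw => by simpa using hL.le hw
  by_contra! hc
  rcases h1.eq_or_lt with e | h1
  · have := hN.inj _ hR.1 _ hu e
    subst this
    have hx : v.x = R.x := le_antisymm (lR v hv) hc
    have ty : v.y ≤ R.y := by simpa using hR.tie hv (by simpa using hc)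
    rcases h3.eq_or_lt with e | h3
    · have := hN.inj _ hv _ hL.1 e
      subst this
      obtain ⟨w, hw, hne⟩ := hN.exists_x_ne R.x
      grind
    · have := hN.pos _ hR.1 _ hv _ hL.1 h2 h3 hLR
      simp only [side, V.pt, hx, sub_self, zero_mul, zero_sub] at this
      nlinarith [lR _ hL.1]
  · rcases h3.eq_or_lt with e | h3
    · have := hN.inj _ hv _ hL.1 e
      subst this
      have hx : u.x = v.x := le_antisymm hc (lL u hu)
      have ty : u.y ≤ v.y := by simpa using hL.tie hu (by simpa using hc)
      have := hN.pos _ hR.1 _ hu _ hL.1 h1 h2 hLR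
      simp only [side, V.pt, hx] at this
      nlinarith [lR _ hL.1]
    · exact hN.quad hR.1 hu hv hL.1 h1 h2 h3 hLR (α := -1) (β := 0) (t := -v.x) (by simp)
        (by simpa using lR v hv) (by simpa using hc) (by simp) (by simpa using lL v hv)

theorem upper_lt {R L : V} (hR : IsExt N 1 0 0 1 R) (hL : IsExt N (-1) 0 0 1 L) : L.x < R.x := by
  have lR : ∀ w ∈ N, w.x ≤ R.x := fun w hw => by simpa using hR.le hw
  have lL : ∀ w ∈ N, L.x ≤ w.x := fun w hw => by simpa using hL.le hw
  by_contra! hc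
  obtain ⟨w, hw, hne⟩ := hN.exists_x_ne R.x
  grind

/-- The vertices of a run are on the upper boundary. -/
theorem upper_top {R L v : V} (hR : IsExt N 1 0 0 1 R) (hL : IsExt N (-1) 0 0 1 L)
    (hRL : R.key ≤ L.key) (hLR : L.key < R.key + 1) (hv : v ∈ N) (h1 : R.key ≤ v.key)
    (h3 : v.key ≤ L.key) {y : ℝ} (hy : (v.x, y) ∈ hull N) : y ≤ v.y := by
  rcases h3.eq_or_lt with e | h3
  · have hlt := hN.upper_lt hR hL
    have := hN.inj _ hv _ hL.1 e
    subst this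
    have hRv : R.key < v.key := by
      rcases hRL.eq_or_lt with e | h
      · rw [hN.inj _ hR.1 _ hv e] at hlt
        exact absurd hlt (lt_irrefl _)
      · exact h
    obtain ⟨u, hu⟩ := hN.exists_adj_left hv
    have h4 : R.key ≤ u.key := by
      by_contra! h
      exact hu.adj _ hR.1 h hRv
    have := hN.upper_mono hR hL hLR hu.left hv h4 hu.lt le_rfl
    have h5 := hN.side_nonneg hu hy
    simp only [side] at h5
    nlinarith
  · obtain ⟨u, hu⟩ := hN.exists_adj_right hv
    have h4 : u.key ≤ L.key := by
      by_contra! h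
      exact hu.adj _ hL.1 h3 h
    have := hN.upper_mono hR hL hLR hv hu.right h1 hu.lt h4
    have h5 := hN.side_nonneg hu hy
    simp only [side, sub_self, mul_zero, sub_zero] at h5
    nlinarith

/-- Everything on the run after `S` is strictly to the right of `S` and below it (`first`). For two
later vertices the orientations of the triples from `S`, `u`, `v`, `E` then leave only one order in
each coordinate. -/
theorem corner_mono {S E u v : V} (hS : IsExt N (-1) 0 0 (-1) S) (hE : IsExt N 0 (-1) (-1) 0 E)
    (hES : E.key < S.key + 1) (hu : u ∈ N) (hv : v ∈ N) (h1 : S.key ≤ u.key)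
    (h2 : u.key < v.key) (h3 : v.key ≤ E.key) : u.x < v.x ∧ v.y < u.y := by
  have lS : ∀ w ∈ N, S.x ≤ w.x := fun w hw => by simpa using hS.le hw
  have lE : ∀ w ∈ N, E.y ≤ w.y := fun w hw => by simpa using hE.le hw
  have tS : ∀ w ∈ N, w.x ≤ S.x → S.y ≤ w.y := fun w hw h => by
    simpa using hS.tie hw (by simpa using h)
  have tE : ∀ w ∈ N, w.y ≤ E.y → E.x ≤ w.x := fun w hw h => by
    simpa using hE.tie hw (by simpa using h)
  -- Two coinciding vertices would span a triangle of area zero with any third vertex of the turn.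
  have ne : ∀ w ∈ N, S.key < w.key → w.key < S.key + 1 → ¬ (w.x = S.x ∧ w.y = S.y) := by
    rintro w hw k1 k2 ⟨e1, e2⟩
    obtain ⟨a, ha, b, hb, g1, g2, g3⟩ := hN.three S hS.1
    have : ∃ c ∈ N, S.key < c.key ∧ c.key < S.key + 1 ∧ c.key ≠ w.key := by
      by_cases h : a.key = w.key
      · exact ⟨b, hb, by linarith, g3, by linarith⟩
      · exact ⟨a, ha, g1, by linarith, h⟩
    obtain ⟨c, hc, g4, g5, g6⟩ := this
    rcases lt_or_gt_of_ne g6 with h | h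
    · have := hN.pos _ hS.1 _ hc _ hw g4 h k2
      simp [side, V.pt, e1, e2] at this
    · have := hN.pos _ hS.1 _ hw _ hc k1 h g5
      simp [side, V.pt, e1, e2] at this
  -- from the first vertex on
  have first : ∀ w ∈ N, S.key < w.key → w.key ≤ E.key → S.x < w.x ∧ w.y < S.y := by
    intro w hw k1 k2
    rcases k2.eq_or_lt with e | k2
    · have := hN.inj _ hw _ hE.1 e
      subst this
      have hne := ne _ hw k1 hES
      have hx : S.x < w.x := by
        refine lt_of_le_of_ne (lS w hw) fun h => hne ⟨h.symm, ?_⟩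
        exact le_antisymm (lE _ hS.1) (tS _ hw h.ge)
      refine ⟨hx, lt_of_le_of_ne (lE _ hS.1) fun h => ?_⟩
      exact absurd (tE _ hS.1 h.ge) hx.not_ge
    · have p := hN.pos _ hS.1 _ hw _ hE.1 k1 k2 hES
      simp only [side, V.pt] at p
      have a1 := lS w hw
      have a2 := lE w hw
      have a3 := lS _ hE.1
      have a4 := lE _ hS.1
      have hx : S.x < w.x := by
        refine lt_of_le_of_ne a1 fun h => ?_
        have := tS w hw h.ge
        nlinarith
      refine ⟨hx, ?_⟩
      by_contra! hy
      nlinarith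
  rcases h1.eq_or_lt with e | h1
  · rw [← hN.inj _ hS.1 _ hu e]
    exact first v hv (by linarith) h3
  · obtain ⟨u1, u2⟩ := first u hu h1 (by linarith)
    obtain ⟨v1, v2⟩ := first v hv (by linarith) h3
    have p := hN.pos _ hS.1 _ hu _ hv h1 h2 (by linarith)
    simp only [side, V.pt] at p
    rcases h3.eq_or_lt with e | h3
    · have := hN.inj _ hv _ hE.1 e
      subst this
      have a2 := lE u hu
      have hx : u.x < v.x := by
        by_contra! hc
        nlinarith
      refine ⟨hx, lt_of_le_of_ne a2 fun h => ?_⟩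
      exact absurd (tE _ hu h.ge) hx.not_ge
    · have p2 := hN.pos _ hu _ hv _ hE.1 h2 h3 (by linarith)
      have p3 := hN.pos _ hS.1 _ hv _ hE.1 (by linarith) h3 hES
      simp only [side, V.pt] at p2 p3
      obtain ⟨e1, e2⟩ := first E hE.1 (by linarith) le_rfl
      have a2 := lE u hu
      have a3 := lE v hv
      have hx : u.x < v.x := by
        by_contra! hc
        have k1 : (u.x - S.x) * (S.y - v.y) < (S.y - u.y) * (v.x - S.x) := by linarith
        have h4 : u.y < v.y := by
          by_contra! h5
          nlinarith
        have k2 : (v.x - S.x) * (S.y - E.y) < (S.y - v.y) * (E.x - S.x) := by linarith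
        have k3 : (v.y - u.y) * (E.x - u.x) < (u.x - v.x) * (u.y - E.y) := by linarith
        have k4 : (u.x - v.x) * (S.y - v.y) ≤ (v.x - S.x) * (v.y - u.y) := by linarith
        have k5 : (v.y - u.y) * ((E.x - u.x) * (S.y - v.y)) ≤
            (v.y - u.y) * ((v.x - S.x) * (u.y - E.y)) := by
          calc _ = (v.y - u.y) * (E.x - u.x) * (S.y - v.y) := by ring
            _ ≤ (u.x - v.x) * (u.y - E.y) * (S.y - v.y) :=
              mul_le_mul_of_nonneg_right k3.le (by linarith)
            _ = (u.x - v.x) * (S.y - v.y) * (u.y - E.y) := by ring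
            _ ≤ (v.x - S.x) * (v.y - u.y) * (u.y - E.y) :=
              mul_le_mul_of_nonneg_right k4 (by linarith)
            _ = _ := by ring
        have k6 := le_of_mul_le_mul_left k5 (by linarith)
        nlinarith
      refine ⟨hx, ?_⟩
      by_contra! hy
      nlinarith

end Cyc

attribute [reducible] side

/-! ## Transformations -/

def V.map (e a b c d : ℝ) (v : V) : V := ⟨e * v.key, a * v.x + b * v.y, c * v.x + d * v.y⟩

theorem side_map (e a b c d : ℝ) (u v w : V) :
    side (u.map e a b c d) (v.map e a b c d) (w.map e a b c d).pt =
      (a * d - b * c) * side u v w.pt := by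
  simp only [side, V.map, V.pt]; ring

theorem hull_map (e a b c d : ℝ) (N : Set V) : hull (V.map e a b c d '' N) =
    (fun z : ℝ × ℝ => (a * z.1 + b * z.2, c * z.1 + d * z.2)) '' hull N := by
  let F : ℝ × ℝ →ₗ[ℝ] ℝ × ℝ :=
    { toFun := fun z => (a * z.1 + b * z.2, c * z.1 + d * z.2)
      map_add' := fun x y => by ext <;> simp <;> ring
      map_smul' := fun r x => by ext <;> simp <;> ring }
  have := F.image_convexHull (V.pt '' N)
  unfold hull
  rw [show (fun z : ℝ × ℝ => (a * z.1 + b * z.2, c * z.1 + d * z.2)) = F from rfl, this,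
    Set.image_image, Set.image_image]
  rfl

/-- The rotation by a right angle, `(x, y) ↦ (-y, x)`. -/
def V.rot (v : V) : V := ⟨v.key, -v.y, v.x⟩

/-- The same vertex in the reversed order. -/
def V.mir (v : V) : V := ⟨-v.key, v.x, v.y⟩

theorem V.rot_eq : V.rot = V.map 1 0 (-1) 1 0 := by
  ext v <;> simp [V.rot, V.map]

theorem hull_rot (N : Set V) : hull (V.rot '' N) = rot (hull N) := by
  rw [V.rot_eq, hull_map]
  ext z
  simp only [Set.mem_image, RealRAM.rot, Set.mem_ofPred_eq]
  grind

/-! ## Chains -/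

/-- Part of the upper boundary, from left to right. -/
structure UpChain (N : Set V) (P : Set (ℝ × ℝ)) (lo hi : V) : Prop where
  pair : ∀ u ∈ N, ∀ v ∈ N, lo.key ≤ u.key → u.key < v.key → v.key ≤ hi.key → UpperPair P u v false
  edge : ∀ u v, Adj N u v → lo.key ≤ u.key → v.key ≤ hi.key → UpperPair P u v true

/-- Part of the lower left boundary, from left to right. -/
structure LowChain (N : Set V) (P : Set (ℝ × ℝ)) (lo hi : V) : Prop where
  mono : ∀ u ∈ N, ∀ v ∈ N, lo.key ≤ u.key → u.key < v.key → v.key ≤ hi.key →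
    u.x < v.x ∧ v.y < u.y
  supp₁ : ∀ u ∈ N, ∀ v ∈ N, lo.key ≤ u.key → u.key < v.key → v.key ≤ hi.key →
    ∃ m, -slope u v ≤ m ∧ SuppAt P u m
  supp₂ : ∀ u ∈ N, ∀ v ∈ N, lo.key ≤ u.key → u.key < v.key → v.key ≤ hi.key →
    ∃ m, m ≤ -slope u v ∧ SuppAt P v m
  edge : ∀ u v, Adj N u v → lo.key ≤ u.key → v.key ≤ hi.key →
    SuppAt P u (-slope u v) ∧ SuppAt P v (-slope u v)

/-- If a point beyond one end were above the line, the segment from it to the other end would pass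
above the nearer end, which is highest on its vertical line. -/
theorem UpperPair.of_top {P : Set (ℝ × ℝ)} (hP : Convex ℝ P) {u v : V} (hu : u.pt ∈ P)
    (hv : v.pt ∈ P) (h : u.x < v.x) (h1 : ∀ y, (u.x, y) ∈ P → y ≤ u.y)
    (h2 : ∀ y, (v.x, y) ∈ P → y ≤ v.y) : UpperPair P u v false := by
  refine ⟨hu, hv, h, fun z hz hc => ?_⟩
  have hd : 0 < v.x - u.x := by linarith
  have e : lineAt u v z.1 = u.y + (v.y - u.y) * (z.1 - u.x) / (v.x - u.x) := by
    unfold lineAt; field_simp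
  rw [e, ← sub_le_iff_le_add', le_div_iff₀ hd]
  rcases hc with hc | hc | hc
  · have hd' : 0 < v.x - z.1 := by linarith
    have h3 := hP hz hv (a := (v.x - u.x) / (v.x - z.1)) (b := (u.x - z.1) / (v.x - z.1))
      (by positivity) (div_nonneg (by linarith) hd'.le) (by field_simp; ring)
    have h4 := h1 (((v.x - u.x) * z.2 + (u.x - z.1) * v.y) / (v.x - z.1)) (by
      convert h3 using 1
      ext
      · simp [V.pt]; field_simp; ring
      · simp [V.pt]; field_simp)
    rw [div_le_iff₀ hd'] at h4
    nlinarith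
  · have hd' : 0 < z.1 - u.x := by linarith
    have h3 := hP hz hu (a := (v.x - u.x) / (z.1 - u.x)) (b := (z.1 - v.x) / (z.1 - u.x))
      (by positivity) (div_nonneg (by linarith) hd'.le) (by field_simp; ring)
    have h4 := h2 (((v.x - u.x) * z.2 + (z.1 - v.x) * u.y) / (z.1 - u.x)) (by
      convert h3 using 1
      ext
      · simp [V.pt]; field_simp; ring
      · simp [V.pt]; field_simp)
    rw [div_le_iff₀ hd'] at h4
    nlinarith
  · exact absurd hc (by simp)

theorem adj_mir {N : Set V} {u v : V} (h : Adj (V.mir '' N) u v) : Adj N v.mir u.mir := by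
  obtain ⟨⟨u, hu, rfl⟩, ⟨v, hv, rfl⟩, h1, h2⟩ := h
  refine ⟨by simpa [V.mir], by simpa [V.mir], by simpa [V.mir] using h1, fun w hw h3 h4 => ?_⟩
  exact h2 w.mir ⟨w, hw, rfl⟩ (by simp [V.mir] at *; linarith) (by simp [V.mir] at *; linarith)

namespace Cyc

variable {N : Set V} (hN : Cyc N)
include hN

/-- The counterclockwise run from `R` to `L` goes from right to left; the negated keys turn it
round. -/
theorem upChain {R L : V} (hR : IsExt N 1 0 0 1 R) (hL : IsExt N (-1) 0 0 1 L)
    (hRL : R.key ≤ L.key) (hLR : L.key < R.key + 1) :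
    UpChain (V.mir '' N) (hull N) L.mir R.mir where
  pair := by
    rintro _ ⟨u, hu, rfl⟩ _ ⟨v, hv, rfl⟩ h1 h2 h3
    simp only [V.mir, neg_le_neg_iff, neg_lt_neg_iff] at h1 h2 h3
    have mu : u.pt ∈ hull N := mem_hull hu
    have mv : v.pt ∈ hull N := mem_hull hv
    have hlt : u.x < v.x := hN.upper_mono hR hL hLR hv hu h3 h2 h1
    exact .of_top (hull_convex N) mu mv hlt
      (fun y hy => hN.upper_top hR hL hRL hLR hu (by linarith) h1 hy)
      (fun y hy => hN.upper_top hR hL hRL hLR hv h3 (by linarith) hy)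
  edge := by
    intro u v h h1 h3
    have h' := adj_mir h
    simp only [V.mir] at h1 h3
    have hlt := hN.upper_mono hR hL hLR h'.left h'.right (by simp [V.mir]; linarith) h'.lt
      (by simp [V.mir]; linarith)
    have mu : u.mir.pt ∈ hull N := mem_hull h'.right
    have mv : v.mir.pt ∈ hull N := mem_hull h'.left
    refine ⟨mu, mv, hlt, fun z hz _ => ?_⟩
    have := hN.side_nonneg h' hz
    simp only [side, V.mir] at this hlt
    have hd : 0 < v.x - u.x := by linarith
    have e : lineAt u v z.1 = u.y + (v.y - u.y) * (z.1 - u.x) / (v.x - u.x) := by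
      unfold lineAt; field_simp
    rw [e, ← sub_le_iff_le_add', le_div_iff₀ hd]
    nlinarith

/-- Each edge of the run supports the polygon at both of its ends. For a chord `u v`, the edge
leaving `u` is at least as steep and the edge entering `v` at most as steep; these are the slopes
that `testA_high` and `testA_low` require. -/
theorem lowChain {S E : V} (hS : IsExt N (-1) 0 0 (-1) S) (hE : IsExt N 0 (-1) (-1) 0 E)
    (hES : E.key < S.key + 1) : LowChain N (hull N) S E := by
  have mono := fun u (hu : u ∈ N) v (hv : v ∈ N) => hN.corner_mono hS hE hES hu hv
  have supp : ∀ u v, Adj N u v → S.key ≤ u.key → v.key ≤ E.key →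
      SuppAt (hull N) u (-slope u v) ∧ SuppAt (hull N) v (-slope u v) := by
    intro u v h h1 h2
    obtain ⟨h3, h4⟩ := mono u h.left v h.right h1 h.lt h2
    have hd : 0 < v.x - u.x := by linarith
    have hm : 0 < -slope u v := by
      rw [slope, ← neg_div]
      exact div_pos (by linarith) hd
    have e : slope u v * (v.x - u.x) = v.y - u.y := div_mul_cancel₀ _ hd.ne'
    refine ⟨⟨hm, mem_hull h.left, fun z hz => ?_⟩, ⟨hm, mem_hull h.right, fun z hz => ?_⟩⟩ <;>
    · have := hN.side_nonneg h hz
      simp only [side] at this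
      rw [← e] at this
      refine le_of_mul_le_mul_left (a := v.x - u.x) ?_ hd
      nlinarith
  refine ⟨mono, fun u hu v hv h1 h2 h3 => ?_, fun u hu v hv h1 h2 h3 => ?_, supp⟩
  · obtain ⟨w, hw⟩ := hN.exists_adj_right hu
    have h4 := not_lt.1 (hw.adj v hv h2)
    obtain ⟨h5, -⟩ := supp u w hw h1 (h4.trans h3)
    refine ⟨_, ?_, h5⟩
    have h6 := h5.2.2 _ (mem_hull hv)
    have h7 := (mono u hu v hv h1 h2 h3).1
    simp only [V.pt] at h6
    rw [slope, ← neg_div, div_le_iff₀ (by linarith)]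
    linarith
  · obtain ⟨w, hw⟩ := hN.exists_adj_left hv
    have h4 : u.key ≤ w.key := by
      by_contra! h; exact hw.adj u hu h h2
    obtain ⟨-, h5⟩ := supp w v hw (h1.trans h4) h3
    refine ⟨_, ?_, h5⟩
    have h6 := h5.2.2 _ (mem_hull hu)
    have h7 := (mono u hu v hv h1 h2 h3).1
    simp only [V.pt] at h6
    rw [show -slope u v = -(v.y - u.y) / (v.x - u.x) by rw [slope, neg_div],
      le_div_iff₀ (by linarith)]
    linarith

/-- An edge that goes down to the right belongs to the lower left chain. -/
theorem edge_mem_low {S E u v : V} (hS : IsExt N (-1) 0 0 (-1) S) (hE : IsExt N 0 (-1) (-1) 0 E)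
    (hSE : S.key ≤ E.key) (hES : E.key < S.key + 1) (h : Adj N u v) (hx : u.x < v.x)
    (hy : v.y < u.y) : ∃ k : ℤ, Adj N (u.sh k) (v.sh k) ∧ S.key ≤ (u.sh k).key ∧
      (v.sh k).key ≤ E.key := by
  have lS : ∀ w ∈ N, S.x ≤ w.x := fun w hw => by simpa using hS.le hw
  have lE : ∀ w ∈ N, E.y ≤ w.y := fun w hw => by simpa using hE.le hw
  obtain ⟨k, hk, h1, h2⟩ := hN.rep (u := S) h.left
  have hA : Adj N (u.sh k) (v.sh k) := by
    refine ⟨hk, hN.sh _ h.right k, by simpa [V.sh] using h.lt, fun w hw h3 h4 => ?_⟩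
    refine h.adj (w.sh (-k)) (hN.sh w hw _) ?_ ?_ <;> simp [V.sh] at * <;> linarith
  refine ⟨k, hA, h1, ?_⟩
  have hx' : (u.sh k).x < (v.sh k).x := hx
  have hy' : (v.sh k).y < (u.sh k).y := hy
  clear h hk
  revert h1 h2 hA hx' hy'
  generalize u.sh k = u
  generalize v.sh k = v
  intro h1 h2 h hx hy
  rcases lt_or_ge u.key E.key with h3 | h3
  · exact not_lt.1 (h.adj E hE.1 h3)
  exfalso
  have hS1 := hN.sh S hS.1 1
  have h4 : v.key ≤ S.key + 1 := by
    have := h.adj _ hS1 (by simpa [V.sh] using h2)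
    simpa [V.sh] using this
  rcases h3.eq_or_lt with e | h3
  · have := hN.inj _ hE.1 _ h.left e
    subst this
    exact absurd (lE v h.right) hy.not_ge
  rcases h4.eq_or_lt with e | h4
  · have := hN.inj _ h.right _ hS1 (by simpa [V.sh] using e)
    have h5 : v.x = S.x := by rw [this]; rfl
    exact absurd (lS u h.left) (by linarith)
  rcases hSE.eq_or_lt with e | hSE
  · have := hN.inj _ hS.1 _ hE.1 e
    subst this
    have p := hN.pos _ hS.1 _ h.left _ h.right h3 h.lt h4
    simp only [side, V.pt] at p
    nlinarith [lS u h.left, lE v h.right]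
  by_cases hc : u.x ≤ E.x
  · exact hN.quad hS.1 hE.1 h.left h.right hSE h3 h.lt h4 (α := 1) (β := 0) (t := u.x) (by simp)
      (by simpa using lS u h.left) (by simpa using hc) (by simp) (by simpa using hx.le)
  · by_cases hc' : v.y ≤ S.y
    · exact hN.quad hS.1 hE.1 h.left h.right hSE h3 h.lt h4 (α := 0) (β := -1) (t := -v.y)
        (by simp) (by simpa using hc') (by simpa using lE v h.right) (by simpa using hy.le)
        (by simp)
    · push Not at hc hc'
      have p := hN.pos _ hE.1 _ h.left _ h.right h3 h.lt (by linarith)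
      simp only [side, V.pt] at p
      nlinarith [lE S hS.1]

end Cyc

attribute [reducible] V.mir

/-! ## Trees of vertices -/

/-- The occurrences of the vertices in a tree in all turns. -/
def cover (T : Tree) : Set V := {v | ∃ k : ℤ, v.sh k ∈ T.toList}

/-- The keys of a tree belong to one turn. -/
structure Spread (T : Tree) : Prop where
  sorted : T.Sorted
  lt : ∀ u ∈ T.toList, ∀ v ∈ T.toList, u.key < v.key + 1

/-- The tree holds the vertices of a convex polygon in counterclockwise order. -/
structure Good (T : Tree) : Prop extends Spread T where
  pos : ∀ u ∈ T.toList, ∀ v ∈ T.toList, ∀ w ∈ T.toList, u.key < v.key → v.key < w.key →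
    0 < side u v w.pt
  length : 3 ≤ T.toList.length

theorem V.sh_zero (v : V) : v.sh 0 = v := by simp [V.sh]

theorem V.sh_sh (v : V) (k l : ℤ) : (v.sh k).sh l = v.sh (k + l) := by simp [V.sh, add_assoc]

theorem V.sh_key (v : V) (k : ℤ) : (v.sh k).key = v.key + k := rfl

theorem side_sh (u v w : V) (k l m : ℤ) : side (u.sh k) (v.sh l) (w.sh m).pt = side u v w.pt := rfl

theorem side_rotate (u v w : V) : side v w u.pt = side u v w.pt := by
  simp only [side, V.pt]; ring

theorem mem_cover {T : Tree} {v : V} (h : v ∈ T.toList) : v ∈ cover T := ⟨0, by rwa [V.sh_zero]⟩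

theorem cover_sh {T : Tree} {v : V} (h : v ∈ cover T) (k : ℤ) : v.sh k ∈ cover T := by
  obtain ⟨l, hl⟩ := h
  exact ⟨l - k, by rwa [V.sh_sh, add_sub_cancel]⟩

theorem Tree.Sorted.inj {T : Tree} (h : T.Sorted) {u v : V} (hu : u ∈ T.toList) (hv : v ∈ T.toList)
    (he : u.key = v.key) : u = v := by
  by_contra hne
  have : Std.Symm (fun u v : V => u.key ≠ v.key) := ⟨fun _ _ h => Ne.symm h⟩
  exact (List.Pairwise.imp (S := fun u v : V => u.key ≠ v.key) (fun h => h.ne) h).forall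
    hu hv hne he

theorem toList_ne_nil {T : Tree} (h : T.isNil = false) : ∃ v, v ∈ T.toList := by
  rw [PW.eq_node h]
  exact ⟨T.root, by simp [Tree.toList]⟩

/-- Each vertex of the tree is shifted into the turn `(c, c + 1]`, and the first of these finitely
many occurrences is taken. -/
theorem exists_next {T : Tree} (hne : T.isNil = false) (c : ℝ) : ∃ v ∈ cover T, c < v.key ∧
    ∀ w ∈ cover T, c < w.key → ¬ w.key < v.key := by
  obtain ⟨a, ha⟩ := toList_ne_nil hne
  let t : V → V := fun v => v.sh (⌊c - v.key⌋ + 1)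
  obtain ⟨v, hv, hmin⟩ := Set.exists_min_image {v | v ∈ T.toList} (fun v => (t v).key)
    (List.finite_toSet _) ⟨a, ha⟩
  refine ⟨t v, cover_sh (mem_cover hv) _, ?_, ?_⟩
  · have := Int.lt_floor_add_one (c - v.key)
    simp only [t, V.sh_key]; push_cast; linarith
  · rintro w ⟨k, hk⟩ h1 h2
    have h3 := hmin _ hk
    simp only [t, V.sh_key] at h2 h3
    push_cast at h2 h3
    have h4 : ⌊c - (w.key + k)⌋ < -k := by
      rw [Int.floor_lt]; push_cast; linarith
    have h5 : (⌊c - (w.key + k)⌋ : ℝ) + 1 ≤ -k := by exact_mod_cast h4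
    linarith

theorem exists_prev {T : Tree} (hne : T.isNil = false) (c : ℝ) : ∃ v ∈ cover T, v.key < c ∧
    ∀ w ∈ cover T, v.key < w.key → ¬ w.key < c := by
  obtain ⟨a, ha⟩ := toList_ne_nil hne
  let t : V → V := fun v => v.sh (⌈c - v.key⌉ - 1)
  obtain ⟨v, hv, hmax⟩ := Set.exists_max_image {v | v ∈ T.toList} (fun v => (t v).key)
    (List.finite_toSet _) ⟨a, ha⟩
  refine ⟨t v, cover_sh (mem_cover hv) _, ?_, ?_⟩
  · have := Int.ceil_lt_add_one (c - v.key)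
    simp only [t, V.sh_key]; push_cast; linarith
  · rintro w ⟨k, hk⟩ h1 h2
    have h3 := hmax _ hk
    simp only [t, V.sh_key] at h1 h3
    push_cast at h1 h3
    have h4 : -k < ⌈c - (w.key + k)⌉ := by
      rw [Int.lt_ceil]; push_cast; linarith
    have h5 : -(k : ℝ) ≤ (⌈c - (w.key + k)⌉ : ℝ) - 1 := by
      have : (-k : ℤ) + 1 ≤ ⌈c - (w.key + k)⌉ := h4
      have : ((-k : ℤ) : ℝ) + 1 ≤ (⌈c - (w.key + k)⌉ : ℝ) := by exact_mod_cast this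
      push_cast at this
      linarith
    linarith

namespace Spread

variable {T : Tree} (hT : Spread T)
include hT

/-- A property of the difference of the numbers of turns. -/
theorem sh_bounds {u v : V} {k l : ℤ} (hu : u.sh k ∈ T.toList) (hv : v.sh l ∈ T.toList) :
    u.key + k < v.key + l + 1 ∧ v.key + l < u.key + k + 1 :=
  ⟨hT.lt _ hu _ hv, hT.lt _ hv _ hu⟩

theorem cover_inj {u v : V} (hu : u ∈ cover T) (hv : v ∈ cover T) (h : u.key = v.key) : u = v := by
  obtain ⟨k, hk⟩ := hu
  obtain ⟨l, hl⟩ := hv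
  obtain ⟨h1, h2⟩ := hT.sh_bounds hk hl
  have e : k = l := by
    have h3 : (k : ℝ) < l + 1 := by linarith
    have h4 : (l : ℝ) < k + 1 := by linarith
    have h3 : k < l + 1 := by exact_mod_cast h3
    have h4 : l < k + 1 := by exact_mod_cast h4
    omega
  subst e
  have := hT.sorted.inj hk hl (by simp [V.sh, h])
  simp only [V.sh, V.mk.injEq, add_left_inj] at this
  ext
  exacts [this.1, this.2.1, this.2.2]

theorem mem_of_cover {f w : V} (hf : f ∈ T.toList) (hw : w ∈ cover T)
    (hmin : ∀ v ∈ T.toList, f.key ≤ v.key) (h1 : f.key ≤ w.key)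
    (h2 : w.key < f.key + 1) : w ∈ T.toList := by
  obtain ⟨k, hk⟩ := hw
  have h3 := hmin _ hk
  have h4 := hT.lt _ hk _ hf
  rw [V.sh_key] at h3 h4
  have e : k = 0 := by
    have h5 : (k : ℝ) < 1 := by linarith
    have h6 : (-1 : ℝ) < k := by linarith
    have h5 : k < 1 := by exact_mod_cast h5
    have h6 : -1 < k := by exact_mod_cast h6
    omega
  rwa [e, V.sh_zero] at hk

end Spread

theorem Good.isNil {T : Tree} (hT : Good T) : T.isNil = false := by
  cases T with
  | nil => exact absurd hT.length (by simp [Tree.toList])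
  | node => rfl

/-- The point is orientation: three occurrences within one turn pass the end of the tree at most
once, so up to a cyclic rotation, which preserves `side`, they are an ordered triple of the tree. -/
theorem Good.cyc {T : Tree} (hT : Good T) : Cyc (cover T) where
  inj u hu v hv h := hT.cover_inj hu hv h
  sh v hv k := cover_sh hv k
  pos := by
    rintro u ⟨k, hk⟩ v ⟨l, hl⟩ w ⟨m, hm⟩ h1 h2 h3
    obtain ⟨a1, a2⟩ := hT.sh_bounds hk hl
    obtain ⟨b1, b2⟩ := hT.sh_bounds hk hm
    obtain ⟨c1, c2⟩ := hT.sh_bounds hl hm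
    have el : l = k ∨ l = k - 1 := by
      have h4 : (l : ℝ) < k + 1 := by linarith
      have h5 : (k : ℝ) - 2 < l := by linarith
      have h4 : l < k + 1 := by exact_mod_cast h4
      have h5 : k - 2 < l := by exact_mod_cast h5
      omega
    have em : m = k ∨ m = k - 1 := by
      have h4 : (m : ℝ) < k + 1 := by linarith
      have h5 : (k : ℝ) - 2 < m := by linarith
      have h4 : m < k + 1 := by exact_mod_cast h4
      have h5 : k - 2 < m := by exact_mod_cast h5
      omega
    rcases el with rfl | rfl <;> rcases em with rfl | rfl
    · have := hT.pos _ hk _ hl _ hm (by simp [V.sh_key]; linarith) (by simp [V.sh_key]; linarith)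
      rwa [side_sh] at this
    · have := hT.pos _ hm _ hk _ hl (by simp [V.sh_key]; linarith) (by simp [V.sh_key]; linarith)
      rwa [side_sh, side_rotate, side_rotate] at this
    · push_cast at *
      linarith
    · have := hT.pos _ hl _ hm _ hk (by simp [V.sh_key]; linarith) (by simp [V.sh_key]; linarith)
      rwa [side_sh, side_rotate] at this
  succ u _ := exists_next hT.isNil u.key
  pred v _ := by
    obtain ⟨u, hu, h1, h2⟩ := exists_prev hT.isNil v.key
    exact ⟨u, hu, h1, h2⟩
  three := by
    intro u hu
    obtain ⟨k, hk⟩ := hu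
    have h3 := hT.length
    have key : ∀ v ∈ T.toList, v ≠ u.sh k → ∃ w, w ∈ cover T ∧ u.key < w.key ∧
        w.key < u.key + 1 ∧ ∃ l : ℤ, w = v.sh l := by
      intro v hv hne
      have hne' : v.key ≠ u.key + k := fun h => hne (hT.sorted.inj hv hk h)
      have h4 := hT.lt _ hv _ hk
      have h5 := hT.lt _ hk _ hv
      rw [V.sh_key] at h4 h5
      rcases lt_or_gt_of_ne hne' with h | h
      · exact ⟨v.sh (1 - k), cover_sh (mem_cover hv) _, by rw [V.sh_key]; push_cast; linarith,
          by rw [V.sh_key]; push_cast; linarith, _, rfl⟩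
      · exact ⟨v.sh (-k), cover_sh (mem_cover hv) _, by rw [V.sh_key]; push_cast; linarith,
          by rw [V.sh_key]; push_cast; linarith, _, rfl⟩
    -- At least two of the first three vertices differ from the given one; `key` shifts them into
    -- its turn.
    have : ∃ a ∈ T.toList, ∃ b ∈ T.toList, a ≠ u.sh k ∧ b ≠ u.sh k ∧ a ≠ b := by
      have hs := hT.sorted
      unfold Tree.Sorted at hs
      match h : T.toList, h3, hs with
      | a :: b :: c :: l, _, hs =>
        have n1 : a ≠ b := fun e => by simp [e] at hs
        have n2 : a ≠ c := fun e => by simp [e] at hs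
        have n3 : b ≠ c := fun e => by simp [e] at hs
        by_cases ha : a = u.sh k
        · exact ⟨b, by simp, c, by simp, fun h => n1 (ha.trans h.symm),
            fun h => n2 (ha.trans h.symm), n3⟩
        · by_cases hb : b = u.sh k
          · exact ⟨a, by simp, c, by simp, ha, fun h => n3 (hb.trans h.symm), n2⟩
          · exact ⟨a, by simp, b, by simp, ha, hb, n1⟩
    obtain ⟨a, ha, b, hb, h1, h2, h4⟩ := this
    obtain ⟨v, hv, a1, a2, l, rfl⟩ := key a ha h1
    obtain ⟨w, hw, b1, b2, m, rfl⟩ := key b hb h2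
    rcases lt_trichotomy (a.sh l).key (b.sh m).key with h | h | h
    · exact ⟨_, hv, _, hw, a1, h, b2⟩
    · exfalso
      have e := hT.cover_inj hv hw h
      obtain ⟨c1, c2⟩ := hT.sh_bounds (u := a) (v := b) (k := 0) (l := 0) (by rwa [V.sh_zero])
        (by rwa [V.sh_zero])
      rw [V.sh_key, V.sh_key] at h
      have e1 : l = m := by
        have h5 : (l : ℝ) < m + 1 := by push_cast at *; linarith
        have h6 : (m : ℝ) < l + 1 := by push_cast at *; linarith
        have h5 : l < m + 1 := by exact_mod_cast h5
        have h6 : m < l + 1 := by exact_mod_cast h6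
        omega
      subst e1
      exact h4 (hT.sorted.inj ha hb (by linarith))
    · exact ⟨_, hw, _, hv, b1, h, a2⟩
  fin := by
    refine ((List.finite_toSet T.toList).image V.pt).subset ?_
    rintro _ ⟨v, ⟨k, hk⟩, rfl⟩
    exact ⟨_, hk, rfl⟩
  nonempty := by
    obtain ⟨v, hv⟩ := toList_ne_nil hT.isNil
    exact ⟨v, mem_cover hv⟩

/-! ### Images of trees -/

theorem Tree.toList_lin (a b c d : ℝ) (T : Tree) :
    (T.lin a b c d).toList = T.toList.map (V.map 1 a b c d) := by
  induction T with
  | nil => rfl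
  | node l v r ihl ihr => simp [toList, lin, ihl, ihr, V.map]

theorem Tree.toList_mirror (T : Tree) : T.mirror.toList = (T.toList.map V.mir).reverse := by
  induction T with
  | nil => rfl
  | node l v r ihl ihr => simp [toList, mirror, ihl, ihr, V.mir]

theorem Tree.toList_shift (T : Tree) : T.shift.toList = T.toList.map (fun v => v.sh 1) := by
  induction T with
  | nil => rfl
  | node l v r ihl ihr => simp [toList, shift, ihl, ihr, V.sh]

theorem Spread.lin {T : Tree} (hT : Spread T) (a b c d : ℝ) : Spread (T.lin a b c d) where
  sorted := by
    have := hT.sorted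
    rw [Tree.Sorted] at *
    rw [Tree.toList_lin, List.pairwise_map]
    simpa [V.map] using this
  lt := by
    simp only [Tree.toList_lin, List.mem_map]
    rintro _ ⟨u, hu, rfl⟩ _ ⟨v, hv, rfl⟩
    simpa [V.map] using hT.lt u hu v hv

theorem Spread.mirror {T : Tree} (hT : Spread T) : Spread T.mirror where
  sorted := by
    have := hT.sorted
    rw [Tree.Sorted] at *
    rw [Tree.toList_mirror, List.pairwise_reverse, List.pairwise_map]
    simpa [V.mir] using this
  lt := by
    simp only [Tree.toList_mirror, List.mem_reverse, List.mem_map]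
    rintro _ ⟨u, hu, rfl⟩ _ ⟨v, hv, rfl⟩
    have := hT.lt v hv u hu
    simp only; linarith

theorem Tree.sorted_shift {T : Tree} (hT : T.Sorted) : T.shift.Sorted := by
  rw [Tree.Sorted] at *
  rw [Tree.toList_shift, List.pairwise_map]
  simpa [V.sh] using hT

theorem Good.lin {T : Tree} (hT : Good T) {a b c d : ℝ} (hd : 0 < a * d - b * c) :
    Good (T.lin a b c d) where
  toSpread := hT.toSpread.lin a b c d
  pos := by
    simp only [Tree.toList_lin, List.mem_map]
    rintro _ ⟨u, hu, rfl⟩ _ ⟨v, hv, rfl⟩ _ ⟨w, hw, rfl⟩ h1 h2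
    simp only [V.map, one_mul] at h1 h2
    rw [side_map]
    exact mul_pos hd (hT.pos u hu v hv w hw h1 h2)
  length := by simpa [Tree.toList_lin] using hT.length

theorem cover_lin (a b c d : ℝ) (T : Tree) : cover (T.lin a b c d) = V.map 1 a b c d '' cover T := by
  ext w
  simp only [cover, Tree.toList_lin, List.mem_map, Set.mem_image, Set.mem_ofPred_eq]
  constructor
  · rintro ⟨k, v, hv, h⟩
    refine ⟨v.sh (-k), ⟨k, by rwa [V.sh_sh, neg_add_cancel, V.sh_zero]⟩, ?_⟩
    have := congrArg (fun z : V => z.sh (-k)) h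
    simp only [V.sh_sh, add_neg_cancel, V.sh_zero] at this
    rw [← this]
    simp [V.map, V.sh]
  · rintro ⟨v, ⟨k, hk⟩, rfl⟩
    exact ⟨k, _, hk, by simp [V.map, V.sh]⟩

theorem cover_mirror (T : Tree) : cover T.mirror = V.mir '' cover T := by
  ext w
  simp only [cover, Tree.toList_mirror, List.mem_reverse, List.mem_map, Set.mem_image,
    Set.mem_ofPred_eq]
  constructor
  · rintro ⟨k, v, hv, h⟩
    refine ⟨v.sh k, ⟨-k, by rwa [V.sh_sh, add_neg_cancel, V.sh_zero]⟩, ?_⟩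
    have := congrArg (fun z : V => z.sh (-k)) h
    simp only [V.sh_sh, add_neg_cancel, V.sh_zero] at this
    rw [← this]
    simp [V.mir, V.sh, add_comm]
  · rintro ⟨v, ⟨k, hk⟩, rfl⟩
    exact ⟨-k, _, hk, by simp [V.mir, V.sh, add_comm]⟩

theorem cover_rot (T : Tree) : cover (T.lin 0 (-1) 1 0) = V.rot '' cover T := by
  rw [cover_lin, V.rot_eq]

theorem Good.rot {T : Tree} (hT : Good T) : Good (T.lin 0 (-1) 1 0) := hT.lin (by norm_num)

/-! ## Simple searches -/

/-- The first vertex of a tree. -/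
def first (T : Tree) : V := (iter (fun t : Tree => !t.left.isNil) Tree.left T.height T).root

@[fun_prop]
theorem comp_first {f : α → Tree} (hf : Comp L 1 f) : Comp L 1 (fun x => first (f x)) := by
  have : Comp L 1 (fun x : Tree => iter (fun t : Tree => !t.left.isNil) Tree.left x.height x) :=
    Comp.loop Tree.height (fun t ht => by
      cases t with
      | nil => simp [Tree.left, Tree.isNil] at ht
      | node l v r => simp [Tree.left, Tree.height]) 1
      (fun t => by have : size t = t.height := rfl; omega) (by fun_prop) (by fun_prop)
  exact Comp.root.comp' (this.comp' hf)

theorem first_spec {T : Tree} (hs : T.Sorted) (hn : T.isNil = false) :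
    first T ∈ T.toList ∧ ∀ v ∈ T.toList, (first T).key ≤ v.key := by
  have := iter_induction (b := fun t : Tree => !t.left.isNil) (f := Tree.left) (μ := Tree.height)
    (fun t ht => by
      cases t with
      | nil => simp [Tree.left, Tree.isNil] at ht
      | node l v r => simp [Tree.left, Tree.height])
    (Q := fun t => t.isNil = false ∧ t.Sorted ∧ (∀ u ∈ t.toList, u ∈ T.toList) ∧
      ∀ v ∈ T.toList, ∃ u ∈ t.toList, u.key ≤ v.key)
    (fun t ⟨h1, h2, h3, h4⟩ hb => by
      rw [PW.eq_node h1] at h2 h3 h4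
      have h5 := Tree.sorted_node.1 h2
      refine ⟨by simpa using hb, h5.1, fun u hu => h3 u (by simp [Tree.toList, hu]),
        fun v hv => ?_⟩
      obtain ⟨u, hu, h6⟩ := h4 v hv
      obtain ⟨a, ha⟩ := toList_ne_nil (T := t.left) (by simpa using hb)
      simp only [Tree.toList, List.mem_append, List.mem_cons] at hu
      rcases hu with hu | rfl | hu
      · exact ⟨u, hu, h6⟩
      · exact ⟨a, ha, (h5.2.2.1 a ha).le.trans h6⟩
      · exact ⟨a, ha, (h5.2.2.2.2 a ha u hu).le.trans h6⟩)
    (n := T.height) (x := T) ⟨hn, hs, fun _ h => h, fun v hv => ⟨v, hv, le_rfl⟩⟩ le_rfl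
  unfold first
  revert this
  generalize iter (fun t : Tree => !t.left.isNil) Tree.left T.height T = t
  rintro ⟨⟨h1, h2, h3, h4⟩, h5⟩
  have h6 : t.left.isNil = true := by simpa using h5
  rw [PW.eq_node h1] at h2 h3 h4
  have h7 : t.left.toList = [] := by
    cases h : t.left with
    | nil => rfl
    | node => simp [h, Tree.isNil] at h6
  refine ⟨h3 _ (by simp [Tree.toList]), fun v hv => ?_⟩
  obtain ⟨u, hu, h8⟩ := h4 v hv
  simp only [Tree.toList, h7, List.nil_append, List.mem_cons] at hu
  rcases hu with rfl | hu
  · exact h8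
  · exact ((Tree.sorted_node.1 h2).2.2.2.1 u hu).le.trans h8

def V.up (v : V) : V := ⟨v.key + 1, v.x, v.y⟩

theorem V.up_eq (v : V) : v.up = v.sh 1 := by simp [V.up, V.sh]

attribute [reducible] V.up

/-- The part of the chain from `S` to the next occurrence of `E`; `f` is the first vertex. -/
def run (T : Tree) (f S E : V) : PW :=
  bif leB S.key E.key then ⟨S, T, E, .nil, E, false⟩ else ⟨S, T, f.up, T.shift, E.up, false⟩

attribute [reducible] run

/-- If the end precedes the start in the tree, the run continues in the next turn. The middle point
of the window is then the second occurrence of the first vertex, and the shifted tree covers the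
rest. -/
theorem run_ok {T : Tree} (hT : Spread T) {f S E : V} (hf : f ∈ T.toList)
    (hmin : ∀ v ∈ T.toList, f.key ≤ v.key) (hS : S ∈ T.toList) (hE : E ∈ T.toList) :
    (run T f S E).Ok (cover T) ∧ (run T f S E).lo = S ∧ (∃ k : ℤ, (run T f S E).hi = E.sh k) ∧
      S.key ≤ (run T f S E).hi.key ∧ (run T f S E).hi.key < S.key + 1 := by
  have hSE := hT.lt _ hS _ hE
  have hES := hT.lt _ hE _ hS
  have hfS := hT.lt _ hS _ hf
  unfold run
  rcases le_or_gt S.key E.key with h | h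
  · rw [leB_iff.2 h, cond_true]
    refine ⟨⟨mem_cover hS, mem_cover hE, mem_cover hE, h, le_rfl, ⟨hT.sorted,
      fun v hv => mem_cover hv, fun w hw h1 h2 => ?_⟩, Gap.nil_iff.2 fun u _ h1 h2 =>
        absurd h2 h1.not_gt⟩, rfl, ⟨0, by rw [V.sh_zero]⟩, h, hES⟩
    obtain ⟨k, hk⟩ := hw
    have h3 := hT.lt _ hk _ hS
    have h4 := hT.lt _ hE _ hk
    rw [V.sh_key] at h3 h4
    have e : k = 0 := by
      have h5 : (k : ℝ) < 1 := by linarith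
      have h6 : (-1 : ℝ) < k := by linarith
      have h5 : k < 1 := by exact_mod_cast h5
      have h6 : -1 < k := by exact_mod_cast h6
      omega
    rwa [e, V.sh_zero] at hk
  · rw [leB_false.2 h, cond_false]
    refine ⟨⟨mem_cover hS, V.up_eq f ▸ cover_sh (mem_cover hf) 1,
      V.up_eq E ▸ cover_sh (mem_cover hE) 1, hfS.le, by simpa [V.up] using hmin _ hE, ⟨hT.sorted,
      fun v hv => mem_cover hv, fun w hw h1 h2 => ?_⟩, ⟨Tree.sorted_shift hT.sorted,
      fun v hv => ?_, fun w hw h1 h2 => ?_⟩⟩, rfl, ⟨1, V.up_eq E⟩, hSE.le, ?_⟩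
    · refine hT.mem_of_cover hf hw hmin ?_ h2
      exact (hmin _ hS).trans h1.le
    · rw [Tree.toList_shift, List.mem_map] at hv
      obtain ⟨u, hu, rfl⟩ := hv
      exact cover_sh (mem_cover hu) 1
    · rw [Tree.toList_shift, List.mem_map]
      refine ⟨w.sh (-1), hT.mem_of_cover hf (cover_sh hw _) hmin ?_ ?_, ?_⟩
      · simp only [V.sh_key] at *; push_cast; linarith
      · simp only [V.sh_key] at *; push_cast; linarith
      · rw [V.sh_sh, neg_add_cancel, V.sh_zero]
    · simp only; linarith

/-! ## Neighbours of the first vertex -/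

/-- One turn from the first vertex `f` on. -/
def turnFrom (T : Tree) (f : V) : PW := ⟨f, .nil, f, T, f.up, true⟩

/-- The second vertex. -/
def second (T : Tree) (f : V) : V :=
  let w := search (fun (_ : Unit) _ _ => false) () (turnFrom T f)
  bif ltB w.lo.key w.x.key then w.x else w.hi

/-- The last vertex. -/
def last (T : Tree) (f : V) : V :=
  let w := search (fun (_ : Unit) _ _ => true) () (turnFrom T f)
  bif ltB w.x.key w.hi.key then w.x else w.lo

instance : CompConst () := ⟨fun {α} _ L k => by
  exact CompIf.toComp (.of_exps (fun _ _ => []) (fun _ _ => []) 8 (by simp) (by simp)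
    (fun _ _ _ _ _ _ => trivial)) (fun _ => Nat.zero_le _)⟩

attribute [reducible] turnFrom second last

/-- `f` is the first vertex of `T`. -/
structure IsFirst (T : Tree) (f : V) : Prop where
  mem : f ∈ T.toList
  le : ∀ v ∈ T.toList, f.key ≤ v.key

section
variable {T : Tree} {f : V}

theorem turnFrom_ok (hT : Spread T) (hf : IsFirst T f) : (turnFrom T f).Ok (cover T) where
  lo := mem_cover hf.mem
  x := mem_cover hf.mem
  hi := show f.up ∈ cover T from V.up_eq f ▸ cover_sh (mem_cover hf.mem) 1
  lo_le := le_rfl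
  le_hi := by simp
  gapA := Gap.nil_iff.2 fun u _ h1 h2 => absurd h2 h1.not_gt
  gapB := ⟨hT.sorted, fun v hv => mem_cover hv, fun w hw h1 h2 =>
    hT.mem_of_cover hf.mem hw hf.le h1.le h2⟩

/-- Constant decisions keep one end of the window at `f`. After the search the middle point may
still coincide with `f`, in which case the other end of the window is the neighbour. -/
theorem second_spec (hT : Spread T) (hf : IsFirst T f) : Adj (cover T) f (second T f) := by
  obtain ⟨h1, h2, h3, h4⟩ := search_spec (d := fun (_ : Unit) _ _ => false) (c := ())
    (turnFrom_ok hT hf) (fun lo hi => lo = f ∧ lo.key < hi.key) ⟨rfl, by simp⟩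
    (fun lo _ hi _ u _ v _ a1 a2 a3 a4 => ⟨fun h => by simp at h, fun _ => ⟨a4.1, by linarith⟩⟩)
  obtain ⟨h5, h6⟩ := h1.adj h2
  unfold second
  revert h1 h2 h3 h4 h5 h6
  generalize search (fun (_ : Unit) _ _ => false) () (turnFrom T f) = w
  intro h1 h2 h3 h4 h5 h6
  rw [h3] at h4 h5
  simp only
  cases hb : ltB w.lo.key w.x.key with
  | true => exact ⟨mem_cover hf.mem, h1.x, by rw [← h3]; exact ltB_iff.1 hb, h5⟩
  | false =>
    have e : w.x.key = f.key := by rw [← h3]; exact le_antisymm (ltB_false.1 hb) h1.lo_le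
    rw [e] at h6
    exact ⟨mem_cover hf.mem, h1.hi, h4, h6⟩

theorem last_spec (hT : Spread T) (hf : IsFirst T f) : Adj (cover T) (last T f) f.up := by
  obtain ⟨h1, h2, h3, h4⟩ := search_spec (d := fun (_ : Unit) _ _ => true) (c := ())
    (turnFrom_ok hT hf) (fun lo hi => hi = f.up ∧ lo.key < hi.key) ⟨rfl, by simp⟩
    (fun lo _ hi _ u _ v _ a1 a2 a3 a4 => ⟨fun _ => ⟨a4.1, by linarith⟩, fun h => by simp at h⟩)
  obtain ⟨h5, h6⟩ := h1.adj h2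
  unfold last
  revert h1 h2 h3 h4 h5 h6
  generalize search (fun (_ : Unit) _ _ => true) () (turnFrom T f) = w
  intro h1 h2 h3 h4 h5 h6
  have hu : f.up ∈ cover T := by rw [← h3]; exact h1.hi
  rw [h3] at h4 h6
  simp only
  cases hb : ltB w.x.key w.hi.key with
  | true => exact ⟨h1.x, hu, by rw [← h3]; exact ltB_iff.1 hb, h6⟩
  | false =>
    have e : w.x.key = f.up.key := by rw [← h3]; exact le_antisymm h1.le_hi (ltB_false.1 hb)
    rw [e] at h5
    exact ⟨h1.lo, hu, h4, h5⟩

end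

/-! ## Extreme vertices -/

/-- The values of `α x + β y` and then of `γ x + δ y` are compared. -/
def lexLt (c : ℝ × ℝ × ℝ × ℝ) (u v : V) : Bool :=
  ltB (c.1 * u.x + c.2.1 * u.y) (c.1 * v.x + c.2.1 * v.y) ||
    (leB (c.1 * u.x + c.2.1 * u.y) (c.1 * v.x + c.2.1 * v.y) &&
      ltB (c.2.2.1 * u.x + c.2.2.2 * u.y) (c.2.2.1 * v.x + c.2.2.2 * v.y))

/-- The decisions in the search for an extreme vertex, given the functions and the first two
vertices. -/
def decExt (p : (ℝ × ℝ × ℝ × ℝ) × V × V) (u v : V) : Bool :=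
  bif leB u.key p.2.1.key then true
  else bif leB (p.2.1.key + 1) v.key then false
  else bif lexLt p.1 p.2.1 u && lexLt p.1 p.2.1 v then lexLt p.1 u v
  else !lexLt p.1 p.2.1 p.2.2

def lexMax (c : ℝ × ℝ × ℝ × ℝ) (u v : V) : V := bif lexLt c u v then v else u

/-- The extreme vertex for the functions `α x + β y` and `γ x + δ y`. -/
def ext (T : Tree) (f : V) (c : ℝ × ℝ × ℝ × ℝ) : V :=
  let w := search decExt (c, f, second T f) (turnFrom T f)
  let b := lexMax c (lexMax c w.lo w.x) w.hi
  bif leB (f.key + 1) b.key then f else b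

attribute [reducible] lexLt lexMax decExt ext

/-- The lexicographic order on finitely many points is that of a linear function. -/
theorem exists_lex_fun {N : Set V} (hN : (V.pt '' N).Finite) {c : ℝ × ℝ × ℝ × ℝ}
    (hc : c.1 * c.2.2.2 - c.2.1 * c.2.2.1 ≠ 0) : ∃ a b : ℝ, (a ≠ 0 ∨ b ≠ 0) ∧
      (∀ u ∈ N, ∀ v ∈ N, lexLt c u v = true ↔ a * u.x + b * u.y < a * v.x + b * v.y) ∧
      ∀ u ∈ N, ∀ v ∈ N, a * u.x + b * u.y = a * v.x + b * v.y → u.pt = v.pt := by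
  obtain ⟨α, β, γ, δ⟩ := c
  simp only at hc
  -- The first function is perturbed by `ε` times the second. Each of the finitely many pairs of
  -- points tolerates all small `ε`, so one `ε` serves for all of them.
  have key : ∀ᶠ ε : ℝ in nhdsWithin 0 (Set.Ioi 0), ∀ p ∈ (V.pt '' N) ×ˢ (V.pt '' N),
      ((α * p.1.1 + β * p.1.2 < α * p.2.1 + β * p.2.2 ∨
        α * p.1.1 + β * p.1.2 ≤ α * p.2.1 + β * p.2.2 ∧
          γ * p.1.1 + δ * p.1.2 < γ * p.2.1 + δ * p.2.2) →
        (α + ε * γ) * p.1.1 + (β + ε * δ) * p.1.2 <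
          (α + ε * γ) * p.2.1 + (β + ε * δ) * p.2.2) := by
    rw [Filter.eventually_all_finite (hN.prod hN)]
    intro p _
    rcases lt_or_ge (α * p.1.1 + β * p.1.2) (α * p.2.1 + β * p.2.2) with h | h
    · have hcont : ContinuousAt (fun ε : ℝ => (α + ε * γ) * p.2.1 + (β + ε * δ) * p.2.2 -
          ((α + ε * γ) * p.1.1 + (β + ε * δ) * p.1.2)) 0 := by fun_prop
      have h0 : 0 < (α + 0 * γ) * p.2.1 + (β + 0 * δ) * p.2.2 -
          ((α + 0 * γ) * p.1.1 + (β + 0 * δ) * p.1.2) := by linarith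
      have h2 := hcont.eventually (lt_mem_nhds h0)
      filter_upwards [nhdsWithin_le_nhds h2] with ε hε _
      linarith
    · filter_upwards [self_mem_nhdsWithin] with ε hε hl
      obtain ⟨h1, h2⟩ := hl.resolve_left h.not_gt
      have : 0 < ε * (γ * p.2.1 + δ * p.2.2 - (γ * p.1.1 + δ * p.1.2)) :=
        mul_pos hε (by linarith)
      linarith
  obtain ⟨ε, hε⟩ := key.exists
  have fwd : ∀ u ∈ N, ∀ v ∈ N, lexLt (α, β, γ, δ) u v = true →
      (α + ε * γ) * u.x + (β + ε * δ) * u.y < (α + ε * γ) * v.x + (β + ε * δ) * v.y := by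
    intro u hu v hv h
    refine hε (u.pt, v.pt) ⟨⟨u, hu, rfl⟩, ⟨v, hv, rfl⟩⟩ ?_
    simpa [lexLt, V.pt] using h
  have tri : ∀ u v : V, lexLt (α, β, γ, δ) u v = true ∨ lexLt (α, β, γ, δ) v u = true ∨
      u.pt = v.pt := by
    intro u v
    simp only [lexLt, Bool.or_eq_true, Bool.and_eq_true, ltB_iff, leB_iff]
    rcases lt_trichotomy (α * u.x + β * u.y) (α * v.x + β * v.y) with h | h | h
    · exact .inl (.inl h)
    · rcases lt_trichotomy (γ * u.x + δ * u.y) (γ * v.x + δ * v.y) with h' | h' | h'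
      · exact .inl (.inr ⟨h.le, h'⟩)
      · refine .inr (.inr ?_)
        have e1 : (α * δ - β * γ) * (u.x - v.x) = 0 := by linear_combination δ * h - β * h'
        have e2 : (α * δ - β * γ) * (u.y - v.y) = 0 := by linear_combination α * h' - γ * h
        have e1 := (mul_eq_zero.1 e1).resolve_left hc
        have e2 := (mul_eq_zero.1 e2).resolve_left hc
        ext <;> simp [V.pt] <;> linarith
      · exact .inr (.inl (.inr ⟨h.ge, h'⟩))
    · exact .inr (.inl (.inl h))
  refine ⟨α + ε * γ, β + ε * δ, ?_, fun u hu v hv => ⟨fwd u hu v hv, fun h => ?_⟩,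
    fun u hu v hv h => ?_⟩
  · by_contra! h
    exact hc (by linear_combination δ * h.1 - γ * h.2)
  · rcases tri u v with h1 | h1 | h1
    · exact h1
    · exact absurd (fwd v hv u hu h1) h.not_gt
    · simp only [V.pt, Prod.mk.injEq] at h1
      rw [h1.1, h1.2] at h
      exact absurd h (lt_irrefl _)
  · rcases tri u v with h1 | h1 | h1
    · exact absurd (fwd u hu v hv h1) h.not_lt
    · exact absurd (fwd v hv u hu h1) h.not_gt
    · exact h1

/-- By `quad`, a linear function goes up and down only once around the polygon. The vertices above
the level of `f` are consecutive and unimodal, so a chord between two of them points towards the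
maximum. If an end of the chord is not above that level, the direction of the first edge tells on
which side of the chord the maximum lies. -/
theorem ext_spec {T : Tree} {f : V} (hT : Good T) (hf : IsFirst T f) {c : ℝ × ℝ × ℝ × ℝ}
    (hc : c.1 * c.2.2.2 - c.2.1 * c.2.2.1 ≠ 0) : ext T f c ∈ T.toList ∧
      IsExt (cover T) c.1 c.2.1 c.2.2.1 c.2.2.2 (ext T f c) := by
  have hN := hT.cyc
  obtain ⟨a, b, hab, hlt, hinj⟩ := exists_lex_fun hN.fin hc
  have hlt' : ∀ u ∈ cover T, ∀ v ∈ cover T, lexLt c u v = false ↔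
      a * v.x + b * v.y ≤ a * u.x + b * u.y := fun u hu v hv => by
    rw [← not_lt, ← hlt u hu v hv, Bool.not_eq_true]
  have hf' := mem_cover hf.mem
  have hf1 : f.up ∈ cover T := V.up_eq f ▸ cover_sh hf' 1
  have h2 := second_spec hT.toSpread hf
  -- the largest vertex
  obtain ⟨m, hm, hfm, hm1, hmax⟩ : ∃ m ∈ cover T, f.key < m.key ∧ m.key ≤ f.key + 1 ∧
      ∀ v ∈ cover T, a * v.x + b * v.y ≤ a * m.x + b * m.y := by
    obtain ⟨_, ⟨m, hm, rfl⟩, hmax⟩ := Set.exists_max_image (V.pt '' cover T)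
      (fun z => a * z.1 + b * z.2) hN.fin (hN.nonempty.image _)
    have hmax' : ∀ v ∈ cover T, a * v.x + b * v.y ≤ a * m.x + b * m.y :=
      fun v hv => hmax _ ⟨v, hv, rfl⟩
    obtain ⟨k, h1, h2, h3⟩ := hN.rep (u := f) hm
    rcases h2.eq_or_lt with e | h2
    · exact ⟨_, hN.sh _ h1 1, by rw [V.sh_key, ← e]; simp, by rw [V.sh_key, ← e]; simp, hmax'⟩
    · exact ⟨_, h1, h2, h3.le, hmax'⟩
  have notup : m.key = f.key + 1 → ∀ u ∈ cover T, ¬ a * f.x + b * f.y < a * u.x + b * u.y := by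
    intro h u hu h'
    have := hN.inj _ hm _ hf1 h
    rw [this] at hmax
    exact absurd (hmax u hu) (not_le.2 h')
  obtain ⟨h3, h4, h5, h6, h7, h8⟩ := search_spec (d := decExt) (c := (c, f, second T f))
    (turnFrom_ok hT.toSpread hf) (fun lo hi => f.key ≤ lo.key ∧ hi.key ≤ f.key + 1 ∧
      lo.key ≤ m.key ∧ m.key ≤ hi.key) ⟨le_rfl, le_rfl, hfm.le, hm1⟩
    (fun lo hlo hi hhi u hu v hv a1 a2 a3 ⟨a4, a5, a6, a7⟩ => by
      simp only [decExt]
      rcases le_or_gt u.key f.key with b1 | b1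
      · rw [leB_iff.2 b1, cond_true]
        exact ⟨fun _ => ⟨by linarith, a5, by linarith, a7⟩, by simp⟩
      rw [leB_false.2 b1, cond_false]
      rcases le_or_gt (f.key + 1) v.key with b2 | b2
      · rw [leB_iff.2 b2, cond_true]
        exact ⟨by simp, fun _ => ⟨a4, by linarith, a6, by linarith⟩⟩
      rw [leB_false.2 b2, cond_false]
      cases hfu : lexLt c f u && lexLt c f v with
      | true =>
        rw [Bool.and_eq_true, hlt f hf' u hu, hlt f hf' v hv] at hfu
        obtain ⟨c1, c2⟩ := hfu
        have hm2 : m.key < f.key + 1 := lt_of_le_of_ne hm1 fun h => notup h u hu c1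
        rw [cond_true, hlt u hu v hv, hlt' u hu v hv]
        refine ⟨fun c3 => ⟨by linarith, a5, ?_, a7⟩, fun c3 => ⟨a4, by linarith, a6, ?_⟩⟩
        · by_contra! c4
          exact hN.quad hf' hm hu hv hfm c4 a2 b2 hab (t := a * u.x + b * u.y) c1.le
            (hmax u hu) le_rfl c3.le
        · by_contra! c4
          exact hN.quad hf' hu hv hm b1 a2 c4 hm2 hab (t := a * v.x + b * v.y) c2.le c3 le_rfl
            (hmax v hv)
      | false =>
        rw [cond_false, Bool.not_eq_true', Bool.not_eq_false', hlt f hf' _ h2.right,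
          hlt' f hf' _ h2.right]
        have hfu' : a * u.x + b * u.y ≤ a * f.x + b * f.y ∨
            a * v.x + b * v.y ≤ a * f.x + b * f.y := by
          rwa [Bool.and_eq_false_iff, hlt' f hf' u hu, hlt' f hf' v hv] at hfu
        have h2u : (second T f).key ≤ u.key := not_lt.1 (h2.adj u hu b1)
        have h2m : (second T f).key ≤ m.key := not_lt.1 (h2.adj m hm hfm)
        refine ⟨fun c3 => ⟨by linarith, a5, ?_, a7⟩, fun c3 => ⟨a4, by linarith, a6, ?_⟩⟩
        · by_contra! c4
          -- a largest vertex before `u`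
          rcases h2m.eq_or_lt with e | h2m
          · have e := hN.inj _ h2.right _ hm e
            rw [e] at c3
            have e2 := hinj f hf' m hm (le_antisymm (hmax f hf') c3)
            have p := hN.pos _ hf' _ hm _ hu hfm c4 (by linarith)
            simp only [V.pt, Prod.mk.injEq] at e2
            simp [side, V.pt, ← e2.1, ← e2.2] at p
          · rcases hfu' with h9 | h9
            · exact hN.quad (hf') h2.right hm hu h2.lt h2m c4 (by linarith) (α := -a) (β := -b)
                (t := -(a * f.x + b * f.y)) (by simpa using hab) (by linarith) (by linarith)
                (by linarith [hmax f hf']) (by linarith)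
            · exact hN.quad (hf') h2.right hm hv h2.lt h2m (c4.trans a2) (by linarith) (α := -a)
                (β := -b) (t := -(a * f.x + b * f.y)) (by simpa using hab) (by linarith)
                (by linarith) (by linarith [hmax f hf']) (by linarith)
        · by_contra! c4
          have hm2 : m.key < f.key + 1 := lt_of_le_of_ne hm1 fun h => notup h _ h2.right c3
          rcases hfu' with h9 | h9
          · rcases h2u.eq_or_lt with e | h2u
            · rw [hN.inj _ h2.right _ hu e] at c3
              linarith
            · exact hN.quad hf' h2.right hu hm h2.lt h2u (by linarith) hm2 hab
                (t := a * f.x + b * f.y) le_rfl c3.le h9 (hmax f hf')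
          · exact hN.quad hf' h2.right hv hm h2.lt (by linarith) c4 hm2 hab
              (t := a * f.x + b * f.y) le_rfl c3.le h9 (hmax f hf'))
  obtain ⟨h9, h10⟩ := h3.adj h4
  unfold ext
  revert h3 h4 h5 h6 h7 h8 h9 h10
  generalize search decExt (c, f, second T f) (turnFrom T f) = w
  intro h3 h4 h5 h6 h7 h8 h9 h10
  have hmax_or : ∀ u v : V, lexMax c u v = u ∨ lexMax c u v = v := fun u v => by
    unfold lexMax; cases lexLt c u v <;> simp
  have hmax_le : ∀ u ∈ cover T, ∀ v ∈ cover T, a * u.x + b * u.y ≤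
      a * (lexMax c u v).x + b * (lexMax c u v).y ∧ a * v.x + b * v.y ≤
      a * (lexMax c u v).x + b * (lexMax c u v).y := fun u hu v hv => by
    unfold lexMax
    cases h : lexLt c u v with
    | true => exact ⟨((hlt u hu v hv).1 h).le, le_rfl⟩
    | false => exact ⟨le_rfl, (hlt' u hu v hv).1 h⟩
  set e := lexMax c (lexMax c w.lo w.x) w.hi with he
  have m1 : lexMax c w.lo w.x ∈ cover T := by
    rcases hmax_or w.lo w.x with h | h <;> rw [h]
    exacts [h3.lo, h3.x]
  have e1 : e ∈ cover T ∧ f.key ≤ e.key ∧ e.key ≤ f.key + 1 := by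
    have := h3.lo_le
    have := h3.le_hi
    rcases hmax_or (lexMax c w.lo w.x) w.hi with h | h <;> rw [he, h]
    · rcases hmax_or w.lo w.x with h | h <;> rw [h]
      · exact ⟨h3.lo, h5, by linarith⟩
      · exact ⟨h3.x, by linarith, by linarith⟩
    · exact ⟨h3.hi, by linarith, h6⟩
  have e2 : a * m.x + b * m.y ≤ a * e.x + b * e.y := by
    obtain ⟨k1, k2⟩ := hmax_le _ h3.lo _ h3.x
    obtain ⟨k3, k4⟩ := hmax_le _ m1 _ h3.hi
    have : m = w.lo ∨ m = w.x ∨ m = w.hi := by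
      rcases h7.eq_or_lt with h | h
      · exact .inl (hN.inj _ hm _ h3.lo h.symm)
      rcases (not_lt.1 (h9 m hm h)).eq_or_lt with h | h
      · exact .inr (.inl (hN.inj _ hm _ h3.x h.symm))
      · exact .inr (.inr (hN.inj _ hm _ h3.hi (le_antisymm h8 (not_lt.1 (h10 m hm h)))))
    rcases this with h | h | h <;> rw [h]
    · exact k1.trans k3
    · exact k2.trans k3
    · exact k4
  have main : ∀ e' ∈ T.toList, e'.x = e.x → e'.y = e.y → e' ∈ T.toList ∧
      IsExt (cover T) c.1 c.2.1 c.2.2.1 c.2.2.2 e' := by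
    intro e' hm' hx hy
    refine ⟨hm', mem_cover hm', fun v hv => ?_⟩
    have h : lexLt c e' v = false := by
      rw [hlt' _ (mem_cover hm') v hv, hx, hy]
      exact (hmax v hv).trans e2
    simp only [lexLt, Bool.or_eq_false_iff, Bool.and_eq_false_iff, ltB_false, leB_false] at h
    rcases h.2 with h' | h'
    · exact .inl h'
    · rcases h.1.lt_or_eq with h | h
      exacts [.inl h, .inr ⟨h, h'⟩]
  simp only
  cases hb : leB (f.key + 1) e.key with
  | true =>
    have := hN.inj _ e1.1 _ hf1 (le_antisymm e1.2.2 (leB_iff.1 hb))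
    exact main f hf.mem (by rw [this]) (by rw [this])
  | false =>
    exact main e (hT.mem_of_cover hf.mem e1.1 hf.le e1.2.1 (leB_false.1 hb)) rfl rfl

/-! ## Membership in the polygon -/

def inTri (a b c : V) (z : ℝ × ℝ) : Bool :=
  ltB b.key c.key && (leB 0 (side a b z) && (leB 0 (side b c z) && leB 0 (side c a z)))

def decIn (p : V × ℝ × ℝ) (u _v : V) : Bool := leB 0 (side p.1 u p.2)

/-- The search in a fan of triangles. -/
def fan (T : Tree) (z : ℝ × ℝ) : PW :=
  search decIn (first T, z)
    ⟨second T (first T), .nil, second T (first T), T, last T (first T), true⟩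

/-- The test whether a point is in the polygon. -/
def inside (T : Tree) (z : ℝ × ℝ) : Bool :=
  inTri (first T) (fan T z).lo (fan T z).x z || inTri (first T) (fan T z).x (fan T z).hi z

attribute [reducible] inTri decIn fan inside

theorem side_swap (u v : V) (z : ℝ × ℝ) (h : 0 ≤ -side u v z) : 0 ≤ side v u z := by
  have : side v u z = -side u v z := by simp only [side]; ring
  rwa [this]

theorem mem_of_inTri {N : Set V} (hN : Cyc N) {a b c : V} {z : ℝ × ℝ} (ha : a ∈ N) (hb : b ∈ N)
    (hc : c ∈ N) (hab : a.key < b.key) (hca : c.key < a.key + 1) (h : inTri a b c z = true) :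
    z ∈ hull N := by
  simp only [inTri, Bool.and_eq_true, leB_iff, ltB_iff] at h
  obtain ⟨h0, h1, h2, h3⟩ := h
  have hD := hN.pos a ha b hb c hc hab h0 hca
  have e : side b c z + side c a z + side a b z = side a b c.pt := by
    simp only [side, V.pt]; ring
  have := (hull_convex N).sum_mem (t := Finset.univ) (w := ![side b c z / side a b c.pt,
    side c a z / side a b c.pt, side a b z / side a b c.pt]) (z := ![a.pt, b.pt, c.pt])
    (by
      intro i _
      fin_cases i <;> simp <;> positivity) (by
      simp only [Fin.sum_univ_three, Matrix.cons_val]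
      rw [← add_div, ← add_div, e, div_self hD.ne']) (by
      intro i _
      fin_cases i
      exacts [mem_hull ha, mem_hull hb, mem_hull hc])
  convert this using 1
  simp only [Fin.sum_univ_three, Matrix.cons_val]
  ext
  · simp only [V.pt, Prod.fst_add, Prod.smul_fst, smul_eq_mul] at *
    field_simp; ring
  · simp only [V.pt, Prod.snd_add, Prod.smul_snd, smul_eq_mul] at *
    field_simp; ring

section
variable {T : Tree} (hT : Good T)
include hT

theorem Good.isFirst : IsFirst T (first T) :=
  ⟨(first_spec hT.sorted hT.isNil).1, (first_spec hT.sorted hT.isNil).2⟩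

/-- What is known about the window in which the polygon is searched. -/
theorem Good.fan_ok : (PW.mk (second T (first T)) .nil (second T (first T)) T (last T (first T))
    true).Ok (cover T) ∧ (second T (first T)).key < (last T (first T)).key := by
  have hN := hT.cyc
  have hf := hT.isFirst
  have h1 := second_spec hT.toSpread hf
  have h2 := last_spec hT.toSpread hf
  have hlt : (second T (first T)).key < (last T (first T)).key := by
    obtain ⟨a, ha, b, hb, a1, a2, a3⟩ := hN.three _ h1.left
    have := h1.adj a ha a1
    by_contra! h
    exact h2.adj b hb (by linarith) a3
  refine ⟨⟨h1.right, h1.right, h2.left, le_rfl, hlt.le, Gap.nil_iff.2 fun u _ h1 h2 =>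
    absurd h2 h1.not_gt, ⟨hT.sorted, fun v hv => mem_cover hv, fun w hw a1 a2 => ?_⟩⟩, hlt⟩
  exact hT.mem_of_cover hf.mem hw hf.le (h1.lt.trans a1).le (a2.trans h2.lt)

theorem inside_sound {z : ℝ × ℝ} (h : inside T z = true) : z ∈ hull (cover T) := by
  have hN := hT.cyc
  have hf := hT.isFirst
  have h1 := second_spec hT.toSpread hf
  have h2 := last_spec hT.toSpread hf
  obtain ⟨hok, hlt⟩ := hT.fan_ok
  obtain ⟨h3, h4, h5, h6⟩ := search_spec (d := decIn) (c := (first T, z)) hok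
    (fun lo hi => (second T (first T)).key ≤ lo.key ∧ hi.key ≤ (last T (first T)).key)
    ⟨le_rfl, le_rfl⟩ (fun lo _ hi _ u _ v _ a1 a2 a3 a4 =>
      ⟨fun _ => ⟨by linarith, a4.2⟩, fun _ => ⟨a4.1, by linarith⟩⟩)
  simp only [inside, fan, Bool.or_eq_true] at h
  revert h3 h4 h5 h6 h
  generalize search _ _ _ = w
  intro h3 h4 h5 h6 h
  have k1 := h1.lt
  have k2 := h2.lt
  have k3 := h3.lo_le
  have k4 := h3.le_hi
  rw [V.up] at k2
  rcases h with h | h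
  · exact mem_of_inTri hN h1.left h3.lo h3.x (by linarith) (by linarith) h
  · exact mem_of_inTri hN h1.left h3.x h3.hi (by linarith) (by linarith) h

/-- The search keeps `z` in the angle at the first vertex between the rays to the two ends of the
window. At the end this angle is cut into at most two triangles of the fan, whose outer sides are
edges of the polygon. -/
theorem inside_of_edges {z : ℝ × ℝ} (hz : ∀ u v, Adj (cover T) u v → 0 ≤ side u v z) :
    inside T z = true := by
  have hN := hT.cyc
  have hf := hT.isFirst
  have h1 := second_spec hT.toSpread hf
  have h2 := last_spec hT.toSpread hf
  obtain ⟨hok, hlt⟩ := hT.fan_ok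
  have hup : (first T).up.key = (first T).key + 1 := rfl
  have h2lt := h2.lt
  rw [hup] at h2lt
  obtain ⟨h3, h4, h5, h6, h7, h8, h9⟩ := search_spec (d := decIn) (c := (first T, z)) hok
    (fun lo hi => lo.key < hi.key ∧ (second T (first T)).key ≤ lo.key ∧
      hi.key ≤ (last T (first T)).key ∧ 0 ≤ side (first T) lo z ∧ 0 ≤ side hi (first T) z)
    ⟨hlt, le_rfl, le_rfl, hz _ _ h1,
      show 0 ≤ side (last T (first T)) (first T).up z from hz _ _ h2⟩
    (fun lo _ hi _ u hu v hv a1 a2 a3 ⟨a4, a5, a6, a7, a8⟩ => by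
      simp only [decIn, leB_iff, leB_false]
      refine ⟨fun h => ⟨by linarith, by linarith, a6, h, a8⟩, fun h => ⟨by linarith, a5, by linarith,
        a7, side_swap _ _ _ ?_⟩⟩
      by_contra! h'
      have p1 := hN.pos _ h1.left _ hu _ hv (h1.lt.trans_le (a5.trans a1)) a2 (by linarith)
      have p2 := hN.pos _ h1.left _ h1.right _ hv h1.lt (by linarith) (by linarith)
      have p3 : 0 ≤ side (first T) (second T (first T)) u.pt := by
        rcases (a5.trans a1).eq_or_lt with e | h''
        · rw [hN.inj _ h1.right _ hu e]; simp [side, V.pt, mul_comm]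
        · exact (hN.pos _ h1.left _ h1.right _ hu h1.lt h'' (by linarith)).le
      have p4 := hz _ _ h1
      -- The Plücker relation between the directions from the first vertex to the second one, to
      -- `u`, to `v` and to `z`. Its signs exclude that `z` is to the right of the ray to `u` and to
      -- the left of the ray to `v`.
      have e : side (first T) (second T (first T)) u.pt * side (first T) v z -
          side (first T) (second T (first T)) v.pt * side (first T) u z +
          side (first T) (second T (first T)) z * side (first T) u v.pt = 0 := by
        simp only [side, V.pt]; ring
      nlinarith [mul_nonneg p3 (by linarith : 0 ≤ side (first T) v z),
        mul_pos p2 (by linarith : 0 < -side (first T) u z), mul_nonneg p4 p1.le])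
  obtain ⟨h10, h11⟩ := h3.adj h4
  simp only [inside, fan]
  revert h3 h4 h5 h6 h7 h8 h9 h10 h11
  generalize search _ _ _ = w
  intro h3 h4 h5 h6 h7 h8 h9 h10 h11
  simp only [inTri, Bool.or_eq_true, Bool.and_eq_true, leB_iff, ltB_iff]
  rcases h3.lo_le.eq_or_lt with e | k1
  · have e := hN.inj _ h3.lo _ h3.x e
    rw [e] at h5 h8
    exact .inr ⟨h5, h8, hz _ _ ⟨h3.x, h3.hi, h5, h11⟩, h9⟩
  rcases h3.le_hi.eq_or_lt with e | k2
  · have e := hN.inj _ h3.x _ h3.hi e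
    rw [← e] at h5 h9
    exact .inl ⟨h5, h8, hz _ _ ⟨h3.lo, h3.x, h5, h10⟩, h9⟩
  rcases le_total 0 (side (first T) w.x z) with h | h
  · exact .inr ⟨k2, h, hz _ _ ⟨h3.x, h3.hi, k2, h11⟩, h9⟩
  · exact .inl ⟨k1, h8, hz _ _ ⟨h3.lo, h3.x, k1, h10⟩, side_swap _ _ _ (by linarith)⟩

theorem mem_hull_iff_edges {z : ℝ × ℝ} :
    z ∈ hull (cover T) ↔ ∀ u v, Adj (cover T) u v → 0 ≤ side u v z :=
  ⟨fun h _ _ ha => hT.cyc.side_nonneg ha h, fun h => inside_sound hT (inside_of_edges hT h)⟩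

theorem inside_iff {z : ℝ × ℝ} : inside T z = true ↔ z ∈ hull (cover T) :=
  ⟨inside_sound hT, fun h => inside_of_edges hT ((mem_hull_iff_edges hT).1 h)⟩

end

/-! ### Tentative prune-and-search on three chains -/

/-! ## Segments of a chain -/

/-- The part of a chain between `a` and `b`. -/
structure Seg where
  a : V
  g : Tree
  b : V

instance : Enc Seg := Enc.via (fun s : Seg => (s.a, s.g, s.b))

namespace Seg

theorem comp_tup : Comp L k (fun s : Seg => (s.a, s.g, s.b)) := Comp.via_to _
@[fun_prop] theorem comp_a : Comp L k Seg.a := Comp.fst.comp' comp_tup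
@[fun_prop] theorem comp_g : Comp L k Seg.g := (Comp.fst.comp' Comp.snd).comp' comp_tup
@[fun_prop] theorem comp_b : Comp L k Seg.b := (Comp.snd.comp' Comp.snd).comp' comp_tup
@[fun_prop] theorem comp_mk : Comp L k (fun z : V × Tree × V => Seg.mk z.1 z.2.1 z.2.2) :=
  .via_of (fun s : Seg => (s.a, s.g, s.b)) _ fun _ => rfl

def nondeg (s : Seg) : Bool := ltB s.a.key s.b.key

/-- The bound up to which a test may be answered `high`. -/
def hi (s : Seg) : V := hb s.a s.b s.g.isNil

/-- The bound from which a test may be answered `low`. -/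
def lo (s : Seg) : V := lb s.a s.b s.g.isNil

def upper (x : ℝ) (s : Seg) : Bool := ltB x s.hi.x

def dup (v : V) : Seg := ⟨v, .nil, v⟩

def splits (s : Seg) : Bool :=
  !s.g.isNil && (ltB s.a.key s.g.root.key && ltB s.g.root.key s.b.key)

/-- The segment with a smaller tree, if the root is not between the ends. -/
def trim (s : Seg) : Seg := bif s.splits then s else ⟨s.a, PW.child s.a.key s.g, s.b⟩

/-- The first part of a segment. -/
def fst (s : Seg) : Seg :=
  bif s.splits then ⟨s.a, s.g.left, s.g.root⟩ else ⟨s.a, PW.child s.a.key s.g, s.b⟩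

/-- The second part of a segment. -/
def snd (s : Seg) : Seg :=
  bif s.splits then ⟨s.g.root, s.g.right, s.b⟩ else dup s.b

@[fun_prop] theorem comp_nondeg : Comp L k nondeg := by unfold nondeg; fun_prop
attribute [reducible] hi lo upper dup splits trim fst snd

theorem trim_a (s : Seg) : s.trim.a = s.a := by unfold trim; cases s.splits <;> rfl
theorem trim_b (s : Seg) : s.trim.b = s.b := by unfold trim; cases s.splits <;> rfl

theorem height_trim (s : Seg) : s.trim.g.height ≤ s.g.height := by
  unfold trim
  cases s.splits
  · exact (PW.height_child _ _).trans (Nat.sub_le _ _)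
  · exact le_rfl

theorem height_fst (s : Seg) : s.fst.g.height ≤ s.g.height - 1 := by
  unfold fst
  cases s.splits
  · exact PW.height_child _ _
  · exact PW.height_left _

theorem height_snd (s : Seg) : s.snd.g.height ≤ s.g.height - 1 := by
  unfold snd
  cases s.splits
  · exact Nat.zero_le _
  · exact PW.height_right _

/-- The segment is a part of the chain of `N` from `l` to `h`; its tree contains vertices
outside only at the ends of the chain. -/
structure Ok (N : Set V) (l h : V) (s : Seg) : Prop where
  a_mem : s.a ∈ N
  b_mem : s.b ∈ N
  le_a : l.key ≤ s.a.key
  lt : s.a.key < s.b.key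
  b_le : s.b.key ≤ h.key
  gap : Gap N s.a s.g s.b
  pure_a : s.a = l ∨ ∀ v ∈ s.g.toList, s.a.key ≤ v.key
  pure_b : s.b = h ∨ ∀ v ∈ s.g.toList, v.key < s.b.key

variable {N : Set V} {l h : V} {s : Seg}

theorem Ok.nondeg (hs : s.Ok N l h) : s.nondeg = true := ltB_iff.2 hs.lt

theorem dup_nondeg (v : V) : (dup v).nondeg = false := by simp [Seg.nondeg]

theorem mem_child {c : ℝ} {G : Tree} {v : V} (hv : v ∈ (PW.child c G).toList) : v ∈ G.toList := by
  cases G with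
  | nil => unfold PW.child at hv; cases h : leB Tree.nil.root.key c <;> rw [h] at hv <;> exact hv
  | node l r x =>
    unfold PW.child at hv
    cases h : leB (Tree.node l r x).root.key c <;> rw [h] at hv <;>
      simp only [cond_true, cond_false, Tree.left, Tree.right] at hv <;> simp [Tree.toList, hv]

theorem Ok.splits (hs : s.Ok N l h) (hsp : s.splits = true) :
    s.fst.Ok N l h ∧ s.snd.Ok N l h := by
  unfold fst snd
  rw [hsp, cond_true, cond_true]
  simp only [Seg.splits, Bool.and_eq_true, Bool.not_eq_true', ltB_iff] at hsp
  obtain ⟨h1, h2, h3⟩ := hsp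
  obtain ⟨m1, m2, k1, k2, k3, gap, p1, p2⟩ := hs
  have hn := PW.eq_node h1
  rw [hn] at gap p1 p2
  have hm := gap.root_mem
  obtain ⟨-, -, s3, s4, -⟩ := Tree.sorted_node.1 gap.sorted
  exact ⟨⟨m1, hm, k1, h2, h3.le.trans k3, gap.left h3.le,
    p1.imp_right fun p v hv => p v (by simp [Tree.toList, hv]), .inr s3⟩,
    ⟨hm, m2, k1.trans h2.le, h3, k3, gap.right h2.le, .inr fun v hv => (s4 v hv).le,
      p2.imp_right fun p v hv => p v (by simp [Tree.toList, hv])⟩⟩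

theorem Ok.child (hs : s.Ok N l h) (hsp : s.splits = false) :
    Ok N l h ⟨s.a, PW.child s.a.key s.g, s.b⟩ :=
  ⟨hs.a_mem, hs.b_mem, hs.le_a, hs.lt, hs.b_le, PW.gap_child hs.gap hsp,
    hs.pure_a.imp_right fun p v hv => p v (mem_child hv),
    hs.pure_b.imp_right fun p v hv => p v (mem_child hv)⟩

theorem Ok.trim (hs : s.Ok N l h) : s.trim.Ok N l h := by
  unfold Seg.trim
  cases hsp : s.splits with
  | true => exact hs
  | false => exact hs.child hsp

theorem child_nil (c : ℝ) : PW.child c .nil = .nil := by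
  unfold PW.child; cases leB Tree.nil.root.key c <;> rfl

/-- Only at the ends of the chain a trimmed segment need not split. -/
theorem Ok.trim_splits (hs : s.Ok N l h) (hsp : s.trim.splits = false) :
    s.trim.g = .nil ∨ s.a = l ∨ s.b = h := by
  by_contra! hc
  obtain ⟨c1, c2, c3⟩ := hc
  have key : ∀ r : Seg, r.Ok N l h → r.a ≠ l → r.b ≠ h → r.g ≠ .nil → r.splits = false →
      ∃ l' r', r.g = .node l' r.g.root r' ∧ r.g.root.key = r.a.key := by
    intro r hr h1 h2 h3 h4
    have hn : r.g.isNil = false := by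
      cases hg : r.g with
      | nil => exact absurd hg h3
      | node => rfl
    have hm : r.g.root ∈ r.g.toList := by rw [PW.eq_node hn]; simp [Tree.toList, Tree.root]
    refine ⟨_, _, PW.eq_node hn, le_antisymm ?_ (hr.pure_a.resolve_left h1 _ hm)⟩
    have h5 := hr.pure_b.resolve_left h2 _ hm
    simp only [Seg.splits, hn, ltB_iff.2 h5, Bool.not_false, Bool.true_and, Bool.and_true,
      ltB_false] at h4
    exact h4
  unfold Seg.trim at hsp c1
  cases h0 : s.splits with
  | true => simp [h0] at hsp
  | false =>
    rw [h0, cond_false] at hsp c1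
    obtain ⟨l', r', e1, e2⟩ := key s hs c2 c3 (fun h => c1 (by simp only [h]; exact child_nil _)) h0
    obtain ⟨l₂, r₂, e3, e4⟩ := key _ (hs.child h0) c2 c3 c1 hsp
    have hm : (PW.child s.a.key s.g).root ∈ (PW.child s.a.key s.g).toList := by
      simp only at e3; rw [e3]; simp [Tree.toList, Tree.root]
    have h1 : PW.child s.a.key s.g = r' := by
      unfold PW.child
      rw [leB_iff.2 e2.le, e1]; rfl
    have h2 := (Tree.sorted_node.1 (e1 ▸ hs.gap.sorted)).2.2.2.1 _ (h1 ▸ hm)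
    rw [h1] at e4
    simp only at e4
    linarith

theorem Ok.not_splits (hs : s.Ok N l h) (hsp : s.trim.splits = false) :
    s.trim.fst.Ok N l h ∧ s.trim.fst.a = s.a ∧ s.trim.fst.b = s.b ∧ s.trim.snd = dup s.b ∧
      (s.trim.fst.g = .nil ∨ s.a = l ∨ s.b = h) := by
  unfold fst snd
  rw [hsp, cond_false, cond_false, trim_b]
  have := hs.trim.child hsp
  refine ⟨by rwa [trim_b] at this, trim_a s, rfl, rfl, (hs.trim_splits hsp).imp_left fun h => ?_⟩
  simp only [h]; exact child_nil _

/-- Consecutive segments, some of them degenerate. -/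
def Chain (N : Set V) (l h : V) : V → List Seg → V → Prop
  | a, [], b => a = b
  | a, s :: t, b => s.a = a ∧ (s.Ok N l h ∨ s = dup a) ∧ Chain N l h s.b t b

theorem chain_append {a b : V} {s t : List Seg} :
    Chain N l h a (s ++ t) b ↔ ∃ m, Chain N l h a s m ∧ Chain N l h m t b := by
  induction s generalizing a with
  | nil => simp [Chain]
  | cons x s ih =>
    simp only [List.cons_append, Chain, ih]
    exact ⟨fun ⟨h1, h2, m, h3, h4⟩ => ⟨m, ⟨h1, h2, h3⟩, h4⟩,
      fun ⟨m, ⟨h1, h2, h3⟩, h4⟩ => ⟨h1, h2, m, h3, h4⟩⟩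

/-- The nondegenerate parts of segments. -/
def parts (t : List Seg) : List Seg :=
  (t.flatMap fun s => [s.trim.fst, s.trim.snd]).filter Seg.nondeg

theorem parts_cons (s : Seg) (t : List Seg) : parts (s :: t) = parts [s] ++ parts t := by
  rw [parts, parts, parts, ← List.filter_append]
  simp

theorem parts_dup (v : V) : parts [dup v] = [] := by
  simp [parts, dup, trim, fst, snd, splits, Tree.isNil, Seg.nondeg, child_nil]

theorem Ok.parts_splits (hs : s.Ok N l h) (hsp : s.trim.splits = true) :
    parts [s] = [s.trim.fst, s.trim.snd] := by
  obtain ⟨h1, h2⟩ := hs.trim.splits hsp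
  simp [parts, h1.nondeg, h2.nondeg]

theorem Ok.parts_not_splits (hs : s.Ok N l h) (hsp : s.trim.splits = false) :
    parts [s] = [s.trim.fst] := by
  obtain ⟨h1, -, -, h4, -⟩ := hs.not_splits hsp
  simp [parts, h1.nondeg, h4, dup_nondeg]

theorem Ok.chain_parts (hs : s.Ok N l h) : Chain N l h s.a (parts [s]) s.b ∧
    ∀ t ∈ parts [s], t.Ok N l h := by
  cases hsp : s.trim.splits with
  | true =>
    obtain ⟨h1, h2⟩ := hs.trim.splits hsp
    rw [hs.parts_splits hsp]
    have e1 : s.trim.fst.a = s.a := by simp [fst, hsp, trim_a]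
    have e2 : s.trim.snd.a = s.trim.fst.b := by simp [fst, snd, hsp]
    have e3 : s.trim.snd.b = s.b := by simp [snd, hsp, trim_b]
    exact ⟨⟨e1, .inl h1, e2, .inl h2, e3⟩, by simp [h1, h2]⟩
  | false =>
    obtain ⟨h1, h2, h3, h4, -⟩ := hs.not_splits hsp
    rw [hs.parts_not_splits hsp]
    exact ⟨⟨h2, .inl h1, h3⟩, by simp [h1]⟩

theorem chain_parts {a b : V} {t : List Seg} (ht : Chain N l h a t b) :
    Chain N l h a (parts t) b ∧ ∀ s ∈ parts t, s.Ok N l h := by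
  induction t generalizing a with
  | nil => exact ⟨ht, by simp [parts]⟩
  | cons s t ih =>
    obtain ⟨h1, h2, h3⟩ := ht
    obtain ⟨i1, i2⟩ := ih h3
    rw [parts_cons]
    rcases h2 with h2 | h2
    · obtain ⟨j1, j2⟩ := h2.chain_parts
      refine ⟨chain_append.2 ⟨s.b, h1 ▸ j1, i1⟩, ?_⟩
      simpa [or_imp, forall_and] using ⟨j2, i2⟩
    · subst h2
      rw [parts_dup]
      exact ⟨i1, i2⟩

theorem chain_le {a b : V} {t : List Seg} (ht : Chain N l h a t b) : a.key ≤ b.key := by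
  induction t generalizing a with
  | nil => exact (congrArg V.key ht).le
  | cons s t ih =>
    obtain ⟨h1, h2, h3⟩ := ht
    have := ih h3
    rcases h2 with h2 | h2
    · have := h2.lt; rw [h1] at this; linarith
    · subst h2; exact this

theorem chain_mem {a b : V} {t : List Seg} (ht : Chain N l h a t b) {s : Seg} (hs : s ∈ t) :
    a.key ≤ s.a.key ∧ s.b.key ≤ b.key := by
  induction t generalizing a with
  | nil => simp at hs
  | cons x t ih =>
    obtain ⟨h1, h2, h3⟩ := ht
    have h5 := chain_le h3
    have h4 : a.key ≤ x.b.key := by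
      rcases h2 with h2 | h2
      · have := h2.lt; rw [h1] at this; linarith
      · subst h2; exact le_rfl
    rcases List.mem_cons.1 hs with rfl | hs
    · exact ⟨by rw [h1], h5⟩
    · obtain ⟨h6, h7⟩ := ih h3 hs
      exact ⟨h4.trans h6, h7⟩

/-- The first part. -/
theorem parts_head {a b : V} {t : List Seg} (ht : Chain N l h a t b) {s : Seg} (hs : s ∈ t)
    (hok : s.Ok N l h) : ∃ x y, parts t = x :: y ∧ x.a = a ∧ x.b.key ≤ s.b.key ∧
      (x.g = .nil ∨ a = l ∨ x.b = h ∨ ∃ x' y', y = x' :: y' ∧ x'.b.key ≤ s.b.key) := by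
  induction t generalizing a with
  | nil => simp at hs
  | cons x t ih =>
    obtain ⟨h1, h2, h3⟩ := ht
    rw [parts_cons]
    rcases h2 with h2 | h2
    · have hle : x.b.key ≤ s.b.key := by
        rcases List.mem_cons.1 hs with rfl | hs
        · exact le_rfl
        · exact (chain_mem h3 hs).1.trans hok.lt.le
      cases hsp : x.trim.splits with
      | true =>
        obtain ⟨h4, h5⟩ := h2.trim.splits hsp
        rw [h2.parts_splits hsp]
        have e1 : x.trim.fst.a = x.a := by simp [fst, hsp, trim_a]
        have e2 : x.trim.snd.a = x.trim.fst.b := by simp [fst, snd, hsp]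
        have e3 : x.trim.snd.b = x.b := by simp [snd, hsp, trim_b]
        have := h5.lt
        rw [e2, e3] at this
        exact ⟨_, _, rfl, e1.trans h1, this.le.trans hle,
          .inr (.inr (.inr ⟨_, _, rfl, by rw [e3]; exact hle⟩))⟩
      | false =>
        obtain ⟨h4, h5, h6, h7, h8⟩ := h2.not_splits hsp
        rw [h2.parts_not_splits hsp]
        refine ⟨_, _, rfl, h5.trans h1, by rw [h6]; exact hle, ?_⟩
        rw [h1] at h8
        rw [h6]
        tauto
    · subst h2
      rw [parts_dup]
      rcases List.mem_cons.1 hs with rfl | hs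
      · exact absurd hok.nondeg (by simp [dup_nondeg])
      · exact ih h3 hs

/-- The last part. -/
theorem parts_last {a b : V} {t : List Seg} (ht : Chain N l h a t b) {s : Seg} (hs : s ∈ t)
    (hok : s.Ok N l h) : ∃ x y, parts t = y ++ [x] ∧ x.b = b ∧ s.a.key ≤ x.a.key ∧
      (x.g = .nil ∨ b = h ∨ x.a = l ∨ ∃ x' y', y = y' ++ [x'] ∧ s.a.key ≤ x'.a.key) := by
  induction t using List.reverseRecOn generalizing b with
  | nil => simp at hs
  | append_singleton t x ih =>
    obtain ⟨m, h3, h1, h2, h4⟩ := chain_append.1 ht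
    have hp : parts (t ++ [x]) = parts t ++ parts [x] := by simp [parts, List.filter_append]
    rw [hp]
    have h4 : x.b = b := h4
    rcases h2 with h2 | h2
    · have hle : s.a.key ≤ x.a.key := by
        rcases List.mem_append.1 hs with hs | hs
        · rw [h1]; exact hok.lt.le.trans (chain_mem h3 hs).2
        · rw [List.mem_singleton.1 hs]
      cases hsp : x.trim.splits with
      | true =>
        obtain ⟨h5, h6⟩ := h2.trim.splits hsp
        rw [h2.parts_splits hsp]
        have e1 : x.trim.fst.a = x.a := by simp [fst, hsp, trim_a]
        have e2 : x.trim.snd.a = x.trim.fst.b := by simp [fst, snd, hsp]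
        have e3 : x.trim.snd.b = x.b := by simp [snd, hsp, trim_b]
        have := h5.lt
        rw [e1, ← e2] at this
        exact ⟨x.trim.snd, parts t ++ [x.trim.fst], by simp, e3.trans h4, hle.trans this.le,
          .inr (.inr (.inr ⟨_, _, rfl, by rw [e1]; exact hle⟩))⟩
      | false =>
        obtain ⟨h5, h6, h7, h8, h9⟩ := h2.not_splits hsp
        rw [h2.parts_not_splits hsp]
        refine ⟨_, _, rfl, h7.trans h4, by rw [h6]; exact hle, ?_⟩
        rw [h4] at h9
        rw [h6]
        tauto
    · subst h2
      rw [parts_dup, List.append_nil]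
      rcases List.mem_append.1 hs with hs | hs
      · obtain rfl : m = b := h4
        exact ih h3 hs
      · rw [List.mem_singleton.1 hs] at hok
        exact absurd hok.nondeg (by simp [dup_nondeg])

end Seg

/-! ## Selecting segments -/

/-- Five consecutive segments. -/
structure Segs where
  s0 : Seg
  s1 : Seg
  s2 : Seg
  s3 : Seg
  s4 : Seg

instance : Enc Segs := Enc.via (fun w : Segs => (w.s0, w.s1, w.s2, w.s3, w.s4))

namespace Segs

theorem comp_tup : Comp L k (fun w : Segs => (w.s0, w.s1, w.s2, w.s3, w.s4)) := Comp.via_to _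
@[fun_prop] theorem comp_s0 : Comp L k Segs.s0 := Comp.fst.comp' comp_tup
@[fun_prop] theorem comp_s1 : Comp L k Segs.s1 := (Comp.fst.comp' Comp.snd).comp' comp_tup
@[fun_prop] theorem comp_s2 : Comp L k Segs.s2 :=
  (Comp.fst.comp' (Comp.snd.comp' Comp.snd)).comp' comp_tup
@[fun_prop] theorem comp_s3 : Comp L k Segs.s3 :=
  (Comp.fst.comp' (Comp.snd.comp' (Comp.snd.comp' Comp.snd))).comp' comp_tup
@[fun_prop] theorem comp_s4 : Comp L k Segs.s4 :=
  (Comp.snd.comp' (Comp.snd.comp' (Comp.snd.comp' Comp.snd))).comp' comp_tup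
@[fun_prop] theorem comp_mk : Comp L k (fun z : Seg × Seg × Seg × Seg × Seg =>
    Segs.mk z.1 z.2.1 z.2.2.1 z.2.2.2.1 z.2.2.2.2) :=
  .via_of (fun w : Segs => (w.s0, w.s1, w.s2, w.s3, w.s4)) _ fun _ => rfl

def list (w : Segs) : List Seg := [w.s0, w.s1, w.s2, w.s3, w.s4]

/-- The largest height of a tree. -/
def eta (w : Segs) : ℕ :=
  max w.s0.g.height (max w.s1.g.height (max w.s2.g.height (max w.s3.g.height w.s4.g.height)))

theorem eta_le {w : Segs} {n : ℕ} : w.eta ≤ n ↔ ∀ s ∈ w.list, s.g.height ≤ n := by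
  simp [eta, list]

/-- One step of the selection; the flags tell which of the last two segments have been found. -/
def push (x : ℝ) (w : Segs × Bool × Bool) (s : Seg) : Segs × Bool × Bool :=
  bif !s.nondeg || w.2.2 then w
  else bif w.2.1 then (⟨w.1.s0, w.1.s1, w.1.s2, w.1.s3, s⟩, true, true)
  else bif s.upper x then (⟨w.1.s0, w.1.s1, w.1.s2, s, w.1.s4⟩, true, false)
  else (⟨w.1.s1, w.1.s2, s, w.1.s3, w.1.s4⟩, false, false)

/-- The first part that is above `x`, the next one, and the last three parts before. -/
def select (x : ℝ) (w : Segs) : Segs :=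
  ((w.list.flatMap fun s => [s.trim.fst, s.trim.snd]).foldl (push x)
    (⟨.dup w.s0.a, .dup w.s0.a, .dup w.s0.a, .dup w.s4.b, .dup w.s4.b⟩, false, false)).1

@[fun_prop] theorem comp_push : Comp L k
    (fun z : ℝ × (Segs × Bool × Bool) × Seg => push z.1 z.2.1 z.2.2) := by unfold push; fun_prop

@[fun_prop]
theorem comp_select {x : α → ℝ} {w : α → Segs} (hx : Comp L k x) (hw : Comp L k w) :
    Comp L k (fun z => select (x z) (w z)) := by
  simp only [select, list, List.flatMap_cons, List.flatMap_nil, List.append_nil, List.cons_append,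
    List.nil_append, List.foldl_cons, List.foldl_nil]
  fun_prop

/-- The segments before the first one above `x`, and the others. -/
structure Split (x : ℝ) (z z' : V) (w : Segs) (l₁ l₂ : List Seg) : Prop where
  not_upper : ∀ s ∈ l₁, s.upper x = false
  front : (l₁ = [] ∧ w.s0 = .dup z ∧ w.s1 = .dup z ∧ w.s2 = .dup z) ∨
    (∃ p, l₁ = [p] ∧ w.s0 = .dup z ∧ w.s1 = .dup z ∧ w.s2 = p) ∨
    (∃ p q, l₁ = [p, q] ∧ w.s0 = .dup z ∧ w.s1 = p ∧ w.s2 = q) ∨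
    ∃ t o p q, l₁ = t ++ [o, p, q] ∧ w.s0 = o ∧ w.s1 = p ∧ w.s2 = q
  back : (l₂ = [] ∧ w.s3 = .dup z' ∧ w.s4 = .dup z') ∨
    (∃ u, l₂ = [u] ∧ u.upper x = true ∧ w.s3 = u ∧ w.s4 = .dup z') ∨
    ∃ u v t, l₂ = u :: v :: t ∧ u.upper x = true ∧ w.s3 = u ∧ w.s4 = v

/-- Invariant: of the nondegenerate parts read so far, `l₁` are those before the first one above `x`
and `l₂` those from it on. The five places hold the last three of `l₁` and the first two of `l₂`,
and the flags say how many of the latter exist. -/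
theorem foldl_push (x : ℝ) (z z' : V) (t : List Seg) : ∀ (w : Segs × Bool × Bool)
    (l₁ l₂ : List Seg), Split x z z' w.1 l₁ l₂ →
    (w.2.1 = match l₂ with | [] => false | _ => true) →
    (w.2.2 = match l₂ with | _ :: _ :: _ => true | _ => false) →
    ∃ l₁' l₂', l₁' ++ l₂' = l₁ ++ l₂ ++ t.filter Seg.nondeg ∧
      Split x z z' (t.foldl (push x) w).1 l₁' l₂' := by
  induction t with
  | nil => exact fun w l₁ l₂ h _ _ => ⟨l₁, l₂, by simp, h⟩
  | cons s t ih =>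
    intro w l₁ l₂ h h3 h4
    rw [List.foldl_cons]
    cases hs : s.nondeg with
    | false =>
      have : push x w s = w := by simp [push, hs]
      rw [this, List.filter_cons_of_neg (by simp [hs])]
      exact ih w l₁ l₂ h h3 h4
    | true =>
      rw [List.filter_cons_of_pos hs]
      match l₂, h, h3, h4 with
      | [], h, h3, h4 =>
        cases hu : s.upper x with
        | true =>
          obtain ⟨l₁', l₂', e, h'⟩ := ih (push x w s) l₁ [s] (by
            have : push x w s = (⟨w.1.s0, w.1.s1, w.1.s2, s, w.1.s4⟩, true, false) := by
              simp [push, hs, hu, h3, h4]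
            rw [this]
            refine ⟨h.not_upper, h.front, .inr (.inl ⟨s, rfl, hu, rfl, ?_⟩)⟩
            rcases h.back with ⟨_, _, h⟩ | ⟨_, h, _⟩ | ⟨_, _, _, h, _⟩
            · exact h
            · simp at h
            · simp at h) (by simp [push, hs, hu, h3, h4]) (by simp [push, hs, hu, h3, h4])
          exact ⟨l₁', l₂', by rw [e]; simp, h'⟩
        | false =>
          obtain ⟨l₁', l₂', e, h'⟩ := ih (push x w s) (l₁ ++ [s]) [] (by
            have : push x w s = (⟨w.1.s1, w.1.s2, s, w.1.s3, w.1.s4⟩, false, false) := by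
              simp [push, hs, hu, h3, h4]
            rw [this]
            refine ⟨?_, ?_, ?_⟩
            · intro r hr
              rcases List.mem_append.1 hr with hr | hr
              · exact h.not_upper r hr
              · rw [List.mem_singleton.1 hr]; exact hu
            · rcases h.front with ⟨e1, e2, e3, e4⟩ | ⟨p, e1, e2, e3, e4⟩ | ⟨p, q, e1, e2, e3, e4⟩ |
                ⟨t, o, p, q, e1, e2, e3, e4⟩
              · exact .inr (.inl ⟨s, by simp [e1], e3, e4, rfl⟩)
              · exact .inr (.inr (.inl ⟨p, s, by simp [e1], e3, e4, rfl⟩))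
              · exact .inr (.inr (.inr ⟨[], p, q, s, by simp [e1], e3, e4, rfl⟩))
              · exact .inr (.inr (.inr ⟨t ++ [o], p, q, s, by simp [e1], e3, e4, rfl⟩))
            · rcases h.back with ⟨_, h1, h2⟩ | ⟨_, h, _⟩ | ⟨_, _, _, h, _⟩
              · exact .inl ⟨rfl, h1, h2⟩
              · simp at h
              · simp at h) (by simp [push, hs, hu, h3, h4]) (by simp [push, hs, hu, h3, h4])
          exact ⟨l₁', l₂', by rw [e]; simp, h'⟩
      | [u], h, h3, h4 =>
        obtain ⟨l₁', l₂', e, h'⟩ := ih (push x w s) l₁ [u, s] (by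
          have : push x w s = (⟨w.1.s0, w.1.s1, w.1.s2, w.1.s3, s⟩, true, true) := by
            simp [push, hs, h3, h4]
          rw [this]
          refine ⟨h.not_upper, h.front, .inr (.inr ⟨u, s, [], rfl, ?_⟩)⟩
          rcases h.back with ⟨h, _⟩ | ⟨v, e, h1, h2, h3⟩ | ⟨_, _, _, h, _⟩
          · simp at h
          · obtain rfl : u = v := by simpa using e
            exact ⟨h1, h2, rfl⟩
          · simp at h) (by simp [push, hs, h3, h4]) (by simp [push, hs, h3, h4])
        exact ⟨l₁', l₂', by rw [e]; simp, h'⟩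
      | u :: v :: r, h, h3, h4 =>
        obtain ⟨l₁', l₂', e, h'⟩ := ih (push x w s) l₁ (u :: v :: r ++ [s]) (by
          have : push x w s = w := by simp [push, h4]
          rw [this]
          refine ⟨h.not_upper, h.front, .inr (.inr ⟨u, v, r ++ [s], rfl, ?_⟩)⟩
          rcases h.back with ⟨h, _⟩ | ⟨_, h, _⟩ | ⟨u', v', r', e, h1, h2, h3⟩
          · simp at h
          · simp at h
          · simp only [List.cons.injEq] at e
            rw [e.1, e.2.1]
            exact ⟨h1, h2, h3⟩) (by simp [push, h3, h4]) (by simp [push, h4])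
        exact ⟨l₁', l₂', by rw [e]; simp, h'⟩

theorem select_split (x : ℝ) (w : Segs) : ∃ l₁ l₂, Seg.parts w.list = l₁ ++ l₂ ∧
    Split x w.s0.a w.s4.b (w.select x) l₁ l₂ := by
  obtain ⟨l₁, l₂, e, h⟩ := foldl_push x w.s0.a w.s4.b (w.list.flatMap fun s => [s.trim.fst, s.trim.snd])
    (⟨.dup w.s0.a, .dup w.s0.a, .dup w.s0.a, .dup w.s4.b, .dup w.s4.b⟩, false, false) [] []
    ⟨by simp, .inl ⟨rfl, rfl, rfl, rfl⟩, .inl ⟨rfl, rfl, rfl⟩⟩ rfl rfl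
  exact ⟨l₁, l₂, by simpa [Seg.parts] using e.symm, h⟩

theorem Split.mem {x : ℝ} {z z' : V} {w : Segs} {l₁ l₂ : List Seg} (h : Split x z z' w l₁ l₂) :
    ∀ s ∈ w.list, s ∈ l₁ ++ l₂ ∨ s = .dup z ∨ s = .dup z' := by
  simp only [list, List.mem_cons, List.not_mem_nil, or_false, List.mem_append]
  rintro s (rfl | rfl | rfl | rfl | rfl)
  · rcases h.front with ⟨e1, e2, e3, e4⟩ | ⟨p, e1, e2, e3, e4⟩ | ⟨p, q, e1, e2, e3, e4⟩ |
      ⟨t, o, p, q, e1, e2, e3, e4⟩ <;> simp [e1, e2]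
  · rcases h.front with ⟨e1, e2, e3, e4⟩ | ⟨p, e1, e2, e3, e4⟩ | ⟨p, q, e1, e2, e3, e4⟩ |
      ⟨t, o, p, q, e1, e2, e3, e4⟩ <;> simp [e1, e3]
  · rcases h.front with ⟨e1, e2, e3, e4⟩ | ⟨p, e1, e2, e3, e4⟩ | ⟨p, q, e1, e2, e3, e4⟩ |
      ⟨t, o, p, q, e1, e2, e3, e4⟩ <;> simp [e1, e4]
  · rcases h.back with ⟨e1, e2, e3⟩ | ⟨u, e1, e2, e3, e4⟩ | ⟨u, v, t, e1, e2, e3, e4⟩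
    · simp [e2]
    · simp [e1, e3]
    · simp [e1, e3]
  · rcases h.back with ⟨e1, e2, e3⟩ | ⟨u, e1, e2, e3, e4⟩ | ⟨u, v, t, e1, e2, e3, e4⟩
    · simp [e3]
    · simp [e4]
    · simp [e1, e4]

/-- Every selected segment is degenerate or a part of an old one, with a subtree below the old root;
this pays for the step. -/
theorem eta_select (x : ℝ) (w : Segs) : (w.select x).eta ≤ w.eta - 1 := by
  obtain ⟨l₁, l₂, e, h⟩ := select_split x w
  rw [eta_le]
  intro s hs
  rcases h.mem s hs with h | rfl | rfl
  · rw [← e, Seg.parts, List.mem_filter, List.mem_flatMap] at h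
    obtain ⟨⟨r, hr, h⟩, -⟩ := h
    have h1 := eta_le.1 (le_refl w.eta) r hr
    have h2 := r.trim.height_fst
    have h3 := r.trim.height_snd
    have h5 := r.height_trim
    simp only [List.mem_cons, List.not_mem_nil, or_false] at h
    rcases h with rfl | rfl <;> omega
  · exact Nat.zero_le _
  · exact Nat.zero_le _

end Segs

/-! ## Windows -/

/-- Consecutive segments with a lower and an upper bound for the sought position. -/
structure Win where
  w : Segs
  c : V
  e : V

def Win.tup (s : Win) : Segs × V × V := (s.w, s.c, s.e)

instance : Enc Win := Enc.via Win.tup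

namespace Win

theorem comp_tup : Comp L k Win.tup := Comp.via_to _
@[fun_prop] theorem comp_w : Comp L k Win.w := Comp.fst.comp' comp_tup
@[fun_prop] theorem comp_c : Comp L k Win.c := (Comp.fst.comp' Comp.snd).comp' comp_tup
@[fun_prop] theorem comp_e : Comp L k Win.e := (Comp.snd.comp' Comp.snd).comp' comp_tup
@[fun_prop] theorem comp_mk : Comp L k (fun z : Segs × V × V => Win.mk z.1 z.2.1 z.2.2) :=
  .via_of Win.tup _ fun _ => rfl

/-- The segment for a test that is to show that the position is low. -/
def low (y : ℝ) (w : Segs) : Seg := bif w.s2.nondeg && ltB w.s2.lo.x y then w.s2 else w.s1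

/-- If the first part above `x` also has its low bound before `y`, then it serves for both answers
of the test. -/
def inner (y : ℝ) (w : Segs) : Bool := w.s3.nondeg && ltB w.s3.lo.x y

/-- The window around the positions between `x` and `y`. -/
def refine (x y : ℝ) (S : Win) : Win :=
  ⟨S.w.select x, (low y (S.w.select x)).hi, (S.w.select x).s3.lo⟩

attribute [reducible] low inner refine

/-- The window belongs to the chain of `N` from `l` to `h`. -/
structure Ok (N : Set V) (l h : V) (S : Win) : Prop where
  chain : Seg.Chain N l h S.w.s0.a S.w.list S.w.s4.b
  e : (S.e = h ∧ S.w.s4.b = h) ∨ ∃ s ∈ S.w.list, s.Ok N l h ∧ s.a = S.e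
  c : (S.c = l ∧ S.w.s0.a = l) ∨ ∃ s ∈ S.w.list, s.Ok N l h ∧ s.b = S.c

/-- The abscissa is increasing along the chain. -/
def Mono (N : Set V) (l h : V) : Prop := ∀ u ∈ N, ∀ v ∈ N, l.key ≤ u.key → u.key < v.key →
  v.key ≤ h.key → u.x < v.x

variable {N : Set V} {l h : V} {s : Seg}

theorem Mono.lt (hm : Mono N l h) (hs : s.Ok N l h) : s.a.x < s.b.x :=
  hm _ hs.a_mem _ hs.b_mem hs.le_a hs.lt hs.b_le

theorem Mono.le (hm : Mono N l h) {u v : V} (hu : u ∈ N) (hv : v ∈ N) (h1 : l.key ≤ u.key)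
    (h2 : u.key ≤ v.key) (h3 : v.key ≤ h.key) (hN : ∀ u ∈ N, ∀ v ∈ N, u.key = v.key → u = v) :
    u.x ≤ v.x := by
  rcases h2.eq_or_lt with e | h2
  · rw [hN u hu v hv e]
  · exact (hm u hu v hv h1 h2 h3).le

theorem Mono.lo_hi (hm : Mono N l h) (hs : s.Ok N l h) :
    s.a.x ≤ s.lo.x ∧ s.lo.x ≤ s.b.x ∧ s.a.x ≤ s.hi.x ∧ s.hi.x ≤ s.b.x := by
  have := hm.lt hs
  unfold Seg.lo Seg.hi lb hb
  cases s.g.isNil <;> simp [this.le]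

theorem hi_of_nil (h : s.g = .nil) : s.hi = s.b := by simp [Seg.hi, hb, h, Tree.isNil]
theorem lo_of_nil (h : s.g = .nil) : s.lo = s.a := by simp [Seg.lo, lb, h, Tree.isNil]
theorem hi_cases (s : Seg) : s.g = .nil ∧ s.hi = s.b ∧ s.lo = s.a ∨ s.hi = s.a ∧ s.lo = s.b := by
  cases hg : s.g with
  | nil => exact .inl ⟨rfl, hi_of_nil hg, lo_of_nil hg⟩
  | node => right; simp [Seg.hi, Seg.lo, hb, lb, hg, Tree.isNil]

section
open Segs
variable {x y : ℝ} {z z' m : V} {w : Segs} {l₁ l₂ : List Seg}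

theorem front_chain (hs : Split x z z' w l₁ l₂) (h₁ : Seg.Chain N l h z l₁ m) :
    Seg.Chain N l h w.s0.a [w.s0, w.s1, w.s2] m := by
  rcases hs.front with ⟨rfl, e2, e3, e4⟩ | ⟨p, rfl, e2, e3, e4⟩ | ⟨p, q, rfl, e2, e3, e4⟩ |
    ⟨t, o, p, q, rfl, e2, e3, e4⟩
  · rw [e2, e3, e4]
    exact ⟨rfl, .inr rfl, rfl, .inr rfl, rfl, .inr rfl, h₁⟩
  · rw [e2, e3, e4]
    exact ⟨rfl, .inr rfl, rfl, .inr rfl, h₁⟩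
  · rw [e2, e3, e4]
    exact ⟨rfl, .inr rfl, h₁⟩
  · rw [e2, e3, e4]
    obtain ⟨m', -, h1, h2⟩ := Seg.chain_append.1 h₁
    exact ⟨rfl, by rw [h1]; exact h2.1, h2.2⟩

theorem back_chain (hs : Split x z z' w l₁ l₂) (h₂ : Seg.Chain N l h m l₂ z') :
    Seg.Chain N l h m [w.s3, w.s4] w.s4.b := by
  rcases hs.back with ⟨rfl, e1, e2⟩ | ⟨u, rfl, e1, e2, e3⟩ | ⟨u, v, t, rfl, e1, e2, e3⟩
  · rw [e1, e2]
    obtain rfl : m = z' := h₂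
    exact ⟨rfl, .inr rfl, rfl, .inr rfl, rfl⟩
  · rw [e2, e3]
    obtain ⟨h1, h2, rfl⟩ := h₂
    exact ⟨h1, h2, rfl, .inr rfl, rfl⟩
  · rw [e2, e3]
    exact ⟨h₂.1, h₂.2.1, h₂.2.2.1, h₂.2.2.2.1, rfl⟩

/-- What is known about a refined window. -/
structure RefineSpec (N : Set V) (l h : V) (x y : ℝ) (S : Win) : Prop where
  ok : (S.refine x y).Ok N l h
  upper : (S.refine x y).w.s3.nondeg = true → (S.refine x y).w.s3.Ok N l h ∧
    x < (S.refine x y).w.s3.hi.x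
  end_eq : (S.refine x y).w.s3.nondeg = false → (S.refine x y).e = h
  low : (Win.low y (S.refine x y).w).nondeg = true → (Win.low y (S.refine x y).w).Ok N l h ∧
    (Win.low y (S.refine x y).w).hi.x ≤ x ∧ (Win.low y (S.refine x y).w).lo.x < y
  start_eq : (Win.low y (S.refine x y).w).nondeg = false → (S.refine x y).c = l
  e_ge : Win.inner y (S.refine x y).w = false → y ≤ (S.refine x y).e.x
  c_le : (S.refine x y).c.x ≤ x
  eta_pos : Win.inner y (S.refine x y).w = false → 0 < S.w.eta

/-- The last part before `x` may have its low bound only after `y`, so the one before it must be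
kept for the low test. One further part at each side keeps a segment that ends at `c` and one that
begins at `e`, unless the chain ends there; these witnesses guarantee at the next refinement that
the selection is not cut off inside the chain. -/
theorem Ok.refine {S : Win} (hS : S.Ok N l h) (hm : Mono N l h)
    (hN : ∀ u ∈ N, ∀ v ∈ N, u.key = v.key → u = v) (hxy : x < y)
    (hc : S.c.x ≤ x) (he : y ≤ S.e.x) (hlx : l.x ≤ x) (hhy : y ≤ h.x) :
    RefineSpec N l h x y S := by
  obtain ⟨l₁, l₂, hp, hs⟩ := select_split x S.w
  obtain ⟨hch, hok⟩ := Seg.chain_parts hS.chain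
  rw [hp] at hch hok
  obtain ⟨m, hch₁, hch₂⟩ := Seg.chain_append.1 hch
  have hf := front_chain hs hch₁
  have hbk := back_chain hs hch₂
  have nu : ∀ s ∈ l₁, s.hi.x ≤ x := fun s h => by
    have := hs.not_upper s h
    simpa [Seg.upper] using this
  -- parts on the left and on the right
  have left_of : ∀ s ∈ l₁ ++ l₂, s.b.x ≤ x → s.upper x = false := fun s h1 h2 => by
    have := (hm.lo_hi (hok s h1)).2.2.2
    simp only [Seg.upper, ltB_false]; linarith
  have right_of : ∀ s ∈ l₁ ++ l₂, y ≤ s.a.x → s ∉ l₁ := fun s h1 h2 h3 => by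
    have := (hm.lo_hi (hok s h1)).2.2.1
    have := nu s h3
    linarith
  have posb : ∀ s : Seg, s.Ok N l h → ∀ t : Seg, t.Ok N l h → s.b.key ≤ t.b.key → s.b.x ≤ t.b.x :=
    fun s h1 t h2 h3 => hm.le h1.b_mem h2.b_mem (h1.le_a.trans h1.lt.le) h3 h2.b_le hN
  have posa : ∀ s : Seg, s.Ok N l h → ∀ t : Seg, t.Ok N l h → s.a.key ≤ t.a.key → s.a.x ≤ t.a.x :=
    fun s h1 t h2 h3 => hm.le h1.a_mem h2.a_mem h1.le_a h3 (h2.lt.le.trans h2.b_le) hN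
  have in₂ : ∀ u t, l₂ = u :: t → u.upper x = true := by
    intro u t e
    rcases hs.back with ⟨e1, _⟩ | ⟨u', e1, e2, _⟩ | ⟨u', v, t', e1, e2, _⟩
    · simp [e1] at e
    · rw [e1, List.cons.injEq] at e; rw [← e.1]; exact e2
    · rw [e1, List.cons.injEq] at e; rw [← e.1]; exact e2
  -- the beginning of the parts
  have head : S.c = l ∧ S.w.s0.a = l ∨ ∃ p t, l₁ = p :: t ∧ p.b.x ≤ x ∧ p.a = S.w.s0.a ∧
      (p.g = .nil ∨ S.w.s0.a = l ∨ ∃ q t', t = q :: t' ∧ q.b.x ≤ x) := by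
    rcases hS.c with h1 | ⟨s, hs1, hs2, hs3⟩
    · exact .inl h1
    · right
      obtain ⟨p, t, e1, e2, e3, e4⟩ := Seg.parts_head hS.chain hs1 hs2
      rw [hp] at e1
      have hpm : p ∈ l₁ ++ l₂ := by rw [e1]; simp
      have hpx : p.b.x ≤ x := (posb p (hok p hpm) s hs2 e3).trans (by rw [hs3]; exact hc)
      cases h1 : l₁ with
      | nil =>
        rw [h1, List.nil_append] at e1
        have := in₂ _ _ e1
        rw [left_of p hpm hpx] at this
        exact absurd this (by simp)
      | cons p' t' =>
        rw [h1, List.cons_append, List.cons.injEq] at e1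
        obtain ⟨rfl, e1⟩ := e1
        refine ⟨p', t', rfl, hpx, e2, ?_⟩
        rcases e4 with e4 | e4 | e4 | ⟨q, t'', e5, e6⟩
        · exact .inl e4
        · exact .inr (.inl e4)
        · rw [e4] at hpx; linarith
        · right; right
          have hqm : q ∈ l₁ ++ l₂ := by rw [h1, List.cons_append, e1, e5]; simp
          have hqx : q.b.x ≤ x := (posb q (hok q hqm) s hs2 e6).trans (by rw [hs3]; exact hc)
          cases h2 : t' with
          | nil =>
            rw [h2, List.nil_append, e5] at e1
            have := in₂ _ _ e1
            rw [left_of q hqm hqx] at this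
            exact absurd this (by simp)
          | cons q' r =>
            rw [h2, e5, List.cons_append, List.cons.injEq] at e1
            exact ⟨q', r, rfl, by rw [e1.1]; exact hqx⟩
  -- the end of the parts
  have tail : S.e = h ∧ S.w.s4.b = h ∨ ∃ p t, l₂ = t ++ [p] ∧
      (p.g = .nil ∨ S.w.s4.b = h ∨ t ≠ []) := by
    rcases hS.e with h1 | ⟨s, hs1, hs2, hs3⟩
    · exact .inl h1
    · right
      obtain ⟨p, t, e1, e2, e3, e4⟩ := Seg.parts_last hS.chain hs1 hs2
      rw [hp] at e1
      have hpm : p ∈ l₁ ++ l₂ := by rw [e1]; simp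
      have hpx : y ≤ p.a.x := le_trans (by rw [hs3]; exact he) (posa s hs2 p (hok p hpm) e3)
      rcases List.eq_nil_or_concat l₂ with h1 | ⟨t', p', h1⟩
      · rw [h1, List.append_nil] at e1
        exact absurd (by rw [e1]; simp) (right_of p hpm hpx)
      · rw [h1, List.concat_eq_append, ← List.append_assoc] at e1
        obtain ⟨e8, e5⟩ := List.append_inj' e1 rfl
        obtain rfl : p' = p := by simpa using e5
        refine ⟨p', t', by simpa using h1, ?_⟩
        rcases e4 with e4 | e4 | e4 | ⟨q, t'', e6, e7⟩
        · exact .inl e4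
        · exact .inr (.inl e4)
        · rw [e4] at hpx; linarith
        · right; right
          rintro rfl
          rw [List.append_nil, e6] at e8
          have hqm : q ∈ l₁ ++ l₂ := by rw [e8]; simp
          exact right_of q hqm (le_trans (by rw [hs3]; exact he) (posa s hs2 q (hok q hqm) e7))
            (by rw [e8]; simp)
  -- the segments in the middle
  have chain' : Seg.Chain N l h (S.w.select x).s0.a (S.w.select x).list (S.w.select x).s4.b :=
    Seg.chain_append.2 ⟨m, hf, hbk⟩
  have upper : (S.w.select x).s3.nondeg = true → (S.w.select x).s3 ∈ l₂ ∧
      (S.w.select x).s3.Ok N l h ∧ x < (S.w.select x).s3.hi.x := by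
    intro hn
    rcases hs.back with ⟨e1, e2, e3⟩ | ⟨u, e1, e2, e3, e4⟩ | ⟨u, v, t, e1, e2, e3, e4⟩
    · rw [e2, Seg.dup_nondeg] at hn; simp at hn
    · rw [e3]; exact ⟨by simp [e1], hok u (by simp [e1]), by simpa [Seg.upper] using e2⟩
    · rw [e3]; exact ⟨by simp [e1], hok u (by simp [e1]), by simpa [Seg.upper] using e2⟩
  have not_nondeg : (S.w.select x).s3.nondeg = false → l₂ = [] ∧
      (S.w.select x).s3 = .dup S.w.s4.b ∧ (S.w.select x).s4 = .dup S.w.s4.b := by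
    intro hn
    rcases hs.back with ⟨e1, e2, e3⟩ | ⟨u, e1, e2, e3, e4⟩ | ⟨u, v, t, e1, e2, e3, e4⟩
    · exact ⟨e1, e2, e3⟩
    · rw [e3, (hok u (by simp [e1])).nondeg] at hn; simp at hn
    · rw [e3, (hok u (by simp [e1])).nondeg] at hn; simp at hn
  have end_eq : (S.w.select x).s3.nondeg = false → S.w.s4.b = h := by
    intro hn
    obtain ⟨h1, -⟩ := not_nondeg hn
    rcases tail with h2 | ⟨p, t, h2, -⟩
    · exact h2.2
    · rw [h1] at h2; simp at h2
  have mem_list : ∀ s, s = (S.w.select x).s0 ∨ s = (S.w.select x).s1 ∨ s = (S.w.select x).s2 ∨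
      s = (S.w.select x).s3 ∨ s = (S.w.select x).s4 → s ∈ (S.w.select x).list := by
    intro s; simp [list]
  have hmx : m.x ≤ x ∨ ¬ S.w.s0.a = l ∨ l₁ ≠ [] := by
    by_cases h1 : l₁ = []
    · rw [h1] at hch₁
      by_cases h2 : S.w.s0.a = l
      · left; rw [← show S.w.s0.a = m from hch₁, h2]; exact hlx
      · exact .inr (.inl h2)
    · exact .inr (.inr h1)
  have e_ok : ((S.refine x y).e = h ∧ (S.w.select x).s4.b = h) ∨
      ∃ s ∈ (S.w.select x).list, s.Ok N l h ∧ s.a = (S.refine x y).e := by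
    change ((S.w.select x).s3.lo = h ∧ _) ∨
      ∃ s ∈ (S.w.select x).list, s.Ok N l h ∧ s.a = (S.w.select x).s3.lo
    cases hn : (S.w.select x).s3.nondeg with
    | false =>
      obtain ⟨h1, h2, h3⟩ := not_nondeg hn
      left
      rw [h2, h3, lo_of_nil rfl]
      exact ⟨end_eq hn, end_eq hn⟩
    | true =>
      obtain ⟨h1, h2, h3⟩ := upper hn
      rcases hi_cases (S.w.select x).s3 with ⟨h4, h5, h6⟩ | ⟨h5, h6⟩
      · exact .inr ⟨_, mem_list _ (by simp), h2, h6.symm⟩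
      · rcases hs.back with ⟨e1, e2, e3⟩ | ⟨u, e1, e2, e3, e4⟩ | ⟨u, v, t, e1, e2, e3, e4⟩
        · rw [e1] at h1; simp at h1
        · left
          have h7 : S.w.s4.b = h := by
            rcases tail with h2 | ⟨p, t, h2, h3⟩
            · exact h2.2
            · rw [e1] at h2
              have ht : t = [] := by
                have := congrArg List.length h2
                simp at this
                exact this
              rw [ht, List.nil_append, List.cons.injEq] at h2
              rcases h3 with h3 | h3 | h3
              · have hlt := hm.lt (hok u (by simp [e1]))
                rw [← h2.1] at h3
                rw [e3, hi_of_nil h3] at h5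
                rw [h5] at hlt
                exact absurd hlt (lt_irrefl _)
              · exact h3
              · exact absurd ht h3
          rw [e1] at hch₂
          have h8 : u.b = S.w.s4.b := hch₂.2.2
          rw [h6, e3, e4, h8]
          exact ⟨h7, h7⟩
        · rw [e1] at hch₂
          refine .inr ⟨_, mem_list _ (.inr (.inr (.inr (.inr rfl)))), ?_, ?_⟩
          · rw [e4]; exact hok v (by simp [e1])
          · rw [h6, e3, e4]; exact hch₂.2.2.1
  have low_spec : ((low y (S.w.select x)).nondeg = true → (low y (S.w.select x)).Ok N l h ∧
      (low y (S.w.select x)).hi.x ≤ x ∧ (low y (S.w.select x)).lo.x < y) ∧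
      ((low y (S.w.select x)).nondeg = false → (low y (S.w.select x)).hi = l) ∧
      ((low y (S.w.select x)).hi = l ∧ (S.w.select x).s0.a = l ∨
        ∃ s ∈ (S.w.select x).list, s.Ok N l h ∧ s.b = (low y (S.w.select x)).hi) := by
    rcases hs.front with ⟨e1, e2, e3, e4⟩ | ⟨p, e1, e2, e3, e4⟩ | ⟨p, q, e1, e2, e3, e4⟩ |
      ⟨t, o, p, q, e1, e2, e3, e4⟩
    · have hz : S.w.s0.a = l := by
        rcases head with h1 | ⟨p, t, h1, -⟩
        · exact h1.2
        · rw [e1] at h1; simp at h1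
      have hlow : low y (S.w.select x) = .dup l := by
        unfold low; rw [e3, e4, hz]; simp [Seg.dup_nondeg]
      rw [hlow, hi_of_nil rfl, e2]
      exact ⟨fun h => by simp [Seg.dup_nondeg] at h, fun _ => rfl, .inl ⟨rfl, hz⟩⟩
    · have hpo := hok p (by simp [e1])
      have hpx := nu p (by simp [e1])
      have key : p.g = .nil ∨ S.w.s0.a = l := by
        rcases head with h1 | ⟨p', t', h1, h2, h3, h4⟩
        · exact .inr h1.2
        · rw [e1, List.cons.injEq] at h1
          rcases h4 with h4 | h4 | ⟨q, t'', h4, h5⟩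
          · exact .inl (h1.1 ▸ h4)
          · exact .inr h4
          · rw [h4] at h1; simp at h1
      have pa : p.a = S.w.s0.a := by rw [e1] at hch₁; exact hch₁.1
      by_cases hlo : p.lo.x < y
      · have hlow : low y (S.w.select x) = p := by
          unfold low; rw [e4, hpo.nondeg, ltB_iff.2 hlo]; rfl
        rw [hlow]
        refine ⟨fun _ => ⟨hpo, hpx, hlo⟩, fun h => by simp [hpo.nondeg] at h, ?_⟩
        rcases key with h1 | h1
        · exact .inr ⟨p, mem_list _ (by simp [e4]), hpo, (hi_of_nil h1).symm⟩
        · rcases hi_cases p with ⟨-, h2, -⟩ | ⟨h2, -⟩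
          · exact .inr ⟨p, mem_list _ (by simp [e4]), hpo, h2.symm⟩
          · exact .inl ⟨by rw [h2, pa, h1], by rw [e2, h1]⟩
      -- A nonempty front that the chain does not start with has a first part ending at or before
      -- `x`, which would put its low bound before `y`.
      · -- `p` is longer than the first part can be
        have hz : S.w.s0.a = l := by
          rcases head with h1 | ⟨p', t', h1, h2, h3, h4⟩
          · exact h1.2
          · rw [e1, List.cons.injEq] at h1
            rw [← h1.1] at h2
            have := (hm.lo_hi hpo).2.1
            linarith
        have hlow : low y (S.w.select x) = .dup l := by
          unfold low; rw [e3, e4, hz, ltB_false.2 (not_lt.1 hlo)]; simp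
        rw [hlow, hi_of_nil rfl, e2]
        exact ⟨fun h => by simp [Seg.dup_nondeg] at h, fun _ => rfl, .inl ⟨rfl, hz⟩⟩
    · have hpo := hok p (by simp [e1])
      have hpx := nu p (by simp [e1])
      have hqo := hok q (by simp [e1])
      have hqx := nu q (by simp [e1])
      rw [e1] at hch₁
      have pa : p.a = S.w.s0.a := hch₁.1
      have qa : q.a = p.b := hch₁.2.2.1
      by_cases hlo : q.lo.x < y
      · have hlow : low y (S.w.select x) = q := by
          unfold low; rw [e4, hqo.nondeg, ltB_iff.2 hlo]; rfl
        rw [hlow]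
        refine ⟨fun _ => ⟨hqo, hqx, hlo⟩, fun h => by simp [hqo.nondeg] at h, .inr ?_⟩
        rcases hi_cases q with ⟨-, h2, -⟩ | ⟨h2, -⟩
        · exact ⟨q, mem_list _ (by simp [e4]), hqo, h2.symm⟩
        · exact ⟨p, mem_list _ (by simp [e3]), hpo, by rw [h2, qa]⟩
      · have hlow : low y (S.w.select x) = p := by
          unfold low; rw [e3, e4, ltB_false.2 (not_lt.1 hlo)]; simp
        have hplo : p.lo.x < y := by
          have h1 := (hm.lo_hi hpo).2.1
          have h2 := (hm.lo_hi hqo).2.2.1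
          rw [qa] at h2
          linarith
        rw [hlow]
        refine ⟨fun _ => ⟨hpo, hpx, hplo⟩, fun h => by simp [hpo.nondeg] at h, ?_⟩
        have key : p.g = .nil ∨ S.w.s0.a = l := by
          rcases head with h1 | ⟨p', t', h1, h2, h3, h4⟩
          · exact .inr h1.2
          · rw [e1, List.cons.injEq] at h1
            rcases h4 with h4 | h4 | ⟨q', t'', h4, h5⟩
            · exact .inl (h1.1 ▸ h4)
            · exact .inr h4
            · rw [h4, List.cons.injEq] at h1
              rw [← h1.2.1] at h5
              have := (hm.lo_hi hqo).2.1
              linarith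
        rcases key with h1 | h1
        · exact .inr ⟨p, mem_list _ (by simp [e3]), hpo, (hi_of_nil h1).symm⟩
        · rcases hi_cases p with ⟨-, h2, -⟩ | ⟨h2, -⟩
          · exact .inr ⟨p, mem_list _ (by simp [e3]), hpo, h2.symm⟩
          · exact .inl ⟨by rw [h2, pa, h1], by rw [e2, h1]⟩
    · have hpo := hok p (by simp [e1])
      have hpx := nu p (by simp [e1])
      have hqo := hok q (by simp [e1])
      have hqx := nu q (by simp [e1])
      have hoo := hok o (by simp [e1])
      rw [e1] at hch₁
      obtain ⟨m', -, h1, h2, h3, h4, h5, h6⟩ := Seg.chain_append.1 hch₁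
      by_cases hlo : q.lo.x < y
      · have hlow : low y (S.w.select x) = q := by
          unfold low; rw [e4, hqo.nondeg, ltB_iff.2 hlo]; rfl
        rw [hlow]
        refine ⟨fun _ => ⟨hqo, hqx, hlo⟩, fun h => by simp [hqo.nondeg] at h, .inr ?_⟩
        rcases hi_cases q with ⟨-, h2, -⟩ | ⟨h2, -⟩
        · exact ⟨q, mem_list _ (by simp [e4]), hqo, h2.symm⟩
        · exact ⟨p, mem_list _ (by simp [e3]), hpo, by rw [h2, h5]⟩
      · have hlow : low y (S.w.select x) = p := by
          unfold low; rw [e3, e4, ltB_false.2 (not_lt.1 hlo)]; simp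
        have hplo : p.lo.x < y := by
          have h1 := (hm.lo_hi hpo).2.1
          have h2 := (hm.lo_hi hqo).2.2.1
          rw [h5] at h2
          linarith
        rw [hlow]
        refine ⟨fun _ => ⟨hpo, hpx, hplo⟩, fun h => by simp [hpo.nondeg] at h, .inr ?_⟩
        rcases hi_cases p with ⟨-, h2, -⟩ | ⟨h2, -⟩
        · exact ⟨p, mem_list _ (by simp [e3]), hpo, h2.symm⟩
        · exact ⟨o, mem_list _ (by simp [e2]), hoo, by rw [h2, h3]⟩
  refine ⟨⟨chain', e_ok, low_spec.2.2⟩, fun h => (upper h).2, fun hn => ?_, low_spec.1,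
    low_spec.2.1, fun hi => ?_, ?_, fun hi => ?_⟩
  · change (S.w.select x).s3.lo = h
    rw [(not_nondeg hn).2.1, lo_of_nil rfl]
    exact end_eq hn
  · change y ≤ (S.w.select x).s3.lo.x
    change inner y (S.w.select x) = false at hi
    rw [inner, Bool.and_eq_false_iff, ltB_false] at hi
    rcases hi with hi | hi
    · rw [(not_nondeg hi).2.1, lo_of_nil rfl]
      change y ≤ S.w.s4.b.x
      rw [end_eq hi]
      exact hhy
    · exact hi
  · change (low y (S.w.select x)).hi.x ≤ x
    cases hn : (low y (S.w.select x)).nondeg with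
    | true => exact (low_spec.1 hn).2.1
    | false => rw [low_spec.2.1 hn]; exact hlx
  -- With all trees empty, all parts are edges. The first one above `x` then begins at or before
  -- `x`, hence before `y`, so the window would be inner.
  · by_contra! hη
    change inner y (S.w.select x) = false at hi
    have hex : ∀ s ∈ l₁ ++ l₂, s.g = .nil := by
      intro s hs'
      rw [← hp, Seg.parts, List.mem_filter, List.mem_flatMap] at hs'
      obtain ⟨⟨r, hr, h1⟩, -⟩ := hs'
      have h2 := eta_le.1 (Nat.le_zero.1 hη).le r hr
      have h3 := r.trim.height_fst
      have h4 := r.trim.height_snd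
      have h6 := r.height_trim
      have h5 : s.g.height = 0 := by
        simp only [List.mem_cons, List.not_mem_nil, or_false] at h1
        rcases h1 with rfl | rfl <;> omega
      cases hg : s.g with
      | nil => rfl
      | node => rw [hg] at h5; simp [Tree.height] at h5
    -- there is a part above `x`
    have hz : S.w.s0.a ≠ S.w.s4.b ∨ l₁ ++ l₂ ≠ [] := by
      rcases head with h1 | ⟨p, t, h1, -⟩
      · rcases tail with h2 | ⟨p, t, h2, -⟩
        · left
          rw [h1.2, h2.2]
          rintro rfl
          linarith
        · right; simp [h2]
      · right; simp [h1]
    have hne : l₁ ++ l₂ ≠ [] := by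
      rcases hz with hz | hz
      · intro h1
        rw [h1] at hch
        exact hz hch
      · exact hz
    have h2 : l₂ ≠ [] := by
      intro h2
      rcases tail with h1 | ⟨p, t, h1, -⟩
      · rw [h2, List.append_nil] at hne hex hok hch
        obtain ⟨t, p, h3⟩ := (List.eq_nil_or_concat l₁).resolve_left hne
        rw [List.concat_eq_append] at h3
        have h4 := nu p (by simp [h3])
        rw [hi_of_nil (hex p (by simp [h3]))] at h4
        rw [h3] at hch
        obtain ⟨m', -, -, -, h5⟩ := Seg.chain_append.1 hch
        rw [show p.b = S.w.s4.b from h5, h1.2] at h4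
        linarith
      · rw [h2] at h1; simp at h1
    have h3 : (S.w.select x).s3.nondeg = true := by
      by_contra h3
      exact h2 (not_nondeg (by simpa using h3)).1
    obtain ⟨u1, u2, u3⟩ := upper h3
    rw [inner, h3, Bool.true_and, ltB_false, lo_of_nil (hex _ (by simp [u1]))] at hi
    have hma : (S.w.select x).s3.a = m := hbk.1
    rw [hma] at hi
    rcases List.eq_nil_or_concat l₁ with h4 | ⟨t, p, h4⟩
    · rw [h4] at hch₁
      rcases head with h5 | ⟨p, t, h5, -⟩
      · rw [← show S.w.s0.a = m from hch₁, h5.2] at hi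
        linarith
      · rw [h4] at h5; simp at h5
    · rw [List.concat_eq_append] at h4
      have h5 := nu p (by simp [h4])
      rw [hi_of_nil (hex p (by simp [h4]))] at h5
      rw [h4] at hch₁
      obtain ⟨m', -, -, -, h6⟩ := Seg.chain_append.1 hch₁
      rw [show p.b = m from h6] at h5
      linarith

end

end Win

/-! ## Searching three chains at the same time -/

/-- Whether the test for the chord `x y` and two segments has the answer `d`. -/
def answer (d : Bool) (x y : V) (s t : Seg) : Bool :=
  s.nondeg && (t.nondeg && bif d then testA x (-slope x y) s.a s.b s.g.isNil t.a t.b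
    else !testA x (-slope x y) s.a s.b s.g.isNil t.a t.b)

@[fun_prop] theorem comp_answer {d : Bool} {x y : α → V} {s t : α → Seg} (hx : Comp L k x)
    (hy : Comp L k y) (hs : Comp L k s) (ht : Comp L k t) :
    Comp L k (fun z => answer d (x z) (y z) (s z) (t z)) := by
  unfold answer; cases d <;> simp only [cond_true, cond_false] <;> fun_prop

/-- A tentative window, a certified window, and whether the tentative one is certified, too. -/
abbrev Half : Type := Win × Win × Bool

/-- Whether the window ends after the chord `x y` has begun, or begins before it has ended. -/
def Half.out (d : Bool) (x y : ℝ) (h : Half) : Bool := bif d then ltB x h.1.c.x else ltB h.1.e.x y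

def Segs.isNil (w : Segs) : Bool :=
  w.s0.g.isNil && (w.s1.g.isNil && (w.s2.g.isNil && (w.s3.g.isNil && w.s4.g.isNil)))

attribute [reducible] Segs.isNil

theorem Segs.isNil_iff {w : Segs} : w.isNil = true ↔ w.eta = 0 := by
  have (t : Tree) : t.isNil = true ↔ t.height = 0 := by
    cases t <;> simp [Tree.isNil, Tree.height]
  simp [Segs.isNil, Segs.eta, this]

/-- The window for the corner of the right angle, what is known about the windows for the apex and
for the other end of the base, and whether the windows are certified at the lower ends. -/
abbrev Tri : Type := PW × Half × Half × Bool

namespace Tri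

/-- Use the chord for the tests. -/
def probe (s : Tri) : Tri :=
  let x := s.1.fst
  let y := s.1.snd
  let u := Win.refine x.x y.x s.2.1.1
  let v := Win.refine (-x.y) (-y.y) s.2.2.1.1
  let i := Win.inner y.x u.w
  let j := Win.inner (-y.y) v.w
  bif answer true x y u.w.s3 v.w.s3 then (s.1.step true, s.2.1, s.2.2.1, true)
  else bif answer false x y (bif i then u.w.s3 else Win.low y.x u.w)
      (bif j then v.w.s3 else Win.low (-y.y) v.w) then (s.1.step false, s.2.1, s.2.2.1, false)
  -- This branch and the next are not reached while the invariant holds. Emptying the trees there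
  -- makes the measure drop on all inputs, as a loop requires.
  else bif i && j then (⟨s.1.lo, .nil, s.1.x, .nil, s.1.hi, false⟩, s.2.1, s.2.2.1, true)
  else bif (!i && s.2.1.1.w.isNil) || (!j && s.2.2.1.1.w.isNil) then
    (⟨s.1.lo, .nil, s.1.x, .nil, s.1.hi, false⟩, s.2.1, s.2.2.1, true)
  else bif i then (s.1, s.2.1, (v, v, true), s.2.2.2)
  else bif j then (s.1, (u, u, true), s.2.2.1, s.2.2.2)
  else (s.1, (u, s.2.1.2.1, false), (v, s.2.2.1.2.1, false), s.2.2.2)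

/-- The flag `d` says at which ends the tentative windows are certified. A chord of the lower chain
beyond a window at such an end is decided at once. It is also decided if it is beyond both windows
at the other ends, or beyond one that is certified. If it is beyond a single uncertified window,
then the other window must be right: it becomes certified, and the first one falls back on its
certified copy. Only a chord within both windows is probed. -/
def step (s : Tri) : Tri :=
  let x := s.1.fst
  let y := s.1.snd
  let d := s.2.2.2
  let i := Half.out (!d) x.x y.x s.2.1
  let j := Half.out (!d) (-x.y) (-y.y) s.2.2.1
  bif !s.1.ready || (Half.out d x.x y.x s.2.1 || Half.out d (-x.y) (-y.y) s.2.2.1) then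
    (s.1.step d, s.2)
  else bif (i && (j || s.2.1.2.2)) || (j && s.2.2.1.2.2) then (s.1.step (!d), s.2)
  else bif i then
    (s.1, (s.2.1.2.1, s.2.1.2.1, true), (s.2.2.1.1, s.2.2.1.1, true), d)
  else bif j then
    (s.1, (s.2.1.1, s.2.1.1, true), (s.2.2.1.2.1, s.2.2.1.2.1, true), d)
  else probe s

/-- A window may grow back to its certified copy, but only while the other one becomes certified as
it is. Hence the maximum over the two scenarios does not increase at a fallback, and the fallback
itself is paid for by the number of uncertified windows. -/
def meas (s : Tri) : ℕ :=
  4 * s.1.meas + 4 * max (s.2.2.1.1.w.eta + max s.2.1.2.1.w.eta s.2.1.1.w.eta)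
    (s.2.1.1.w.eta + max s.2.2.1.2.1.w.eta s.2.2.1.1.w.eta) +
    ((bif s.2.1.2.2 then 0 else 1) + (bif s.2.2.1.2.2 then 0 else 1))

theorem meas_probe {s : Tri} (hs : s.1.done = false) : s.probe.meas < s.meas := by
  have h1 := PW.meas_step hs true
  have h2 := PW.meas_step hs false
  have h3 := Segs.eta_select s.1.fst.x s.2.1.1.w
  have h4 := Segs.eta_select (-s.1.fst.y) s.2.2.1.1.w
  have h5 : (PW.mk s.1.lo .nil s.1.x .nil s.1.hi false).meas < s.1.meas := by
    have : 0 < s.1.A.height ∨ 0 < s.1.B.height := by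
      simp only [PW.done, Bool.and_eq_false_iff] at hs
      exact hs.imp PW.height_pos PW.height_pos
    cases ht : s.1.turn <;> simp [PW.meas, ht, Tree.height] <;> omega
  have h6 : s.2.1.1.w.isNil = false → 0 < s.2.1.1.w.eta := fun h => by
    rw [← Bool.not_eq_true, Segs.isNil_iff] at h; omega
  have h7 : s.2.2.1.1.w.isNil = false → 0 < s.2.2.1.1.w.eta := fun h => by
    rw [← Bool.not_eq_true, Segs.isNil_iff] at h; omega
  have h8 : ∀ b : Bool, (bif b then 0 else 1) ≤ 1 := by decide
  have h9 := h8 s.2.1.2.2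
  have h10 := h8 s.2.2.1.2.2
  simp only [probe]
  generalize answer true _ _ _ _ = c₁
  generalize answer false _ _ _ _ = c₂
  generalize Win.inner s.1.snd.x _ = i
  generalize Win.inner (-s.1.snd.y) _ = j
  cases c₁
  · cases c₂
    · cases i <;> cases j <;> cases hr : s.2.1.1.w.isNil <;> cases hq : s.2.2.1.1.w.isNil <;>
        simp only [hr, hq, forall_const] at h6 h7 <;>
        simp only [cond_true, cond_false, Bool.not_true, Bool.not_false, Bool.and_true,
          Bool.and_false, Bool.or_true, Bool.or_false, meas, Win.refine] <;> omega
    · simp only [cond_true, cond_false, meas]; omega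
  · simp only [cond_true, meas]; omega

theorem meas_step {s : Tri} (hs : s.1.done = false) : s.step.meas < s.meas := by
  have h1 := PW.meas_step hs s.2.2.2
  have h2 := PW.meas_step hs (!s.2.2.2)
  have h3 := meas_probe hs
  simp only [step, cond_eq_ite]
  split_ifs with c1 c2 c3 c4
  · simp only [meas]; omega
  · simp only [meas]; omega
  · simp [c3] at c2
    simp only [meas, c2, cond_true, cond_false]
    omega
  · simp [c4] at c2
    simp only [meas, c2, cond_true, cond_false]
    omega
  · exact h3

attribute [reducible] Half.out probe step

theorem eta_le_size (w : Segs) : w.eta ≤ size w := by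
  have h (s : Seg) : s.g.height ≤ size s :=
    (le_max_left (size s.g) (size s.b)).trans (le_max_right (size s.a) _)
  have e : size w = max (size w.s0) (max (size w.s1) (max (size w.s2) (max (size w.s3)
    (size w.s4)))) := rfl
  have h0 := h w.s0
  have h1 := h w.s1
  have h2 := h w.s2
  have h3 := h w.s3
  have h4 := h w.s4
  rw [e, Segs.eta]
  omega

theorem meas_le (s : Tri) : s.meas ≤ 18 * (size s + 1) := by
  have h1 := PW.meas_le s.1
  have h (w : Win) : w.w.eta ≤ size w := (eta_le_size w.w).trans (le_max_left _ (size (w.c, w.e)))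
  have h2 := h s.2.1.1
  have h3 := h s.2.1.2.1
  have h4 := h s.2.2.1.1
  have h5 := h s.2.2.1.2.1
  have e (h : Half) : size h = max (size h.1) (max (size h.2.1) 0) := rfl
  have e1 : size s = max (size s.1) (max (size s.2.1) (max (size s.2.2.1) 0)) := rfl
  rw [e, e] at e1
  have h8 : ∀ b : Bool, (bif b then 0 else 1) ≤ 1 := by decide
  have h9 := h8 s.2.1.2.2
  have h10 := h8 s.2.2.1.2.2
  simp only [meas]
  omega

/-- The edge with the corner of the right angle. -/
def solve (s : Tri) : PW := (iter (fun s : Tri => !s.1.done) step s.meas s).1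

@[fun_prop] theorem comp_solve {f : α → Tri} (hf : Comp L 1 f) :
    Comp L 1 (fun x => solve (f x)) :=
  (Comp.fst.comp' (Comp.loop (L := L) (b := fun s : Tri => !s.1.done) (f := step) meas
    (fun s hs => meas_step (by simpa using hs)) 18 meas_le (by fun_prop) (by fun_prop))).comp' hf

end Tri

/-! ## The edge with the corner of the right angle -/

/-- The half belongs to the chain of `N` from `l` to `h`, on which the sought position is `t`. -/
structure Half.Inv (N : Set V) (l h : V) (t : ℝ) (H : Half) : Prop where
  ok : H.1.Ok N l h
  ok' : H.2.1.Ok N l h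
  c : H.2.1.c.x ≤ t
  e : t ≤ H.2.1.e.x
  flag : H.2.2 = true → H.1.c.x ≤ t ∧ t ≤ H.1.e.x

/-- Three chains and a triangle for which the tests are correct. -/
structure Tri.Setting (N : Set V) (S E : V) (Nr : Set V) (lr hr : V) (Nq : Set V) (lq hq : V)
    (a b : ℝ) : Prop where
  mono : ∀ u ∈ N, ∀ v ∈ N, S.key ≤ u.key → u.key < v.key → v.key ≤ E.key → u.x < v.x ∧ v.y < u.y
  le : ∀ v ∈ N, S.key ≤ v.key → v.key ≤ E.key → (v.x ≤ a ↔ b ≤ v.y)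
  ge : ∀ v ∈ N, S.key ≤ v.key → v.key ≤ E.key → (a ≤ v.x ↔ v.y ≤ b)
  mr : Win.Mono Nr lr hr
  mq : Win.Mono Nq lq hq
  ir : ∀ u ∈ Nr, ∀ v ∈ Nr, u.key = v.key → u = v
  iq : ∀ u ∈ Nq, ∀ v ∈ Nq, u.key = v.key → u = v
  br : ∀ v ∈ N, lr.x ≤ v.x ∧ v.x ≤ hr.x
  bq : ∀ v ∈ N, lq.x ≤ -v.y ∧ -v.y ≤ hq.x
  high : ∀ u ∈ N, ∀ v ∈ N, S.key ≤ u.key → u.key < v.key → v.key ≤ E.key → ∀ s t : Seg,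
    s.Ok Nr lr hr → t.Ok Nq lq hq → testA u (-slope u v) s.a s.b s.g.isNil t.a t.b = true →
    u.x ≤ a ∨ s.hi.x ≤ a ∨ t.hi.x ≤ -b
  low : ∀ u ∈ N, ∀ v ∈ N, S.key ≤ u.key → u.key < v.key → v.key ≤ E.key → ∀ s t : Seg,
    s.Ok Nr lr hr → t.Ok Nq lq hq → testA u (-slope u v) s.a s.b s.g.isNil t.a t.b = false →
    a ≤ v.x ∨ a ≤ s.lo.x ∨ -b ≤ t.lo.x

namespace Tri

variable {N : Set V} {S E : V} {Nr : Set V} {lr hr : V} {Nq : Set V} {lq hq : V} {a b : ℝ}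

/-- The lower, or the upper, ends of the tentative windows are certified. -/
def Cert (a b : ℝ) (d : Bool) (u v : Win) : Prop :=
  d = true ∧ u.c.x ≤ a ∧ v.c.x ≤ -b ∨ d = false ∧ a ≤ u.e.x ∧ -b ≤ v.e.x

/-- The chord is within the tentative windows. -/
def Mid (x y : V) (u v : Win) : Prop :=
  u.c.x ≤ x.x ∧ y.x ≤ u.e.x ∧ v.c.x ≤ -x.y ∧ -y.y ≤ v.e.x

structure PInv (N : Set V) (S E : V) (a : ℝ) (w : PW) : Prop where
  ok : w.Ok N
  lo : S.key ≤ w.lo.key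
  hi : w.hi.key ≤ E.key
  le : w.lo.x ≤ a
  ge : a ≤ w.hi.x

theorem PInv.step {w : PW} (hw : PInv N S E a w) (d : Bool)
    (h : w.ready = true → (d = true → w.fst.x ≤ a) ∧ (d = false → a ≤ w.snd.x)) : PInv N S E a (w.step d) := by
  unfold PW.step
  cases hr : w.ready with
  | false => exact ⟨hw.ok.skip hr, by rw [cond_false, PW.skip_lo]; exact hw.lo,
      by rw [cond_false, PW.skip_hi]; exact hw.hi, by rw [cond_false, PW.skip_lo]; exact hw.le,
      by rw [cond_false, PW.skip_hi]; exact hw.ge⟩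
  | true =>
    have h := h hr
    obtain ⟨h1, h2, h3, h4, h5⟩ := hw.ok.fst_snd hr
    cases d with
    | true => exact ⟨hw.ok.high hr, by simp only [cond_true, PW.high_lo]; exact hw.lo.trans h3,
        by simp only [cond_true, PW.high_hi]; exact hw.hi,
        by simpa only [cond_true, PW.high_lo] using h.1 rfl,
        by simp only [cond_true, PW.high_hi]; exact hw.ge⟩
    | false => exact ⟨hw.ok.low hr, by simp only [cond_true, cond_false, PW.low_lo]; exact hw.lo,
        by simp only [cond_true, cond_false, PW.low_hi]; exact h5.trans hw.hi,
        by simp only [cond_true, cond_false, PW.low_lo]; exact hw.le,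
        by simpa only [cond_true, cond_false, PW.low_hi] using h.2 rfl⟩

/-- `up` and `down` express the tentative state: at each end at least one of the two windows is
right, but these need not be the same window. -/
structure Inv (N : Set V) (S E : V) (Nr : Set V) (lr hr : V) (Nq : Set V) (lq hq : V) (a b : ℝ)
    (s : Tri) : Prop where
  p : PInv N S E a s.1
  r : s.2.1.Inv Nr lr hr a
  q : s.2.2.1.Inv Nq lq hq (-b)
  up : a ≤ s.2.1.1.e.x ∨ -b ≤ s.2.2.1.1.e.x
  down : s.2.1.1.c.x ≤ a ∨ s.2.2.1.1.c.x ≤ -b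
  mid : s.1.ready = true ∧ Mid s.1.fst s.1.snd s.2.1.1 s.2.2.1.1 ∨
    Cert a b s.2.2.2 s.2.1.1 s.2.2.1.1

variable (G : Setting N S E Nr lr hr Nq lq hq a b) {s : Tri}

-- A positive answer for segments whose bounds are beyond `x` means in each of its three
-- alternatives that the corner is not before `x`; a negative answer for segments with bounds before
-- `y` means that it is not beyond `y`. In both cases the lower chain shrinks. In the remaining
-- cases the answers bound the refined windows themselves, both of them tentatively, or one of them
-- for certain if the other one is inner.
include G in
theorem inv_probe (hs : Inv N S E Nr lr hr Nq lq hq a b s) (hrd : s.1.ready = true)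
    (hm : Mid s.1.fst s.1.snd s.2.1.1 s.2.2.1.1) :
    Inv N S E Nr lr hr Nq lq hq a b s.probe := by
  obtain ⟨pok, plo, phi, ple, pge⟩ := id hs.p
  obtain ⟨h1, h2, h3, h4, h5⟩ := pok.fst_snd hrd
  have h3 := plo.trans h3
  have h5 := h5.trans phi
  obtain ⟨xlt, ylt⟩ := G.mono _ h1 _ h2 h3 h4 h5
  obtain ⟨m1, m2, m3, m4⟩ := id hm
  have xle := G.le _ h1 h3 (h4.le.trans h5)
  have yge := G.ge _ h2 (h3.trans h4.le) h5
  have R := hs.r.ok.refine G.mr G.ir xlt m1 m2 (G.br _ h1).1 (G.br _ h2).2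
  have Q := hs.q.ok.refine G.mq G.iq (neg_lt_neg ylt) m3 m4 (G.bq _ h1).1 (G.bq _ h2).2
  have al : lr.x ≤ a := (G.br _ pok.lo).1.trans ple
  have ah : a ≤ hr.x := pge.trans (G.br _ pok.hi).2
  have bl : lq.x ≤ -b := (G.bq _ pok.lo).1.trans
    (neg_le_neg ((G.le _ pok.lo plo (pok.lo_le.trans (pok.le_hi.trans phi))).1 ple))
  have bh : -b ≤ hq.x := (neg_le_neg ((G.ge _ pok.hi (plo.trans (pok.lo_le.trans pok.le_hi))
    phi).1 pge)).trans (G.bq _ pok.hi).2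
  have high := G.high _ h1 _ h2 h3 h4 h5
  have low := G.low _ h1 _ h2 h3 h4 h5
  have hA : answer true s.1.fst s.1.snd (Win.refine s.1.fst.x s.1.snd.x s.2.1.1).w.s3
      (Win.refine (-s.1.fst.y) (-s.1.snd.y) s.2.2.1.1).w.s3 = true → s.1.fst.x ≤ a := by
    intro h
    simp only [answer, Bool.and_eq_true, cond_true] at h
    obtain ⟨n1, n2, h⟩ := h
    rcases high _ _ (R.upper n1).1 (Q.upper n2).1 h with h | h | h
    · exact h
    · exact (R.upper n1).2.le.trans h
    · exact xle.2 (neg_le_neg_iff.1 ((Q.upper n2).2.le.trans h))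
  have hB : answer false s.1.fst s.1.snd (Win.refine s.1.fst.x s.1.snd.x s.2.1.1).w.s3
      (Win.refine (-s.1.fst.y) (-s.1.snd.y) s.2.2.1.1).w.s3 = true → a ≤ s.1.snd.x ∨
        a ≤ (Win.refine s.1.fst.x s.1.snd.x s.2.1.1).e.x ∨
        -b ≤ (Win.refine (-s.1.fst.y) (-s.1.snd.y) s.2.2.1.1).e.x := by
    intro h
    simp only [answer, Bool.and_eq_true, Bool.not_eq_true', cond_false] at h
    exact low _ _ (R.upper h.1).1 (Q.upper h.2.1).1 h.2.2
  have no : ∀ s' t' : Seg, answer true s.1.fst s.1.snd s' t' = false →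
      s'.nondeg = true → t'.nondeg = true → answer false s.1.fst s.1.snd s' t' = true := by
    intro s' t' h h1 h2
    simpa [answer, h1, h2] using h
  have no' : ∀ s' t' : Seg, answer false s.1.fst s.1.snd s' t' = false →
      s'.nondeg = true → t'.nondeg = true →
      testA s.1.fst (-slope s.1.fst s.1.snd) s'.a s'.b s'.g.isNil t'.a t'.b = true := by
    intro s' t' h h1 h2
    simpa [answer, h1, h2] using h
  have hD : ∀ s' t' : Seg, s'.Ok Nr lr hr → t'.Ok Nq lq hq → s'.lo.x < s.1.snd.x →
      t'.lo.x < -s.1.snd.y → answer false s.1.fst s.1.snd s' t' = true → a ≤ s.1.snd.x := by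
    intro s' t' o1 o2 l1 l2 h
    simp only [answer, Bool.and_eq_true, Bool.not_eq_true', cond_false] at h
    rcases low _ _ o1 o2 h.2.2 with h | h | h
    · exact h
    · exact h.trans l1.le
    · exact yge.2 (neg_le_neg_iff.1 (h.trans l2.le))
  have inn : ∀ {x y : ℝ} {w : Win}, Win.inner y (Win.refine x y w).w = true →
      (Win.refine x y w).w.s3.nondeg = true ∧ (Win.refine x y w).e.x < y := by
    intro x y w h
    rw [Win.inner, Bool.and_eq_true, ltB_iff] at h
    exact h
  simp only [probe]
  cases h₁ : answer true s.1.fst s.1.snd (Win.refine s.1.fst.x s.1.snd.x s.2.1.1).w.s3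
      (Win.refine (-s.1.fst.y) (-s.1.snd.y) s.2.2.1.1).w.s3 with
  | true =>
    have hx := hA h₁
    exact ⟨hs.p.step true fun _ => ⟨fun _ => hx, nofun⟩, hs.r, hs.q, hs.up, hs.down,
      .inr (.inl ⟨rfl, m1.trans hx, m3.trans (neg_le_neg (xle.1 hx))⟩)⟩
  | false =>
    have hx₁ := no _ _ h₁
    -- The first test was not answered positively. Either a segment is missing, and its window
    -- extends to the end of the chain, or the answer was negative, which bounds one of the three
    -- positions from above.
    have F₁ : a ≤ s.1.snd.x ∨ a ≤ (Win.refine s.1.fst.x s.1.snd.x s.2.1.1).e.x ∨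
        -b ≤ (Win.refine (-s.1.fst.y) (-s.1.snd.y) s.2.2.1.1).e.x := by
      cases n1 : (Win.refine s.1.fst.x s.1.snd.x s.2.1.1).w.s3.nondeg with
      | false => rw [R.end_eq n1]; exact .inr (.inl ah)
      | true =>
        cases n2 : (Win.refine (-s.1.fst.y) (-s.1.snd.y) s.2.2.1.1).w.s3.nondeg with
        | false => rw [Q.end_eq n2]; exact .inr (.inr bh)
        | true => exact hB (hx₁ n1 n2)
    have hlow : a ≤ s.1.snd.x → Inv N S E Nr lr hr Nq lq hq a b
        (s.1.step false, s.2.1, s.2.2.1, false) := fun hy =>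
      ⟨hs.p.step false fun _ => ⟨nofun, fun _ => hy⟩, hs.r, hs.q, hs.up, hs.down,
        .inr (.inr ⟨rfl, hy.trans m2, (neg_le_neg (yge.1 hy)).trans m4⟩)⟩
    have qe : a ≤ s.1.snd.x ∨ a ≤ (Win.refine s.1.fst.x s.1.snd.x s.2.1.1).e.x →
        (Win.refine s.1.fst.x s.1.snd.x s.2.1.1).e.x < s.1.snd.x → -b ≤ -s.1.snd.y := fun h h' =>
      neg_le_neg (yge.1 (h.elim id fun h => h.trans h'.le))
    cases hi : Win.inner s.1.snd.x (Win.refine s.1.fst.x s.1.snd.x s.2.1.1).w with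
    | true =>
      obtain ⟨i1, i2⟩ := inn hi
      obtain ⟨o1, o2⟩ := R.upper i1
      cases hj : Win.inner (-s.1.snd.y) (Win.refine (-s.1.fst.y) (-s.1.snd.y) s.2.2.1.1).w with
      | true =>
        obtain ⟨j1, j2⟩ := inn hj
        have h2 := hx₁ i1 j1
        simp only [h2, cond_true, cond_false]
        exact hlow (hD _ _ o1 (Q.upper j1).1 i2 j2 h2)
      | false =>
        have hp := Q.eta_pos hj
        have hn : s.2.2.1.1.w.isNil = false := by
          rw [← Bool.not_eq_true, Segs.isNil_iff]; omega
        simp only [cond_true, cond_false, hn, Bool.not_true, Bool.not_false, Bool.and_false,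
          Bool.false_and, Bool.or_false]
        cases h₂ : answer false s.1.fst s.1.snd (Win.refine s.1.fst.x s.1.snd.x s.2.1.1).w.s3
            (Win.low (-s.1.snd.y) (Win.refine (-s.1.fst.y) (-s.1.snd.y) s.2.2.1.1).w) with
        | true =>
          have h3 := h₂
          simp only [answer, Bool.and_eq_true] at h3
          obtain ⟨l1, l2, l3⟩ := Q.low h3.2.1
          exact hlow (hD _ _ o1 l1 i2 l3 h₂)
        | false =>
          -- The segment of the apex is inner. If the positive answer stems from the corner or the
          -- apex, then the corner is not before `x`, where the new window of the base end has
          -- already begun.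
          have c' : (Win.refine (-s.1.fst.y) (-s.1.snd.y) s.2.2.1.1).c.x ≤ -b := by
            cases n : (Win.low (-s.1.snd.y)
                (Win.refine (-s.1.fst.y) (-s.1.snd.y) s.2.2.1.1).w).nondeg with
            | false => rw [Q.start_eq n]; exact bl
            | true =>
              rcases high _ _ o1 (Q.low n).1 (no' _ _ h₂ i1 n) with h | h | h
              · exact Q.c_le.trans (neg_le_neg (xle.1 h))
              · exact Q.c_le.trans (neg_le_neg (xle.1 (o2.le.trans h)))
              · exact h
          have e' : -b ≤ (Win.refine (-s.1.fst.y) (-s.1.snd.y) s.2.2.1.1).e.x := by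
            rcases F₁ with h | h | h
            · exact (qe (.inl h) i2).trans (Q.e_ge hj)
            · exact (qe (.inr h) i2).trans (Q.e_ge hj)
            · exact h
          exact ⟨hs.p, hs.r, ⟨Q.ok, Q.ok, c', e', fun _ => ⟨c', e'⟩⟩, .inr e', .inr c',
            .inl ⟨hrd, m1, m2, Q.c_le, Q.e_ge hj⟩⟩
    | false =>
      have hp := R.eta_pos hi
      have hn : s.2.1.1.w.isNil = false := by
        rw [← Bool.not_eq_true, Segs.isNil_iff]; omega
      cases hj : Win.inner (-s.1.snd.y) (Win.refine (-s.1.fst.y) (-s.1.snd.y) s.2.2.1.1).w with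
      | true =>
        obtain ⟨j1, j2⟩ := inn hj
        obtain ⟨o1, o2⟩ := Q.upper j1
        simp only [cond_true, cond_false, hn, Bool.not_true, Bool.not_false, Bool.and_false,
          Bool.false_and, Bool.or_false]
        cases h₂ : answer false s.1.fst s.1.snd
            (Win.low s.1.snd.x (Win.refine s.1.fst.x s.1.snd.x s.2.1.1).w)
            (Win.refine (-s.1.fst.y) (-s.1.snd.y) s.2.2.1.1).w.s3 with
        | true =>
          have h3 := h₂
          simp only [answer, Bool.and_eq_true] at h3
          obtain ⟨l1, l2, l3⟩ := R.low h3.1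
          exact hlow (hD _ _ l1 o1 l3 j2 h₂)
        | false =>
          have c' : (Win.refine s.1.fst.x s.1.snd.x s.2.1.1).c.x ≤ a := by
            cases n : (Win.low s.1.snd.x (Win.refine s.1.fst.x s.1.snd.x s.2.1.1).w).nondeg with
            | false => rw [R.start_eq n]; exact al
            | true =>
              rcases high _ _ (R.low n).1 o1 (no' _ _ h₂ n j1) with h | h | h
              · exact R.c_le.trans h
              · exact h
              · exact R.c_le.trans (xle.2 (neg_le_neg_iff.1 (o2.le.trans h)))
          have e' : a ≤ (Win.refine s.1.fst.x s.1.snd.x s.2.1.1).e.x := by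
            rcases F₁ with h | h | h
            · exact h.trans (R.e_ge hi)
            · exact h
            · exact (yge.2 (neg_le_neg_iff.1 (h.trans j2.le))).trans (R.e_ge hi)
          exact ⟨hs.p, ⟨R.ok, R.ok, c', e', fun _ => ⟨c', e'⟩⟩, hs.q, .inl e', .inl c',
            .inl ⟨hrd, R.c_le, R.e_ge hi, m3, m4⟩⟩
      | false =>
        have hq := Q.eta_pos hj
        have hnq : s.2.2.1.1.w.isNil = false := by
          rw [← Bool.not_eq_true, Segs.isNil_iff]; omega
        simp only [cond_false, hn, hnq, Bool.and_false, Bool.or_false]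
        cases h₂ : answer false s.1.fst s.1.snd
            (Win.low s.1.snd.x (Win.refine s.1.fst.x s.1.snd.x s.2.1.1).w)
            (Win.low (-s.1.snd.y) (Win.refine (-s.1.fst.y) (-s.1.snd.y) s.2.2.1.1).w) with
        | true =>
          have h3 := h₂
          simp only [answer, Bool.and_eq_true] at h3
          obtain ⟨l1, l2, l3⟩ := R.low h3.1
          obtain ⟨k1, k2, k3⟩ := Q.low h3.2.1
          exact hlow (hD _ _ l1 k1 l3 k3 h₂)
        | false =>
          -- Since the negative answer was refused, the test was positive or a segment is missing;
          -- either way one of the lower ends is right. The corner passing `x` counts for both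
          -- windows.
          have F₂ : (Win.refine s.1.fst.x s.1.snd.x s.2.1.1).c.x ≤ a ∨
              (Win.refine (-s.1.fst.y) (-s.1.snd.y) s.2.2.1.1).c.x ≤ -b := by
            cases n : (Win.low s.1.snd.x (Win.refine s.1.fst.x s.1.snd.x s.2.1.1).w).nondeg with
            | false => rw [R.start_eq n]; exact .inl al
            | true =>
              cases n' : (Win.low (-s.1.snd.y)
                  (Win.refine (-s.1.fst.y) (-s.1.snd.y) s.2.2.1.1).w).nondeg with
              | false => rw [Q.start_eq n']; exact .inr bl
              | true =>
                rcases high _ _ (R.low n).1 (Q.low n').1 (no' _ _ h₂ n n') with h | h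
                · exact .inl (R.c_le.trans h)
                · exact h
          exact ⟨hs.p, ⟨R.ok, hs.r.ok', hs.r.c, hs.r.e, nofun⟩,
            ⟨Q.ok, hs.q.ok', hs.q.c, hs.q.e, nofun⟩,
            F₁.elim (fun h => .inl (h.trans (R.e_ge hi))) id, F₂,
            .inl ⟨hrd, R.c_le, R.e_ge hi, Q.c_le, Q.e_ge hj⟩⟩

include G in
theorem inv_step (hs : Inv N S E Nr lr hr Nq lq hq a b s) :
    Inv N S E Nr lr hr Nq lq hq a b s.step := by
  cases hrd : s.1.ready with
  | false =>
    simp only [step, hrd, Bool.not_false, Bool.true_or, cond_true]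
    refine ⟨hs.p.step _ fun h => by simp [hrd] at h, hs.r, hs.q, hs.up, hs.down, ?_⟩
    exact .inr (hs.mid.resolve_left fun h => by simp [hrd] at h)
  | true =>
    obtain ⟨pok, plo, phi, ple, pge⟩ := id hs.p
    obtain ⟨h1, h2, h3, h4, h5⟩ := pok.fst_snd hrd
    have h3 := plo.trans h3
    have h5 := h5.trans phi
    have xle := G.le _ h1 h3 (h4.le.trans h5)
    have yge := G.ge _ h2 (h3.trans h4.le) h5
    have xle' : s.1.fst.x ≤ a ↔ -s.1.fst.y ≤ -b := by rw [xle, neg_le_neg_iff]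
    have yge' : a ≤ s.1.snd.x ↔ -b ≤ -s.1.snd.y := by rw [yge, neg_le_neg_iff]
    have key := G.mono _ h1 _ h2 h3 h4 h5
    have hpr := inv_probe G hs hrd
    have move : ∀ d, (d = true → s.1.fst.x ≤ a) ∧ (d = false → a ≤ s.1.snd.x) →
        Cert a b s.2.2.2 s.2.1.1 s.2.2.1.1 → Inv N S E Nr lr hr Nq lq hq a b (s.1.step d, s.2) :=
      fun d h h' => ⟨hs.p.step d fun _ => h, hs.r, hs.q, hs.up, hs.down, .inr h'⟩
    obtain ⟨r1, r2, r3, r4, r5⟩ := id hs.r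
    obtain ⟨q1, q2, q3, q4, q5⟩ := id hs.q
    have up := hs.up
    have down := hs.down
    have mid := hs.mid
    simp only [step]
    simp only [Cert, Mid] at *
    cases hd : s.2.2.2 with
    | true =>
      simp only [hd, Half.out, hrd, Bool.not_true, Bool.false_or, cond_true, cond_false] at *
      cases h0 : ltB s.1.fst.x s.2.1.1.c.x || ltB (-s.1.fst.y) s.2.2.1.1.c.x with
      | true =>
        rw [Bool.or_eq_true, ltB_iff, ltB_iff] at h0
        have hc := mid.resolve_left (by rintro ⟨-, h6, -, h7, -⟩; rcases h0 with h | h <;> linarith)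
        refine move true ⟨fun _ => ?_, nofun⟩ hc
        simp only [true_and, Bool.true_eq_false, false_and, or_false] at hc
        exact h0.elim (fun h => h.le.trans hc.1) fun h => xle'.2 (h.le.trans hc.2)
      | false =>
        rw [Bool.or_eq_false_iff, ltB_false, ltB_false] at h0
        cases hi : ltB s.2.1.1.e.x s.1.snd.x <;> cases hj : ltB s.2.2.1.1.e.x (-s.1.snd.y) <;>
          simp only [ltB_iff, ltB_false] at hi hj
        · exact hpr ⟨h0.1, hi, h0.2, hj⟩
        all_goals
          have hc := mid.resolve_left (by rintro ⟨-, -, h6, -, h7⟩; linarith)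
          have hc' := hc
          simp only [true_and, Bool.true_eq_false, false_and, or_false] at hc'
          simp only [cond_true, cond_false, Bool.true_and, Bool.false_and, Bool.false_or,
            Bool.true_or, Bool.or_false]
        · cases hf : s.2.2.1.2.2 with
          | true =>
            exact move false ⟨nofun, fun _ => yge'.2 ((q5 hf).2.trans hj.le)⟩ hc
          | false =>
            -- If the end of the other window is the right one, the corner is before the end of the
            -- chord, which this window contains.
            have e : a ≤ s.2.1.1.e.x := up.elim id fun h => (yge'.2 (h.trans hj.le)).trans hi
            exact ⟨hs.p, ⟨r1, r1, hc'.1, e, fun _ => ⟨hc'.1, e⟩⟩, ⟨q2, q2, q3, q4, fun _ => ⟨q3, q4⟩⟩,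
              .inl e, .inl hc'.1, .inr (.inl ⟨rfl, hc'.1, q3⟩)⟩
        · cases hf : s.2.1.2.2 with
          | true => exact move false ⟨nofun, fun _ => (r5 hf).2.trans hi.le⟩ hc
          | false =>
            have e : -b ≤ s.2.2.1.1.e.x := up.elim (fun h => (yge'.1 (h.trans hi.le)).trans hj) id
            exact ⟨hs.p, ⟨r2, r2, r3, r4, fun _ => ⟨r3, r4⟩⟩, ⟨q1, q1, hc'.2, e, fun _ => ⟨hc'.2, e⟩⟩,
              .inr e, .inl r3, .inr (.inl ⟨rfl, r3, hc'.2⟩)⟩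
        · exact move false ⟨nofun, fun _ => up.elim (fun h => h.trans hi.le)
            fun h => yge'.2 (h.trans hj.le)⟩ hc
    | false =>
      simp only [hd, Half.out, hrd, Bool.not_true, Bool.not_false, Bool.false_or, cond_true,
        cond_false] at *
      cases h0 : ltB s.2.1.1.e.x s.1.snd.x || ltB s.2.2.1.1.e.x (-s.1.snd.y) with
      | true =>
        rw [Bool.or_eq_true, ltB_iff, ltB_iff] at h0
        have hc := mid.resolve_left (by rintro ⟨-, -, h6, -, h7⟩; rcases h0 with h | h <;> linarith)
        refine move false ⟨nofun, fun _ => ?_⟩ hc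
        simp only [true_and, Bool.false_eq_true, false_and, false_or] at hc
        exact h0.elim (fun h => hc.1.trans h.le) fun h => yge'.2 (hc.2.trans h.le)
      | false =>
        rw [Bool.or_eq_false_iff, ltB_false, ltB_false] at h0
        cases hi : ltB s.1.fst.x s.2.1.1.c.x <;> cases hj : ltB (-s.1.fst.y) s.2.2.1.1.c.x <;>
          simp only [ltB_iff, ltB_false] at hi hj
        · exact hpr ⟨hi, h0.1, hj, h0.2⟩
        all_goals
          have hc := mid.resolve_left (by rintro ⟨-, h6, -, h7, -⟩; linarith)
          have hc' := hc
          simp only [true_and, Bool.false_eq_true, false_and, false_or] at hc'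
          simp only [cond_true, cond_false, Bool.true_and, Bool.false_and, Bool.false_or,
            Bool.true_or, Bool.or_false]
        · cases hf : s.2.2.1.2.2 with
          | true =>
            exact move true ⟨fun _ => xle'.2 (hj.le.trans (q5 hf).1), nofun⟩ hc
          | false =>
            have e : s.2.1.1.c.x ≤ a := down.elim id fun h => hi.trans (xle'.2 (hj.le.trans h))
            exact ⟨hs.p, ⟨r1, r1, e, hc'.1, fun _ => ⟨e, hc'.1⟩⟩, ⟨q2, q2, q3, q4, fun _ => ⟨q3, q4⟩⟩,
              .inl hc'.1, .inl e, .inr (.inr ⟨rfl, hc'.1, q4⟩)⟩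
        · cases hf : s.2.1.2.2 with
          | true => exact move true ⟨fun _ => hi.le.trans (r5 hf).1, nofun⟩ hc
          | false =>
            have e : s.2.2.1.1.c.x ≤ -b := down.elim (fun h => hj.trans (xle'.1 (hi.le.trans h))) id
            exact ⟨hs.p, ⟨r2, r2, r3, r4, fun _ => ⟨r3, r4⟩⟩, ⟨q1, q1, e, hc'.2, fun _ => ⟨e, hc'.2⟩⟩,
              .inl r4, .inr e, .inr (.inr ⟨rfl, r4, hc'.2⟩)⟩
        · exact move true ⟨fun _ => down.elim (fun h => hi.le.trans h)
            fun h => xle'.2 (hj.le.trans h), nofun⟩ hc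

/-- The edge that has been found contains the corner. -/
theorem solve_spec (hs : Inv N S E Nr lr hr Nq lq hq a b s)
    (G : Setting N S E Nr lr hr Nq lq hq a b) : PInv N S E a s.solve ∧ s.solve.done = true := by
  obtain ⟨h1, h2⟩ := iter_induction (b := fun s : Tri => !s.1.done) (f := step) (μ := meas)
    (fun s hs => meas_step ((Bool.not_eq_true' _).mp hs)) (Q := Inv N S E Nr lr hr Nq lq hq a b)
    (fun s hs _ => inv_step G hs) hs le_rfl
  exact ⟨h1.p, by simpa [solve] using h2⟩

end Tri

/-! ## The windows at the beginning -/

/-- The segment, degenerate if it has only one point. -/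
def Seg.make (a : V) (g : Tree) (b : V) : Seg := bif ltB a.key b.key then ⟨a, g, b⟩ else .dup a

def Win.start (w : PW) : Win :=
  ⟨⟨.dup w.lo, .make w.lo w.A w.x, .make w.x w.B w.hi, .dup w.hi, .dup w.hi⟩, w.lo, w.hi⟩

attribute [reducible] Seg.make Win.start

/-- The trees contain no points beyond the middle of the window. -/
def PW.Pure (w : PW) : Prop :=
  (w.x = w.hi ∨ ∀ v ∈ w.A.toList, v.key < w.x.key) ∧ ∀ v ∈ w.B.toList, w.x.key ≤ v.key

theorem Win.start_ok {N : Set V} {w : PW} (hw : w.Ok N) (hp : w.Pure)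
    (hN : ∀ u ∈ N, ∀ v ∈ N, u.key = v.key → u = v) : (Win.start w).Ok N w.lo w.hi := by
  obtain ⟨h1, h2, h3, h4, h5, h6, h7⟩ := hw
  have make : ∀ a ∈ N, ∀ b ∈ N, ∀ g, a.key ≤ b.key → (Seg.make a g b).a = a ∧
      (Seg.make a g b).b = b ∧ (a.key < b.key → Seg.make a g b = ⟨a, g, b⟩) ∧
      (¬ a.key < b.key → Seg.make a g b = .dup a) := by
    intro a ha b hb g hab
    unfold Seg.make
    rcases hab.lt_or_eq with h | h
    · simp [ltB_iff.2 h, h]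
    · obtain rfl := hN a ha b hb h
      simp [Seg.dup, ltB_false.2 (le_refl a.key)]
  obtain ⟨a1, a2, a3, a4⟩ := make _ h1 _ h2 w.A h4
  obtain ⟨b1, b2, b3, b4⟩ := make _ h2 _ h3 w.B h5
  refine ⟨⟨rfl, .inr rfl, a1, ?_, b1.trans a2.symm, ?_, b2.symm,
    .inr (congrArg Seg.dup b2.symm), rfl,
    .inr rfl, rfl⟩, .inl ⟨rfl, rfl⟩, .inl ⟨rfl, rfl⟩⟩
  · by_cases h : w.lo.key < w.x.key
    · left; rw [show (Win.start w).w.s1 = _ from a3 h]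
      exact ⟨h1, h2, le_rfl, h, h5, h6, .inl rfl, hp.1⟩
    · exact .inr (a4 h)
  · by_cases h : w.x.key < w.hi.key
    · left; rw [show (Win.start w).w.s2 = _ from b3 h]
      exact ⟨h2, h3, h4, h, le_rfl, h7, .inr hp.2, .inl rfl⟩
    · exact .inr ((b4 h).trans (congrArg Seg.dup a2.symm))

theorem run_pure {T : Tree} (hT : Spread T) {f S E : V} (hf : IsFirst T f) : (run T f S E).Pure := by
  unfold run
  cases leB S.key E.key with
  | true => exact ⟨.inl rfl, by simp [Tree.toList]⟩
  | false =>
    refine ⟨.inr fun v hv => hT.lt _ hv _ hf.mem, fun v hv => ?_⟩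
    change v ∈ T.shift.toList at hv
    rw [Tree.toList_shift, List.mem_map] at hv
    obtain ⟨u, hu, rfl⟩ := hv
    have := hf.le u hu
    change f.key + 1 ≤ u.key + ((1 : ℤ) : ℝ)
    push_cast
    linarith

/-- The upper boundary from left to right. -/
def upper (T : Tree) : PW :=
  run T.mirror (first T.mirror) (ext T (first T) (-1, 0, 0, 1)).mir (ext T (first T) (1, 0, 0, 1)).mir

/-- The lower left boundary from left to right. -/
def lower (T : Tree) : PW :=
  run T (first T) (ext T (first T) (-1, 0, 0, -1)) (ext T (first T) (0, -1, -1, 0))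

/-- The tree of the polygon after a rotation by a right angle. -/
def turned (T : Tree) : Tree := T.lin 0 (-1) 1 0

instance : CompConst ((-1, 0, 0, 1) : ℝ × ℝ × ℝ × ℝ) := ⟨fun L k => by fun_prop⟩
attribute [reducible] upper lower turned

structure UpperSpec (N : Set V) (P : Set (ℝ × ℝ)) (w : PW) : Prop where
  ok : w.Ok N
  pure : w.Pure
  chain : UpChain N P w.lo w.hi
  inj : ∀ u ∈ N, ∀ v ∈ N, u.key = v.key → u = v
  le : ∀ z ∈ P, w.lo.x ≤ z.1
  ge : ∀ z ∈ P, z.1 ≤ w.hi.x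

theorem Good.first {T : Tree} (hT : Good T) : IsFirst T (first T) :=
  ⟨(first_spec hT.sorted hT.isNil).1, (first_spec hT.sorted hT.isNil).2⟩

theorem Good.turned {T : Tree} (hT : Good T) : Good (turned T) := hT.rot

theorem upper_spec {T : Tree} (hT : Good T) :
    UpperSpec (V.mir '' cover T) (hull (cover T)) (upper T) := by
  obtain ⟨l1, l2⟩ := ext_spec hT hT.first (c := (-1, 0, 0, 1)) (by norm_num)
  obtain ⟨r1, r2⟩ := ext_spec hT hT.first (c := (1, 0, 0, 1)) (by norm_num)
  have hm := hT.toSpread.mirror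
  have mm : ∀ v ∈ T.toList, v.mir ∈ T.mirror.toList := fun v hv => by
    rw [Tree.toList_mirror]; exact List.mem_reverse.2 (List.mem_map_of_mem hv)
  have hf : IsFirst T.mirror (RealRAM.first T.mirror) := by
    have := first_spec hm.sorted (T := T.mirror) (by
      cases h : T.mirror with
      | nil => have := mm _ l1; simp [h, Tree.toList] at this
      | node => rfl)
    exact ⟨this.1, this.2⟩
  obtain ⟨h1, h2, ⟨k, h3⟩, h4, h5⟩ := run_ok hm hf.mem hf.le (mm _ l1) (mm _ r1)
  have r3 : IsExt (cover T) 1 0 0 1 ((ext T (RealRAM.first T) (1, 0, 0, 1)).sh (-k)) :=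
    ⟨cover_sh r2.1 _, r2.2⟩
  have e : (upper T).hi = ((ext T (RealRAM.first T) (1, 0, 0, 1)).sh (-k)).mir := by
    rw [upper, h3]; simp [V.sh, V.mir]; ring
  have e' : (upper T).lo = (ext T (RealRAM.first T) (-1, 0, 0, 1)).mir := h2
  change _ ≤ (upper T).hi.key at h4
  change (upper T).hi.key < _ at h5
  rw [e] at h4 h5
  refine ⟨cover_mirror T ▸ h1, run_pure hm hf, ?_, ?_, fun z hz => ?_, fun z hz => ?_⟩
  · rw [e, e']
    exact hT.cyc.upChain r3 l2 (by linarith) (by linarith)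
  · rintro _ ⟨u, hu, rfl⟩ _ ⟨v, hv, rfl⟩ h
    rw [hT.cyc.inj u hu v hv (neg_injective h)]
  · rw [e']
    have := le_of_hull (fun v hv => l2.le hv) hz
    simp only; linarith
  · rw [e]
    have := le_of_hull (fun v hv => r3.le hv) hz
    simp only; linarith

structure LowerSpec (T : Tree) (w : PW) : Prop where
  ok : w.Ok (cover T)
  lo : IsExt (cover T) (-1) 0 0 (-1) w.lo
  hi : IsExt (cover T) 0 (-1) (-1) 0 w.hi
  le : w.lo.key ≤ w.hi.key
  lt : w.hi.key < w.lo.key + 1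

theorem lower_spec {T : Tree} (hT : Good T) : LowerSpec T (lower T) := by
  obtain ⟨l1, l2⟩ := ext_spec hT hT.first (c := (-1, 0, 0, -1)) (by norm_num)
  obtain ⟨r1, r2⟩ := ext_spec hT hT.first (c := (0, -1, -1, 0)) (by norm_num)
  obtain ⟨h1, h2, ⟨k, h3⟩, h4, h5⟩ := run_ok hT.toSpread hT.first.mem hT.first.le l1 r1
  refine ⟨h1, ?_, ?_, ?_, ?_⟩
  · rw [lower, h2]; exact l2
  · rw [lower, h3]; exact ⟨cover_sh r2.1 _, r2.2⟩
  · rw [lower, h2]; exact h4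
  · rw [lower, h2]; exact h5

/-! ## The search for the lower left edge -/

/-- An empty tree certifies that no vertex lies between the ends, so the chord is an edge and its
line bounds the whole polygon. -/
theorem Seg.Ok.upperPair {N : Set V} {P : Set (ℝ × ℝ)} {l h : V} (hu : UpChain N P l h) {s : Seg}
    (hs : s.Ok N l h) : UpperPair P s.a s.b s.g.isNil := by
  cases hg : s.g with
  | nil => exact hu.edge _ _ ⟨hs.a_mem, hs.b_mem, hs.lt, Gap.nil_iff.1 (hg ▸ hs.gap)⟩ hs.le_a hs.b_le
  | node => exact hu.pair _ hs.a_mem _ hs.b_mem hs.le_a hs.lt hs.b_le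

/-- A largest triangle, the leftmost one. -/
structure Best (P : Set (ℝ × ℝ)) (a b w h : ℝ) : Prop where
  opt : Opt P a b w h
  min : ∀ a' b' w' h', Fits P a' b' w' h' → w' * h' = w * h → a ≤ a'

/-- A point on a strictly falling edge of the lower left boundary. -/
structure OnLower (N : Set V) (S E : V) (a b : ℝ) (u v : V) : Prop where
  adj : Adj N u v
  le : S.key ≤ u.key
  ge : v.key ≤ E.key
  x₁ : u.x ≤ a
  x₂ : a ≤ v.x
  y : (v.y - u.y) * (a - u.x) = (v.x - u.x) * (b - u.y)

/-- The chain falls strictly, so comparing a vertex with the corner by abscissa or by ordinate gives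
the same result. This links positions on the upper chain with positions on the right chain. -/
theorem OnLower.iff {N : Set V} {S E : V} {a b : ℝ} {u v w : V}
    (mono : ∀ u ∈ N, ∀ v ∈ N, S.key ≤ u.key → u.key < v.key → v.key ≤ E.key →
      u.x < v.x ∧ v.y < u.y) (inj : ∀ u ∈ N, ∀ v ∈ N, u.key = v.key → u = v)
    (ho : OnLower N S E a b u v) (hw : w ∈ N) (h1 : S.key ≤ w.key) (h2 : w.key ≤ E.key) :
    (w.x ≤ a ↔ b ≤ w.y) ∧ (a ≤ w.x ↔ w.y ≤ b) := by
  obtain ⟨hadj, h3, h4, x1, x2, y⟩ := ho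
  obtain ⟨m1, m2⟩ := mono _ hadj.left _ hadj.right h3 hadj.lt h4
  have hx : 0 < v.x - u.x := by linarith
  have hy : 0 < u.y - v.y := by linarith
  have y1 : b ≤ u.y := by nlinarith
  have y2 : v.y ≤ b := by nlinarith
  have e1 : a ≤ u.x ↔ u.y ≤ b := ⟨fun h => by nlinarith, fun h => by nlinarith⟩
  have e2 : v.x ≤ a ↔ b ≤ v.y := ⟨fun h => by nlinarith, fun h => by nlinarith⟩
  rcases le_or_gt w.key u.key with h | h
  · rcases h.lt_or_eq with h | h
    · obtain ⟨m3, m4⟩ := mono _ hw _ hadj.left h1 h (hadj.lt.le.trans h4)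
      exact ⟨⟨fun _ => by linarith, fun _ => by linarith⟩,
        ⟨fun _ => by linarith, fun _ => by linarith⟩⟩
    · rw [inj _ hw _ hadj.left h]
      exact ⟨⟨fun _ => y1, fun _ => x1⟩, e1⟩
  · rcases (not_lt.1 (hadj.adj _ hw h)).lt_or_eq with h | h
    · obtain ⟨m3, m4⟩ := mono _ hadj.right _ hw (h3.trans hadj.lt.le) h h2
      exact ⟨⟨fun _ => by linarith, fun _ => by linarith⟩,
        ⟨fun _ => by linarith, fun _ => by linarith⟩⟩
    · rw [← inj _ hadj.right _ hw h]
      exact ⟨e2, ⟨fun _ => y2, fun _ => x2⟩⟩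

/-- The combinatorial search meets the geometry here: its two assumptions about the test are the
contrapositives of `testA_high` and `testA_low`, with the supporting slopes provided by the lower
chain. -/
theorem Tri.setting {T : Tree} (hT : Good T) {w r q : PW} (hw : LowerSpec T w) {Nr Nq : Set V}
    (hr : UpperSpec Nr (hull (cover T)) r) (hq : UpperSpec Nq (rot (hull (cover T))) q)
    {a b c d : ℝ} (ht : Best (hull (cover T)) a b c d) {u v : V}
    (ho : OnLower (cover T) w.lo w.hi a b u v) :
    Setting (cover T) w.lo w.hi Nr r.lo r.hi Nq q.lo q.hi a b := by
  have hP := hull_convex (cover T)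
  obtain ⟨mono, s₁, s₂, -⟩ := hT.cyc.lowChain hw.lo hw.hi hw.lt
  have iff := fun v hv => ho.iff mono hT.cyc.inj (w := v) hv
  have hm : ∀ u ∈ cover T, ∀ v ∈ cover T, w.lo.key ≤ u.key → u.key < v.key → v.key ≤ w.hi.key →
      0 < -slope u v := fun u hu v hv h1 h2 h3 => by
    obtain ⟨m1, m2⟩ := mono u hu v hv h1 h2 h3
    rw [slope, ← neg_div]
    exact div_pos (by linarith) (by linarith)
  refine ⟨mono, fun v hv h1 h2 => (iff v hv h1 h2).1, fun v hv h1 h2 => (iff v hv h1 h2).2,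
    fun u hu v hv h1 h2 h3 => (hr.chain.pair u hu v hv h1 h2 h3).lt,
    fun u hu v hv h1 h2 h3 => (hq.chain.pair u hu v hv h1 h2 h3).lt, hr.inj, hq.inj,
    fun v hv => ⟨hr.le _ (mem_hull hv), hr.ge _ (mem_hull hv)⟩,
    fun v hv => ⟨hq.le (-v.y, v.x) ?_, hq.ge (-v.y, v.x) ?_⟩, ?_, ?_⟩
  · simpa [rot, V.pt] using mem_hull hv
  · simpa [rot, V.pt] using mem_hull hv
  · intro u hu v hv h1 h2 h3 s t hs ht' htest
    by_contra! hc
    obtain ⟨m, hm1, hm2⟩ := s₁ u hu v hv h1 h2 h3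
    have := testA_high hP ht.opt (hs.upperPair hr.chain) (ht'.upperPair hq.chain) hm2
      (hm u hu v hv h1 h2 h3) hm1 hc.2.1 hc.2.2 hc.1
      (not_le.1 fun h => hc.1.not_ge ((iff u hu h1 (h2.le.trans h3)).1.2 h))
    rw [htest] at this
    simp at this
  · intro u hu v hv h1 h2 h3 s t hs ht' htest
    by_contra! hc
    obtain ⟨m, hm1, hm2⟩ := s₂ u hu v hv h1 h2 h3
    obtain ⟨m1, m2⟩ := mono u hu v hv h1 h2 h3
    have := testA_low hP ht.opt ht.min (hs.upperPair hr.chain) (ht'.upperPair hq.chain) hm2 hm1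
      m1 (by rw [slope]; have : v.x - u.x ≠ 0 := by linarith
             field_simp; ring) hc.2.1 hc.2.2 hc.1
      (not_le.1 fun h => hc.1.not_ge ((iff v hv (h1.trans h2.le) h3).2.2 h))
    rw [htest] at this
    simp at this

theorem PW.Ok.step_lt {N : Set V} {w : PW} (hw : w.Ok N) (h : w.lo.key < w.hi.key) (d : Bool) :
    (w.step d).lo.key < (w.step d).hi.key := by
  unfold PW.step
  cases hr : w.ready with
  | false => simpa only [cond_false, skip_lo, skip_hi] using h
  | true =>
    obtain ⟨-, -, h3, h4, h5⟩ := hw.fst_snd hr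
    cases d
    · simp only [cond_true, cond_false, low_lo, low_hi]; linarith
    · simp only [cond_true, high_lo, high_hi]; linarith

theorem Tri.step_lt {N : Set V} {s : Tri} (hs : s.1.Ok N) (h : s.1.lo.key < s.1.hi.key) :
    s.step.1.lo.key < s.step.1.hi.key := by
  let Q (t : Tri) : Prop := t.1.lo.key < t.1.hi.key
  have hc (c : Bool) (x y : Tri) (hx : Q x) (hy : Q y) : Q (bif c then x else y) := by
    cases c <;> assumption
  have hd (d : Bool) (t) : Q (s.1.step d, t) := hs.step_lt h d
  have h' (u v w x t) : Q (⟨s.1.lo, u, v, w, s.1.hi, x⟩, t) := h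
  have h'' (t) : Q (s.1, t) := h
  exact hc _ _ _ (hd _ _) <| hc _ _ _ (hd _ _) <| hc _ _ _ (h'' _) <| hc _ _ _ (h'' _) <|
    hc _ _ _ (hd _ _) <| hc _ _ _ (hd _ _) <| hc _ _ _ (h' _ _ _ _ _) <|
    hc _ _ _ (h' _ _ _ _ _) <| hc _ _ _ (h'' _) <| hc _ _ _ (h'' _) (h'' _)

theorem Tri.solve_lt {N : Set V} {S E : V} {Nr : Set V} {lr hr : V} {Nq : Set V} {lq hq : V}
    {a b : ℝ} {s : Tri} (hs : Inv N S E Nr lr hr Nq lq hq a b s)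
    (G : Setting N S E Nr lr hr Nq lq hq a b) (h : s.1.lo.key < s.1.hi.key) :
    s.solve.lo.key < s.solve.hi.key :=
  (iter_induction (b := fun s : Tri => !s.1.done) (f := step) (μ := meas)
    (fun s hs => meas_step (by simpa using hs))
    (Q := fun s => Inv N S E Nr lr hr Nq lq hq a b s ∧ s.1.lo.key < s.1.hi.key)
    (fun s hs _ => ⟨inv_step G hs.1, Tri.step_lt hs.1.p.ok hs.2⟩) ⟨hs, h⟩ le_rfl).1.2

/-- The edge of the lower left boundary with the corner of the right angle. -/
def lowerEdge (w r q : PW) : PW :=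
  Tri.solve (w, (Win.start r, Win.start r, true), (Win.start q, Win.start q, true), true)

attribute [reducible] lowerEdge

theorem lowerEdge_spec {T : Tree} (hT : Good T) {w r q : PW} (hw : LowerSpec T w) {Nr Nq : Set V}
    (hr : UpperSpec Nr (hull (cover T)) r) (hq : UpperSpec Nq (rot (hull (cover T))) q)
    {a b c d : ℝ} (ht : Best (hull (cover T)) a b c d) {u v : V}
    (ho : OnLower (cover T) w.lo w.hi a b u v) :
    Tri.PInv (cover T) w.lo w.hi a (lowerEdge w r q) ∧ (lowerEdge w r q).done = true ∧
      (lowerEdge w r q).lo.key < (lowerEdge w r q).hi.key := by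
  have G := Tri.setting hT hw hr hq ht ho
  have m := ht.opt.1.2.2.1
  have mx : (-b, a) ∈ rot (hull (cover T)) := by simpa [rot] using m
  have h1 := hw.lo.le ho.adj.left
  have h2 : v.x ≤ w.hi.x := by
    rcases ho.ge.lt_or_eq with h | h
    · exact (G.mono _ ho.adj.right _ hw.ok.hi (ho.le.trans ho.adj.lt.le) h le_rfl).1.le
    · rw [hT.cyc.inj _ ho.adj.right _ hw.ok.hi h]
  have r1 := hr.le _ m
  have r2 := hr.ge _ m
  have q1 := hq.le _ mx
  have q2 := hq.ge _ mx
  have or := Win.start_ok hr.ok hr.pure hr.inj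
  have oq := Win.start_ok hq.ok hq.pure hq.inj
  have I : Tri.Inv (cover T) w.lo w.hi Nr r.lo r.hi Nq q.lo q.hi a b
      (w, (Win.start r, Win.start r, true), (Win.start q, Win.start q, true), true) :=
    ⟨⟨hw.ok, le_rfl, le_rfl, by linarith [ho.x₁], ho.x₂.trans h2⟩,
    ⟨or, or, r1, r2, fun _ => ⟨r1, r2⟩⟩, ⟨oq, oq, q1, q2, fun _ => ⟨q1, q2⟩⟩, .inl r2, .inl r1,
    .inr (.inl ⟨rfl, r1, q1⟩)⟩
  obtain ⟨h3, h4⟩ := Tri.solve_spec I G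
  exact ⟨h3, h4, Tri.solve_lt I G (ho.le.trans_lt (ho.adj.lt.trans_le ho.ge))⟩

/-! ### Finding the remaining edges and the finitely many candidates -/

/-! ## Searching for edges of two chains -/

namespace PW

/-- The window is a single edge. -/
def single (w : PW) : Bool := w.done && !(ltB w.lo.key w.x.key && ltB w.x.key w.hi.key)

def usable (w : PW) : Bool := w.done || w.ready

/-- A finished window may still consist of two edges. The vertex between them then plays the part of
a degenerate chord, and the next move keeps one of the edges. -/
def c₁ (w : PW) : V := bif w.done then w.x else w.fst
def c₂ (w : PW) : V := bif w.done then w.x else w.snd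

/-- The line that is used in tests. -/
def e₁ (w : PW) : V := bif w.done then w.lo else w.fst
def e₂ (w : PW) : V := bif w.single then w.hi else bif w.done then w.x else w.snd

def move (w : PW) (d : Bool) : PW :=
  bif w.done then bif d then ⟨w.x, .nil, w.x, .nil, w.hi, false⟩
    else ⟨w.lo, .nil, w.lo, .nil, w.x, false⟩
  else w.step d

def todo (w : PW) : ℕ := bif w.single then 0 else w.meas + 1

@[fun_prop] theorem comp_single : Comp L k single := by unfold single; fun_prop
attribute [reducible] usable c₁ c₂ e₁ e₂ move

theorem todo_le (w : PW) : w.todo ≤ w.meas + 1 := by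
  unfold todo; cases w.single <;> simp

theorem todo_move {w : PW} (h : w.single = false) (d : Bool) : (w.move d).todo < w.todo := by
  rw [show w.todo = w.meas + 1 by simp [todo, h]]
  cases hd : w.done with
  | true =>
    have h1 (v hi : V) : (PW.mk v .nil v .nil hi false).single = true := by
      simp [single, done, Tree.isNil]
    have h2 (v hi : V) : (PW.mk v .nil v .nil hi false).todo = 0 := by rw [todo, h1, cond_true]
    simp only [move, hd, cond_true]
    cases d <;> simp only [cond_true, cond_false, h2] <;> omega
  | false =>
    have h1 := meas_step hd d
    have h2 := (w.step d).todo_le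
    simp only [move, hd, cond_false]
    omega

/-- The sought position is in the window. -/
structure At (N : Set V) (S E : V) (t : ℝ) (w : PW) : Prop extends Tri.PInv N S E t w where
  lt : S.key < E.key → w.lo.key < w.hi.key

variable {N : Set V} {S E : V} {t : ℝ} {w : PW}

theorem not_single (h : w.single = false) (hd : w.done = true) :
    w.lo.key < w.x.key ∧ w.x.key < w.hi.key := by
  simpa [single, hd] using h

theorem At.chord (hw : At N S E t w) (h : w.single = false) (hu : w.usable = true) :
    w.c₁ ∈ N ∧ w.c₂ ∈ N ∧ S.key ≤ w.c₁.key ∧ w.c₁.key ≤ w.c₂.key ∧ w.c₂.key ≤ E.key ∧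
      (w.done = false → w.c₁.key < w.c₂.key) := by
  unfold c₁ c₂
  cases hd : w.done with
  | true =>
    obtain ⟨h1, h2⟩ := not_single h hd
    exact ⟨hw.ok.x, hw.ok.x, hw.lo.trans h1.le, le_rfl, h2.le.trans hw.hi, nofun⟩
  | false =>
    obtain ⟨h1, h2, h3, h4, h5⟩ := hw.ok.fst_snd (by simpa [usable, hd] using hu)
    exact ⟨h1, h2, hw.lo.trans h3, h4.le, h5.trans hw.hi, fun _ => h4⟩

theorem At.move (hw : At N S E t w) (h : w.single = false) (d : Bool)
    (h' : w.usable = true → (d = true → w.c₁.x ≤ t) ∧ (d = false → t ≤ w.c₂.x)) :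
    At N S E t (w.move d) := by
  unfold PW.move
  cases hd : w.done with
  | true =>
    obtain ⟨h1, h2⟩ := not_single h hd
    obtain ⟨g1, g2⟩ := h' (by simp [usable, hd])
    obtain ⟨a1, a2⟩ := hw.ok.adj hd
    simp only [c₁, c₂, hd, cond_true] at g1 g2
    have nil (v : V) : Gap N v .nil v := Gap.nil_iff.2 fun u _ h1 h2 => absurd h2 h1.not_gt
    cases d with
    | true => exact ⟨⟨⟨hw.ok.x, hw.ok.x, hw.ok.hi, le_rfl, h2.le, nil _, Gap.nil_iff.2 a2⟩,
        hw.lo.trans h1.le, hw.hi, g1 rfl, hw.ge⟩, fun _ => h2⟩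
    | false => exact ⟨⟨⟨hw.ok.lo, hw.ok.lo, hw.ok.x, le_rfl, h1.le, nil _, Gap.nil_iff.2 a1⟩,
        hw.lo, h2.le.trans hw.hi, hw.le, g2 rfl⟩, fun _ => h1⟩
  | false =>
    simp only [c₁, c₂, hd, cond_false, usable, Bool.false_or] at h'
    exact ⟨hw.toPInv.step d h', fun hS => hw.ok.step_lt (hw.lt hS) d⟩

theorem At.adj (hw : At N S E t w) (hS : S.key < E.key) (h : w.single = true) : Adj N w.lo w.hi := by
  simp only [single, Bool.and_eq_true, Bool.not_eq_true', Bool.and_eq_false_iff, ltB_false] at h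
  obtain ⟨a1, a2⟩ := hw.ok.adj h.1
  refine ⟨hw.ok.lo, hw.ok.hi, hw.lt hS, fun u hu h1 h2 => ?_⟩
  rcases h.2 with h | h
  · exact a2 u hu (h.trans_lt h1) h2
  · exact a1 u hu h1 (h2.trans_le h)

/-- The edge on which the search goes on. -/
theorem At.edge (hw : At N S E t w) (h : w.single = false) (hd : w.done = true) :
    Adj N w.lo w.x ∧ w.x.key ≤ E.key :=
  ⟨⟨hw.ok.lo, hw.ok.x, (not_single h hd).1, (hw.ok.adj hd).1⟩, (not_single h hd).2.le.trans hw.hi⟩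

end PW

/-- Which of two windows, one of which is not yet a single edge, is to be made smaller. -/
def pick (r q : PW) (c : Bool) : Bool := bif r.single then false else bif q.single then true else c

attribute [reducible] pick

section
variable {γ : Type} [Enc γ] (d : γ → PW → PW → Bool × Bool)

/-- A window without a usable chord is moved first; that only replaces a tree by a child and leaves
the ends alone, so the direction given to the move is immaterial. -/
def pairStep (s : γ × PW × PW) : γ × PW × PW :=
  bif s.2.1.single || s.2.1.usable then bif s.2.2.single || s.2.2.usable then
    bif pick s.2.1 s.2.2 (d s.1 s.2.1 s.2.2).1 then
      (s.1, s.2.1.move (d s.1 s.2.1 s.2.2).2, s.2.2)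
    else (s.1, s.2.1, s.2.2.move (d s.1 s.2.1 s.2.2).2)
  else (s.1, s.2.1, s.2.2.move true) else (s.1, s.2.1.move true, s.2.2)

def pairTodo (s : γ × PW × PW) : ℕ := s.2.1.todo + s.2.2.todo

def pairSearch (s : γ × PW × PW) : γ × PW × PW :=
  iter (fun s : γ × PW × PW => !(s.2.1.single && s.2.2.single)) (pairStep d) (pairTodo s) s

variable {d}

theorem pick_single {r q : PW} {c : Bool} (h : (!(r.single && q.single)) = true) :
    (pick r q c = true → r.single = false) ∧ (pick r q c = false → q.single = false) := by
  unfold pick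
  cases hr : r.single <;> cases hq : q.single <;> simp_all

omit [Enc γ] in
theorem todo_pairStep (s : γ × PW × PW) (h : (!(s.2.1.single && s.2.2.single)) = true) :
    pairTodo (pairStep d s) < pairTodo s := by
  unfold pairTodo
  unfold pairStep
  cases h1 : s.2.1.single || s.2.1.usable with
  | false => exact Nat.add_lt_add_right (PW.todo_move (by simp_all) _) _
  | true =>
    cases h2 : s.2.2.single || s.2.2.usable with
    | false => exact Nat.add_lt_add_left (PW.todo_move (by simp_all) _) _
    | true =>
      obtain ⟨h3, h4⟩ := pick_single (c := (d s.1 s.2.1 s.2.2).1) h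
      cases h5 : pick s.2.1 s.2.2 (d s.1 s.2.1 s.2.2).1 with
      | true => exact Nat.add_lt_add_right (PW.todo_move (h3 h5) _) _
      | false => exact Nat.add_lt_add_left (PW.todo_move (h4 h5) _) _

theorem comp_pairStep (hd : Comp L 0 (fun z : γ × PW × PW => d z.1 z.2.1 z.2.2)) :
    Comp L 0 (pairStep d) := by unfold pairStep; fun_prop

theorem pairTodo_le (s : γ × PW × PW) : pairTodo s ≤ 6 * (size s + 1) := by
  have h1 := s.2.1.todo_le
  have h2 := s.2.2.todo_le
  have h3 := PW.meas_le s.2.1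
  have h4 := PW.meas_le s.2.2
  have e : size s = max (size s.1) (max (size s.2.1) (size s.2.2)) := rfl
  unfold pairTodo
  omega

@[fun_prop] theorem comp_pairSearch (hd : Comp L 0 (fun z : γ × PW × PW => d z.1 z.2.1 z.2.2)) :
    Comp L 1 (pairSearch d) :=
  Comp.loop (L := L) (b := fun s : γ × PW × PW => !(s.2.1.single && s.2.2.single))
    (f := pairStep d) pairTodo todo_pairStep 6 pairTodo_le (by fun_prop) (comp_pairStep hd)

omit [Enc γ] in
theorem pairSearch_spec {c : γ} {r q : PW} {N N' : Set V} {S E S' E' : V} {t t' : ℝ}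
    (hr : r.At N S E t) (hq : q.At N' S' E' t')
    (hd : ∀ r q : PW, r.At N S E t → q.At N' S' E' t' → (r.single || r.usable) = true →
      (q.single || q.usable) = true → (!(r.single && q.single)) = true →
      (pick r q (d c r q).1 = true → ((d c r q).2 = true → r.c₁.x ≤ t) ∧
        ((d c r q).2 = false → t ≤ r.c₂.x)) ∧
      (pick r q (d c r q).1 = false → ((d c r q).2 = true → q.c₁.x ≤ t') ∧
        ((d c r q).2 = false → t' ≤ q.c₂.x))) :
    ((pairSearch d (c, r, q)).2.1.At N S E t ∧ (pairSearch d (c, r, q)).2.1.single = true) ∧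
      (pairSearch d (c, r, q)).2.2.At N' S' E' t' ∧
        (pairSearch d (c, r, q)).2.2.single = true := by
  obtain ⟨⟨h1, h2, h3⟩, h4⟩ := iter_induction
    (b := fun s : γ × PW × PW => !(s.2.1.single && s.2.2.single)) (f := pairStep d)
    (μ := pairTodo) todo_pairStep
    (Q := fun s => s.1 = c ∧ s.2.1.At N S E t ∧ s.2.2.At N' S' E' t') (fun s ⟨h1, h2, h3⟩ hb => by
      unfold pairStep
      rw [h1]
      cases g1 : s.2.1.single || s.2.1.usable with
      | false => exact ⟨rfl, h2.move (by simp_all) _ (by simp_all), h3⟩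
      | true =>
        cases g2 : s.2.2.single || s.2.2.usable with
        | false => exact ⟨rfl, h2, h3.move (by simp_all) _ (by simp_all)⟩
        | true =>
          obtain ⟨g3, g4⟩ := hd _ _ h2 h3 g1 g2 hb
          obtain ⟨g5, g6⟩ := pick_single (c := (d c s.2.1 s.2.2).1) hb
          cases g7 : pick s.2.1 s.2.2 (d c s.2.1 s.2.2).1 with
          | true => exact ⟨rfl, h2.move (g5 g7) _ fun _ => g3 g7, h3⟩
          | false => exact ⟨rfl, h2, h3.move (g6 g7) _ fun _ => g4 g7⟩)
    (n := pairTodo (c, r, q)) (x := (c, r, q)) ⟨rfl, hr, hq⟩ le_rfl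
  simp only [Bool.not_eq_false', Bool.and_eq_true] at h4
  exact ⟨⟨h2, h4.1⟩, h3, h4.2⟩

end

/-! ## Largest triangles in a family that depends linearly on a parameter -/

/-- The family extends to both sides of the optimum, so the derivative of the area is neither
positive nor negative. -/
theorem Opt.stationary {P : Set (ℝ × ℝ)} {a b w h : ℝ} (hP : Convex ℝ P) (ht : Opt P a b w h)
    {α β γ δ s t : ℝ} (hs : 0 < s) (ht' : 0 < t)
    (p₁ : (a + s * α, b + s * β) ∈ P) (q₁ : (a + s * α + (w + s * γ), b + s * β) ∈ P)
    (r₁ : (a + s * α, b + s * β + (h + s * δ)) ∈ P)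
    (p₂ : (a - t * α, b - t * β) ∈ P) (q₂ : (a - t * α + (w - t * γ), b - t * β) ∈ P)
    (r₂ : (a - t * α, b - t * β + (h - t * δ)) ∈ P) : γ * h + δ * w = 0 := by
  have h1 := ht.deriv_le hP (α := α) (β := β) (ρ := β + δ) (σ := α + γ) hs hs hs p₁
    (mem_congr r₁) (mem_congr q₁)
  have h2 := ht.deriv_le hP (α := -α) (β := -β) (ρ := -β - δ) (σ := -α - γ) ht' ht' ht'
    (mem_congr p₂) (mem_congr r₂) (mem_congr q₂)
  linarith

/-- A triangle with its corner, its width and its height. -/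
abbrev Tr : Type := ℝ × ℝ × ℝ × ℝ

/-- The stationary triangle on the line through two given ones. -/
def crit (s t : Tr) : Tr :=
  let γ := t.2.2.1 - s.2.2.1
  let δ := t.2.2.2 - s.2.2.2
  let θ := (0 - (γ * s.2.2.2 + δ * s.2.2.1)) / (γ * δ + γ * δ)
  (s.1 + θ * (t.1 - s.1), s.2.1 + θ * (t.2.1 - s.2.1), s.2.2.1 + θ * γ, s.2.2.2 + θ * δ)

/-- If both legs vary, the area along the line is a proper quadratic polynomial, so its stationary
parameter is unique and given by a rational formula. -/
theorem crit_eq {a b w h a' b' w' h' θ : ℝ} (hγ : w' - w ≠ 0) (hδ : h' - h ≠ 0)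
    (hs : (w' - w) * (h + θ * (h' - h)) + (h' - h) * (w + θ * (w' - w)) = 0) :
    crit (a, b, w, h) (a', b', w', h') =
      (a + θ * (a' - a), b + θ * (b' - b), w + θ * (w' - w), h + θ * (h' - h)) := by
  have e : (0 - ((w' - w) * h + (h' - h) * w)) /
      ((w' - w) * (h' - h) + (w' - w) * (h' - h)) = θ := by
    rw [div_eq_iff (by
      have := mul_ne_zero hγ hδ
      rw [← two_mul]; exact mul_ne_zero two_ne_zero this)]
    linear_combination -hs
  simp only [crit, e]

attribute [reducible] crit

/-! ## The apex and the end of the base, if the edge with the corner is known -/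

def sup (x y : ℝ) : ℝ := bif leB x y then y else x
def inf (x y : ℝ) : ℝ := bif leB x y then x else y

theorem sup_eq (x y : ℝ) : sup x y = max x y := by
  unfold sup
  cases h : leB x y with
  | true => exact (max_eq_right (leB_iff.1 h)).symm
  | false => exact (max_eq_left (leB_false.1 h).le).symm

theorem inf_eq (x y : ℝ) : inf x y = min x y := by
  unfold inf
  cases h : leB x y with
  | true => exact (min_eq_left (leB_iff.1 h)).symm
  | false => exact (min_eq_right (leB_false.1 h).le).symm

attribute [reducible] sup inf

/-- The abscissa of the point of the edge at the height `-z`. -/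
def absc (c : V × V) (z : ℝ) : ℝ := c.1.x + (c.1.y + z) / (0 - slope c.1 c.2)

/-- Together with `bot`, this is the range which the edge and the two windows leave for the abscissa
of the corner. -/
def top (c : V × V) (r q : PW) : ℝ := inf c.2.x (inf r.hi.x (absc c q.hi.x))
def bot (c : V × V) (r q : PW) : ℝ := sup c.1.x (sup r.lo.x (absc c q.lo.x))

def testOn (c : V × V) (s : ℝ) (r q : PW) : Bool :=
  testA ⟨0, s, lineAt c.1 c.2 s⟩ (0 - slope c.1 c.2) r.e₁ r.e₂ r.done q.e₁ q.e₂

/-- A chord that sticks out of the range from `bot` to `top` is decided by the range alone.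
Otherwise the test is made at the earlier of the two lower chord ends: a positive answer shows that
the corner has passed it, and a negative one that the corner is not beyond the later of the two
upper chord ends. -/
def decOn (c : V × V) (r q : PW) : Bool × Bool :=
  bif !r.single && leB (top c r q) r.c₂.x then (true, false)
  else bif !r.single && leB r.c₁.x (bot c r q) then (true, true)
  else bif !q.single && leB (top c r q) (absc c q.c₂.x) then (false, false)
  else bif !q.single && leB (absc c q.c₁.x) (bot c r q) then (false, true)
  else bif testOn c (bif pick r q (leB r.c₁.x (absc c q.c₁.x)) then r.c₁.x else absc c q.c₁.x) r q
    then (pick r q (leB r.c₁.x (absc c q.c₁.x)), true)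
  else (pick r q (leB (absc c q.c₂.x) r.c₂.x), false)

attribute [reducible] absc top bot testOn decOn

namespace PW

variable {t : ℝ} {w : PW}

theorem lt_hb (h₁ : w.single = false → t < w.c₁.x) (h₂ : t < w.hi.x) :
    t < (RealRAM.hb w.e₁ w.e₂ w.done).x := by
  unfold RealRAM.hb e₁ e₂
  cases hs : w.single with
  | true =>
    have hd : w.done = true := by unfold single at hs; simp_all
    simpa [hd] using h₂
  | false =>
    have := h₁ hs
    unfold c₁ at this
    cases hd : w.done <;> simpa [hd] using this

theorem lb_lt (h₁ : w.single = false → w.c₂.x < t) (h₂ : w.lo.x < t) :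
    (RealRAM.lb w.e₁ w.e₂ w.done).x < t := by
  unfold RealRAM.lb e₁ e₂
  cases hs : w.single with
  | true =>
    have hd : w.done = true := by unfold single at hs; simp_all
    simpa [hd] using h₂
  | false =>
    have := h₁ hs
    unfold c₂ at this
    cases hd : w.done
    · simpa [hd] using this
    · simpa [hd] using h₂

end PW

namespace PW.At

variable {N : Set V} {P : Set (ℝ × ℝ)} {S E : V} {t : ℝ} {w : PW}

theorem upperPair (hN : UpChain N P S E) (hS : S.key < E.key) (hw : At N S E t w)
    (h : (w.single || w.usable) = true) : UpperPair P w.e₁ w.e₂ w.done := by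
  unfold e₁ e₂
  cases hs : w.single with
  | true =>
    have hd : w.done = true := by unfold single at hs; simp_all
    simp only [hd, cond_true]
    exact hN.edge _ _ (hw.adj hS hs) hw.lo hw.hi
  | false =>
    rw [hs, Bool.false_or] at h
    cases hd : w.done with
    | true =>
      obtain ⟨h1, h2⟩ := hw.edge hs hd
      exact hN.edge _ _ h1 hw.lo h2
    | false =>
      obtain ⟨h1, h2, h3, h4, h5, h6⟩ := hw.chord hs h
      have := hN.pair _ h1 _ h2 h3 (h6 hd) h5
      simpa [c₁, c₂, hd] using this

theorem chord_le (hN : UpChain N P S E) (hw : At N S E t w) (hs : w.single = false)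
    (h : w.usable = true) : w.c₁.x ≤ w.c₂.x := by
  obtain ⟨h1, h2, h3, h4, h5, h6⟩ := hw.chord hs h
  cases hd : w.done with
  | true => simp [c₁, c₂, hd]
  | false => exact (hN.pair _ h1 _ h2 h3 (h6 hd) h5).lt.le

end PW.At

/-- The corner of the right angle is on the edge `u v`. -/
structure OnEdgeAt (P : Set (ℝ × ℝ)) (u v : V) (a b : ℝ) : Prop where
  supp : SuppAt P u (-slope u v)
  mem : v.pt ∈ P
  lt : u.x < v.x
  x₁ : u.x ≤ a
  x₂ : a ≤ v.x
  y : b = lineAt u v a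

theorem lineAt_eq (u v : V) (x : ℝ) : lineAt u v x = u.y + slope u v * (x - u.x) := rfl

namespace OnEdgeAt

variable {P : Set (ℝ × ℝ)} {u v : V} {a b w h : ℝ} (ho : OnEdgeAt P u v a b)
include ho

theorem absc_lt {x : ℝ} : a < absc (u, v) x ↔ -b < x := by
  have := ho.supp.1
  rw [absc, ho.y, lineAt_eq, zero_sub, ← sub_lt_iff_lt_add', lt_div_iff₀ this]
  constructor <;> intro h <;> linarith

theorem lt_absc {x : ℝ} : absc (u, v) x < a ↔ x < -b := by
  have := ho.supp.1
  rw [absc, ho.y, lineAt_eq, zero_sub, ← lt_sub_iff_add_lt', div_lt_iff₀ this]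
  constructor <;> intro h <;> linarith

theorem lineAt_mem (hP : Convex ℝ P) {x : ℝ} (h₁ : u.x ≤ x) (h₂ : x ≤ v.x) :
    (x, lineAt u v x) ∈ P :=
  RealRAM.lineAt_mem hP ho.supp.2.1 ho.mem ho.lt h₁ h₂

theorem dec {Nr Nq : Set V} {S E S' E' : V} {r q : PW} (hP : Convex ℝ P)
    (ht : Best P a b w h) (hNr : UpChain Nr P S E) (hNq : UpChain Nq (rot P) S' E')
    (hS : S.key < E.key) (hS' : S'.key < E'.key)
    (hr : r.At Nr S E a) (hq : q.At Nq S' E' (-b)) (ur : (r.single || r.usable) = true)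
    (uq : (q.single || q.usable) = true) (hn : (!(r.single && q.single)) = true) :
    (pick r q (decOn (u, v) r q).1 = true → ((decOn (u, v) r q).2 = true → r.c₁.x ≤ a) ∧
      ((decOn (u, v) r q).2 = false → a ≤ r.c₂.x)) ∧
    (pick r q (decOn (u, v) r q).1 = false → ((decOn (u, v) r q).2 = true → q.c₁.x ≤ -b) ∧
      ((decOn (u, v) r q).2 = false → -b ≤ q.c₂.x)) := by
  have ht₁ : a ≤ top (u, v) r q := by
    rw [top, inf_eq, inf_eq]
    exact le_min ho.x₂ (le_min hr.ge (not_lt.1 fun h => (ho.lt_absc.1 h).not_ge hq.ge))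
  have ht₀ : bot (u, v) r q ≤ a := by
    rw [bot, sup_eq, sup_eq]
    exact max_le ho.x₁ (max_le hr.le (not_lt.1 fun h => (ho.absc_lt.1 h).not_ge hq.le))
  have le1 {x : ℝ} : a ≤ absc (u, v) x ↔ -b ≤ x := by
    rw [← not_lt, ← not_lt, ho.lt_absc]
  have le2 {x : ℝ} : absc (u, v) x ≤ a ↔ x ≤ -b := by
    rw [← not_lt, ← not_lt, ho.absc_lt]
  have pt (h : r.single = false) : pick r q true = true := by
    unfold pick; cases q.single <;> simp [h]
  have pf (h : q.single = false) : pick r q false = false := by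
    unfold pick; cases r.single <;> simp [h]
  have pp (c : Bool) : pick r q (pick r q c) = pick r q c := by
    unfold pick; cases r.single <;> cases q.single <;> rfl
  simp only [decOn]
  cases h1 : !r.single && leB (top (u, v) r q) r.c₂.x with
  | true =>
    rw [Bool.and_eq_true, leB_iff, Bool.not_eq_true'] at h1
    simp only [cond_true, pt h1.1]
    exact ⟨fun _ => ⟨nofun, fun _ => ht₁.trans h1.2⟩, nofun⟩
  | false =>
  cases h2 : !r.single && leB r.c₁.x (bot (u, v) r q) with
  | true =>
    rw [Bool.and_eq_true, leB_iff, Bool.not_eq_true'] at h2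
    simp only [cond_true, cond_false, pt h2.1]
    exact ⟨fun _ => ⟨fun _ => h2.2.trans ht₀, nofun⟩, nofun⟩
  | false =>
  cases h3 : !q.single && leB (top (u, v) r q) (absc (u, v) q.c₂.x) with
  | true =>
    rw [Bool.and_eq_true, leB_iff, Bool.not_eq_true'] at h3
    simp only [cond_true, cond_false, pf h3.1]
    exact ⟨nofun, fun _ => ⟨nofun, fun _ => le1.1 (ht₁.trans h3.2)⟩⟩
  | false =>
  cases h4 : !q.single && leB (absc (u, v) q.c₁.x) (bot (u, v) r q) with
  | true =>
    rw [Bool.and_eq_true, leB_iff, Bool.not_eq_true'] at h4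
    simp only [cond_true, cond_false, pf h4.1]
    exact ⟨nofun, fun _ => ⟨fun _ => le2.1 (h4.2.trans ht₀), nofun⟩⟩
  | false =>
  simp only [cond_false]
  simp only [Bool.and_eq_false_iff, Bool.not_eq_false', leB_false] at h1 h2 h3 h4
  have k1 (h : r.single = false) : bot (u, v) r q < r.c₁.x ∧ r.c₁.x ≤ r.c₂.x ∧
      r.c₂.x < top (u, v) r q := ⟨h2.resolve_left (by simp [h]),
    hr.chord_le hNr h (by simpa [h] using ur), h1.resolve_left (by simp [h])⟩
  have k2 (h : q.single = false) : bot (u, v) r q < absc (u, v) q.c₁.x ∧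
      absc (u, v) q.c₁.x ≤ absc (u, v) q.c₂.x ∧ absc (u, v) q.c₂.x < top (u, v) r q := by
    refine ⟨h4.resolve_left (by simp [h]), ?_, h3.resolve_left (by simp [h])⟩
    have := hq.chord_le hNq h (by simpa [h] using uq)
    have := ho.supp.1
    simp only [absc, zero_sub]
    gcongr
  have T₁ : top (u, v) r q ≤ v.x ∧ top (u, v) r q ≤ r.hi.x ∧
      top (u, v) r q ≤ absc (u, v) q.hi.x := by simp [top, inf_eq]
  have T₀ : u.x ≤ bot (u, v) r q ∧ r.lo.x ≤ bot (u, v) r q ∧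
      absc (u, v) q.lo.x ≤ bot (u, v) r q := by simp [bot, sup_eq]
  set s := bif pick r q (leB r.c₁.x (absc (u, v) q.c₁.x)) then r.c₁.x else absc (u, v) q.c₁.x
    with hs
  have s₁ : bot (u, v) r q < s ∧ s < top (u, v) r q ∧ (r.single = false → s ≤ r.c₁.x) ∧
      (q.single = false → s ≤ absc (u, v) q.c₁.x) := by
    rw [hs]
    unfold pick
    cases hr : r.single <;> cases hq : q.single
    · obtain ⟨a1, a2, a3⟩ := k1 hr
      obtain ⟨b1, b2, b3⟩ := k2 hq
      cases hl : leB r.c₁.x (absc (u, v) q.c₁.x)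
      · have := leB_false.1 hl
        simp; refine ⟨?_, ?_, ?_⟩ <;> linarith
      · have := leB_iff.1 hl
        simp; refine ⟨?_, ?_, ?_⟩ <;> linarith
    · obtain ⟨a1, a2, a3⟩ := k1 hr
      simp; constructor <;> linarith
    · obtain ⟨b1, b2, b3⟩ := k2 hq
      simp; constructor <;> linarith
    · simp [hr, hq] at hn
  obtain ⟨s1, s2, s3, s4⟩ := s₁
  have pr := hr.upperPair hNr hS ur
  have pq := hq.upperPair hNq hS' uq
  have hm := ho.supp.1
  cases h5 : testOn (u, v) s r q with
  | true =>
    have key : s ≤ a := by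
      by_contra! hc
      have := testA_high (x := ⟨0, s, lineAt u v s⟩) (m := -slope u v) hP ht.opt pr pq
        ⟨hm, ho.lineAt_mem hP (by linarith) (by linarith), fun z hz => by
          have := ho.supp.2.2 z hz
          simp only [lineAt_eq]; linarith⟩ hm le_rfl
        (PW.lt_hb (fun h => hc.trans_le (s3 h)) (by linarith))
        (PW.lt_hb (fun h => ho.absc_lt.1 (hc.trans_le (s4 h))) (ho.absc_lt.1 (by linarith)))
        hc (by simp only [ho.y, lineAt_eq]; nlinarith)
      rw [testOn, zero_sub] at h5
      simp only [] at h5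
      rw [this] at h5
      simp at h5
    simp only [cond_true, pp]
    refine ⟨fun h => ⟨fun _ => ?_, nofun⟩, fun h => ⟨fun _ => ?_, nofun⟩⟩
    · rwa [hs, h, cond_true] at key
    · rw [hs, h, cond_false] at key
      exact le2.1 key
  | false =>
    simp only [cond_false, pp]
    have key : ¬ ((r.single = false → r.c₂.x < a) ∧ (q.single = false → q.c₂.x < -b)) := by
      rintro ⟨c1, c2⟩
      have sa : s < a := by
        cases g : r.single with
        | false => have := k1 g; linarith [s3 g, c1 g]
        | true =>
          have g' : q.single = false := by simpa [g] using hn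
          have := k2 g'
          linarith [s4 g', ho.lt_absc.2 (c2 g')]
      -- Any point of the edge strictly between the tested point and the corner can serve as the
      -- second end of the chord; the midpoint is taken.
      have := testA_low (x := ⟨0, s, lineAt u v s⟩) (y := ⟨0, (s + a) / 2, lineAt u v ((s + a) / 2)⟩)
        (m := -slope u v) hP ht.opt ht.min pr pq
        ⟨hm, ho.lineAt_mem hP (by linarith) (by linarith [ho.x₂]), fun z hz => by
          have := ho.supp.2.2 z hz
          simp only [lineAt_eq]; linarith⟩ le_rfl (by simp only; linarith)
        (by simp only [lineAt_eq]; ring)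
        (PW.lb_lt c1 (by linarith))
        (PW.lb_lt c2 (ho.lt_absc.1 (by linarith)))
        (by simp only; linarith) (by simp only [ho.y, lineAt_eq]; nlinarith)
      rw [testOn, zero_sub] at h5
      simp only [] at h5
      rw [this] at h5
      simp at h5
    refine ⟨fun h => ⟨nofun, fun _ => ?_⟩, fun h => ⟨nofun, fun _ => ?_⟩⟩
    · by_contra! hc
      refine key ⟨fun _ => hc, fun g => ?_⟩
      unfold pick at h
      cases g' : r.single
      · simp only [g, g', cond_false, leB_iff] at h
        exact ho.lt_absc.1 (h.trans_lt hc)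
      · simp [g'] at h
    · by_contra! hc
      refine key ⟨fun g => ?_, fun _ => hc⟩
      unfold pick at h
      cases g' : q.single
      · simp only [g, g', cond_false, leB_false] at h
        exact h.trans (ho.lt_absc.2 hc)
      · simp [g, g'] at h

end OnEdgeAt

/-! ## The triangles with their corners on three given edges -/

/-- The triangle is largest. -/
def Tr.Opt (P : Set (ℝ × ℝ)) (t : Tr) : Prop := RealRAM.Opt P t.1 t.2.1 t.2.2.1 t.2.2.2

theorem Opt.of_area {P : Set (ℝ × ℝ)} {a b w h a' b' w' h' : ℝ} (ht : Opt P a b w h)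
    (hf : Fits P a' b' w' h') (he : w' * h' = w * h) : Opt P a' b' w' h' :=
  ⟨hf, fun _ _ _ _ h => he ▸ ht.2 _ _ _ _ h⟩

theorem UpperPair.lineAt_mem {P : Set (ℝ × ℝ)} (hP : Convex ℝ P) {u v : V} {e : Bool}
    (h : UpperPair P u v e) {x : ℝ} (h₁ : u.x ≤ x) (h₂ : x ≤ v.x) : (x, lineAt u v x) ∈ P :=
  RealRAM.lineAt_mem hP h.mem₁ h.mem₂ h.lt h₁ h₂

theorem Opt.top_eq {P : Set (ℝ × ℝ)} (hP : Convex ℝ P) {a b w h : ℝ} (ht : Opt P a b w h) {u v : V}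
    (hu : UpperPair P u v true) (h₁ : u.x ≤ a) (h₂ : a ≤ v.x) : b + h = lineAt u v a :=
  le_antisymm (hu.le _ ht.1.2.2.2.2 (.inr (.inr rfl))) (ht.top (hu.lineAt_mem hP h₁ h₂))

theorem rot_convex {P : Set (ℝ × ℝ)} (hP : Convex ℝ P) : Convex ℝ (rot P) := by
  intro x hx y hy s t hs ht hst
  have := hP hx hy hs ht hst
  change ((s • x + t • y).2, -(s • x + t • y).1) ∈ P
  convert this using 1
  ext <;> simp
  ring

theorem Opt.right_eq {P : Set (ℝ × ℝ)} (hP : Convex ℝ P) {a b w h : ℝ} (ht : Opt P a b w h)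
    {u v : V} (hu : UpperPair (rot P) u v true) (h₁ : u.x ≤ -b) (h₂ : -b ≤ v.x) :
    a + w = lineAt u v (-b) := by
  have m := hu.lineAt_mem (rot_convex hP) h₁ h₂
  simp only [rot, Set.mem_ofPred_eq, neg_neg] at m
  refine le_antisymm (hu.le (-b, a + w) ?_ (.inr (.inr rfl))) (ht.rightmost m)
  simpa [rot] using ht.1.2.2.2.1

/-- The triangle whose corner is the point of the edge `c` with the abscissa `s` and whose other
corners are on the edges `r` and `q`. -/
def edgeTri (c : V × V) (r q : PW) (s : ℝ) : Tr :=
  (s, lineAt c.1 c.2 s, lineAt q.lo q.hi (0 - lineAt c.1 c.2 s) - s,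
    lineAt r.lo r.hi s - lineAt c.1 c.2 s)

def edgeTris (c : V × V) (r q : PW) : Tr × Tr × Tr :=
  (edgeTri c r q (bot c r q), edgeTri c r q (top c r q),
    crit (edgeTri c r q (bot c r q)) (edgeTri c r q (top c r q)))

/-- Candidates for a largest triangle with the corner of the right angle on the edge `c`. -/
def candOn (s : (V × V) × PW × PW) : Tr × Tr × Tr :=
  edgeTris (pairSearch decOn s).1 (pairSearch decOn s).2.1 (pairSearch decOn s).2.2

theorem pairSearch_fst {γ : Type} {d : γ → PW → PW → Bool × Bool} (s : γ × PW × PW) :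
    (pairSearch d s).1 = s.1 :=
  (iter_induction (b := fun s : γ × PW × PW => !(s.2.1.single && s.2.2.single)) (f := pairStep d)
    (μ := pairTodo) todo_pairStep (Q := fun t => t.1 = s.1) (fun t ht _ => by
      rw [← ht]; unfold pairStep
      cases t.2.1.single || t.2.1.usable <;> cases t.2.2.single || t.2.2.usable <;>
        cases pick t.2.1 t.2.2 (d t.1 t.2.1 t.2.2).1 <;> rfl) (n := pairTodo s) rfl le_rfl).1

/-- A largest triangle touches the edges above and to the right of its corner, so it is the member
at `a` of the linear family on the three edges. It is at an end of the range or stationary. -/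
theorem edgeTris_spec {P : Set (ℝ × ℝ)} {u v : V} {a b w h : ℝ} (ho : OnEdgeAt P u v a b)
    (hP : Convex ℝ P) (ht : Opt P a b w h) {r q : PW} (hr : UpperPair P r.lo r.hi true)
    (hq : UpperPair (rot P) q.lo q.hi true) (hra : r.lo.x ≤ a ∧ a ≤ r.hi.x)
    (hqb : q.lo.x ≤ -b ∧ -b ≤ q.hi.x) :
    (edgeTris (u, v) r q).1.Opt P ∨ (edgeTris (u, v) r q).2.1.Opt P ∨
      (edgeTris (u, v) r q).2.2.Opt P := by
  have ht₁ : a ≤ top (u, v) r q := by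
    rw [top, inf_eq, inf_eq]
    exact le_min ho.x₂ (le_min hra.2 (not_lt.1 fun h => (ho.lt_absc.1 h).not_ge hqb.2))
  have ht₀ : bot (u, v) r q ≤ a := by
    rw [bot, sup_eq, sup_eq]
    exact max_le ho.x₁ (max_le hra.1 (not_lt.1 fun h => (ho.absc_lt.1 h).not_ge hqb.1))
  have T₁ : top (u, v) r q ≤ v.x ∧ top (u, v) r q ≤ r.hi.x ∧
      top (u, v) r q ≤ absc (u, v) q.hi.x := by simp [top, inf_eq]
  have T₀ : u.x ≤ bot (u, v) r q ∧ r.lo.x ≤ bot (u, v) r q ∧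
      absc (u, v) q.lo.x ≤ bot (u, v) r q := by simp [bot, sup_eq]
  have hw := ht.1.1
  have hh := ht.1.2.1
  have ew := ht.right_eq hP hq hqb.1 hqb.2
  have eh := ht.top_eq hP hr hra.1 hra.2
  have hm := ho.supp.1
  obtain ⟨γ, hγ⟩ : ∃ γ, γ = -(slope q.lo q.hi * slope u v) - 1 := ⟨_, rfl⟩
  obtain ⟨δ, hδ⟩ : ∃ δ, δ = slope r.lo r.hi - slope u v := ⟨_, rfl⟩
  have lin (s : ℝ) : edgeTri (u, v) r q s =
      (a + (s - a) * 1, b + (s - a) * slope u v, w + (s - a) * γ, h + (s - a) * δ) := by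
    have h1 : lineAt u v s = b + (s - a) * slope u v := by
      rw [ho.y, lineAt_eq, lineAt_eq]; ring
    have h2 : w = lineAt q.lo q.hi (-b) - a := by linarith
    have h3 : h = lineAt r.lo r.hi a - b := by linarith
    simp only [edgeTri, h1]
    rw [h2, h3, hγ, hδ]
    simp only [lineAt_eq]
    refine Prod.ext (by ring) (Prod.ext rfl (Prod.ext ?_ ?_)) <;> simp <;> ring
  have mem (s : ℝ) (h1 : bot (u, v) r q ≤ s) (h2 : s ≤ top (u, v) r q) :
      (a + (s - a) * 1, b + (s - a) * slope u v) ∈ P ∧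
      (a + (s - a) * 1 + (w + (s - a) * γ), b + (s - a) * slope u v) ∈ P ∧
      (a + (s - a) * 1, b + (s - a) * slope u v + (h + (s - a) * δ)) ∈ P := by
    have e := lin s
    simp only [edgeTri, Prod.mk.injEq] at e
    obtain ⟨e1, e2, e3, e4⟩ := e
    rw [← e1, ← e2, ← e3, ← e4]
    have ba (x : ℝ) : absc (u, v) x = u.x + (u.y + x) / (-slope u v) := by rw [absc, zero_sub]
    refine ⟨ho.lineAt_mem hP (by linarith) (by linarith), ?_, ?_⟩
    · have := hq.lineAt_mem (rot_convex hP) (x := -lineAt u v s) ?_ ?_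
      · simp only [rot, Set.mem_ofPred_eq, neg_neg] at this
        exact mem_congr this
      · have h3 := T₀.2.2.trans h1
        rw [ba, ← le_sub_iff_add_le', div_le_iff₀ hm] at h3
        rw [lineAt_eq]; linarith
      · have h3 := h2.trans T₁.2.2
        rw [ba, ← sub_le_iff_le_add', le_div_iff₀ hm] at h3
        rw [lineAt_eq]; linarith
    · exact mem_congr (hr.lineAt_mem hP (x := s) (by linarith) (by linarith))
  have self : edgeTri (u, v) r q a = (a, b, w, h) := by rw [lin]; simp
  rcases ht₀.eq_or_lt with e | l₀
  · left
    simpa only [edgeTris, e, self, Tr.Opt] using ht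
  rcases ht₁.eq_or_lt with e | l₁
  · right; left
    simpa only [edgeTris, ← e, self, Tr.Opt] using ht
  obtain ⟨a1, a2, a3⟩ := mem _ (ht₀.trans ht₁) le_rfl
  obtain ⟨b1, b2, b3⟩ := mem _ le_rfl (ht₀.trans ht₁)
  have st := ht.stationary hP (α := 1) (β := slope u v) (γ := γ) (δ := δ) (sub_pos.2 l₁)
    (sub_pos.2 l₀) a1 a2 a3 (mem_congr b1) (mem_congr b2) (mem_congr b3)
  -- If one leg is constant, stationarity makes the other one constant too; all members of the
  -- family then have the same area, and the one at the lower end is largest as well.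
  by_cases hγ0 : γ = 0
  · have hδ0 : δ = 0 := by
      rw [hγ0, zero_mul, zero_add] at st
      exact (mul_eq_zero.1 st).resolve_right hw.ne'
    left
    simp only [edgeTris, lin, hγ0, hδ0, mul_zero, add_zero, Tr.Opt]
    simp only [hγ0, hδ0, mul_zero, add_zero] at b2 b3
    exact ht.of_area ⟨hw, hh, b1, b2, b3⟩ rfl
  · have hδ0 : δ ≠ 0 := by
      rintro rfl
      rw [zero_mul, add_zero] at st
      exact hγ0 ((mul_eq_zero.1 st).resolve_right hh.ne')
    right; right
    obtain ⟨τ, hτ⟩ : ∃ τ, τ = top (u, v) r q := ⟨_, rfl⟩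
    obtain ⟨σ, hσ⟩ : ∃ σ, σ = bot (u, v) r q := ⟨_, rfl⟩
    have hd : τ - σ ≠ 0 := by rw [hτ, hσ]; linarith
    have e : crit (edgeTri (u, v) r q σ) (edgeTri (u, v) r q τ) = (a, b, w, h) := by
      rw [lin, lin]
      have w1 : w + (τ - a) * γ - (w + (σ - a) * γ) = (τ - σ) * γ := by ring
      have w2 : h + (τ - a) * δ - (h + (σ - a) * δ) = (τ - σ) * δ := by ring
      rw [crit_eq (θ := (a - σ) / (τ - σ)) (by rw [w1]; exact mul_ne_zero hd hγ0)
        (by rw [w2]; exact mul_ne_zero hd hδ0)]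
      · refine Prod.ext ?_ (Prod.ext ?_ (Prod.ext ?_ ?_)) <;> simp <;> field_simp <;> ring
      · rw [w1, w2]
        field_simp
        linear_combination (τ - σ) * st
    simpa only [edgeTris, ← hτ, ← hσ, e, Tr.Opt] using ht

theorem candOn_spec {P : Set (ℝ × ℝ)} {u v : V} {a b w h : ℝ} (ho : OnEdgeAt P u v a b)
    (hP : Convex ℝ P) (ht : Best P a b w h) {Nr Nq : Set V} {S E S' E' : V} {r q : PW}
    (hNr : UpChain Nr P S E) (hNq : UpChain Nq (rot P) S' E')
    (hS : S.key < E.key) (hS' : S'.key < E'.key) (hr : r.At Nr S E a)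
    (hq : q.At Nq S' E' (-b)) :
    (candOn ((u, v), r, q)).1.Opt P ∨ (candOn ((u, v), r, q)).2.1.Opt P ∨
      (candOn ((u, v), r, q)).2.2.Opt P := by
  obtain ⟨⟨h1, h2⟩, h3, h4⟩ := pairSearch_spec (d := decOn) (c := (u, v)) hr hq
    fun r q hr hq => ho.dec hP ht hNr hNq hS hS' hr hq
  have e := pairSearch_fst (d := decOn) ((u, v), r, q)
  have := edgeTris_spec ho hP ht.opt (hNr.edge _ _ (h1.adj hS h2) h1.lo h1.hi)
    (hNq.edge _ _ (h3.adj hS' h4) h3.lo h3.hi) ⟨h1.le, h1.ge⟩ ⟨h3.le, h3.ge⟩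
  simpa only [candOn, e] using this

attribute [reducible] edgeTri edgeTris candOn

/-! ## The candidates with the corner of the right angle on the lower left boundary -/

/-- The edge delivered by the search need not be the one assumed for the corner. But both support
the polygon and contain points over the abscissa `a`, so their lines agree there. -/
theorem OnLower.onEdgeAt {N : Set V} {P : Set (ℝ × ℝ)} (hP : Convex ℝ P) {S E u v x y : V}
    {a b : ℝ} (hN : LowChain N P S E) (hm : (a, b) ∈ P) (ho : OnLower N S E a b u v)
    (h : Adj N x y) (hS : S.key ≤ x.key) (hE : y.key ≤ E.key) (hx : x.x ≤ a) (hy : a ≤ y.x) :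
    OnEdgeAt P x y a b := by
  obtain ⟨s₁, s₂⟩ := hN.edge _ _ h hS hE
  obtain ⟨t₁, t₂⟩ := hN.edge _ _ ho.adj ho.le ho.ge
  have m₁ := (hN.mono _ h.left _ h.right hS h.lt hE).1
  have m₂ := (hN.mono _ ho.adj.left _ ho.adj.right ho.le ho.adj.lt ho.ge).1
  have key : OnEdgeAt P x y a (lineAt x y a) := ⟨s₁, s₂.2.1, m₁, hx, hy, rfl⟩
  refine ⟨s₁, s₂.2.1, m₁, hx, hy, le_antisymm ?_ ?_⟩
  · have h1 := t₁.2.2 _ (key.lineAt_mem hP hx hy)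
    have h2 : b = lineAt u v a := by
      have := ho.y
      have : v.x - u.x ≠ 0 := by linarith
      rw [lineAt_eq, slope]
      grind
    rw [h2, lineAt_eq]
    linarith
  · have h1 := s₁.2.2 _ hm
    rw [lineAt_eq]
    linarith

/-- Candidates for a largest triangle whose corner of the right angle is on the boundary. -/
def candLower (w r q : PW) : (Tr × Tr × Tr) × Tr × Tr × Tr :=
  let e := lowerEdge w r q
  (candOn ((e.lo, e.x), r, q), candOn ((e.x, e.hi), r, q))

attribute [reducible] candLower

theorem UpperSpec.lt {N : Set V} {P : Set (ℝ × ℝ)} {w : PW} (hw : UpperSpec N P w) {t y t' y' : ℝ}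
    (ht : (t, y) ∈ P) (ht' : (t', y') ∈ P) (h : t ≠ t') : w.lo.key < w.hi.key := by
  refine (hw.ok.lo_le.trans hw.ok.le_hi).lt_of_ne fun e => h ?_
  have e := hw.inj _ hw.ok.lo _ hw.ok.hi e
  have h1 := hw.le _ ht
  have h2 := hw.le _ ht'
  have h3 := hw.ge _ ht
  have h4 := hw.ge _ ht'
  grind

theorem candLower_spec {T : Tree} (hT : Good T) {w r q : PW} (hw : LowerSpec T w) {Nr Nq : Set V}
    (hr : UpperSpec Nr (hull (cover T)) r) (hq : UpperSpec Nq (rot (hull (cover T))) q)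
    {a b c d : ℝ} (ht : Best (hull (cover T)) a b c d) {u v : V}
    (ho : OnLower (cover T) w.lo w.hi a b u v) :
    ((candLower w r q).1.1.Opt (hull (cover T)) ∨ (candLower w r q).1.2.1.Opt (hull (cover T)) ∨
      (candLower w r q).1.2.2.Opt (hull (cover T))) ∨
    (candLower w r q).2.1.Opt (hull (cover T)) ∨ (candLower w r q).2.2.1.Opt (hull (cover T)) ∨
      (candLower w r q).2.2.2.Opt (hull (cover T)) := by
  obtain ⟨hp, hd, hlt⟩ := lowerEdge_spec hT hw hr hq ht ho
  have hP := hull_convex (cover T)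
  have hL := hT.cyc.lowChain hw.lo hw.hi hw.lt
  obtain ⟨hcw, hdh, m1, m2, m3⟩ := ht.opt.1
  have r1 := hr.lt m1 m2 (by linarith)
  have mb : (-b, a) ∈ rot (hull (cover T)) := by simpa [rot] using m1
  have q1 := hq.lt (t' := -(b + d)) (y' := a) mb (by simpa [rot, add_comm] using m3) (by linarith)
  have key {x y : V} (h : Adj (cover T) x y) (hS : w.lo.key ≤ x.key) (hE : y.key ≤ w.hi.key)
      (hx : x.x ≤ a) (hy : a ≤ y.x) :=
    candOn_spec (ho.onEdgeAt hP hL m1 h hS hE hx hy) hP ht hr.chain hq.chain r1 q1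
      ⟨⟨hr.ok, le_rfl, le_rfl, hr.le _ m1, hr.ge _ m1⟩, fun h => h⟩
      ⟨⟨hq.ok, le_rfl, le_rfl, hq.le _ mb, hq.ge _ mb⟩, fun h => h⟩
  obtain ⟨a1, a2⟩ := hp.ok.adj hd
  have inj := hT.cyc.inj
  by_cases h : (lowerEdge w r q).lo.key < (lowerEdge w r q).x.key ∧ a ≤ (lowerEdge w r q).x.x
  · exact .inl (key ⟨hp.ok.lo, hp.ok.x, h.1, a1⟩ hp.lo (hp.ok.le_hi.trans hp.hi) hp.le h.2)
  · right
    have h1 : (lowerEdge w r q).x.x ≤ a ∧ (lowerEdge w r q).x.key < (lowerEdge w r q).hi.key := by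
      rcases hp.ok.lo_le.lt_or_eq with g | g
      · have g' : (lowerEdge w r q).x.x < a := not_le.1 fun g' => h ⟨g, g'⟩
        refine ⟨g'.le, hp.ok.le_hi.lt_of_ne fun e => ?_⟩
        rw [inj _ hp.ok.x _ hp.ok.hi e] at g'
        exact g'.not_ge hp.ge
      · rw [← inj _ hp.ok.lo _ hp.ok.x g]
        exact ⟨hp.le, hlt⟩
    exact key ⟨hp.ok.x, hp.ok.hi, h1.2, a2⟩ (hp.lo.trans hp.ok.lo_le) hp.hi h1.1 hp.ge

/-! ## The apex and the end of the base, if the corner can be moved to the left and down -/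

/-- The image under the reflection `(x, y) ↦ (x, -y)`. -/
def refl (P : Set (ℝ × ℝ)) : Set (ℝ × ℝ) := {z | (z.1, -z.2) ∈ P}

def V.refl (v : V) : V := ⟨v.key, v.x, -v.y⟩

/-- The image of `N` is the upper left part of the boundary, from left to right. -/
structure UpLeft (N : Set V) (P : Set (ℝ × ℝ)) (S E : V) : Prop where
  chain : LowChain N (refl P) S E
  mem : ∀ v ∈ N, v.refl.pt ∈ P
  left : ∀ z ∈ P, S.x ≤ z.1
  top : ∀ z ∈ P, z.2 ≤ -E.y
  hE : E ∈ N
  inj : ∀ u ∈ N, ∀ v ∈ N, u.key = v.key → u = v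

section
variable {N N' : Set V} {P : Set (ℝ × ℝ)} {S E S' E' : V} {a b w h : ℝ}

/-- With a highest vertex strictly to the left of the corner, moving left would lengthen the base
without loss of height. -/
theorem UpLeft.le_hi (hN : UpLeft N P S E) (hP : Convex ℝ P) (ht : Free P a b w h) : a ≤ E.x := by
  by_contra! hc
  have h1 := ht.left_le hP hc (hN.mem _ hN.hE)
  have h2 : b + h ≤ -E.y := hN.top _ ht.opt.1.2.2.2.2
  change h ≤ (b + h - -E.y) / _ * w at h1
  have hw := ht.opt.1.1
  have hh := ht.opt.1.2.1
  have h3 : (b + h - -E.y) / (a - E.x) ≤ 0 :=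
    div_nonpos_of_nonpos_of_nonneg (by linarith) (by linarith)
  nlinarith

theorem UpLeft.ge (hN : UpLeft N P S E) (hP : Convex ℝ P) (ht : Free P a b w h) {v : V}
    (hv : v ∈ N) (hx : v.x ≤ a) : -v.y ≤ b + h := by
  have m := hN.mem v hv
  have hE := hN.le_hi hP ht
  rcases hx.eq_or_lt with e | hx
  · exact ht.opt.top (e ▸ m)
  · have h1 := hN.top _ m
    have hd : 0 < E.x - v.x := by linarith
    have h3 := ht.opt.top (lineAt_mem hP m (hN.mem _ hN.hE) (sub_pos.1 hd) hx.le hE)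
    have h4 : 0 ≤ (E.refl.y - v.refl.y) / (E.x - v.x) := div_nonneg (by
      simp only [V.refl, V.pt] at h1 ⊢; linarith) hd.le
    simp only [lineAt, V.refl] at h3 h4
    nlinarith

/-- The supporting lines at the two ends of the chord have slopes on either side of that of the
chord. In a finished window the chord is a single vertex, and the slope is that of the edge before
it. -/
theorem UpLeft.ref (hN : UpLeft N P S E) (hP : Convex ℝ P) (ht : Free P a b w h) {r : PW}
    (hr : r.At N S E a) (hs : r.single = false) (hu : r.usable = true) :
    Ref P a (b + h) (0 - slope r.e₁ r.e₂) r.c₁.refl r.c₂.refl := by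
  obtain ⟨h1, h2, h3, h4, h5, h6⟩ := hr.chord hs hu
  have of {m₁ m₂ u : ℝ} (hu₁ : u ≤ m₁) (hu₂ : m₂ ≤ u) (s₁ : SuppAt (refl P) r.c₁ m₁)
      (s₂ : SuppAt (refl P) r.c₂ m₂) (e : r.c₁.y - r.c₂.y = u * (r.c₂.x - r.c₁.x))
      (l : r.c₁.x ≤ r.c₂.x) : Ref P a (b + h) u r.c₁.refl r.c₂.refl := by
    have m : (a, -(b + h)) ∈ refl P := by simpa [refl] using ht.opt.1.2.2.2.2
    have g1 := s₁.2.2 _ m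
    have g2 := s₂.2.2 _ m
    have g3 := s₂.1
    simp only at g1 g2
    refine ⟨g3.trans_le hu₂, hN.mem _ h1, hN.mem _ h2, ?_, l, fun k => ?_, fun k => ?_,
      hN.ge hP ht h1, hN.ge hP ht h2, fun k => ?_⟩ <;> simp only [V.refl] at * <;> nlinarith
  unfold PW.e₁ PW.e₂
  rw [hs]
  cases hd : r.done with
  | true =>
    obtain ⟨k1, k2⟩ := hr.edge hs hd
    have := (hN.chain.edge _ _ k1 hr.lo k2).2
    unfold PW.c₁ PW.c₂ at *
    simp only [hd, cond_true, cond_false, zero_sub] at *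
    exact of le_rfl le_rfl this this (by ring) le_rfl
  | false =>
    unfold PW.c₁ PW.c₂ at *
    simp only [hd, cond_false, zero_sub] at *
    obtain ⟨m₁, l₁, s₁⟩ := hN.chain.supp₁ _ h1 _ h2 h3 (h6 trivial) h5
    obtain ⟨m₂, l₂, s₂⟩ := hN.chain.supp₂ _ h1 _ h2 h3 (h6 trivial) h5
    have l := (hN.chain.mono _ h1 _ h2 h3 (h6 trivial) h5).1
    exact of l₁ l₂ s₁ s₂ (by
      have : r.snd.x - r.fst.x ≠ 0 := by linarith
      rw [slope]; field_simp; ring) l.le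

theorem UpLeft.onEdge (hN : UpLeft N P S E) (hP : Convex ℝ P) (ht : Free P a b w h) {r : PW}
    (hr : r.At N S E a) (hs : r.single = true) :
    OnEdge P a (b + h) (0 - slope r.e₁ r.e₂) r.lo.refl r.hi.refl ∧
      (r.lo.x < r.hi.x → 0 < 0 - slope r.e₁ r.e₂) := by
  have hd : r.done = true := by unfold PW.single at hs; simp_all
  simp only [PW.e₁, PW.e₂, hs, hd, cond_true, zero_sub]
  have m₁ := hN.mem _ hr.ok.lo
  have m₂ := hN.mem _ hr.ok.hi
  by_cases hS : S.key < E.key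
  · have ha := hr.adj hS hs
    have l := (hN.chain.mono _ ha.left _ ha.right hr.lo ha.lt hr.hi).1
    obtain ⟨⟨p, -, s⟩, -⟩ := hN.chain.edge _ _ ha hr.lo hr.hi
    have hd : 0 < r.hi.x - r.lo.x := by linarith
    have e : slope r.lo r.hi * (r.hi.x - r.lo.x) = r.hi.y - r.lo.y := div_mul_cancel₀ _ hd.ne'
    have g1 := s (a, -(b + h)) (by simpa [refl] using ht.opt.1.2.2.2.2)
    have g3 := ht.opt.top (lineAt_mem hP m₁ m₂ l hr.le hr.ge)
    rw [lineAt, show (r.hi.refl.y - r.lo.refl.y) / _ = -slope r.lo r.hi by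
      simp only [slope, V.refl]; ring] at g3
    refine ⟨⟨m₁, m₂, p.le, hr.le, hr.ge, ?_, ?_⟩, fun _ => p⟩ <;> simp only [V.refl] at * <;>
      linarith
  -- Here the upper left boundary is the single vertex `E`, which is both leftmost and highest, so
  -- the apex is that vertex.
  · have e1 : r.lo.key = E.key := le_antisymm
      (hr.ok.lo_le.trans (hr.ok.le_hi.trans hr.hi)) (by linarith [hr.lo])
    have e2 : r.hi.key = E.key := le_antisymm hr.hi
      (by linarith [hr.lo, hr.ok.lo_le, hr.ok.le_hi])
    have e1 := hN.inj _ hr.ok.lo _ hN.hE e1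
    have e2 := hN.inj _ hr.ok.hi _ hN.hE e2
    have l1 := hr.le
    have l2 := hr.ge
    rw [e1] at l1 m₁
    rw [e2] at l2 m₂
    have e : E.x = a := le_antisymm l1 l2
    have T : b + h = -E.y := le_antisymm (hN.top _ ht.opt.1.2.2.2.2)
      (ht.opt.top (by rw [← e]; exact m₂))
    rw [e1, e2]
    refine ⟨⟨m₂, m₂, ?_, l1, l2, ?_, ?_⟩, fun h => absurd h (lt_irrefl _)⟩ <;>
      simp [slope, V.refl, T, e]

end

/-- A test: whether the height over the line through the point `p` is too large. -/
def steeper (p : V) (u : ℝ) (z : V) : Bool :=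
  ltB (p.refl.y - z.refl.x) (u * (z.refl.y - p.refl.x))

def steepPair (r q : PW) : Bool := ltB 1 ((0 - slope r.e₁ r.e₂) * (0 - slope q.e₁ q.e₂))

/-- For a steep pair some window can be cut from below, and for a flat pair some window can be cut
from above; the comparison of the two reference points selects it. If one window is already an edge,
the comparison with one of its ends decides the direction in the other one. -/
def decFree (_ : Bool) (r q : PW) : Bool × Bool :=
  bif r.single then
    (false, steeper q.c₁ (0 - slope q.e₁ q.e₂) (bif steepPair r q then r.hi else r.lo))
  else bif q.single then
    (true, steeper r.c₁ (0 - slope r.e₁ r.e₂) (bif steepPair r q then q.hi else q.lo))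
  else bif steepPair r q then (steeper r.c₁ (0 - slope r.e₁ r.e₂) q.c₁, true)
  else (!steeper r.c₂ (0 - slope r.e₁ r.e₂) q.c₂, false)

attribute [reducible] steeper V.refl steepPair decFree

section
variable {N N' : Set V} {P : Set (ℝ × ℝ)} {S E S' E' : V} {a b w h : ℝ}

theorem Free.dec_single (hP : Convex ℝ P) (ht : Free P a b w h) (hN : UpLeft N P S E)
    (hN' : UpLeft N' (RealRAM.flip P) S' E') {r q : PW} (hr : r.At N S E a) (hq : q.At N' S' E' b)
    (h1 : r.single = true) (h2 : q.single = false) (uq : q.usable = true) :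
    (steeper q.c₁ (0 - slope q.e₁ q.e₂) (bif steepPair r q then r.hi else r.lo) = true →
      q.c₁.x ≤ b) ∧
    (steeper q.c₁ (0 - slope q.e₁ q.e₂) (bif steepPair r q then r.hi else r.lo) = false →
      b ≤ q.c₂.x) := by
  have R := (hN.onEdge hP ht hr h1).1
  have Q := hN'.ref (flip_convex hP) ht.flip hq h2 uq
  cases hs : steepPair r q with
  | true =>
    rw [steepPair, ltB_iff] at hs
    simp only [cond_true, steeper, ltB_iff, ltB_false]
    exact ⟨fun h => (edge_steep_up hP ht R Q hs h :),
      fun h => (edge_steep_down hP ht R Q h :)⟩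
  | false =>
    rw [steepPair, ltB_false] at hs
    simp only [cond_false, steeper, ltB_iff, ltB_false]
    exact ⟨fun h => (edge_flat_up hP ht R Q h :),
      fun h => (edge_flat_down hP ht R Q hs h :)⟩

theorem Free.dec (hP : Convex ℝ P) (ht : Free P a b w h) (hN : UpLeft N P S E)
    (hN' : UpLeft N' (RealRAM.flip P) S' E') (c : Bool) {r q : PW} (hr : r.At N S E a)
    (hq : q.At N' S' E' b) (ur : (r.single || r.usable) = true)
    (uq : (q.single || q.usable) = true) (hn : (!(r.single && q.single)) = true) :
    (pick r q (decFree c r q).1 = true → ((decFree c r q).2 = true → r.c₁.x ≤ a) ∧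
      ((decFree c r q).2 = false → a ≤ r.c₂.x)) ∧
    (pick r q (decFree c r q).1 = false → ((decFree c r q).2 = true → q.c₁.x ≤ b) ∧
      ((decFree c r q).2 = false → b ≤ q.c₂.x)) := by
  unfold pick decFree
  cases h1 : r.single with
  | true =>
    have h2 : q.single = false := by simpa [h1] using hn
    exact ⟨nofun, fun _ => ht.dec_single hP hN hN' hr hq h1 h2 (by simpa [h2] using uq)⟩
  | false =>
  have ur : r.usable = true := by simpa [h1] using ur
  cases h2 : q.single with
  | true =>
    have := ht.flip.dec_single (flip_convex hP) hN' hN hq hr h2 h1 ur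
    have e : steepPair q r = steepPair r q := by simp only [steepPair, mul_comm]
    exact ⟨fun _ => by rw [e] at this; exact this, nofun⟩
  | false =>
    have R := hN.ref hP ht hr h1 ur
    have Q := hN'.ref (flip_convex hP) ht.flip hq h2 (by simpa [h2] using uq)
    simp only [cond_false]
    cases hs : steepPair r q with
    | true =>
      rw [steepPair, ltB_iff] at hs
      simp only [cond_true, steeper, ltB_iff, ltB_false]
      exact ⟨fun h => ⟨fun _ => (both_steep_right hP ht R Q hs h :), nofun⟩,
        fun h => ⟨fun _ => (both_steep_up hP ht R Q hs h :), nofun⟩⟩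
    | false =>
      rw [steepPair, ltB_false] at hs
      simp only [cond_false, steeper, ltB_iff, ltB_false, Bool.not_eq_true', Bool.not_eq_false']
      exact ⟨fun h => ⟨nofun, fun _ => (both_flat_left hP ht R Q hs h :)⟩,
        fun h => ⟨nofun, fun _ => (both_flat_down hP ht R Q hs h :)⟩⟩

/-! ### The candidates -/

/-- The triangle with the apex `r` and the other end `q` of the base. -/
def cornerTri (r q : V) : Tr := (r.x, q.x, (0 - q.y) - r.x, (0 - r.y) - q.x)

/-- Candidates for a largest triangle with the apex `r` and the end of the base on an edge. -/
def cornerTris (r : V) (q : PW) : Tr × Tr × Tr :=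
  (cornerTri r q.lo, cornerTri r q.hi, crit (cornerTri r q.lo) (cornerTri r q.hi))

def Tr.flip (t : Tr) : Tr := (t.2.1, t.1, t.2.2.2, t.2.2.1)

/-- The apex is fixed and the base slides vertically along the edge of its other end, which is again
a linear family. Inside the edge there is room upwards below the apex, and downwards by `Free.down`.
-/
theorem cornerTris_spec (hP : Convex ℝ P) (ht : Free P a b w h) (hN' : UpLeft N' (RealRAM.flip P) S' E')
    {q : PW} (hq : q.At N' S' E' b) (hs : q.single = true) {r : V} (hx : r.x = a)
    (hy : b + h = -r.y) :
    (cornerTris r q).1.Opt P ∨ (cornerTris r q).2.1.Opt P ∨ (cornerTris r q).2.2.Opt P := by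
  obtain ⟨Q, hv⟩ := hN'.onEdge (flip_convex hP) ht.flip hq hs
  obtain ⟨v, ev⟩ : ∃ v, v = 0 - slope q.e₁ q.e₂ := ⟨_, rfl⟩
  rw [← ev] at Q hv
  obtain ⟨m1, m2, n, l1, l2, e1, e2⟩ := Q
  simp only at l1 l2 e1 e2
  obtain ⟨hw, hh, p1, p2, p3⟩ := ht.opt.1
  have lo : cornerTri r q.lo =
      (a + (q.lo.x - b) * 0, b + (q.lo.x - b) * 1, w + (q.lo.x - b) * v, h + (q.lo.x - b) * -1) := by
    simp only [cornerTri, hx]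
    refine Prod.ext ?_ (Prod.ext ?_ (Prod.ext ?_ ?_)) <;> simp <;> linarith
  have hi : cornerTri r q.hi =
      (a + (q.hi.x - b) * 0, b + (q.hi.x - b) * 1, w + (q.hi.x - b) * v, h + (q.hi.x - b) * -1) := by
    simp only [cornerTri, hx]
    refine Prod.ext ?_ (Prod.ext ?_ (Prod.ext ?_ ?_)) <;> simp <;> linarith
  rcases l1.eq_or_lt with e | l1
  · left; simpa [cornerTris, lo, e, Tr.Opt] using ht.opt
  rcases l2.eq_or_lt with e | l2
  · right; left; simpa [cornerTris, hi, e, Tr.Opt] using ht.opt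
  right; right
  obtain ⟨s, hs, hdn⟩ := ht.down.resolve_right fun hc => (hc _ m1).not_gt (by simpa [V.pt] using l1)
  have hlo : 0 < b - q.lo.x := sub_pos.2 l1
  have hhi : 0 < q.hi.x - b := sub_pos.2 l2
  have qm : ((b, a + w) : ℝ × ℝ) ∈ RealRAM.flip P := p2
  have st := ht.opt.stationary hP (α := 0) (β := 1) (γ := v) (δ := -1)
    (s := min h (q.hi.x - b)) (t := min s (b - q.lo.x)) (by positivity) (by positivity)
    (mem_congr (seg_mem hP (dx := 0) (dy := 1) hh p1 (by simpa using p3)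
      (ε := min h (q.hi.x - b)) (by positivity) (min_le_left _ _)))
    (mem_congr (mem_of_flip (seg_mem (flip_convex hP) (dx := 1) (dy := v) hhi qm (mem_congr m2)
      (ε := min h (q.hi.x - b)) (by positivity) (min_le_right _ _))))
    (mem_congr p3)
    (mem_congr (seg_mem hP (dx := 0) (dy := -1) hs p1 (mem_congr hdn)
      (ε := min s (b - q.lo.x)) (by positivity) (min_le_left _ _)))
    (mem_congr (mem_of_flip (seg_mem (flip_convex hP) (dx := -1) (dy := -v) hlo qm (mem_congr m1)
      (ε := min s (b - q.lo.x)) (by positivity) (min_le_right _ _))))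
    (mem_congr p3)
  obtain ⟨σ, hσ⟩ : ∃ σ, σ = q.lo.x := ⟨_, rfl⟩
  obtain ⟨τ, hτ⟩ : ∃ τ, τ = q.hi.x := ⟨_, rfl⟩
  have hd : τ - σ ≠ 0 := by rw [hτ, hσ]; linarith
  have hv0 : v ≠ 0 := by rintro rfl; linarith
  have w1 : w + (τ - b) * v - (w + (σ - b) * v) = (τ - σ) * v := by ring
  have w2 : h + (τ - b) * -1 - (h + (σ - b) * -1) = (τ - σ) * -1 := by ring
  have e : crit (cornerTri r q.lo) (cornerTri r q.hi) = (a, b, w, h) := by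
    rw [lo, hi, ← hσ, ← hτ, crit_eq (θ := (b - σ) / (τ - σ)) (by rw [w1]; exact mul_ne_zero hd hv0)
      (by rw [w2]; exact mul_ne_zero hd (by norm_num))]
    · refine Prod.ext ?_ (Prod.ext ?_ (Prod.ext ?_ ?_)) <;> simp <;> field_simp <;> ring
    · rw [w1, w2]
      field_simp
      linear_combination (τ - σ) * st
  simpa only [cornerTris, e, Tr.Opt] using ht.opt

theorem Tr.Opt.flip {t : Tr} (ht : t.Opt (RealRAM.flip P)) : t.flip.Opt P := RealRAM.Opt.flip ht

/-- Candidates for a largest triangle whose corner of the right angle can be moved. -/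
def candFree (r q : PW) : ((Tr × Tr × Tr) × Tr × Tr × Tr) × (Tr × Tr × Tr) × Tr × Tr × Tr :=
  let s := (pairSearch decFree (false, r, q)).2
  ((cornerTris s.1.lo s.2, cornerTris s.1.hi s.2), cornerTris s.2.lo s.1, cornerTris s.2.hi s.1)

/-- If apex and base end were both inside their edges, optimality to the right and upwards would
give `u * w ≤ h` and `v * h ≤ w`, hence `u * v ≤ 1`, against `Free.tie`. So one of them is a vertex.
-/
theorem candFree_spec (hP : Convex ℝ P) (ht : Free P a b w h) {r q : PW}
    (hN : UpLeft N P r.lo r.hi) (hN' : UpLeft N' (RealRAM.flip P) q.lo q.hi) (hr : r.Ok N) (hq : q.Ok N') :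
    (((candFree r q).1.1.1.Opt P ∨ (candFree r q).1.1.2.1.Opt P ∨ (candFree r q).1.1.2.2.Opt P) ∨
      (candFree r q).1.2.1.Opt P ∨ (candFree r q).1.2.2.1.Opt P ∨ (candFree r q).1.2.2.2.Opt P) ∨
    ((candFree r q).2.1.1.flip.Opt P ∨ (candFree r q).2.1.2.1.flip.Opt P ∨
        (candFree r q).2.1.2.2.flip.Opt P) ∨
      (candFree r q).2.2.1.flip.Opt P ∨ (candFree r q).2.2.2.1.flip.Opt P ∨
        (candFree r q).2.2.2.2.flip.Opt P := by
  have m := ht.opt.1.2.2.1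
  have hP' := flip_convex hP
  obtain ⟨⟨h1, h2⟩, h3, h4⟩ := pairSearch_spec (d := decFree) (c := false) (r := r) (q := q)
    (t := a) (t' := b)
    ⟨⟨hr, le_rfl, le_rfl, hN.left _ m, hN.le_hi hP ht⟩, fun h => h⟩
    ⟨⟨hq, le_rfl, le_rfl, hN'.left (b, a) m, hN'.le_hi hP' ht.flip⟩, fun h => h⟩
    fun r q hr hq => ht.dec hP hN hN' false hr hq
  simp only [candFree]
  generalize (pairSearch decFree (false, r, q)).2 = s at *
  obtain ⟨R, hu⟩ := hN.onEdge hP ht h1 h2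
  obtain ⟨Q, hv⟩ := hN'.onEdge hP' ht.flip h3 h4
  generalize 0 - slope s.1.e₁ s.1.e₂ = u at *
  generalize 0 - slope s.2.e₁ s.2.e₂ = v at *
  have r1 := R.line₁
  have r2 := R.line₂
  have q1 := Q.line₁
  have q2 := Q.line₂
  simp only at r1 r2 q1 q2
  rcases (show s.1.lo.x ≤ a from R.le₁).eq_or_lt with e | l1
  · exact .inl (.inl (cornerTris_spec hP ht hN' h3 h4 e (by rw [r1, e]; ring)))
  rcases (show a ≤ s.1.hi.x from R.le₂).eq_or_lt with e | l2
  · exact .inl (.inr (cornerTris_spec hP ht hN' h3 h4 e.symm (by rw [r2, e]; ring)))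
  right
  rcases (show s.2.lo.x ≤ b from Q.le₁).eq_or_lt with e | l3
  · exact .inl ((cornerTris_spec hP' ht.flip hN h1 h2 e (by rw [q1, e]; ring)).imp
      (fun h => h.flip) (Or.imp (fun h => h.flip) fun h => h.flip))
  rcases (show b ≤ s.2.hi.x from Q.le₂).eq_or_lt with e | l4
  · exact .inr ((cornerTris_spec hP' ht.flip hN h1 h2 e.symm (by rw [q2, e]; ring)).imp
      (fun h => h.flip) (Or.imp (fun h => h.flip) fun h => h.flip))
  exfalso
  have k1 := R.right hP ht.opt l2
  have k2 := Q.right hP' ht.opt.flip l4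
  have hu := hu (l1.trans l2)
  have hv := hv (l3.trans l4)
  have hw := ht.opt.1.1
  have hh := ht.opt.1.2.1
  refine ht.tie hP l1 R.mem₁ l3 Q.mem₁ (R.left_slope l1) (Q.left_slope l3) hu ?_
  by_contra! hc
  nlinarith

end

attribute [reducible] cornerTris cornerTri Tr.flip candFree

/-! ### Existence, the two cases for the corner, and the choice among the candidates -/

/-! ## Existence of a largest triangle -/

theorem side_add (u v : V) (x y s c d : ℝ) : side u v (x + s * c, y + s * d) =
    side u v (x, y) + s * ((v.x - u.x) * d - (v.y - u.y) * c) := by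
  simp only [side]; ring

namespace Cyc

variable {N : Set V} (hN : Cyc N)
include hN

theorem side_next {u v w : V} (h : Adj N u v) (h' : Adj N v w) : 0 < side u v w.pt := by
  obtain ⟨x, hx, y, hy, h1, h2, h3⟩ := hN.three u h.left
  have h4 := not_lt.1 (h.adj x hx h1)
  exact hN.pos _ h.left _ h.right _ h'.right h.lt h'.lt
    ((not_lt.1 (h'.adj y hy (h4.trans_lt h2))).trans_lt h3)

/-- The two neighbouring edges cut the line of an edge down to the edge itself. -/
theorem between {u v : V} (h : Adj N u v) (hx : u.x < v.x) {x y : ℝ} (hz : (x, y) ∈ hull N)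
    (h0 : side u v (x, y) = 0) : u.x ≤ x ∧ x ≤ v.x := by
  obtain ⟨t, ht⟩ := hN.exists_adj_left h.left
  obtain ⟨w, hw⟩ := hN.exists_adj_right h.right
  have h1 := hN.side_next ht h
  have h2 := hN.side_next h hw
  have h3 := hN.side_nonneg ht hz
  have h4 := hN.side_nonneg hw hz
  have hd : 0 < v.x - u.x := by linarith
  have e1 : (v.x - u.x) * side t u (x, y) = (x - u.x) * side t u v.pt := by
    simp only [side, V.pt] at *; linear_combination (u.x - t.x) * h0
  have e2 : (v.x - u.x) * side v w (x, y) = (v.x - x) * side u v w.pt := by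
    simp only [side, V.pt] at *; linear_combination (w.x - v.x) * h0
  constructor <;> by_contra! hc <;> nlinarith

end Cyc

variable {T : Tree} (hT : Good T)
include hT

/-- Only an edge whose line contains the point can block the motion immediately; the others leave
some room, and there are only finitely many. -/
theorem ray {x y c d : ℝ} (hm : (x, y) ∈ hull (cover T)) :
    (∃ s > 0, (x + s * c, y + s * d) ∈ hull (cover T)) ∨ ∃ u v, Adj (cover T) u v ∧
      side u v (x, y) = 0 ∧ (v.x - u.x) * d - (v.y - u.y) * c < 0 := by
  by_contra! h
  obtain ⟨h1, h2⟩ := h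
  have ev : ∀ e ∈ (V.pt '' cover T) ×ˢ (V.pt '' cover T), ∀ᶠ s : ℝ in nhdsWithin 0 (Set.Ioi 0),
      ∀ u v, Adj (cover T) u v → u.pt = e.1 → v.pt = e.2 →
        0 ≤ side u v (x + s * c, y + s * d) := by
    intro e _
    by_cases hc : ∃ u v, Adj (cover T) u v ∧ u.pt = e.1 ∧ v.pt = e.2
    · obtain ⟨u, v, ha, e1, e2⟩ := hc
      have key : ∀ᶠ s : ℝ in nhdsWithin 0 (Set.Ioi 0), 0 ≤ side u v (x + s * c, y + s * d) := by
        rcases (hT.cyc.side_nonneg ha hm).eq_or_lt with h0 | h0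
        · filter_upwards [self_mem_nhdsWithin] with s hs
          rw [side_add, ← h0, zero_add]
          exact mul_nonneg (le_of_lt hs) (h2 u v ha h0.symm)
        · have : ContinuousAt (fun s : ℝ => side u v (x + s * c, y + s * d)) 0 := by
            simp only [side]; fun_prop
          refine Filter.Eventually.filter_mono nhdsWithin_le_nhds ?_
          filter_upwards [this.eventually_const_lt (u := 0) (by simpa using h0)] with s hs
          exact hs.le
      filter_upwards [key] with s hs u' v' _ e1' e2'
      have a1 := e1'.trans e1.symm
      have a2 := e2'.trans e2.symm
      simp only [V.pt, Prod.mk.injEq] at a1 a2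
      simpa only [side, a1, a2] using hs
    · exact Filter.Eventually.of_forall fun s u v ha e1 e2 => absurd ⟨u, v, ha, e1, e2⟩ hc
  have fin := hT.cyc.fin.prod hT.cyc.fin
  obtain ⟨s, hs, hs'⟩ := (((Filter.eventually_all_finite fin).2 ev).and
    (self_mem_nhdsWithin (s := Set.Ioi (0 : ℝ)) (a := 0))).exists
  exact h1 s hs' ((mem_hull_iff_edges hT).2 fun u v ha =>
    hs (u.pt, v.pt) ⟨⟨u, ha.left, rfl⟩, v, ha.right, rfl⟩ u v ha rfl rfl)

/-- The centroid of three vertices is on the line of no edge, so by `ray` it can be moved both right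
and up. -/
theorem exists_fits : ∃ a b w h, Fits (hull (cover T)) a b w h := by
  have hN := hT.cyc
  obtain ⟨p, hp⟩ := hN.nonempty
  obtain ⟨q, hq, r, hr, h1, h2, h3⟩ := hN.three p hp
  have hP := hull_convex (cover T)
  have hpos := hN.pos _ hp _ hq _ hr h1 h2 h3
  have m : ((p.x + q.x + r.x) / 3, (p.y + q.y + r.y) / 3) ∈ hull (cover T) := by
    have m1 := hP (mem_hull hp) (mem_hull hq) (a := 1 / 2) (b := 1 / 2) (by norm_num)
      (by norm_num) (by norm_num)
    exact mem_congr (hP m1 (mem_hull hr) (a := 2 / 3) (b := 1 / 3) (by norm_num) (by norm_num)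
      (by norm_num)) (by simp [V.pt]; ring) (by simp [V.pt]; ring)
  have pos : ∀ u v, Adj (cover T) u v →
      side u v ((p.x + q.x + r.x) / 3, (p.y + q.y + r.y) / 3) ≠ 0 := by
    intro u v ha h0
    have a1 := hN.side_nonneg ha (mem_hull hp)
    have a2 := hN.side_nonneg ha (mem_hull hq)
    have a3 := hN.side_nonneg ha (mem_hull hr)
    have e : side u v p.pt + side u v q.pt + side u v r.pt = 0 := by
      simp only [side, V.pt] at *; linear_combination 3 * h0
    have b1 : side u v p.pt = 0 := by linarith
    have b2 : side u v q.pt = 0 := by linarith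
    have b3 : side u v r.pt = 0 := by linarith
    obtain ⟨w, hw⟩ := hN.exists_adj_right ha.right
    have c := hN.side_next ha hw
    have c1 : (v.x - u.x) * side p q r.pt = 0 := by
      simp only [side, V.pt] at *
      linear_combination (p.x - r.x) * b2 + (q.x - p.x) * b3 + (r.x - q.x) * b1
    have c2 : (v.y - u.y) * side p q r.pt = 0 := by
      simp only [side, V.pt] at *
      linear_combination (p.y - r.y) * b2 + (q.y - p.y) * b3 + (r.y - q.y) * b1
    have c1 := (mul_eq_zero.1 c1).resolve_right hpos.ne'
    have c2 := (mul_eq_zero.1 c2).resolve_right hpos.ne'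
    simp [side, c1, c2] at c
  obtain ⟨s, hs, k1⟩ := (ray hT (c := 1) (d := 0) m).resolve_right
    fun ⟨u, v, h, h', _⟩ => pos u v h h'
  obtain ⟨t, ht, k2⟩ := (ray hT (c := 0) (d := 1) m).resolve_right
    fun ⟨u, v, h, h', _⟩ => pos u v h h'
  exact ⟨_, _, s, t, hs, ht, m, by simpa using k1, by simpa using k2⟩

/-- Compactness is used twice, first for the area and then for the abscissa on the set of
maximisers. Degenerate triangles are admitted to make the set closed; the positive maximum excludes
them afterwards. -/
theorem exists_best : ∃ a b w h, Best (hull (cover T)) a b w h := by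
  obtain ⟨a₀, b₀, w₀, h₀, hw₀, hh₀, p₀, q₀, r₀⟩ := exists_fits hT
  have hc : IsCompact (hull (cover T)) := hT.cyc.fin.isCompact_convexHull ℝ
  let K : Set ((ℝ × ℝ) × (ℝ × ℝ) × (ℝ × ℝ)) :=
    (hull (cover T) ×ˢ hull (cover T) ×ˢ hull (cover T)) ∩
      {z | z.2.1.2 = z.1.2 ∧ z.2.2.1 = z.1.1 ∧ z.1.1 ≤ z.2.1.1 ∧ z.1.2 ≤ z.2.2.2}
  have hK : IsCompact K := by
    refine (hc.prod (hc.prod hc)).inter_right ?_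
    refine .and (isClosed_eq (by fun_prop) (by fun_prop)) (.and (isClosed_eq (by fun_prop)
      (by fun_prop)) (.and (isClosed_le (by fun_prop) (by fun_prop))
      (isClosed_le (by fun_prop) (by fun_prop))))
  let f : (ℝ × ℝ) × (ℝ × ℝ) × (ℝ × ℝ) → ℝ := fun z => (z.2.1.1 - z.1.1) * (z.2.2.2 - z.1.2)
  have hf : Continuous f := by fun_prop
  have mem {a b w h : ℝ} (hf : Fits (hull (cover T)) a b w h) :
      ((a, b), (a + w, b), (a, b + h)) ∈ K :=
    ⟨⟨hf.2.2.1, hf.2.2.2.1, hf.2.2.2.2⟩, rfl, rfl, by simpa using hf.1.le,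
      by simpa using hf.2.1.le⟩
  obtain ⟨z, hz, hmax⟩ := hK.exists_isMaxOn ⟨_, mem ⟨hw₀, hh₀, p₀, q₀, r₀⟩⟩ hf.continuousOn
  obtain ⟨y, ⟨⟨⟨hp, hq, hr⟩, e1, e2, e3, e4⟩, hy⟩, hmin⟩ :=
    (hK.inter_right (isClosed_eq hf (continuous_const (y := f z)))).exists_isMinOn ⟨z, hz, rfl⟩
      (continuous_fst.comp continuous_fst).continuousOn
  obtain ⟨⟨a, b⟩, ⟨c, b'⟩, a', d⟩ := y
  simp only at e1 e2 e3 e4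
  subst e1 e2
  have hy : (c - a') * (d - b') = f z := hy
  have le : ∀ a b w h, Fits (hull (cover T)) a b w h → w * h ≤ f z := fun a b w h hf => by
    have : (a + w - a) * (b + h - b) ≤ f z := hmax (mem hf)
    simpa using this
  have pos := le _ _ _ _ ⟨hw₀, hh₀, p₀, q₀, r₀⟩
  have pos' : 0 < (c - a') * (d - b') := by rw [hy]; nlinarith
  have hw : 0 < c - a' := pos_of_mul_pos_left pos' (by linarith)
  have hh : 0 < d - b' := pos_of_mul_pos_right pos' (by linarith)
  refine ⟨a', b', c - a', d - b', ⟨⟨hw, hh, hp, by simpa using hq, by simpa using hr⟩,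
    fun a b w h hf => hy ▸ le _ _ _ _ hf⟩, fun a b w h hf e => ?_⟩
  exact hmin (show _ ∈ _ from ⟨mem hf, by
    change (a + w - a) * (b + h - b) = f z; rw [← hy, ← e]; ring⟩)

/-- The corner of the right angle is on the lower left boundary or can be moved. -/
theorem Best.cases {a b w h : ℝ} (ht : Best (hull (cover T)) a b w h) {S E : V}
    (hS : IsExt (cover T) (-1) 0 0 (-1) S) (hE : IsExt (cover T) 0 (-1) (-1) 0 E)
    (hSE : S.key ≤ E.key) (hES : E.key < S.key + 1) :
    (∃ u v, OnLower (cover T) S E a b u v) ∨ Free (hull (cover T)) a b w h := by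
  have hN := hT.cyc
  obtain ⟨hw, hh, p, q, r⟩ := ht.opt.1
  have low : ∀ u v, Adj (cover T) u v → side u v (a, b) = 0 → u.x < v.x → v.y < u.y →
      ∃ u v, OnLower (cover T) S E a b u v := by
    intro u v ha h0 hx hy
    obtain ⟨k, h1, h2, h3⟩ := hN.edge_mem_low hS hE hSE hES ha hx hy
    obtain ⟨h4, h5⟩ := hN.between ha hx p h0
    exact ⟨_, _, h1, h2, h3, h4, h5, by simp only [side, V.sh] at *; linarith⟩
  by_contra! hc
  obtain ⟨hc, hF⟩ := hc
  refine hF ⟨ht.opt, ?_, ?_, fun s hs t ht' hf => ?_⟩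
  -- An edge that blocks the motion to the left goes down. Falling to the right, it belongs to the
  -- lower left boundary; vertical, it has all of `P` to its right; falling to the left, it would
  -- cut off the apex above the corner.
  · refine (ray hT (c := -1) (d := 0) p).imp (fun ⟨s, hs, h⟩ => ⟨s, hs, ?_⟩)
      fun ⟨u, v, ha, h0, h1⟩ z hz => ?_
    · exact mem_congr h
    · have h2 := hN.side_nonneg ha r
      have h3 := hN.side_nonneg ha hz
      have hy : v.y < u.y := by linarith
      rcases lt_trichotomy u.x v.x with hx | hx | hx
      · obtain ⟨u, v, h⟩ := low u v ha h0 hx hy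
        exact absurd h (hc u v)
      · simp only [side, hx, sub_self, zero_mul] at *
        nlinarith
      · simp only [side] at *
        nlinarith
  -- The same for an edge that blocks the motion downwards: it goes to the right, and a rising one
  -- would cut off the base end.
  · refine (ray hT (c := 0) (d := -1) p).imp (fun ⟨s, hs, h⟩ => ⟨s, hs, ?_⟩)
      fun ⟨u, v, ha, h0, h1⟩ z hz => ?_
    · exact mem_congr h
    · have h2 := hN.side_nonneg ha q
      have h3 := hN.side_nonneg ha hz
      have hx : u.x < v.x := by linarith
      rcases lt_trichotomy v.y u.y with hy | hy | hy
      · obtain ⟨u, v, h⟩ := low u v ha h0 hx hy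
        exact absurd h (hc u v)
      · simp only [side, hy, sub_self, zero_mul] at *
        nlinarith
      · simp only [side] at *
        nlinarith
  · linarith [ht.min _ _ _ _ hf rfl]

omit hT

/-! ## The best candidate -/

def valid (T : Tree) (t : Tr) : Bool :=
  ltB 0 t.2.2.1 && (ltB 0 t.2.2.2 && (inside T (t.1, t.2.1) &&
    (inside T (t.1 + t.2.2.1, t.2.1) && inside T (t.1, t.2.1 + t.2.2.2))))

def better (T : Tree) (s t : Tr) : Tr :=
  bif valid T t && ltB (s.2.2.1 * s.2.2.2) (t.2.2.1 * t.2.2.2) then t else s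

def better₃ (T : Tree) (s : Tr) (t : Tr × Tr × Tr) : Tr :=
  better T (better T (better T s t.1) t.2.1) t.2.2

def flip₃ (t : Tr × Tr × Tr) : Tr × Tr × Tr := (t.1.flip, t.2.1.flip, t.2.2.flip)

/-- A largest triangle with its horizontal and vertical sides to the right of and above their
common corner. -/
def best (T : Tree) : Tr :=
  let A := candLower (lower T) (upper T) (upper (turned T))
  let B := candFree (lower (T.mirror.lin 1 0 0 (-1))) (lower (T.lin 0 1 (-1) 0))
  better₃ T (better₃ T (better₃ T (better₃ T (better₃ T (better₃ T (0, 0, 0, 0) A.1) A.2)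
    B.1.1) B.1.2) (flip₃ B.2.1)) (flip₃ B.2.2)

def Tr.Fits (P : Set (ℝ × ℝ)) (t : Tr) : Prop := RealRAM.Fits P t.1 t.2.1 t.2.2.1 t.2.2.2

/-- The area is zero, or the triangle fits. -/
def Tr.Sound (P : Set (ℝ × ℝ)) (t : Tr) : Prop := t.2.2.1 * t.2.2.2 = 0 ∨ t.Fits P

/-- Candidates are checked before they are accepted, so those computed under a false case assumption
do no harm; one largest triangle among them suffices. -/
theorem better_spec (hT : Good T) {s : Tr} (hs : s.Sound (hull (cover T))) (t : Tr) :
    (better T s t).Sound (hull (cover T)) ∧ (s.Opt (hull (cover T)) ∨ t.Opt (hull (cover T)) →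
      (better T s t).Opt (hull (cover T))) := by
  have hv : valid T t = true ↔ t.Fits (hull (cover T)) := by
    simp [valid, ltB_iff, inside_iff hT, Tr.Fits, Fits]
  unfold better
  cases h : valid T t && ltB (s.2.2.1 * s.2.2.2) (t.2.2.1 * t.2.2.2) with
  | true =>
    rw [Bool.and_eq_true, ltB_iff, hv] at h
    exact ⟨.inr h.1, fun h' => h'.elim (fun g => absurd h.2 (g.2 _ _ _ _ h.1).not_gt) id⟩
  | false =>
    rw [Bool.and_eq_false_iff, ← Bool.not_eq_true, hv, ltB_false] at h
    refine ⟨hs, fun h' => h'.elim id fun g => ?_⟩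
    have h := h.resolve_left fun h => h g.1
    have f : s.Fits (hull (cover T)) := hs.resolve_left fun e => by
      have := mul_pos g.1.1 g.1.2.1
      linarith
    exact Opt.of_area g f (le_antisymm (g.2 _ _ _ _ f) h)

theorem better₃_spec (hT : Good T) {s : Tr} (hs : s.Sound (hull (cover T))) (t : Tr × Tr × Tr) :
    (better₃ T s t).Sound (hull (cover T)) ∧ (s.Opt (hull (cover T)) ∨
      (t.1.Opt (hull (cover T)) ∨ t.2.1.Opt (hull (cover T)) ∨ t.2.2.Opt (hull (cover T))) →
      (better₃ T s t).Opt (hull (cover T))) := by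
  obtain ⟨h1, h2⟩ := better_spec hT hs t.1
  obtain ⟨h3, h4⟩ := better_spec hT h1 t.2.1
  obtain ⟨h5, h6⟩ := better_spec hT h3 t.2.2
  exact ⟨h5, by tauto⟩

theorem LowerSpec.upLeft {w : PW} {P : Set (ℝ × ℝ)} (hT : Good T) (hw : LowerSpec T w)
    (e : hull (cover T) = refl P) : UpLeft (cover T) P w.lo w.hi where
  chain := e ▸ hT.cyc.lowChain hw.lo hw.hi hw.lt
  mem v hv := by
    have := mem_hull hv
    rw [e] at this
    exact this
  left z hz := by
    have := le_of_hull (fun v hv => hw.lo.le hv) (z := (z.1, -z.2)) (by rw [e]; simpa [refl])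
    linarith
  top z hz := by
    have := le_of_hull (fun v hv => hw.hi.le hv) (z := (z.1, -z.2)) (by rw [e]; simpa [refl])
    linarith
  hE := hw.hi.1
  inj := hT.cyc.inj

theorem Good.refl (hT : Good T) : Good (T.mirror.lin 1 0 0 (-1)) where
  toSpread := hT.toSpread.mirror.lin _ _ _ _
  pos := by
    simp only [Tree.toList_lin, Tree.toList_mirror, List.mem_map, List.mem_reverse]
    rintro _ ⟨_, ⟨u, hu, rfl⟩, rfl⟩ _ ⟨_, ⟨v, hv, rfl⟩, rfl⟩ _ ⟨_, ⟨w, hw, rfl⟩, rfl⟩ h1 h2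
    simp only [V.map] at h1 h2
    have := hT.pos w hw v hv u hu (by linarith) (by linarith)
    simp only [side, V.map, V.pt] at *
    linarith
  length := by simpa [Tree.toList_lin, Tree.toList_mirror] using hT.length

theorem hull_refl (T : Tree) : hull (cover (T.mirror.lin 1 0 0 (-1))) =
    RealRAM.refl (hull (cover T)) := by
  rw [cover_lin, cover_mirror, hull_map]
  have e : hull (V.mir '' cover T) = hull (cover T) := by
    unfold hull; rw [Set.image_image]; rfl
  rw [e]
  ext z
  constructor
  · rintro ⟨y, hy, rfl⟩
    simpa [RealRAM.refl] using hy
  · exact fun h => ⟨_, h, by simp⟩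

theorem hull_refl_flip (T : Tree) : hull (cover (T.lin 0 1 (-1) 0)) =
    RealRAM.refl (flip (hull (cover T))) := by
  rw [cover_lin, hull_map]
  ext z
  constructor
  · rintro ⟨y, hy, rfl⟩
    simpa [RealRAM.refl, flip] using hy
  · exact fun h => ⟨_, h, by simp⟩

theorem best_spec (hT : Good T) : (best T).Opt (hull (cover T)) := by
  obtain ⟨a, b, w, h, ht⟩ := exists_best hT
  have hl := lower_spec hT
  have s₀ : Tr.Sound (hull (cover T)) (0, 0, 0, 0) := .inl (by simp)
  unfold best
  have hA := fun u v ho => candLower_spec hT hl (upper_spec hT)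
    (q := upper (turned T)) (Nq := V.mir '' cover (turned T))
    (by
      have := upper_spec hT.turned
      rwa [turned, cover_rot, hull_rot, ← cover_rot, ← turned] at this) ht (u := u) (v := v) ho
  have T₁ := hT.refl
  have T₂ : Good (T.lin 0 1 (-1) 0) := hT.lin (by norm_num)
  have hr := lower_spec T₁
  have hq := lower_spec T₂
  have hB := fun hF => candFree_spec (hull_convex (cover T)) (a := a) (b := b) (w := w) (h := h) hF
    (hr.upLeft T₁ (hull_refl T)) (hq.upLeft T₂ (hull_refl_flip T)) hr.ok hq.ok
  have hAB := (ht.cases hT hl.lo hl.hi hl.le hl.lt).imp (fun ⟨u, v, h⟩ => hA u v h) hB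
  generalize candLower _ _ _ = A at *
  generalize candFree _ _ = B at *
  obtain ⟨s1, h1⟩ := better₃_spec hT s₀ A.1
  obtain ⟨s2, h2⟩ := better₃_spec hT s1 A.2
  obtain ⟨s3, h3⟩ := better₃_spec hT s2 B.1.1
  obtain ⟨s4, h4⟩ := better₃_spec hT s3 B.1.2
  obtain ⟨s5, h5⟩ := better₃_spec hT s4 (flip₃ B.2.1)
  obtain ⟨s6, h6⟩ := better₃_spec hT s5 (flip₃ B.2.2)
  simp only [flip₃] at h5 h6
  rcases hAB with (h | h) | (h | h) | h | h
  · exact h6 (.inl (h5 (.inl (h4 (.inl (h3 (.inl (h2 (.inl (h1 (.inr h)))))))))))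
  · exact h6 (.inl (h5 (.inl (h4 (.inl (h3 (.inl (h2 (.inr h)))))))))
  · exact h6 (.inl (h5 (.inl (h4 (.inl (h3 (.inr h)))))))
  · exact h6 (.inl (h5 (.inl (h4 (.inr h)))))
  · exact h6 (.inl (h5 (.inr h)))
  · exact h6 (.inr h)

attribute [reducible] valid better₃ flip₃
@[fun_prop] theorem comp_better : Comp L 1 (fun z : Tree × Tr × Tr => better z.1 z.2.1 z.2.2) := by
  unfold better; fun_prop
@[fun_prop] theorem comp_best : Comp L 1 best := by unfold best; fun_prop

/-! ### From the stored polygon, the angle and the placements to the normal form, and back to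
programs -/

/-! ## Orientation -/

/-- The tree holds the vertices of a convex polygon in order. -/
structure Tree.IsConvex (T : Tree) : Prop extends Spread T where
  length : 3 ≤ T.toList.length
  side : (∀ u ∈ T.toList, ∀ v ∈ T.toList, ∀ w ∈ T.toList, u.key < v.key → v.key < w.key →
    0 < side u v w.pt) ∨ ∀ u ∈ T.toList, ∀ v ∈ T.toList, ∀ w ∈ T.toList, u.key < v.key →
    v.key < w.key → RealRAM.side u v w.pt < 0

theorem Tree.IsConvex.lin {T : Tree} (hT : T.IsConvex) {a b c d : ℝ} (hd : a * d - b * c ≠ 0) :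
    (T.lin a b c d).IsConvex where
  toSpread := hT.toSpread.lin a b c d
  length := by simpa [Tree.toList_lin] using hT.length
  side := by
    simp only [Tree.toList_lin, List.forall_mem_map, side_map]
    simp only [V.map, one_mul]
    rcases hd.lt_or_gt with hd | hd <;> rcases hT.side with h | h
    · exact .inr fun u hu v hv w hw h1 h2 => mul_neg_of_neg_of_pos hd (h u hu v hv w hw h1 h2)
    · exact .inl fun u hu v hv w hw h1 h2 => mul_pos_of_neg_of_neg hd (h u hu v hv w hw h1 h2)
    · exact .inl fun u hu v hv w hw h1 h2 => mul_pos hd (h u hu v hv w hw h1 h2)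
    · exact .inr fun u hu v hv w hw h1 h2 => mul_neg_of_pos_of_neg hd (h u hu v hv w hw h1 h2)

/-- Three points of the tree in order. -/
def three (T : Tree) : V × V × V :=
  bif T.left.isNil then
    bif T.right.left.isNil then (T.root, T.right.root, T.right.right.root)
    else (T.root, T.right.left.root, T.right.root)
  else bif T.right.isNil then
    bif T.left.left.isNil then (T.left.root, T.left.right.root, T.root)
    else (T.left.left.root, T.left.root, T.root)
  else (T.left.root, T.root, T.right.root)

theorem three_spec {T : Tree} (hT : T.Sorted) (h : 3 ≤ T.toList.length) :
    (three T).1 ∈ T.toList ∧ (three T).2.1 ∈ T.toList ∧ (three T).2.2 ∈ T.toList ∧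
      (three T).1.key < (three T).2.1.key ∧ (three T).2.1.key < (three T).2.2.key := by
  suffices hs : [(three T).1, (three T).2.1, (three T).2.2].Sublist T.toList by
    have := List.Pairwise.sublist hs hT
    refine ⟨hs.subset (by simp), hs.subset (by simp), hs.subset (by simp), ?_⟩
    simp only [List.pairwise_cons, List.mem_cons] at this
    exact ⟨this.1 _ (.inl rfl), this.2.1 _ (.inl rfl)⟩
  have one (l : Tree) (v : V) (r : Tree) : [v].Sublist (Tree.node l v r).toList := by
    simp [Tree.toList]
  have two (l : Tree) (v : V) (r : Tree) (u : V) (hu : u ∈ l.toList) :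
      [u, v].Sublist (Tree.node l v r).toList := by
    exact (List.singleton_sublist.2 hu).append (by simp : [v].Sublist (v :: r.toList))
  have two' (l : Tree) (v : V) (r : Tree) (u : V) (hu : u ∈ r.toList) :
      [v, u].Sublist (Tree.node l v r).toList :=
    (List.nil_sublist _).append ((List.singleton_sublist.2 hu).cons_cons v)
  cases T with
  | nil => simp [Tree.toList] at h
  | node l v r =>
  cases l with
  | node l₁ u l₂ =>
    cases r with
    | node r₁ w r₂ =>
      exact (one l₁ u l₂).append ((one r₁ w r₂).cons_cons v)
    | nil =>
      cases l₁ with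
      | node l₃ w l₄ =>
        exact (two _ u l₂ w (by simp [Tree.toList])).append
          ((List.nil_sublist []).cons_cons v)
      | nil =>
        cases l₂ with
        | nil => simp [Tree.toList] at h
        | node l₃ w l₄ =>
          exact (two' _ u _ w (by simp [Tree.toList])).append ((List.nil_sublist []).cons_cons v)
  | nil =>
    cases r with
    | nil => simp [Tree.toList] at h
    | node r₁ w r₂ =>
      cases r₁ with
      | node r₃ u r₄ => exact (two _ w r₂ u (by simp [Tree.toList])).cons_cons v
      | nil =>
        cases r₂ with
        | nil => simp [Tree.toList] at h
        | node r₃ u r₄ => exact (two' _ w _ u (by simp [Tree.toList])).cons_cons v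

/-- The tree in counterclockwise order. -/
def oriented (T : Tree) : Tree :=
  bif ltB 0 (side (three T).1 (three T).2.1 (three T).2.2.pt) then T else T.mirror

theorem hull_mirror (T : Tree) : hull (cover T.mirror) = hull (cover T) := by
  rw [cover_mirror]
  unfold hull
  rw [Set.image_image]
  rfl

theorem hull_oriented (T : Tree) : hull (cover (oriented T)) = hull (cover T) := by
  unfold oriented
  cases ltB _ _
  · exact hull_mirror T
  · rfl

theorem oriented_good {T : Tree} (hT : T.IsConvex) : Good (oriented T) := by
  obtain ⟨h1, h2, h3, h4, h5⟩ := three_spec hT.sorted hT.length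
  unfold oriented
  rcases hT.side with h | h
  · rw [ltB_iff.2 (h _ h1 _ h2 _ h3 h4 h5)]
    exact ⟨hT.toSpread, h, hT.length⟩
  · rw [ltB_false.2 (h _ h1 _ h2 _ h3 h4 h5).le]
    refine ⟨hT.toSpread.mirror, ?_, by simpa [Tree.toList_mirror] using hT.length⟩
    simp only [cond_false, Tree.toList_mirror, List.mem_reverse, List.forall_mem_map]
    intro u hu v hv w hw h1 h2
    have := h w hw v hv u hu (neg_lt_neg_iff.1 h2) (neg_lt_neg_iff.1 h1)
    simp only [RealRAM.side, V.pt] at *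
    linarith

/-! ## Reading a tree from memory -/

/-- Memory holds no keys. Halving the interval of keys at each node produces increasing ones on the
way down, all strictly inside the initial interval. -/
theorem Raw.view_spec (t : Raw) : ∀ p q : ℝ, p < q →
    (t.view false p q 1 0 0 1).toList.map V.pt = t.toList ∧ (t.view false p q 1 0 0 1).Sorted ∧
      ∀ u ∈ (t.view false p q 1 0 0 1).toList, p < u.key ∧ u.key < q := by
  induction t with
  | nil => exact fun p q _ => ⟨rfl, .nil, by simp [view, Tree.toList]⟩
  | node l x y r ihl ihr =>
    intro p q h
    obtain ⟨l1, l2, l3⟩ := ihl p ((p + q) / 2) (by linarith)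
    obtain ⟨r1, r2, r3⟩ := ihr ((p + q) / 2) q (by linarith)
    refine ⟨by simp [view, Tree.toList, toList, l1, r1, V.pt], ?_, ?_⟩
    · simp only [Tree.Sorted, view, cond_false, Tree.toList, List.pairwise_append,
        List.pairwise_cons, List.mem_cons]
      refine ⟨l2, ⟨fun v hv => (r3 v hv).1, r2⟩, ?_⟩
      rintro u hu v (rfl | hv)
      · exact (l3 u hu).2
      · exact (l3 u hu).2.trans (r3 v hv).1
    · simp only [view, cond_false, Tree.toList, List.mem_append, List.mem_cons]
      rintro u (hu | rfl | hu)
      · exact ⟨(l3 u hu).1, by linarith [(l3 u hu).2]⟩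
      · exact ⟨by simp only; linarith, by simp only; linarith⟩
      · exact ⟨by linarith [(r3 u hu).1], (r3 u hu).2⟩

/-- The tree in memory with keys between zero and one. -/
abbrev Raw.tree (t : Raw) : Tree := t.view false 0 1 1 0 0 1

open AlphaTriangle (Plane Placement IsConvexPolygon region sgn orient)

section

variable {t : Raw} {n : ℕ} {v : Fin n → Plane}

theorem Raw.tree_isConvex (hv : IsConvexPolygon v)
    (ht : t.toList = List.ofFn fun i => (v i 0, v i 1)) : t.tree.IsConvex := by
  obtain ⟨h1, h2, h3⟩ := t.view_spec 0 1 one_pos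
  have hl : t.tree.toList.length = n := by simpa [ht] using congrArg List.length h1
  have hi : ∀ u ∈ t.tree.toList, ∃ i : Fin n, u = t.tree.toList[(i : ℕ)] ∧
      u.pt = (v i 0, v i 1) := by
    intro u hu
    obtain ⟨i, hi, rfl⟩ := List.mem_iff_getElem.1 hu
    refine ⟨⟨i, hl ▸ hi⟩, rfl, ?_⟩
    have : (t.tree.toList.map V.pt)[i]'(by simpa using hi) = (List.ofFn fun i => (v i 0, v i 1))[i]'(by
      simpa [hl] using hi) := by simp only [h1, ht]
    simpa using this
  have key : ∀ i j : Fin n, t.tree.toList[(i : ℕ)].key < t.tree.toList[(j : ℕ)].key → i < j := by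
    intro i j h
    by_contra! hc
    rcases hc.eq_or_lt with rfl | hc
    · exact h.false
    · exact h.not_gt (List.pairwise_iff_getElem.1 h2 _ _ _ _ hc)
  have side_eq : ∀ u v w : V, ∀ p q r : Plane, u.pt = (p 0, p 1) → v.pt = (q 0, q 1) →
      w.pt = (r 0, r 1) → side u v w.pt = orient p q r := by
    intro u v w p q r hu hv hw
    simp only [V.pt, Prod.mk.injEq] at hu hv hw
    simp only [side, V.pt, orient, hu, hv, hw]
  refine ⟨⟨h2, fun u hu v hv => by linarith [(h3 u hu).2, (h3 v hv).1]⟩, by rw [hl]; exact hv.1, ?_⟩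
  refine hv.2.imp (fun h u hu v hv w hw => ?_) (fun h u hu v hv w hw => ?_)
  all_goals
    obtain ⟨i, e1, e2⟩ := hi u hu
    obtain ⟨j, e3, e4⟩ := hi v hv
    obtain ⟨k, e5, e6⟩ := hi w hw
    rw [side_eq u v w _ _ _ e2 e4 e6, e1, e3, e5]
    exact fun h1 h2 => h i j k (key _ _ h1) (key _ _ h2)

theorem Raw.hull_tree (ht : t.toList = List.ofFn fun i => (v i 0, v i 1)) :
    hull (cover t.tree) = (fun p : Plane => (p 0, p 1)) '' region v := by
  have e : V.pt '' cover t.tree = (fun p : Plane => (p 0, p 1)) '' Set.range v := by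
    have h1 := (t.view_spec 0 1 one_pos).1
    ext z
    have hz : z ∈ t.tree.toList.map V.pt ↔ z ∈ (fun p : Plane => (p 0, p 1)) '' Set.range v := by
      rw [h1, ht]; simp [List.mem_ofFn]
    rw [← hz, List.mem_map]
    constructor
    · rintro ⟨u, ⟨k, hk⟩, rfl⟩
      exact ⟨_, hk, rfl⟩
    · rintro ⟨u, hu, rfl⟩
      exact ⟨u, ⟨0, by rwa [V.sh_zero]⟩, rfl⟩
  let F : Plane →ₗ[ℝ] ℝ × ℝ :=
    { toFun := fun p => (p 0, p 1), map_add' := fun _ _ => rfl, map_smul' := fun _ _ => rfl }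
  unfold hull region
  rw [e]
  exact (F.image_convexHull _).symm

theorem sgn_mul_self (b : Bool) : sgn b * sgn b = 1 := by cases b <;> simp [sgn]

/-- The tree of the polygon after the linear map which makes the triangles with the cotangent `c`
of the angle and the placement `d` right-angled. -/
def Tree.place (d : Placement) (c : ℝ) (T : Tree) : Tree :=
  T.lin (sgn d.1) (-(sgn d.2 * c)) 0 (sgn d.2)

theorem Raw.mem_region_iff (ht : t.toList = List.ofFn fun i => (v i 0, v i 1)) (d : Placement)
    (c : ℝ) (p : Plane) : p ∈ region v ↔
      (sgn d.1 * p 0 - sgn d.2 * c * p 1, sgn d.2 * p 1) ∈ hull (cover (t.tree.place d c)) := by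
  rw [Tree.place, cover_lin, hull_map, hull_tree ht, Set.image_image]
  have h1 := sgn_mul_self d.1
  have h2 := sgn_mul_self d.2
  constructor
  · exact fun h => ⟨p, h, by simp; ring⟩
  · rintro ⟨q, hq, e⟩
    simp only [Prod.mk.injEq] at e
    have e1 : q 1 = p 1 := by
      linear_combination sgn d.2 * e.2 - (q 1 - p 1) * h2
    have e0 : q 0 = p 0 := by
      rw [e1] at e
      linear_combination sgn d.1 * e.1 - (q 0 - p 0) * h1
    have : q = p := by
      ext i; fin_cases i
      · exact e0
      · exact e1
    rwa [← this]

theorem Raw.place_good (hv : IsConvexPolygon v)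
    (ht : t.toList = List.ofFn fun i => (v i 0, v i 1)) (d : Placement) (c : ℝ) :
    Good (oriented (t.tree.place d c)) :=
  oriented_good ((Raw.tree_isConvex hv ht).lin (by
    have h1 := sgn_mul_self d.1
    have h2 := sgn_mul_self d.2
    intro h
    have : (sgn d.1 * sgn d.1) * (sgn d.2 * sgn d.2) = 0 := by
      linear_combination sgn d.1 * sgn d.2 * h
    rw [h1, h2] at this
    norm_num at this))

end

attribute [reducible] three oriented

open AlphaTriangle (Plane Placement IsConvexPolygon region sgn orient area HasPlacement
  IsAxisAlignedTriangle IsInscribed IsLargest outPoint)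

/-! ## Axis-aligned triangles -/

/-- On the angles in question the cosine is injective. With `x` and `y` the signed legs of the side
`p r` of length `ρ`, the condition `x = ρ cos θ` becomes `x sin θ = y cos θ`, because `x² + y² = ρ²`
and `y > 0`. The second form is linear and needs no root. -/
theorem angle_iff {θ : ℝ} (h0 : 0 < θ) (hπ : θ < Real.pi) {d : Placement} {p q r : Plane}
    (hq : q 1 = p 1) (h : HasPlacement d p q r) : EuclideanGeometry.angle r p q = θ ↔
      sgn d.1 * (r 0 - p 0) = Real.cos θ / Real.sin θ * (sgn d.2 * (r 1 - p 1)) := by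
  obtain ⟨hw, hh⟩ := h
  have hs := Real.sin_pos_of_pos_of_lt_pi h0 hπ
  have h1 := sgn_mul_self d.1
  have h2 := sgn_mul_self d.2
  have hc := Real.cos_sq_add_sin_sq θ
  generalize sgn d.1 = σ at *
  generalize sgn d.2 = σ' at *
  have e : (EuclideanGeometry.angle r p q = θ) ↔
      Real.cos (EuclideanGeometry.angle r p q) = Real.cos θ :=
    (Real.injOn_cos.eq_iff ⟨EuclideanGeometry.angle_nonneg _ _ _,
      EuclideanGeometry.angle_le_pi _ _ _⟩ ⟨h0.le, hπ.le⟩).symm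
  rw [e, EuclideanGeometry.angle, InnerProductGeometry.cos_angle]
  have n1 : ‖q -ᵥ p‖ = σ * (q 0 - p 0) := by
    rw [EuclideanSpace.norm_eq, Fin.sum_univ_two, Real.sqrt_eq_iff_mul_self_eq (by positivity) hw.le]
    simp [hq]
    linear_combination -(q 0 - p 0) ^ 2 * h1
  have n2 : ‖r -ᵥ p‖ * ‖r -ᵥ p‖ = (σ * (r 0 - p 0)) ^ 2 + (σ' * (r 1 - p 1)) ^ 2 := by
    rw [EuclideanSpace.norm_eq, Fin.sum_univ_two, Real.mul_self_sqrt (by positivity)]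
    simp
    linear_combination -(r 0 - p 0) ^ 2 * h1 - (r 1 - p 1) ^ 2 * h2
  have n3 : inner ℝ (r -ᵥ p) (q -ᵥ p) = (σ * (r 0 - p 0)) * (σ * (q 0 - p 0)) := by
    simp [PiLp.inner_apply, Fin.sum_univ_two, hq]
    linear_combination -(r 0 - p 0) * (q 0 - p 0) * h1
  have n4 : 0 ≤ ‖r -ᵥ p‖ := norm_nonneg _
  rw [n1, n3]
  generalize ‖r -ᵥ p‖ = ρ at *
  generalize σ * (q 0 - p 0) = w at *
  generalize σ * (r 0 - p 0) = x at *
  generalize σ' * (r 1 - p 1) = y at *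
  generalize Real.cos θ = c at *
  generalize Real.sin θ = s at *
  have hρ : 0 < ρ := n4.lt_of_ne' (by rintro rfl; nlinarith)
  rw [mul_div_mul_right _ _ hw.ne', div_eq_iff hρ.ne', div_mul_eq_mul_div, eq_div_iff hs.ne']
  constructor
  · rintro rfl
    have : y * y = ρ * s * (ρ * s) := by linear_combination -n2 - ρ ^ 2 * hc
    have := (mul_self_inj hh.le (by positivity)).1 this
    rw [this]; ring
  · intro h
    have : y * y = ρ * s * (ρ * s) := by
      linear_combination (-s ^ 2) * n2 - y ^ 2 * hc - (x * s + c * y) * h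
    have := (mul_self_inj hh.le (by positivity)).1 this
    have : (x - c * ρ) * s = 0 := by rw [this] at h; linear_combination h
    linarith [(mul_eq_zero.1 this).resolve_right hs.ne']

theorem isInscribed_iff {n : ℕ} {v : Fin n → Plane} {p q r : Plane} :
    IsInscribed v p q r ↔ p ∈ region v ∧ q ∈ region v ∧ r ∈ region v := by
  constructor
  · intro h
    have := (subset_convexHull ℝ _).trans h
    exact ⟨this (by simp), this (by simp), this (by simp)⟩
  · rintro ⟨h1, h2, h3⟩
    refine convexHull_min ?_ (convex_convexHull ℝ _)
    rintro _ (rfl | rfl | rfl) <;> assumption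

theorem area_eq {d : Placement} {p q r : Plane} (hq : q 1 = p 1) (h : HasPlacement d p q r) :
    area p q r = sgn d.1 * (q 0 - p 0) * (sgn d.2 * (r 1 - p 1)) / 2 := by
  have h1 : |sgn d.1| = 1 := by cases d.1 <;> simp [sgn]
  have h2 : |sgn d.2| = 1 := by cases d.2 <;> simp [sgn]
  rw [area, orient, hq, sub_self, zero_mul, sub_zero, abs_mul, ← abs_of_pos h.1, ← abs_of_pos h.2,
    abs_mul, abs_mul, h1, h2, one_mul, one_mul]

/-- Three points of the plane. -/
abbrev Corners : Type := (ℝ × ℝ) × (ℝ × ℝ) × ℝ × ℝ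

/-- The inverse of the map of `Tree.place`. -/
def unplace (d : Placement) (c x y : ℝ) : ℝ × ℝ := (sgn d.1 * (x + c * y), sgn d.2 * y)

/-- A largest triangle with the given placement, and twice its area. -/
def cand (d : Placement) (x : Tree × ℝ) : ℝ × Corners :=
  let t := best (oriented (x.1.place d x.2))
  (t.2.2.1 * t.2.2.2, unplace d x.2 t.1 t.2.1, unplace d x.2 (t.1 + t.2.2.1) t.2.1,
    unplace d x.2 t.1 (t.2.1 + t.2.2.2))

/-- A largest triangle with one of the given placements. -/
def cands (x : Tree × ℝ) : List Placement → ℝ × Corners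
  | [] => (0, (0, 0), (0, 0), 0, 0)
  | d :: l => bif ltB (cands x l).1 (cand d x).1 then cand d x else cands x l

instance (b : Bool) : CompConst (sgn b) := by
  cases b <;> simp only [sgn, if_true, Bool.false_eq_true, if_false] <;> infer_instance

@[fun_prop] theorem comp_cand (d : Placement) : Comp L 1 (cand d) := by
  unfold cand unplace Tree.place; fun_prop

theorem comp_cands (l : List Placement) : Comp L 1 (fun x => cands x l) := by
  induction l with
  | nil => unfold cands; fun_prop
  | cons d l ih => unfold cands; fun_prop

theorem cands_spec (x : Tree × ℝ) (l : List Placement) (h : ∀ d ∈ l, 0 < (cand d x).1) :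
    (∀ d ∈ l, (cand d x).1 ≤ (cands x l).1) ∧
      ((cands x l).1 = 0 ∨ ∃ d ∈ l, cands x l = cand d x) := by
  induction l with
  | nil => simp [cands]
  | cons d l ih =>
    obtain ⟨h1, h2⟩ := ih fun e he => h e (List.mem_cons_of_mem _ he)
    unfold cands
    cases hb : ltB (cands x l).1 (cand d x).1 with
    | true =>
      rw [ltB_iff] at hb
      simp only [cond_true, List.forall_mem_cons]
      exact ⟨⟨le_rfl, fun e he => (h1 e he).trans hb.le⟩, .inr ⟨d, by simp, rfl⟩⟩
    | false =>
      rw [ltB_false] at hb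
      simp only [cond_false, List.forall_mem_cons]
      exact ⟨⟨hb, h1⟩, h2.imp id fun ⟨e, he, h⟩ => ⟨e, List.mem_cons_of_mem _ he, h⟩⟩

def toPlane (z : ℝ × ℝ) : Plane := !₂[z.1, z.2]

section

variable {t : Raw} {n : ℕ} {v : Fin n → Plane} (hv : IsConvexPolygon v)
  (ht : t.toList = List.ofFn fun i => (v i 0, v i 1)) {θ : ℝ} (h0 : 0 < θ) (hπ : θ < Real.pi)
include hv ht h0 hπ

theorem cand_le {d : Placement} {p q r : Plane} (hq : q 1 = p 1)
    (ha : EuclideanGeometry.angle r p q = θ) (h : HasPlacement d p q r)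
    (hi : IsInscribed v p q r) :
    2 * area p q r ≤ (cand d (t.tree, Real.cos θ / Real.sin θ)).1 := by
  rw [isInscribed_iff] at hi
  rw [angle_iff h0 hπ hq h] at ha
  simp only [Raw.mem_region_iff ht d (Real.cos θ / Real.sin θ)] at hi
  have hb := best_spec (Raw.place_good hv ht d (Real.cos θ / Real.sin θ))
  rw [Tr.Opt, hull_oriented] at hb
  have := hb.2 _ _ _ _
    ⟨h.1, h.2, hi.1, mem_congr hi.2.1 (by rw [hq]; ring) (by rw [hq]),
      mem_congr hi.2.2 (by linear_combination -ha)⟩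
  rw [area_eq hq h]
  simp only [cand]
  linarith

theorem cand_spec (d : Placement) :
    let c := cand d (t.tree, Real.cos θ / Real.sin θ)
    let p := toPlane c.2.1
    let q := toPlane c.2.2.1
    let r := toPlane c.2.2.2
    0 < c.1 ∧ q 1 = p 1 ∧ EuclideanGeometry.angle r p q = θ ∧ HasPlacement d p q r ∧
      IsInscribed v p q r ∧ 2 * area p q r = c.1 := by
  intro c p q r
  obtain ⟨hw, hh, hp, hq, hr⟩ := (best_spec (Raw.place_good hv ht d (Real.cos θ / Real.sin θ))).1
  have h1 := sgn_mul_self d.1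
  have h2 := sgn_mul_self d.2
  rw [hull_oriented] at hp hq hr
  generalize hτ : Real.cos θ / Real.sin θ = τ at *
  have e : c = cand d (t.tree, τ) := by simp only [c, hτ]
  simp only [cand] at e
  generalize best _ = w at *
  have p0 : p 0 = sgn d.1 * (w.1 + τ * w.2.1) := by simp only [p, e]; rfl
  have p1 : p 1 = sgn d.2 * w.2.1 := by simp only [p, e]; rfl
  have q0 : q 0 = sgn d.1 * (w.1 + w.2.2.1 + τ * w.2.1) := by simp only [q, e]; rfl
  have q1 : q 1 = p 1 := by simp only [p, q, e]; rfl
  have r0 : r 0 = sgn d.1 * (w.1 + τ * (w.2.1 + w.2.2.2)) := by simp only [r, e]; rfl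
  have r1 : r 1 = sgn d.2 * (w.2.1 + w.2.2.2) := by simp only [r, e]; rfl
  have ew : sgn d.1 * (q 0 - p 0) = w.2.2.1 := by
    rw [q0, p0]; linear_combination w.2.2.1 * h1
  have eh : sgn d.2 * (r 1 - p 1) = w.2.2.2 := by
    rw [r1, p1]; linear_combination w.2.2.2 * h2
  have hpl : HasPlacement d p q r := ⟨ew ▸ hw, eh ▸ hh⟩
  refine ⟨e ▸ mul_pos hw hh, q1, (angle_iff h0 hπ q1 hpl).2 ?_, hpl, isInscribed_iff.2 ?_, ?_⟩
  · rw [hτ, eh, r0, p0]; linear_combination τ * w.2.2.2 * h1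
  · simp only [Raw.mem_region_iff ht d τ]
    refine ⟨?_, ?_, ?_⟩
    · refine mem_congr hp ?_ (by rw [p1]; linear_combination w.2.1 * h2)
      rw [p0, p1]; linear_combination (w.1 + τ * w.2.1) * h1 - τ * w.2.1 * h2
    · refine mem_congr hq ?_ (by rw [q1, p1]; linear_combination w.2.1 * h2)
      rw [q0, q1, p1]; linear_combination (w.1 + w.2.2.1 + τ * w.2.1) * h1 - τ * w.2.1 * h2
    · refine mem_congr hr ?_ (by rw [r1]; linear_combination (w.2.1 + w.2.2.2) * h2)
      rw [r0, r1]
      linear_combination (w.1 + τ * (w.2.1 + w.2.2.2)) * h1 - τ * (w.2.1 + w.2.2.2) * h2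
  · rw [area_eq q1 hpl, ew, eh, e]; ring

theorem cands_isLargest {D : Set Placement} (hD : D.Nonempty) (l : List Placement)
    (hl : ∀ d, d ∈ l ↔ d ∈ D) :
    let c := cands (t.tree, Real.cos θ / Real.sin θ) l
    IsLargest θ D v (toPlane c.2.1) (toPlane c.2.2.1) (toPlane c.2.2.2) := by
  intro c
  have hc := cand_spec hv ht h0 hπ
  obtain ⟨h1, h2⟩ := cands_spec (t.tree, Real.cos θ / Real.sin θ) l fun d _ => (hc d).1
  obtain ⟨d, hd⟩ := hD
  have := (hc d).1.trans_le (h1 d ((hl d).2 hd))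
  obtain ⟨e, he, h⟩ := h2.resolve_left this.ne'
  obtain ⟨-, c1, c2, c3, c4, c5⟩ := hc e
  simp only [c, h]
  refine ⟨⟨c1, c2, e, (hl e).1 he, c3⟩, c4, fun p q r ⟨g1, g2, d, hd, g3⟩ g4 => ?_⟩
  have := cand_le hv ht h0 hπ g1 g2 g3 g4
  have := h ▸ h1 d ((hl d).2 hd)
  linarith

end

/-! ## Running a program -/

theorem exists_program (L : Layout) {f : Tree × ℝ → ℝ × Corners} (hf : Comp L 1 f) (e₁ e₂ : IExp)
    (h₁ : e₁.Below 2 2) (h₂ : e₂.Below 2 2) : ∃ (P : Prog) (c : ℕ), ∀ (s : State) (t : Raw),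
      L.rep s.iarr s.rarr t (e₁.eval s) (e₂.eval s) → ∃ s' T, Exec P s s' T ∧
        T ≤ c * (t.height + 1) ∧
        outPoint s' 0 = toPlane (f (t.tree, s.rreg 0 / s.rreg 1)).2.1 ∧
        outPoint s' 2 = toPlane (f (t.tree, s.rreg 0 / s.rreg 1)).2.2.1 ∧
        outPoint s' 4 = toPlane (f (t.tree, s.rreg 0 / s.rreg 1)).2.2.2 := by
  obtain ⟨-, c, P, hP⟩ := hf
  let es : List IExp := [e₁, e₂, .const 0]
  let fs : List RExp := [.const 0, .const 1, .const 1, .const 0, .const 0, .const 1,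
    .div (.reg 0) (.reg 1)]
  -- The tree takes integer registers 2 to 4 and real registers 2 to 7 (the key interval from 0 to 1
  -- and the identity matrix); the cotangent is in real register 8. The result starts at real
  -- register 9 with the doubled area, so the coordinates start at 10.
  refine ⟨.seq (assignI 2 es) (.seq (assignR 2 fs) (.seq (P 2 2 5 9) (copyR 10 0 6))),
    (e₁.cost + e₂.cost + 40) + c, fun s t ht => ?_⟩
  obtain ⟨s₁, a1, a2, a3, a4⟩ := exec_assignI 2 2 es (by
    simp only [es]
    intro e he
    fin_cases he
    · exact h₁
    · exact h₂
    · exact fun _ _ _ => rfl) 2 le_rfl s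
  obtain ⟨s₂, b1, b2, b3, b4⟩ := exec_assignR 2 2 fs (by
    simp only [fs]
    intro e he
    fin_cases he
    iterate 6 exact fun _ _ _ => rfl
    exact RExp.Low.below ⟨Nat.zero_lt_two, Nat.one_lt_two⟩) 2 le_rfl s₁
  have hs : Agree 2 2 s s₂ := a2.trans b2
  have hx : Holds L s₂ 2 2 (t.tree, s.rreg 0 / s.rreg 1) := by
    rw [holds_prod]
    refine ⟨⟨t, false, ?_, ?_, ?_⟩, ?_⟩
    · simp only [hs.1, hs.2.1, b3]
      rw [a4 0 (by simp [es]), a4 1 (by simp [es])]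
      exact ht
    · simp only [b3]
      rw [a4 2 (by simp [es])]
      rfl
    · simp only
      rw [b4 0 (by simp [fs]), b4 1 (by simp [fs]), b4 2 (by simp [fs]), b4 3 (by simp [fs]),
        b4 4 (by simp [fs]), b4 5 (by simp [fs])]
      simp [fs, RExp.eval]
    · refine (b4 6 (by simp [fs])).trans ?_
      simp [fs, RExp.eval, a3]
  obtain ⟨s₃, T, c1, c2, -, c3⟩ := hP 2 2 5 9 le_rfl le_rfl s₂ _ hx
  obtain ⟨s₄, d1, -, -, -, d2, -⟩ := exec_copyR 10 0 6 (.inl (by norm_num)) s₃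
  refine ⟨s₄, _, .seq a1 (.seq b1 (.seq c1 d1)), ?_, ?_⟩
  · have e : size (t.tree, s.rreg 0 / s.rreg 1) = t.height := by
      change max t.tree.height 0 = _
      rw [Raw.view_height, max_eq_left (Nat.zero_le _)]
    rw [e, one_mul] at c2
    have : e₁.cost + e₂.cost + 40 ≤ (e₁.cost + e₂.cost + 40) * (t.height + 1) :=
      Nat.le_mul_of_pos_right _ (by omega)
    rw [add_mul]
    simp only [es, fs, IExp.cost, RExp.cost, List.map_cons, List.map_nil, List.sum_cons,
      List.sum_nil]
    omega
  · generalize f _ = y at *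
    obtain ⟨-, ⟨k0, k1⟩, ⟨k2, k3⟩, k4, k5⟩ := c3
    have j0 := d2 0 (by norm_num)
    have j1 := d2 1 (by norm_num)
    have j2 := d2 2 (by norm_num)
    have j3 := d2 3 (by norm_num)
    have j4 := d2 4 (by norm_num)
    have j5 := d2 5 (by norm_num)
    simp only [Nat.reduceAdd] at j0 j1 j2 j3 j4 j5
    simp only [outPoint, toPlane, j0, j1, j2, j3, j4, j5, zero_add, Nat.reduceAdd]
    exact ⟨congrArg₂ (fun a b : ℝ => !₂[a, b]) k0 k1, congrArg₂ (fun a b : ℝ => !₂[a, b]) k2 k3,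
      congrArg₂ (fun a b : ℝ => !₂[a, b]) k4 k5⟩

open AlphaTriangle (Plane Placement IsConvexPolygon IsLargest HasParameters StoredInArray
  StoredInTree IsTree FindsLargest)

/-! ## The two representations -/

def Raw.InNodes (ia : ℕ → ℤ → ℤ) (ra : ℕ → ℤ → ℝ) : Raw → ℤ → Prop
  | nil, a => a = -1
  | node l x y r, a => 0 ≤ a ∧ l.InNodes ia ra (ia 0 a) ∧ r.InNodes ia ra (ia 1 a) ∧
      ra 0 a = x ∧ ra 1 a = y

/-- Trees that are given by pointers. -/
def nodeLayout : Layout where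
  rep ia ra t a _ := t.InNodes ia ra a
  isNil i := .ile (.reg i) (.const (-1))
  addr i := .reg i
  left₁ i := .get 0 (.reg i)
  left₂ _ := .const 0
  right₁ i := .get 1 (.reg i)
  right₂ _ := .const 0
  nil₁ := -1
  nil₂ := 0
  cost := 3
  cost_isNil _ := le_rfl
  cost_addr _ := by simp [IExp.cost]
  cost_left₁ _ := by simp [IExp.cost]
  cost_left₂ _ := by simp [IExp.cost]
  cost_right₁ _ := by simp [IExp.cost]
  cost_right₂ _ := by simp [IExp.cost]
  below i m n h := by
    refine ⟨?_, ?_, ?_, ?_, ?_⟩ <;> intro s s' hs <;>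
      simp [IExp.eval, hs.1, hs.2.2.1 i (by omega)]
  rep_nil _ _ := rfl
  isNil_iff s i t h := by
    cases t with
    | nil => exact iff_of_true (le_of_eq h) rfl
    | node l x y r =>
      have : 0 ≤ s.ireg i := h.1
      simp [BExp.holds, IExp.eval]
      omega
  node s i l x y r h := ⟨h.2.1, h.2.2.1, h.2.2.2.1, h.2.2.2.2⟩

theorem exists_inNodes {s : State} {a : ℤ} {l : List ℤ} {h : ℕ} (ht : IsTree s a l h) :
    ∃ t : Raw, t.InNodes s.iarr s.rarr a ∧ t.height = h ∧
      t.toList = l.map fun b => (s.rarr 0 b, s.rarr 1 b) := by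
  induction ht with
  | nil => exact ⟨.nil, rfl, rfl, rfl⟩
  | node a l l' h h' ha _ _ ih ih' =>
    obtain ⟨t, h1, h2, h3⟩ := ih
    obtain ⟨t', h1', h2', h3'⟩ := ih'
    exact ⟨.node t _ _ t', ⟨ha, h1, h1', rfl, rfl⟩, by simp [Raw.height, h2, h2'],
      by simp [Raw.toList, h3, h3']⟩

def Raw.InArray (ra : ℕ → ℤ → ℝ) : Raw → ℤ → ℤ → Prop
  | nil, a, b => b ≤ a
  | node l x y r, a, b => a < b ∧ l.InArray ra a ((a + b) / 2) ∧
      r.InArray ra ((a + b) / 2 + 1) b ∧ ra 0 ((a + b) / 2) = x ∧ ra 1 ((a + b) / 2) = y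

/-- Intervals of an array as balanced trees. -/
def arrayLayout : Layout where
  rep _ ra t a b := t.InArray ra a b
  isNil i := .ile (.reg (i + 1)) (.reg i)
  addr i := .half (.add (.reg i) (.reg (i + 1)))
  left₁ i := .reg i
  left₂ i := .half (.add (.reg i) (.reg (i + 1)))
  right₁ i := .add (.half (.add (.reg i) (.reg (i + 1)))) (.const 1)
  right₂ i := .reg (i + 1)
  nil₁ := 0
  nil₂ := 0
  cost := 6
  cost_isNil _ := by simp [IExp.cost, BExp.cost]
  cost_addr _ := by simp [IExp.cost]
  cost_left₁ _ := by simp [IExp.cost]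
  cost_left₂ _ := by simp [IExp.cost]
  cost_right₁ _ := by simp [IExp.cost]
  cost_right₂ _ := by simp [IExp.cost]
  below i m n h := by
    refine ⟨?_, ?_, ?_, ?_, ?_⟩ <;> intro s s' hs <;>
      simp [IExp.eval, hs.2.2.1 i (by omega), hs.2.2.1 (i + 1) (by omega)]
  rep_nil _ _ := le_rfl (a := (0 : ℤ))
  isNil_iff s i t h := by
    cases t with
    | nil => exact iff_of_true h rfl
    | node l x y r => exact iff_of_false (not_le.2 h.1) (by simp)
  node s i l x y r h := ⟨h.2.1, h.2.2.1, h.2.2.2.1, h.2.2.2.2⟩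

/-- Bisection: the middle cell is the root, and fewer than `2 ^ (k + 1)` cells leave fewer than `2 ^
k` on each side of it. -/
theorem exists_inArray (ra : ℕ → ℤ → ℝ) (k : ℕ) : ∀ (m : ℕ) (a : ℤ), m < 2 ^ k →
    ∃ t : Raw, t.InArray ra a (a + m) ∧ t.height ≤ k ∧
      t.toList = (List.range m).map fun j : ℕ => (ra 0 (a + j), ra 1 (a + j)) := by
  induction k with
  | zero => exact fun m a h => ⟨.nil, by simp [Raw.InArray]; omega, le_rfl, by
      rw [show m = 0 by simpa using h]; rfl⟩
  | succ k ih =>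
    intro m a h
    rcases Nat.eq_zero_or_pos m with rfl | hm
    · exact ⟨.nil, by simp [Raw.InArray], Nat.zero_le _, rfl⟩
    have h' : m < 2 * 2 ^ k := by rwa [pow_succ, mul_comm] at h
    obtain ⟨l, l1, l2, l3⟩ := ih (m / 2) a (by omega)
    obtain ⟨r, r1, r2, r3⟩ := ih (m - m / 2 - 1) (a + (m / 2 : ℕ) + 1) (by omega)
    have e : (a + (a + m)) / 2 = a + (m / 2 : ℕ) := by omega
    refine ⟨.node l _ _ r, ⟨by omega, by rwa [e], ?_, rfl, rfl⟩, ?_, ?_⟩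
    · rw [e]
      convert r1 using 1
      omega
    · simp only [Raw.height]; omega
    · have hm' : m = m / 2 + (1 + (m - m / 2 - 1)) := by omega
      conv_rhs => rw [hm', List.range_add, List.range_add]
      simp [Raw.toList, l3, r3, e, Function.comp_def, add_assoc]

/-! ## The theorem -/

/-- As `e < 3`, additive constants in the running time are absorbed by the logarithm. -/
theorem one_lt_log {n : ℕ} (hn : 3 ≤ n) : 1 < Real.log n := by
  have : (3 : ℝ) ≤ n := by exact_mod_cast hn
  rw [Real.lt_log_iff_exp_lt (by linarith)]
  exact Real.exp_one_lt_three.trans_le this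

theorem exists_findsLargest (D : Set Placement) (hD : D.Nonempty) (L : Layout) (e₁ e₂ : IExp)
    (h₁ : e₁.Below 2 2) (h₂ : e₂.Below 2 2) : ∃ (P : Prog) (c : ℕ), ∀ (θ : ℝ), 0 < θ →
      θ < Real.pi → ∀ (n : ℕ) (v : Fin n → Plane), IsConvexPolygon v → ∀ (s : State) (t : Raw)
      (C : ℝ), HasParameters s n θ → L.rep s.iarr s.rarr t (e₁.eval s) (e₂.eval s) →
      t.toList = List.ofFn (fun i => (v i 0, v i 1)) → t.height ≤ C * Real.log n →
        FindsLargest P s (c * (C + 1) * Real.log n) θ D v := by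
  classical
  -- The placements are listed in the text of the program, which therefore depends on `D` and on
  -- nothing else.
  let l : List Placement := (Finset.univ.filter (· ∈ D)).toList
  obtain ⟨P, c, h⟩ := exists_program L (comp_cands (L := L) l) e₁ e₂ h₁ h₂
  refine ⟨P, c, fun θ h0 hπ n v hv s t C hs ht hl hh => ?_⟩
  obtain ⟨s', T, g1, g2, g3, g4, g5⟩ := h s t ht
  refine ⟨s', T, g1, ?_, ?_⟩
  · have := one_lt_log hv.1
    calc (T : ℝ) ≤ c * (t.height + 1) := by exact_mod_cast g2
      _ ≤ c * (C * Real.log n + Real.log n) := by gcongr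
      _ = _ := by ring
  · rw [g3, g4, g5, hs.2.1, hs.2.2]
    exact cands_isLargest hv hl h0 hπ hD l (by simp [l])

end RealRAM
end

theorem theorem2 (D : Set AlphaTriangle.Placement) (hD : D.Nonempty) :
    (∃ (P : RealRAM.Prog) (C : ℝ),
      ∀ (α : ℝ), 0 < α → α < Real.pi →
      ∀ (n : ℕ) (v : Fin n → AlphaTriangle.Plane), AlphaTriangle.IsConvexPolygon v →
      ∀ s : RealRAM.State, AlphaTriangle.HasParameters s n α → AlphaTriangle.StoredInArray s v →
        AlphaTriangle.FindsLargest P s (C * Real.log n) α D v) ∧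
    (∃ P : RealRAM.Prog, ∀ K : ℝ, ∃ C : ℝ,
      ∀ (α : ℝ), 0 < α → α < Real.pi →
      ∀ (n : ℕ) (v : Fin n → AlphaTriangle.Plane), AlphaTriangle.IsConvexPolygon v →
      ∀ (s : RealRAM.State) (h : ℕ), AlphaTriangle.HasParameters s n α →
        AlphaTriangle.StoredInTree s v h → (h : ℝ) ≤ K * Real.log n →
        AlphaTriangle.FindsLargest P s (C * Real.log n) α D v) := by
  constructor
  · obtain ⟨P, c, h⟩ := RealRAM.exists_findsLargest D hD RealRAM.arrayLayout (.const 0) (.reg 0)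
      (fun _ _ _ => rfl) (RealRAM.IExp.below_reg (by norm_num))
    -- The bisection tree has height at most `log₂ n + 1`, which is at most `(1 / log 2 + 1) * log
    -- n`; the last `1` is the additive one of `exists_findsLargest`.
    refine ⟨P, c * (1 / Real.log 2 + 1 + 1), fun α h0 hπ n v hv s hs ha => ?_⟩
    obtain ⟨t, t1, t2, t3⟩ := RealRAM.exists_inArray s.rarr (Nat.log 2 n + 1) n 0
      (Nat.lt_pow_succ_log_self one_lt_two n)
    refine h α h0 hπ n v hv s t _ hs ?_ ?_ ?_
    · change t.InArray s.rarr 0 (s.ireg 0)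
      rwa [hs.1, ← zero_add (n : ℤ)]
    · rw [t3]
      refine List.ext_getElem (by simp) fun i h1 h2 => ?_
      have := ha ⟨i, by simpa using h2⟩
      simpa using this
    · have h1 := RealRAM.one_lt_log hv.1
      have h2 : 0 < Real.log 2 := Real.log_pos one_lt_two
      have h3 := hv.1
      have h4 : (Nat.log 2 n : ℝ) ≤ Real.log n / Real.log 2 := Real.natLog_le_logb n 2
      calc (t.height : ℝ) ≤ Nat.log 2 n + 1 := by exact_mod_cast t2
        _ ≤ Real.log n / Real.log 2 + Real.log n := by gcongr
        _ = _ := by ring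
  · obtain ⟨P, c, h⟩ := RealRAM.exists_findsLargest D hD RealRAM.nodeLayout (.reg 1) (.const 0)
      (RealRAM.IExp.below_reg (by norm_num)) (fun _ _ _ => rfl)
    refine ⟨P, fun K => ⟨c * (K + 1), fun α h0 hπ n v hv s h' hs ht hh => ?_⟩⟩
    obtain ⟨node, n1, n2⟩ := ht
    obtain ⟨t, t1, t2, t3⟩ := RealRAM.exists_inNodes n1
    refine h α h0 hπ n v hv s t K hs t1 ?_ (by rwa [t2])
    rw [t3, List.map_ofFn]
    congr 1
    funext i
    simp [n2 i]
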